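/- Conventions. A *tangent category* $(\mathbb X,\mathbb T)$ is a category with a tangent bundle functor $\mathrm T$ and natural transformations $p\colon\mathrm T\Rightarrow\mathrm{id}$, $z\colon\mathrm{id}\Rightarrow\mathrm T$, $s\colon\mathrm T_2\Rightarrow\mathrm T$, $l\colon\mathrm T\Rightarrow\mathrm T^2$, $c\colon\mathrm T^2\Rightarrow\mathrm T^2$ satisfying the usual axioms (each $p_A$ is an additive bundle whose $n$-fold fibre powers exist and are preserved by all $\mathrm T^m$; $l$ and $c$ are additive, coherent, and the vertical lift is universal). The trivial tangent structure $\mathbb 1$ on $\mathbb X$ has $\mathrm T=\mathrm{id}$ and all transformations identities. A *lax* tangent morphism $(F,\alpha)$ has a distributive law $\alpha\colon F\mathrm T\Rightarrow\mathrm T'F$ compatible with $p,z,s,l,c$; a *colax* one has $\beta\colon\mathrm T'F\Rightarrow F\mathrm T$ compatible with $p,z,s,l,c$, and $F$ preserves the fibre powers of the projection and the pullback expressing universality of the vertical lift; it is *strong* if $\beta$ is invertible and *strict* if $\beta$ is an identity. Let $\mathbb X$ be a small category with the trivial tangent structure $\mathbb 1$, and let $\epsilon\in\{\text{lax},\text{colax},\text{strong},\text{strict}\}$.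 * $\mathrm{TNGFIB}_\epsilon(\mathbb X,\mathbb 1)$: objects are small cloven tangent fibrations, i.e. tangent categories $(\mathbb X',\mathbb T')$ with a strict tangent morphism $\Pi\colon\mathbb X'\to\mathbb X$ and a cleavage of $\Pi$ such that $\mathrm T'$ preserves cartesian morphisms; 1-cells are the functors over $\mathbb X$ preserving cartesian morphisms with a distributive law lying over the identity, generated under composition by tangent morphisms of kind $\epsilon$; 2-cells are the vertical natural transformations compatible with the laws. * $\mathrm{INDXTNG}_\epsilon(\mathbb X,\mathbb 1)$: objects are indexed tangent categories, i.e. pseudofunctors from $\mathbb X^{\mathrm{op}}$ to small tangent categories and strong tangent morphisms; 1-cells are the pseudonatural transformations between the underlying pseudofunctors (with invertible distributors) with distributive laws on the fibres, generated under composition by those that are fibrewise tangent morphisms of kind $\epsilon$ with laws compatible with the distributors; 2-cells are the modifications compatible with the laws. * $\mathrm{TNG}_\epsilon(\mathrm{INDX}(\mathbb X))$ (tangent indexed categories over $(\mathbb X,\mathbb 1)$): objects are the tangent objects, with pointwise limits, of the 2-category $\mathrm{INDX}(\mathbb X)$ of pseudofunctors $\mathbb X^{\mathrm{op}}\to\mathrm{Cat}$,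 pseudonatural transformations and modifications; 1-cells are generated by the tangent 1-morphisms of kind $\epsilon$; 2-cells are the compatible 2-cells. Let $\mathscr I$ be the assignment sending a tangent fibration to its fibres, the fibre over $A$ having the tangent bundle functor $z_A^*\mathrm T'$, and let $\mathscr F$ be the assignment sending an indexed tangent category to its category of elements, with tangent bundle functor $(A,E)\mapsto(\mathrm TA,p_A^*\mathrm T^AE)$; both act on 1-cells and 2-cells in the induced way. 1. For $\epsilon$ lax, colax or strong, $\mathscr I\colon\mathrm{TNGFIB}_\epsilon(\mathbb X,\mathbb 1)\to\mathrm{INDXTNG}_\epsilon(\mathbb X,\mathbb 1)$ and $\mathscr F\colon\mathrm{INDXTNG}_\epsilon(\mathbb X,\mathbb 1)\to\mathrm{TNGFIB}_\epsilon(\mathbb X,\mathbb 1)$ are well-defined strict 2-functors. There are 2-adjunctions $\mathscr F\dashv\mathscr I$ and $\mathscr I\dashv\mathscr F$, and every 2-adjunction of either form is an equivalence: its unit and counit are invertible. 2. There are strict 2-functors $\mathscr I_=\colon\mathrm{TNGFIB}_{\text{strict}}(\mathbb X,\mathbb 1)\to\mathrm{INDXTNG}_{\text{strict}}(\mathbb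 X,\mathbb 1)$ and $\mathscr F_=$ in the opposite direction that become 2-naturally isomorphic to the restrictions of the strong $\mathscr I$ and $\mathscr F$ after the inclusion of strict into strong morphisms. There are 2-adjunctions $\mathscr F_=\dashv\mathscr I_=$ and $\mathscr I_=\dashv\mathscr F_=$, and every 2-adjunction of either form is an equivalence. 3. Consequently indexed tangent categories and tangent indexed categories over the trivial base agree: for every $\epsilon$, sending a tangent object of $\mathrm{INDX}(\mathbb X)$ to its fibrewise components, with the distributors of its tangent bundle 1-morphism as distributive laws of the substitution functors, is a well-defined strict 2-functor $\mathrm{TNG}_\epsilon(\mathrm{INDX}(\mathbb X))\to\mathrm{INDXTNG}_\epsilon(\mathbb X,\mathbb 1)$ and an equivalence of 2-categories (bijective on 1-cells and on 2-cells, and essentially surjective on objects). -/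

import Mathlib

open CategoryTheory Opposite Bicategory
open scoped Pseudofunctor.StrongTrans

universe w w' v v' v'' u u' u'' t t'

namespace TangentGrothendieck

/-! ### Fibre powers and additive bundles -/

/-- The maps `pr i : P ⟶ E` exhibit `P` as the `(n + 1)`-fold pullback of `q` along itself. -/
structure IsFibrePower {C : Type u} [Category.{v} C] {E B P : C} (q : E ⟶ B) {n : ℕ}
    (pr : Fin (n + 1) → (P ⟶ E)) : Prop where
  comm : ∀ i j, pr i ≫ q = pr j ≫ q
  lift : ∀ {X : C} (f : Fin (n + 1) → (X ⟶ E)), (∀ i j, f i ≫ q = f j ≫ q) →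
    ∃! k : X ⟶ P, ∀ i, k ≫ pr i = f i

/-- The data of an additive bundle: a projection, a zero, a candidate `E₂` for the pullback of the
projection along itself, and a sum. -/
structure BundleData (C : Type u) [Category.{v} C] where
  B : C
  E : C
  E₂ : C
  q : E ⟶ B
  zero : B ⟶ E
  fst : E₂ ⟶ E
  snd : E₂ ⟶ E
  sum : E₂ ⟶ E

/-- The image of bundle data under a functor. -/
def BundleData.map {C : Type u} [Category.{v} C] {C' : Type u'} [Category.{v'} C']
    (b : BundleData C) (F : C ⥤ C') : BundleData C' where
  B := F.obj b.B
  E := F.obj b.E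
  E₂ := F.obj b.E₂
  q := F.map b.q
  zero := F.map b.zero
  fst := F.map b.fst
  snd := F.map b.snd
  sum := F.map b.sum

/-- An additive bundle: all fibre powers of the projection exist, and zero and sum make it a
commutative monoid in the slice over `B`. Maps into `E₂` are named by their components. -/
structure BundleData.IsAdditive {C : Type u} [Category.{v} C] (b : BundleData C) : Prop where
  powers : ∀ n : ℕ, ∃ (P : C) (pr : Fin (n + 1) → (P ⟶ b.E)), IsFibrePower b.q pr
  isPullback : IsPullback b.fst b.snd b.q b.q
  zero_q : b.zero ≫ b.q = 𝟙 b.B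
  sum_q : b.sum ≫ b.q = b.fst ≫ b.q
  zero_add : ∀ k : b.E ⟶ b.E₂, k ≫ b.fst = b.q ≫ b.zero → k ≫ b.snd = 𝟙 b.E → k ≫ b.sum = 𝟙 b.E
  comm : ∀ k : b.E₂ ⟶ b.E₂, k ≫ b.fst = b.snd → k ≫ b.snd = b.fst → k ≫ b.sum = b.sum
  assoc : ∀ {X : C} (xy yz xy_z x_yz : X ⟶ b.E₂), xy ≫ b.snd = yz ≫ b.fst →
    xy_z ≫ b.fst = xy ≫ b.sum → xy_z ≫ b.snd = yz ≫ b.snd →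
    x_yz ≫ b.fst = xy ≫ b.fst → x_yz ≫ b.snd = yz ≫ b.sum → xy_z ≫ b.sum = x_yz ≫ b.sum

/-- `(f, g)` is a morphism of additive bundles. -/
structure IsAdditiveHom {C : Type u} [Category.{v} C] (b b' : BundleData C) (f : b.B ⟶ b'.B)
    (g : b.E ⟶ b'.E) : Prop where
  q : g ≫ b'.q = b.q ≫ f
  zero : b.zero ≫ g = f ≫ b'.zero
  sum : ∀ g₂ : b.E₂ ⟶ b'.E₂, g₂ ≫ b'.fst = b.fst ≫ g → g₂ ≫ b'.snd = b.snd ≫ g →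
    b.sum ≫ g = g₂ ≫ b'.sum

/-! ### Tangent categories -/

/-- The data of a tangent structure, with chosen objects `T₂ A`. -/
structure TangentData (C : Type u) [Category.{v} C] where
  T : C ⥤ C
  T₂ : C → C
  π₁ : ∀ A, T₂ A ⟶ T.obj A
  π₂ : ∀ A, T₂ A ⟶ T.obj A
  p : ∀ A, T.obj A ⟶ A
  z : ∀ A, A ⟶ T.obj A
  s : ∀ A, T₂ A ⟶ T.obj A
  l : ∀ A, T.obj A ⟶ T.obj (T.obj A)
  c : ∀ A, T.obj (T.obj A) ⟶ T.obj (T.obj A)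

namespace TangentData

variable {C : Type u} [Category.{v} C] (D : TangentData C)

/-- The bundle `(A, T A, p, z, s)`. -/
def bundle (A : C) : BundleData C where
  B := A
  E := D.T.obj A
  E₂ := D.T₂ A
  q := D.p A
  zero := D.z A
  fst := D.π₁ A
  snd := D.π₂ A
  sum := D.s A

/-- The iterates `T^m`. -/
def iter : ℕ → (C ⥤ C)
  | 0 => 𝟭 C
  | m + 1 => iter m ⋙ D.T

/-- The axioms of a tangent category. -/
structure IsTangent : Prop where
  p_nat : ∀ {A B : C} (f : A ⟶ B), D.T.map f ≫ D.p B = D.p A ≫ f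
  z_nat : ∀ {A B : C} (f : A ⟶ B), f ≫ D.z B = D.z A ≫ D.T.map f
  s_nat : ∀ {A B : C} (f : A ⟶ B) (f₂ : D.T₂ A ⟶ D.T₂ B), f₂ ≫ D.π₁ B = D.π₁ A ≫ D.T.map f →
    f₂ ≫ D.π₂ B = D.π₂ A ≫ D.T.map f → D.s A ≫ D.T.map f = f₂ ≫ D.s B
  l_nat : ∀ {A B : C} (f : A ⟶ B), D.T.map f ≫ D.l B = D.l A ≫ D.T.map (D.T.map f)
  c_nat : ∀ {A B : C} (f : A ⟶ B),
    D.T.map (D.T.map f) ≫ D.c B = D.c A ≫ D.T.map (D.T.map f)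
  additive : ∀ A, (D.bundle A).IsAdditive
  preserves : ∀ (m : ℕ) (A : C) {n : ℕ} {P : C} (pr : Fin (n + 1) → (P ⟶ D.T.obj A)),
    IsFibrePower (D.p A) pr →
      IsFibrePower ((D.iter m).map (D.p A)) (fun i => (D.iter m).map (pr i))
  l_additive : ∀ A, IsAdditiveHom (D.bundle A) ((D.bundle A).map D.T) (D.z A) (D.l A)
  c_additive : ∀ A,
    IsAdditiveHom ((D.bundle A).map D.T) (D.bundle (D.T.obj A)) (𝟙 (D.T.obj A)) (D.c A)
  l_coassoc : ∀ A, D.l A ≫ D.T.map (D.l A) = D.l A ≫ D.l (D.T.obj A)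
  c_c : ∀ A, D.c A ≫ D.c A = 𝟙 _
  c_braid : ∀ A, D.T.map (D.c A) ≫ D.c (D.T.obj A) ≫ D.T.map (D.c A) =
    D.c (D.T.obj A) ≫ D.T.map (D.c A) ≫ D.c (D.T.obj A)
  l_c : ∀ A, D.l A ≫ D.c A = D.l A
  l_c_c : ∀ A, D.l (D.T.obj A) ≫ D.T.map (D.c A) ≫ D.c (D.T.obj A) =
    D.c A ≫ D.T.map (D.l A)
  universal : ∀ (A : C) (k : D.T₂ A ⟶ D.T.obj (D.T₂ A)),
    k ≫ D.T.map (D.π₁ A) = D.π₁ A ≫ D.l A → k ≫ D.T.map (D.π₂ A) = D.π₂ A ≫ D.z (D.T.obj A) →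
    IsPullback (k ≫ D.T.map (D.s A)) (D.π₁ A ≫ D.p A) (D.T.map (D.p A)) (D.z A)

variable (C) in
/-- The trivial tangent structure: everything is an identity. -/
def trivial : TangentData C where
  T := 𝟭 C
  T₂ A := A
  π₁ A := 𝟙 A
  π₂ A := 𝟙 A
  p A := 𝟙 A
  z A := 𝟙 A
  s A := 𝟙 A
  l A := 𝟙 A
  c A := 𝟙 A

end TangentData

/-! ### Tangent morphisms -/

/-- The four kinds of tangent morphisms. -/
inductive Flavour
  | lax
  | colax
  | strong
  | strict

/-- `true` if the distributive law is directed `T' ∘ F ⇒ F ∘ T` (colax), `false` if it is directed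
`F ∘ T ⇒ T' ∘ F` (lax). Strong and strict morphisms are particular colax morphisms. -/
def Flavour.isColax : Flavour → Bool
  | lax => false
  | colax => true
  | strong => true
  | strict => true

section Laws

variable {C : Type u} [Category.{v} C] {C' : Type u'} [Category.{v'} C']
  {C'' : Type u''} [Category.{v''} C'']

/-- The components of a distributive law of a functor, lax or colax. -/
def Law (o : Bool) (D : TangentData C) (D' : TangentData C') (F : C ⥤ C') : Type (max u v') :=
  match o with
  | false => ∀ A, F.obj (D.T.obj A) ⟶ D'.T.obj (F.obj A)
  | true => ∀ A, D'.T.obj (F.obj A) ⟶ F.obj (D.T.obj A)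

/-- Naturality of a distributive law. -/
def Law.IsNatural {D : TangentData C} {D' : TangentData C'} {F : C ⥤ C'} :
    ∀ {o : Bool}, Law o D D' F → Prop
  | false, α => ∀ {A B : C} (f : A ⟶ B),
      F.map (D.T.map f) ≫ α B = α A ≫ D'.T.map (F.map f)
  | true, α => ∀ {A B : C} (f : A ⟶ B),
      D'.T.map (F.map f) ≫ α B = α A ≫ F.map (D.T.map f)

/-- The identity law of the identity functor. -/
def Law.id (o : Bool) (D : TangentData C) : Law o D D (𝟭 C) :=
  match o with
  | false => fun A => 𝟙 (D.T.obj A)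
  | true => fun A => 𝟙 (D.T.obj A)

/-- The law of a composite functor. -/
def Law.comp {D : TangentData C} {D' : TangentData C'} {D'' : TangentData C''} {F : C ⥤ C'}
    {G : C' ⥤ C''} : ∀ {o : Bool}, Law o D D' F → Law o D' D'' G → Law o D D'' (F ⋙ G)
  | false, α, β => fun A => G.map (α A) ≫ β (F.obj A)
  | true, α, β => fun A => β (F.obj A) ≫ G.map (α A)

/-- Compatibility of a natural transformation with distributive laws. -/
def Law.Compat {D : TangentData C} {D' : TangentData C'} {F G : C ⥤ C'} :
    ∀ {o : Bool}, Law o D D' F → Law o D D' G → (F ⟶ G) → Prop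
  | false, α, β, θ => ∀ A, α A ≫ D'.T.map (θ.app A) = θ.app (D.T.obj A) ≫ β A
  | true, α, β, θ => ∀ A, α A ≫ θ.app (D.T.obj A) = D'.T.map (θ.app A) ≫ β A

/-- `F` preserves the fibre powers of the projection and the pullbacks that express the
universality of the vertical lift. -/
structure PreservesTangentLimits (D : TangentData C) (F : C ⥤ C') : Prop where
  power : ∀ (A : C) {n : ℕ} {P : C} (pr : Fin (n + 1) → (P ⟶ D.T.obj A)),
    IsFibrePower (D.p A) pr → IsFibrePower (F.map (D.p A)) (fun i => F.map (pr i))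
  vertical : ∀ (A : C) (k : D.T₂ A ⟶ D.T.obj (D.T₂ A)),
    k ≫ D.T.map (D.π₁ A) = D.π₁ A ≫ D.l A → k ≫ D.T.map (D.π₂ A) = D.π₂ A ≫ D.z (D.T.obj A) →
    IsPullback (F.map (k ≫ D.T.map (D.s A))) (F.map (D.π₁ A ≫ D.p A)) (F.map (D.T.map (D.p A)))
      (F.map (D.z A))

/-- Lax tangent morphisms `(F, α)`. -/
structure IsLaxMorphism (D : TangentData C) (D' : TangentData C') (F : C ⥤ C')
    (α : Law false D D' F) : Prop where
  natural : α.IsNatural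
  additive : ∀ A : C, IsAdditiveHom ((D.bundle A).map F) (D'.bundle (F.obj A)) (𝟙 (F.obj A)) (α A)
  lift : ∀ A : C, F.map (D.l A) ≫ α (D.T.obj A) ≫ D'.T.map (α A) = α A ≫ D'.l (F.obj A)
  flip : ∀ A : C, F.map (D.c A) ≫ α (D.T.obj A) ≫ D'.T.map (α A) =
    α (D.T.obj A) ≫ D'.T.map (α A) ≫ D'.c (F.obj A)

/-- Colax tangent morphisms `(F, β)`. -/
structure IsColaxMorphism (D : TangentData C) (D' : TangentData C') (F : C ⥤ C')
    (β : Law true D D' F) : Prop where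
  natural : β.IsNatural
  additive : ∀ A : C, IsAdditiveHom (D'.bundle (F.obj A)) ((D.bundle A).map F) (𝟙 (F.obj A)) (β A)
  lift : ∀ A : C, D'.l (F.obj A) ≫ D'.T.map (β A) ≫ β (D.T.obj A) = β A ≫ F.map (D.l A)
  flip : ∀ A : C, D'.c (F.obj A) ≫ D'.T.map (β A) ≫ β (D.T.obj A) =
    D'.T.map (β A) ≫ β (D.T.obj A) ≫ F.map (D.c A)
  preserves : PreservesTangentLimits D F

/-- Tangent morphisms of each flavour: a strong morphism is a colax one with invertible law, a
strict morphism is a colax one with identity law. -/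
def IsTangentMorphism (D : TangentData C) (D' : TangentData C') (F : C ⥤ C') :
    ∀ fl : Flavour, Law fl.isColax D D' F → Prop
  | .lax, α => IsLaxMorphism D D' F α
  | .colax, β => IsColaxMorphism D D' F β
  | .strong, β => IsColaxMorphism D D' F β ∧ ∀ A : C, IsIso (β A)
  | .strict, β => IsColaxMorphism D D' F β ∧
      ∃ h : ∀ A : C, D'.T.obj (F.obj A) = F.obj (D.T.obj A), ∀ A : C, β A = eqToHom (h A)

variable {D : TangentData C} {D' : TangentData C'} {D'' : TangentData C''} {o : Bool}

theorem Law.isNatural_id : (Law.id o D).IsNatural := by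
  cases o <;> intro A B f <;> simp [Law.id]

theorem Law.IsNatural.comp {F : C ⥤ C'} {G : C' ⥤ C''} {α : Law o D D' F} {β : Law o D' D'' G}
    (hα : α.IsNatural) (hβ : β.IsNatural) : (α.comp β).IsNatural := by
  cases o
  · intro A B f
    have h1 := hα f
    have h2 := hβ (F.map f)
    simp only [Law.comp, Functor.comp_map, Category.assoc]
    rw [← h2, ← G.map_comp_assoc, h1, G.map_comp_assoc]
  · intro A B f
    have h1 := hα f
    have h2 := hβ (F.map f)
    simp only [Law.comp, Functor.comp_map, Category.assoc]
    rw [← G.map_comp, ← h1, G.map_comp, ← Category.assoc, h2, Category.assoc]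

theorem Law.compat_id {F : C ⥤ C'} (α : Law o D D' F) : α.Compat α (𝟙 F) := by
  cases o <;> intro A <;> simp

theorem Law.Compat.vcomp {F G H : C ⥤ C'} {α : Law o D D' F} {β : Law o D D' G}
    {γ : Law o D D' H} {θ : F ⟶ G} {ψ : G ⟶ H} (h : α.Compat β θ) (h' : β.Compat γ ψ) :
    α.Compat γ (θ ≫ ψ) := by
  cases o <;> intro A <;> have h1 := h A <;> have h2 := h' A
  · simp only [NatTrans.comp_app, Functor.map_comp, Category.assoc]
    rw [reassoc_of% h1, h2]
  · simp only [NatTrans.comp_app, Functor.map_comp, Category.assoc]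
    rw [reassoc_of% h1, h2]

theorem Law.Compat.whiskerLeft {F : C ⥤ C'} {G H : C' ⥤ C''} (α : Law o D D' F)
    {β : Law o D' D'' G} {γ : Law o D' D'' H} {θ : G ⟶ H} (h : β.Compat γ θ) :
    (α.comp β).Compat (α.comp γ) (F.whiskerLeft θ) := by
  cases o <;> intro A <;> have h1 := h (F.obj A)
  · simp only [Law.comp, Functor.whiskerLeft_app, Category.assoc]
    rw [h1, θ.naturality_assoc]
  · simp only [Law.comp, Functor.whiskerLeft_app, Category.assoc]
    rw [θ.naturality, reassoc_of% h1]

theorem Law.Compat.whiskerRight {F G : C ⥤ C'} {H : C' ⥤ C''} {α : Law o D D' F}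
    {β : Law o D D' G} {γ : Law o D' D'' H} (hγ : γ.IsNatural) {θ : F ⟶ G}
    (h : α.Compat β θ) : (α.comp γ).Compat (β.comp γ) (Functor.whiskerRight θ H) := by
  cases o <;> intro A <;> have h1 := h A <;> have h2 := hγ (θ.app A)
  · simp only [Law.comp, Functor.whiskerRight_app, Category.assoc]
    rw [← h2, ← H.map_comp_assoc, h1, H.map_comp_assoc]
  · simp only [Law.comp, Functor.whiskerRight_app, Category.assoc]
    rw [← H.map_comp, h1, H.map_comp, reassoc_of% h2]

end Laws

/-! ### 2-categories of objects, 1-cells and 2-cells with extra structure -/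

/-- Extra structure on objects and 1-cells of a bicategory, together with a condition on 2-cells. -/
structure Displayed (B : Type u) [Bicategory.{w, v} B] where
  Ob : Type u'
  base : Ob → B
  Str : ∀ {x y : Ob}, (base x ⟶ base y) → Type v'
  idStr : ∀ x : Ob, Str (𝟙 (base x))
  compStr : ∀ {x y t : Ob} {f : base x ⟶ base y} {g : base y ⟶ base t},
    Str f → Str g → Str (f ≫ g)
  Two : ∀ {x y : Ob} {f g : base x ⟶ base y}, Str f → Str g → (f ⟶ g) → Prop
  two_id : ∀ {x y : Ob} {f : base x ⟶ base y} (a : Str f), Two a a (𝟙 f)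
  two_comp : ∀ {x y : Ob} {f g h : base x ⟶ base y} {a : Str f} {b : Str g} {c : Str h}
    {η : f ⟶ g} {θ : g ⟶ h}, Two a b η → Two b c θ → Two a c (η ≫ θ)
  two_whiskerLeft : ∀ {x y t : Ob} {f : base x ⟶ base y} {g h : base y ⟶ base t} (a : Str f)
    {b : Str g} {c : Str h} {η : g ⟶ h}, Two b c η → Two (compStr a b) (compStr a c) (f ◁ η)
  two_whiskerRight : ∀ {x y t : Ob} {f g : base x ⟶ base y} {h : base y ⟶ base t} {a : Str f}
    {b : Str g} (c : Str h) {η : f ⟶ g}, Two a b η → Two (compStr a c) (compStr b c) (η ▷ h)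
  two_associator : ∀ {x y t r : Ob} {f : base x ⟶ base y} {g : base y ⟶ base t}
    {h : base t ⟶ base r} (a : Str f) (b : Str g) (c : Str h),
    Two (compStr (compStr a b) c) (compStr a (compStr b c)) (α_ f g h).hom ∧
    Two (compStr a (compStr b c)) (compStr (compStr a b) c) (α_ f g h).inv
  two_leftUnitor : ∀ {x y : Ob} {f : base x ⟶ base y} (a : Str f),
    Two (compStr (idStr x) a) a (λ_ f).hom ∧ Two a (compStr (idStr x) a) (λ_ f).inv
  two_rightUnitor : ∀ {x y : Ob} {f : base x ⟶ base y} (a : Str f),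
    Two (compStr a (idStr y)) a (ρ_ f).hom ∧ Two a (compStr a (idStr y)) (ρ_ f).inv

namespace Displayed

variable {B : Type u} [Bicategory.{w, v} B]

/-- A class of 1-cells. -/
abbrev OneCells (D : Displayed.{w, v, v', u, u'} B) :=
  ∀ {x y : D.Ob} {f : D.base x ⟶ D.base y}, D.Str f → Prop

/-- The closure of a class of 1-cells under identities and composition. -/
inductive Generated (D : Displayed.{w, v, v', u, u'} B) (W : D.OneCells) :
    ∀ {x y : D.Ob} {f : D.base x ⟶ D.base y}, D.Str f → Prop
  | of {x y : D.Ob} {f : D.base x ⟶ D.base y} (a : D.Str f) : W a → Generated D W a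
  | id (x : D.Ob) : Generated D W (D.idStr x)
  | comp {x y t : D.Ob} {f : D.base x ⟶ D.base y} {g : D.base y ⟶ D.base t} {a : D.Str f}
      {b : D.Str g} : Generated D W a → Generated D W b → Generated D W (D.compStr a b)

theorem Generated.mono {D : Displayed.{w, v, v', u, u'} B} {W W' : D.OneCells}
    (h : ∀ {x y : D.Ob} {f : D.base x ⟶ D.base y} (a : D.Str f), W a → W' a)
    {x y : D.Ob} {f : D.base x ⟶ D.base y} {a : D.Str f} (ha : D.Generated W a) :
    D.Generated W' a := by
  induction ha with
  | of a ha => exact .of a (h a ha)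
  | id x => exact .id x
  | comp _ _ h1 h2 => exact .comp h1 h2

/-- Objects of the 2-category with 1-cells generated by `W`. -/
structure Total (D : Displayed.{w, v, v', u, u'} B) (W : D.OneCells) where
  obj : D.Ob

/-- 1-cells: a 1-cell of the base bicategory with extra structure. -/
structure Total.Hom {D : Displayed.{w, v, v', u, u'} B} {W : D.OneCells} (x y : D.Total W) where
  hom : D.base x.obj ⟶ D.base y.obj
  str : D.Str hom
  gen : D.Generated W str

/-- 2-cells: a 2-cell of the base bicategory compatible with the extra structures. -/
@[ext]
structure Total.Hom₂ {D : Displayed.{w, v, v', u, u'} B} {W : D.OneCells} {x y : D.Total W}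
    (f g : Total.Hom x y) where
  cell : f.hom ⟶ g.hom
  two : D.Two f.str g.str cell

instance {D : Displayed.{w, v, v', u, u'} B} {W : D.OneCells} : CategoryStruct (D.Total W) where
  Hom x y := Total.Hom x y
  id x := ⟨𝟙 _, D.idStr _, .id _⟩
  comp f g := ⟨f.hom ≫ g.hom, D.compStr f.str g.str, .comp f.gen g.gen⟩

instance {D : Displayed.{w, v, v', u, u'} B} {W : D.OneCells} (x y : D.Total W) :
    Category (x ⟶ y) where
  Hom f g := Total.Hom₂ f g
  id f := ⟨𝟙 _, D.two_id _⟩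
  comp η θ := ⟨η.cell ≫ θ.cell, D.two_comp η.two θ.two⟩
  id_comp _ := Total.Hom₂.ext (Category.id_comp _)
  comp_id _ := Total.Hom₂.ext (Category.comp_id _)
  assoc _ _ _ := Total.Hom₂.ext (Category.assoc _ _ _)

theorem Total.hom₂_ext {D : Displayed.{w, v, v', u, u'} B} {W : D.OneCells} {x y : D.Total W}
    {f g : x ⟶ y} {η θ : f ⟶ g} (h : η.cell = θ.cell) : η = θ :=
  Total.Hom₂.ext h

instance {D : Displayed.{w, v, v', u, u'} B} {W : D.OneCells} : Bicategory (D.Total W) where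
  whiskerLeft f _ _ (η : Total.Hom₂ _ _) := Total.Hom₂.mk (f.hom ◁ η.cell) (D.two_whiskerLeft f.str η.two)
  whiskerRight (η : Total.Hom₂ _ _) h := Total.Hom₂.mk (η.cell ▷ h.hom) (D.two_whiskerRight h.str η.two)
  associator f g h :=
    { hom := Total.Hom₂.mk ((α_ f.hom g.hom h.hom).hom) ((D.two_associator f.str g.str h.str).1)
      inv := Total.Hom₂.mk ((α_ f.hom g.hom h.hom).inv) ((D.two_associator f.str g.str h.str).2)
      hom_inv_id := Total.hom₂_ext (Iso.hom_inv_id _)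
      inv_hom_id := Total.hom₂_ext (Iso.inv_hom_id _) }
  leftUnitor f :=
    { hom := Total.Hom₂.mk ((λ_ f.hom).hom) ((D.two_leftUnitor f.str).1)
      inv := Total.Hom₂.mk ((λ_ f.hom).inv) ((D.two_leftUnitor f.str).2)
      hom_inv_id := Total.hom₂_ext (Iso.hom_inv_id _)
      inv_hom_id := Total.hom₂_ext (Iso.inv_hom_id _) }
  rightUnitor f :=
    { hom := Total.Hom₂.mk ((ρ_ f.hom).hom) ((D.two_rightUnitor f.str).1)
      inv := Total.Hom₂.mk ((ρ_ f.hom).inv) ((D.two_rightUnitor f.str).2)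
      hom_inv_id := Total.hom₂_ext (Iso.hom_inv_id _)
      inv_hom_id := Total.hom₂_ext (Iso.inv_hom_id _) }
  whiskerLeft_id _ _ := Total.hom₂_ext (whiskerLeft_id _ _)
  whiskerLeft_comp _ _ _ _ _ _ := Total.hom₂_ext (whiskerLeft_comp _ _ _)
  id_whiskerLeft _ := Total.hom₂_ext (id_whiskerLeft _)
  comp_whiskerLeft _ _ _ _ _ := Total.hom₂_ext (comp_whiskerLeft _ _ _)
  id_whiskerRight _ _ := Total.hom₂_ext (id_whiskerRight _ _)
  comp_whiskerRight _ _ _ := Total.hom₂_ext (comp_whiskerRight _ _ _)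
  whiskerRight_id _ := Total.hom₂_ext (whiskerRight_id _)
  whiskerRight_comp _ _ _ := Total.hom₂_ext (whiskerRight_comp _ _ _)
  whisker_assoc _ _ _ _ _ := Total.hom₂_ext (whisker_assoc _ _ _)
  whisker_exchange _ _ := Total.hom₂_ext (whisker_exchange _ _)
  pentagon _ _ _ _ := Total.hom₂_ext (pentagon _ _ _ _)
  triangle _ _ := Total.hom₂_ext (triangle _ _)

/-- The inclusion of the 2-categories generated by two nested classes of 1-cells. -/
def inclusion {D : Displayed.{w, v, v', u, u'} B} {W W' : D.OneCells}
    (h : ∀ {x y : D.Ob} {f : D.base x ⟶ D.base y} (a : D.Str f), W a → W' a) :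
    StrictPseudofunctor (D.Total W) (D.Total W') :=
  StrictPseudofunctor.mk'
    { obj := fun x => ⟨x.obj⟩
      map := fun (f : Total.Hom _ _) => Total.Hom.mk f.hom f.str (f.gen.mono h)
      map₂ := fun (η : Total.Hom₂ _ _) => Total.Hom₂.mk η.cell η.two
      map₂_id := fun _ => rfl
      map₂_comp := fun _ _ => rfl
      map_id := fun _ => rfl
      map_comp := fun _ _ => rfl
      map₂_whisker_left := fun _ _ _ _ => by
        rw [eqToHom_refl, eqToHom_refl, Category.id_comp, Category.comp_id]; rfl
      map₂_whisker_right := fun _ _ => by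
        rw [eqToHom_refl, eqToHom_refl, Category.id_comp, Category.comp_id]; rfl
      map₂_left_unitor := fun _ => by rw [eqToHom_refl, Category.id_comp]; rfl
      map₂_right_unitor := fun _ => by rw [eqToHom_refl, Category.id_comp]; rfl
      map₂_associator := fun _ _ _ => by
        rw [eqToHom_refl, eqToHom_refl, Category.id_comp, Category.comp_id]; rfl }

end Displayed

/-! ### Strict natural transformations, adjunctions and equivalences of 2-functors -/

section TwoFunctors

variable {B : Type u} [Bicategory.{w, v} B] {B' : Type u'} [Bicategory.{w', v'} B']

/-- A strict 2-natural transformation between strict 2-functors. -/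
structure TwoNatTrans (F G : StrictPseudofunctor B B') where
  app : ∀ x : B, F.obj x ⟶ G.obj x
  naturality : ∀ {x y : B} (f : x ⟶ y), F.map f ≫ app y = app x ≫ G.map f
  naturality₂ : ∀ {x y : B} {f g : x ⟶ y} (η : f ⟶ g),
    F.map₂ η ▷ app y = eqToHom (naturality f) ≫ app x ◁ G.map₂ η ≫ eqToHom (naturality g).symm

/-- A strict 2-natural transformation with invertible components. -/
def TwoNatTrans.IsInvertible {F G : StrictPseudofunctor B B'} (τ : TwoNatTrans F G) : Prop :=
  ∀ x : B, ∃ g : G.obj x ⟶ F.obj x, τ.app x ≫ g = 𝟙 (F.obj x) ∧ g ≫ τ.app x = 𝟙 (G.obj x)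

/-- A strict 2-adjunction `L ⊣ R`. -/
structure TwoAdjunction (L : StrictPseudofunctor B B') (R : StrictPseudofunctor B' B) where
  unit : TwoNatTrans (StrictPseudofunctor.id B) (L.comp R)
  counit : TwoNatTrans (R.comp L) (StrictPseudofunctor.id B')
  left_triangle : ∀ x : B, L.map (unit.app x) ≫ counit.app (L.obj x) = 𝟙 (L.obj x)
  right_triangle : ∀ y : B', unit.app (R.obj y) ≫ R.map (counit.app y) = 𝟙 (R.obj y)

/-- A 2-adjunction is an equivalence if its unit and counit are invertible. -/
structure TwoAdjunction.IsEquivalence {L : StrictPseudofunctor B B'}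
    {R : StrictPseudofunctor B' B} (adj : TwoAdjunction L R) : Prop where
  unit : adj.unit.IsInvertible
  counit : adj.counit.IsInvertible

/-- A 2-functor is an equivalence of 2-categories: it is bijective on 1-cells and on 2-cells and
essentially surjective on objects. -/
structure IsTwoEquivalence (F : StrictPseudofunctor B B') : Prop where
  bijective : ∀ x y : B, Function.Bijective (fun f : x ⟶ y => F.map f)
  bijective₂ : ∀ {x y : B} (f g : x ⟶ y), Function.Bijective (fun η : f ⟶ g => F.map₂ η)
  surjective : ∀ y : B', ∃ (x : B) (f : F.obj x ⟶ y) (g : y ⟶ F.obj x),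
    f ≫ g = 𝟙 (F.obj x) ∧ g ≫ f = 𝟙 y

end TwoFunctors

/-! ### Cloven fibrations and their fibres -/

section Vertical

variable {X : Type u} [Category.{v} X] {C : Type u'} [Category.{v'} C]

/-- The inclusion of a fibre into the total category. -/
abbrev inc (P : C ⥤ X) (A : X) : P.Fiber A ⥤ C := Functor.Fiber.fiberInclusion

variable {P : C ⥤ X}

/-- The vertical morphism into the domain of a cartesian morphism `χ` over `k`, induced by a
morphism `φ` over `k`. -/
noncomputable def vert {A A' : X} (k : A ⟶ A') {E₀ E₁ : P.Fiber A} {e : C}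
    (χ : (inc P A).obj E₁ ⟶ e) (hχ : P.IsStronglyCartesian k χ) (φ : (inc P A).obj E₀ ⟶ e)
    (h : P.IsHomLift k φ) : E₀ ⟶ E₁ :=
  ⟨@Functor.IsStronglyCartesian.map _ _ _ _ P _ _ _ _ k χ hχ _ _ (𝟙 A) k
      (Category.id_comp k).symm φ h,
    @Functor.IsStronglyCartesian.map_isHomLift _ _ _ _ P _ _ _ _ k χ hχ _ _ (𝟙 A) k
      (Category.id_comp k).symm φ h⟩

theorem vert_fac {A A' : X} (k : A ⟶ A') {E₀ E₁ : P.Fiber A} {e : C}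
    (χ : (inc P A).obj E₁ ⟶ e) (hχ : P.IsStronglyCartesian k χ) (φ : (inc P A).obj E₀ ⟶ e)
    (h : P.IsHomLift k φ) : (inc P A).map (vert k χ hχ φ h) ≫ χ = φ :=
  @Functor.IsStronglyCartesian.fac _ _ _ _ P _ _ _ _ k χ hχ _ _ (𝟙 A) k
    (Category.id_comp k).symm φ h

theorem vert_ext {A A' : X} (k : A ⟶ A') {E₀ E₁ : P.Fiber A} {e : C}
    (χ : (inc P A).obj E₁ ⟶ e) (hχ : P.IsStronglyCartesian k χ) {ξ ξ' : E₀ ⟶ E₁}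
    (h : (inc P A).map ξ ≫ χ = (inc P A).map ξ' ≫ χ) : ξ = ξ' :=
  Subtype.ext (@Functor.IsStronglyCartesian.ext _ _ _ _ P _ _ _ _ k χ hχ _ _ (𝟙 A) _ _
    ξ.2 ξ'.2 h)

theorem isHomLift_comp {A A' A'' : X} {f : A ⟶ A'} {g : A' ⟶ A''} {E E' E'' : C} {φ : E ⟶ E'}
    {ψ : E' ⟶ E''} (hφ : P.IsHomLift f φ) (hψ : P.IsHomLift g ψ) :
    P.IsHomLift (f ≫ g) (φ ≫ ψ) :=
  inferInstance

theorem isHomLift_of_eq {A A' : X} {f g : A ⟶ A'} {E E' : C} {φ : E ⟶ E'}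
    (hφ : P.IsHomLift f φ) (h : f = g) : P.IsHomLift g φ := h ▸ hφ

theorem isHomLift_comp_eq {A A' A'' : X} {f : A ⟶ A'} {g : A' ⟶ A''} {k : A ⟶ A''}
    {E E' E'' : C} {φ : E ⟶ E'} {ψ : E' ⟶ E''} (hφ : P.IsHomLift f φ) (hψ : P.IsHomLift g ψ)
    (h : f ≫ g = k) : P.IsHomLift k (φ ≫ ψ) :=
  isHomLift_of_eq (isHomLift_comp hφ hψ) h

theorem isStronglyCartesian_comp {A A' A'' : X} {f : A ⟶ A'} {g : A' ⟶ A''} {E E' E'' : C}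
    {φ : E ⟶ E'} {ψ : E' ⟶ E''} (hφ : P.IsStronglyCartesian f φ)
    (hψ : P.IsStronglyCartesian g ψ) : P.IsStronglyCartesian (f ≫ g) (φ ≫ ψ) :=
  inferInstance

theorem isStronglyCartesian_id {A : X} (E : P.Fiber A) :
    P.IsStronglyCartesian (𝟙 A) (𝟙 ((inc P A).obj E)) :=
  haveI : P.IsHomLift (𝟙 A) (𝟙 ((inc P A).obj E)) := IsHomLift.id E.2
  Functor.IsStronglyCartesian.of_isIso P (𝟙 A) (𝟙 _)

/-- The comparison of two cartesian morphisms over the same map with the same codomain. -/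
noncomputable def vertIso {A A' : X} (k : A ⟶ A') {E₀ E₁ : P.Fiber A} {e : C}
    (χ₀ : (inc P A).obj E₀ ⟶ e) (h₀ : P.IsStronglyCartesian k χ₀)
    (χ₁ : (inc P A).obj E₁ ⟶ e) (h₁ : P.IsStronglyCartesian k χ₁) : E₀ ≅ E₁ where
  hom := vert k χ₁ h₁ χ₀ h₀.toIsHomLift
  inv := vert k χ₀ h₀ χ₁ h₁.toIsHomLift
  hom_inv_id := vert_ext k χ₀ h₀ (by
    rw [CategoryTheory.Functor.map_comp, Category.assoc, vert_fac, vert_fac, CategoryTheory.Functor.map_id, Category.id_comp])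
  inv_hom_id := vert_ext k χ₁ h₁ (by
    rw [CategoryTheory.Functor.map_comp, Category.assoc, vert_fac, vert_fac, CategoryTheory.Functor.map_id, Category.id_comp])

end Vertical

/-- A cleavage: a choice of cartesian lifts. -/
structure Cleavage {X : Type u} [Category.{v} X] {C : Type u'} [Category.{v'} C] (P : C ⥤ X) where
  pull : ∀ {A A' : X}, (A ⟶ A') → P.Fiber A' → P.Fiber A
  lift : ∀ {A A' : X} (f : A ⟶ A') (E : P.Fiber A'),
    (inc P A).obj (pull f E) ⟶ (inc P A').obj E
  cartesian : ∀ {A A' : X} (f : A ⟶ A') (E : P.Fiber A'), P.IsStronglyCartesian f (lift f E)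

namespace Cleavage

variable {X : Type u} [Category.{v} X] {C : Type u'} [Category.{v'} C] {P : C ⥤ X}
  (cl : Cleavage P)

theorem isHomLift {A A' : X} (f : A ⟶ A') (E : P.Fiber A') : P.IsHomLift f (cl.lift f E) :=
  (cl.cartesian f E).toIsHomLift

/-- The action of the substitution functor `f^*` on morphisms. -/
noncomputable def pullMap {A A' : X} (f : A ⟶ A') {E E' : P.Fiber A'} (ξ : E ⟶ E') :
    cl.pull f E ⟶ cl.pull f E' :=
  vert f (cl.lift f E') (cl.cartesian f E') (cl.lift f E ≫ (inc P A').map ξ)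
    (isHomLift_comp_eq (cl.isHomLift f E) ξ.2 (Category.comp_id f))

theorem pullMap_lift {A A' : X} (f : A ⟶ A') {E E' : P.Fiber A'} (ξ : E ⟶ E') :
    (inc P A).map (cl.pullMap f ξ) ≫ cl.lift f E' = cl.lift f E ≫ (inc P A').map ξ :=
  vert_fac _ _ _ _ _

/-- The substitution functor `f^*`. -/
noncomputable def pullFunctor {A A' : X} (f : A ⟶ A') : P.Fiber A' ⥤ P.Fiber A where
  obj E := cl.pull f E
  map ξ := cl.pullMap f ξ
  map_id E := vert_ext f _ (cl.cartesian f E) (by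
    rw [pullMap_lift, CategoryTheory.Functor.map_id, CategoryTheory.Functor.map_id, Category.comp_id, Category.id_comp])
  map_comp {E E' E''} ξ ξ' := vert_ext f _ (cl.cartesian f E'') (by
    rw [pullMap_lift, CategoryTheory.Functor.map_comp, CategoryTheory.Functor.map_comp, Category.assoc, pullMap_lift,
      ← Category.assoc, ← Category.assoc, pullMap_lift])

/-- The unitor `id^* ≅ id`. -/
noncomputable def unit {A : X} (E : P.Fiber A) : cl.pull (𝟙 A) E ≅ E :=
  vertIso (𝟙 A) (cl.lift (𝟙 A) E) (cl.cartesian _ _) (𝟙 _) (isStronglyCartesian_id E)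

theorem unit_hom {A : X} (E : P.Fiber A) : (inc P A).map (cl.unit E).hom = cl.lift (𝟙 A) E :=
  (Category.comp_id _).symm.trans (vert_fac _ _ _ _ _)

/-- The compositor `(f ≫ g)^* ≅ f^* g^*`. -/
noncomputable def compositor {A A' A'' : X} (f : A ⟶ A') (g : A' ⟶ A'') (E : P.Fiber A'') :
    cl.pull (f ≫ g) E ≅ cl.pull f (cl.pull g E) :=
  vertIso (f ≫ g) (cl.lift (f ≫ g) E) (cl.cartesian _ _) (cl.lift f (cl.pull g E) ≫ cl.lift g E)
    (isStronglyCartesian_comp (cl.cartesian _ _) (cl.cartesian _ _))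

theorem compositor_hom {A A' A'' : X} (f : A ⟶ A') (g : A' ⟶ A'') (E : P.Fiber A'') :
    (inc P A).map (cl.compositor f g E).hom ≫ cl.lift f (cl.pull g E) ≫ cl.lift g E =
      cl.lift (f ≫ g) E :=
  vert_fac _ _ _ _ _

theorem compositor_inv {A A' A'' : X} (f : A ⟶ A') (g : A' ⟶ A'') (E : P.Fiber A'') :
    (inc P A).map (cl.compositor f g E).inv ≫ cl.lift (f ≫ g) E =
      cl.lift f (cl.pull g E) ≫ cl.lift g E :=
  vert_fac _ _ _ _ _

theorem unit_naturality {A : X} {E E' : P.Fiber A} (ξ : E ⟶ E') :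
    cl.pullMap (𝟙 A) ξ ≫ (cl.unit E').hom = (cl.unit E).hom ≫ ξ :=
  (inc P A).map_injective (by
    rw [CategoryTheory.Functor.map_comp, CategoryTheory.Functor.map_comp, unit_hom, unit_hom, pullMap_lift])

theorem compositor_naturality {A A' A'' : X} (f : A ⟶ A') (g : A' ⟶ A'') {E E' : P.Fiber A''}
    (ξ : E ⟶ E') : cl.pullMap (f ≫ g) ξ ≫ (cl.compositor f g E').hom =
      (cl.compositor f g E).hom ≫ cl.pullMap f (cl.pullMap g ξ) :=
  vert_ext (f ≫ g) (cl.lift f (cl.pull g E') ≫ cl.lift g E')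
    (isStronglyCartesian_comp (cl.cartesian _ _) (cl.cartesian _ _)) (by
    rw [CategoryTheory.Functor.map_comp, CategoryTheory.Functor.map_comp, Category.assoc, compositor_hom, pullMap_lift,
      Category.assoc, ← Category.assoc _ (cl.lift f _), pullMap_lift, Category.assoc,
      pullMap_lift, ← compositor_hom, Category.assoc, Category.assoc])

theorem eqToHom_lift {A A' : X} {f g : A ⟶ A'} (h : f = g) (E : P.Fiber A')
    (h' : cl.pull f E = cl.pull g E) :
    (inc P A).map (eqToHom h') ≫ cl.lift g E = cl.lift f E := by
  subst h
  exact (congrArg (· ≫ _) ((inc P A).map_id _)).trans (Category.id_comp _)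

theorem associativity {A B A' A'' : X} (f : A ⟶ B) (g : B ⟶ A') (h : A' ⟶ A'')
    (E : P.Fiber A'') (h' : cl.pull (f ≫ g ≫ h) E = cl.pull ((f ≫ g) ≫ h) E) :
    (cl.compositor f (g ≫ h) E).hom ≫ cl.pullMap f (cl.compositor g h E).hom ≫
      (cl.compositor f g (cl.pull h E)).inv ≫ (cl.compositor (f ≫ g) h E).inv = eqToHom h' :=
  vert_ext ((f ≫ g) ≫ h) _ (cl.cartesian _ E) (by
    rw [cl.eqToHom_lift (Category.assoc f g h).symm]
    simp only [CategoryTheory.Functor.map_comp, Category.assoc]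
    rw [compositor_inv, ← Category.assoc ((inc P A).map (cl.compositor f g _).inv),
      compositor_inv, Category.assoc, ← Category.assoc ((inc P A).map (cl.pullMap f _)),
      pullMap_lift, Category.assoc, compositor_hom, compositor_hom])

theorem left_unitality {A A' : X} (f : A ⟶ A') (E : P.Fiber A')
    (h : cl.pull (f ≫ 𝟙 A') E = cl.pull f E) :
    (cl.compositor f (𝟙 A') E).hom ≫ cl.pullMap f (cl.unit E).hom = eqToHom h :=
  vert_ext f _ (cl.cartesian f E) (by
    rw [cl.eqToHom_lift (Category.comp_id f), CategoryTheory.Functor.map_comp, Category.assoc, pullMap_lift,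
      unit_hom, compositor_hom])

theorem right_unitality {A A' : X} (f : A ⟶ A') (E : P.Fiber A')
    (h : cl.pull (𝟙 A ≫ f) E = cl.pull f E) :
    (cl.compositor (𝟙 A) f E).hom ≫ (cl.unit (cl.pull f E)).hom = eqToHom h :=
  vert_ext f _ (cl.cartesian f E) (by
    rw [cl.eqToHom_lift (Category.id_comp f), CategoryTheory.Functor.map_comp, Category.assoc,
      unit_hom, compositor_hom])

end Cleavage

/-- The indexed category of fibres of a cloven fibration. -/
noncomputable def Cleavage.fibres {X : Type u} [Category.{u} X] {C : Type u} [Category.{u} C]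
    {P : C ⥤ X} (cl : Cleavage P) : Pseudofunctor (LocallyDiscrete Xᵒᵖ) Cat.{u, u} :=
  LocallyDiscrete.mkPseudofunctor (B₀ := Xᵒᵖ) (C := Cat.{u, u})
    (fun A => Cat.of (P.Fiber A.unop))
    (fun f => (cl.pullFunctor f.unop).toCatHom)
    (fun A => Cat.Hom.isoMk (NatIso.ofComponents (fun E => cl.unit E)
      (fun ξ => cl.unit_naturality ξ)))
    (fun f g => Cat.Hom.isoMk (NatIso.ofComponents (fun E => cl.compositor g.unop f.unop E)
      (fun ξ => cl.compositor_naturality g.unop f.unop ξ)))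
    (fun f g h => by
      apply Cat.Hom₂.ext
      ext E
      rw [Cat.Hom₂.eqToHom_toNatTrans, eqToHom_app]
      refine Eq.trans ?_ (cl.associativity h.unop g.unop f.unop E (by simp))
      change (cl.compositor h.unop (g.unop ≫ f.unop) E).hom ≫
        cl.pullMap h.unop (cl.compositor g.unop f.unop E).hom ≫ 𝟙 _ ≫
        (cl.compositor h.unop g.unop (cl.pull f.unop E)).inv ≫
        (cl.compositor (h.unop ≫ g.unop) f.unop E).inv = _
      rw [Category.id_comp])
    (fun f => by
      apply Cat.Hom₂.ext
      ext E
      rw [Cat.Hom₂.eqToHom_toNatTrans, eqToHom_app]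
      refine Eq.trans ?_ (cl.left_unitality f.unop E (by simp))
      change (cl.compositor f.unop (𝟙 _) E).hom ≫ cl.pullMap f.unop (cl.unit E).hom ≫ 𝟙 _ = _
      exact congrArg (_ ≫ ·) (Category.comp_id _))
    (fun f => by
      apply Cat.Hom₂.ext
      ext E
      rw [Cat.Hom₂.eqToHom_toNatTrans, eqToHom_app]
      refine Eq.trans ?_ (cl.right_unitality f.unop E (by simp))
      change (cl.compositor (𝟙 _) f.unop E).hom ≫ (cl.unit (cl.pull f.unop E)).hom ≫ 𝟙 _ = _
      exact congrArg (_ ≫ ·) (Category.comp_id _))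

section LawCoherence

variable {C : Type u} [Category.{v} C] {C' : Type u'} [Category.{v'} C']
  {C'' : Type u''} [Category.{v''} C''] {C''' : Type t} [Category.{t'} C''']
  {D : TangentData C} {D' : TangentData C'} {D'' : TangentData C''} {D''' : TangentData C'''}
  {o : Bool} {F : C ⥤ C'} {G : C' ⥤ C''} {H : C'' ⥤ C'''}

theorem Law.compat_of_eq {α β : Law o D D' F} (h : α = β) : α.Compat β (𝟙 F) :=
  h ▸ Law.compat_id α

theorem Law.comp_assoc (α : Law o D D' F) (β : Law o D' D'' G) (γ : Law o D'' D''' H) :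
    ((α.comp β).comp γ : Law o D D''' (F ⋙ G ⋙ H)) = α.comp (β.comp γ) := by
  cases o <;> funext A <;> simp [Law.comp]

theorem Law.id_comp (α : Law o D D' F) : ((Law.id o D).comp α : Law o D D' F) = α := by
  cases o <;> funext A <;> simp [Law.comp, Law.id]

theorem Law.comp_id (α : Law o D D' F) : (α.comp (Law.id o D') : Law o D D' F) = α := by
  cases o <;> funext A <;> simp [Law.comp, Law.id]

end LawCoherence

/-! ### Tangent fibrations -/

section Fibration

variable {X : Type u} [Category.{v} X] {C : Type u'} [Category.{v'} C]

/-- The functor `P` is a strict tangent morphism: it preserves the pullbacks of the tangent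
structure and carries the structure of `D'` to that of `D` on the nose. -/
structure IsStrictOver (D : TangentData X) (D' : TangentData C) (P : C ⥤ X) : Prop where
  T : ∀ {A A' : X} {f : A ⟶ A'} {E E' : C} {φ : E ⟶ E'}, P.IsHomLift f φ →
    P.IsHomLift (D.T.map f) (D'.T.map φ)
  p : ∀ {A : X} (E : P.Fiber A), P.IsHomLift (D.p A) (D'.p E.1)
  z : ∀ {A : X} (E : P.Fiber A), P.IsHomLift (D.z A) (D'.z E.1)
  s : ∀ {A : X} (E : P.Fiber A) (k : P.obj (D'.T₂ E.1) ⟶ D.T₂ A),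
    P.IsHomLift (k ≫ D.π₁ A) (D'.π₁ E.1) → P.IsHomLift (k ≫ D.π₂ A) (D'.π₂ E.1) →
      P.IsHomLift (k ≫ D.s A) (D'.s E.1)
  l : ∀ {A : X} (E : P.Fiber A), P.IsHomLift (D.l A) (D'.l E.1)
  c : ∀ {A : X} (E : P.Fiber A), P.IsHomLift (D.c A) (D'.c E.1)
  preserves : PreservesTangentLimits D' P

end Fibration

/-- A functor with a cleavage and tangent data on its total category. -/
structure RawFibration (X : Type u) [Category.{v} X] where
  tot : BasedCategory.{v', u'} X
  cl : Cleavage tot.p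
  D : TangentData tot.obj

/-- Cloven tangent fibrations over `(X, D)`: strict tangent morphisms with a cleavage, whose total
tangent bundle functor preserves cartesian lifts. -/
structure RawFibration.IsTangent {X : Type u} [Category.{v} X] (D : TangentData X)
    (Q : RawFibration.{v, v', u, u'} X) : Prop where
  base : D.IsTangent
  total : Q.D.IsTangent
  strict : IsStrictOver D Q.D Q.tot.p
  cartesian : ∀ {A A' : X} {f : A ⟶ A'} {E E' : Q.tot.obj} {φ : E ⟶ E'},
    Q.tot.p.IsStronglyCartesian f φ → Q.tot.p.IsStronglyCartesian (D.T.map f) (Q.D.T.map φ)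

section FibrationTwoCategory

variable {X : Type u} [Category.{v} X]

/-- A law that makes a functor over `X` a morphism of tangent fibrations over the identity of
`(X, D)`: the law lies over the identity, and the functor preserves cartesian morphisms. -/
structure IsFibrationLaw (D : TangentData X) {Q Q' : RawFibration.{v, v', u, u'} X} {o : Bool}
    (F : BasedFunctor Q.tot Q'.tot) (β : Law o Q.D Q'.D F.toFunctor) : Prop where
  natural : β.IsNatural
  vertical : ∀ E : Q.tot.obj,
    match o, β with
    | false, β => Q'.tot.p.IsHomLift (𝟙 (D.T.obj (Q.tot.p.obj E))) (β E)
    | true, β => Q'.tot.p.IsHomLift (𝟙 (D.T.obj (Q.tot.p.obj E))) (β E)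
  cartesian : ∀ {A A' : X} {f : A ⟶ A'} {E E' : Q.tot.obj} {φ : E ⟶ E'},
    Q.tot.p.IsStronglyCartesian f φ → Q'.tot.p.IsStronglyCartesian f (F.map φ)

theorem isHomLift_id_id {C : Type u'} [Category.{v'} C] {P : C ⥤ X} {A : X} {E E' E'' : C}
    {φ : E ⟶ E'} {ψ : E' ⟶ E''} (hφ : P.IsHomLift (𝟙 A) φ) (hψ : P.IsHomLift (𝟙 A) ψ) :
    P.IsHomLift (𝟙 A) (φ ≫ ψ) :=
  isHomLift_comp_eq hφ hψ (Category.id_comp _)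

theorem isFibrationLaw_id {D : TangentData X} {Q : RawFibration.{v, v', u, u'} X} {o : Bool}
    (hQ : Q.IsTangent D) :
    IsFibrationLaw D (Q := Q) (Q' := Q) (𝟙 Q.tot : BasedFunctor Q.tot Q.tot) (Law.id o Q.D) where
  natural := Law.isNatural_id
  vertical E := by
    have h : Q.tot.p.IsHomLift (D.T.map (𝟙 (Q.tot.p.obj E))) (Q.D.T.map (𝟙 E)) :=
      hQ.strict.T inferInstance
    rw [CategoryTheory.Functor.map_id, CategoryTheory.Functor.map_id] at h
    cases o <;> exact h
  cartesian h := h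

theorem IsFibrationLaw.comp {D : TangentData X} {Q Q' Q'' : RawFibration.{v, v', u, u'} X}
    {o : Bool} {F : BasedFunctor Q.tot Q'.tot} {G : BasedFunctor Q'.tot Q''.tot}
    {β : Law o Q.D Q'.D F.toFunctor} {γ : Law o Q'.D Q''.D G.toFunctor}
    (h : IsFibrationLaw D F β) (h' : IsFibrationLaw D G γ) :
    IsFibrationLaw D (Q := Q) (Q' := Q'') (F.comp G) (β.comp γ) where
  natural := h.natural.comp h'.natural
  vertical E := by
    have h1 := h.vertical E
    have h2 := h'.vertical (F.obj E)
    have e : Q'.tot.p.obj (F.obj E) = Q.tot.p.obj E := F.w_obj E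
    rw [e] at h2
    cases o
    · exact isHomLift_id_id (G.preserves_isHomLift _ _) h2
    · exact isHomLift_id_id h2 (G.preserves_isHomLift _ _)
  cartesian := fun k => h'.cartesian (h.cartesian k)

/-- Tangent fibrations over `(X, D)`, functors with a distributive law, and vertical natural
transformations. -/
def fibDisplayed (o : Bool) (D : TangentData X) :
    Displayed (BasedCategory.{v', u'} X) where
  Ob := {Q : RawFibration.{v, v', u, u'} X // Q.IsTangent D}
  base Q := Q.1.tot
  Str {Q Q'} F := {β : Law o Q.1.D Q'.1.D F.toFunctor // IsFibrationLaw D (Q := Q.1) (Q' := Q'.1) F β}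
  idStr Q := ⟨Law.id o Q.1.D, isFibrationLaw_id Q.2⟩
  compStr β γ := ⟨β.1.comp γ.1, β.2.comp γ.2⟩
  Two β γ θ := β.1.Compat γ.1 θ.toNatTrans
  two_id β := Law.compat_id β.1
  two_comp h h' := h.vcomp h'
  two_whiskerLeft β _ _ _ h := h.whiskerLeft β.1
  two_whiskerRight γ _ h := h.whiskerRight γ.2.natural
  two_associator a b c :=
    ⟨Law.compat_of_eq (Law.comp_assoc a.1 b.1 c.1), Law.compat_of_eq (Law.comp_assoc a.1 b.1 c.1).symm⟩
  two_leftUnitor a :=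
    ⟨Law.compat_of_eq (Law.id_comp a.1), Law.compat_of_eq (Law.id_comp a.1).symm⟩
  two_rightUnitor a :=
    ⟨Law.compat_of_eq (Law.comp_id a.1), Law.compat_of_eq (Law.comp_id a.1).symm⟩

/-- The 2-categories of tangent fibrations over `(X, D)` with 1-cells generated by the lax, colax,
strong or strict morphisms. -/
abbrev TngFib (fl : Flavour) (D : TangentData X) :=
  (fibDisplayed.{v, v', u, u'} fl.isColax D).Total
    (fun {Q Q' F} β => IsTangentMorphism Q.1.D Q'.1.D F.toFunctor fl β.1)

end FibrationTwoCategory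

/-! ### The tangent structures of the fibres of a tangent fibration -/

section Fibres

variable {X : Type u} [Category.{v} X] {D : TangentData X}

theorem isHomLift_factor {C : Type u'} [Category.{v'} C] {P : C ⥤ X} {A A' : X} {f : A ⟶ A'}
    {e e₁ e' x : C} {k : e ⟶ e₁} {m : e₁ ⟶ e'} {χ : x ⟶ e₁} (hA : A = P.obj e)
    (h : P.IsHomLift f (k ≫ m)) (hχ : P.IsHomLift (eqToHom hA ≫ P.map k) χ) :
    P.IsHomLift f (χ ≫ m) := by
  subst hA
  rw [eqToHom_refl, Category.id_comp] at hχ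
  obtain rfl := IsHomLift.codomain_eq P f (k ≫ m)
  have e : f = P.map (k ≫ m) := by simpa using IsHomLift.fac P f (k ≫ m)
  rw [e, P.map_comp]
  exact isHomLift_comp hχ inferInstance

namespace TangentData.IsTangent

variable {C : Type u'} [Category.{v'} C] {D' : TangentData C} (h : D'.IsTangent)

theorem z_p (h : D'.IsTangent) (A : C) : D'.z A ≫ D'.p A = 𝟙 A := (h.additive A).zero_q

theorem p_z (h : D'.IsTangent) (A : C) : D'.p A ≫ D'.z A ≫ D'.p A = D'.p A := by rw [h.z_p, Category.comp_id]

theorem z_l (h : D'.IsTangent) (A : C) : D'.z A ≫ D'.l A = D'.z A ≫ D'.T.map (D'.z A) := (h.l_additive A).zero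

theorem z_z_c (h : D'.IsTangent) (A : C) :
    (D'.z A ≫ D'.T.map (D'.z A)) ≫ D'.c A = D'.z A ≫ D'.T.map (D'.z A) := by
  have h1 : D'.T.map (D'.z A) ≫ D'.c A = 𝟙 _ ≫ D'.z (D'.T.obj A) := (h.c_additive A).zero
  rw [Category.assoc, h1, Category.id_comp, h.z_nat]

/-- The pair `(z, z)`. -/
noncomputable def zz (A : C) : A ⟶ D'.T₂ A :=
  (h.additive A).isPullback.lift (D'.z A) (D'.z A) rfl

theorem zz_fst (A : C) : h.zz A ≫ D'.π₁ A = D'.z A := (h.additive A).isPullback.lift_fst _ _ _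

theorem zz_snd (A : C) : h.zz A ≫ D'.π₂ A = D'.z A := (h.additive A).isPullback.lift_snd _ _ _

theorem zz_s (A : C) : h.zz A ≫ D'.s A = D'.z A := by
  let k : D'.T.obj A ⟶ D'.T₂ A := (h.additive A).isPullback.lift (D'.p A ≫ D'.z A) (𝟙 _)
    (by change (D'.p A ≫ D'.z A) ≫ D'.p A = 𝟙 _ ≫ D'.p A
        rw [Category.assoc, h.p_z, Category.id_comp])
  have k1 : k ≫ D'.π₁ A = D'.p A ≫ D'.z A := (h.additive A).isPullback.lift_fst _ _ _
  have k2 : k ≫ D'.π₂ A = 𝟙 _ := (h.additive A).isPullback.lift_snd _ _ _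
  have k3 : k ≫ D'.s A = 𝟙 _ := (h.additive A).zero_add k k1 k2
  have e : h.zz A = D'.z A ≫ k := (h.additive A).isPullback.hom_ext
    (by change h.zz A ≫ D'.π₁ A = (D'.z A ≫ k) ≫ D'.π₁ A
        rw [h.zz_fst, Category.assoc, k1, ← Category.assoc, h.z_p, Category.id_comp])
    (by change h.zz A ≫ D'.π₂ A = (D'.z A ≫ k) ≫ D'.π₂ A
        rw [h.zz_snd, Category.assoc, k2, Category.comp_id])
  rw [e, Category.assoc, k3, Category.comp_id]

end TangentData.IsTangent

namespace RawFibration.IsTangent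

variable {Q : RawFibration.{v, v', u, u'} X} (h : Q.IsTangent D)

/-- `T' E`, in the fibre over `T A`. -/
def tan {A : X} (E : Q.tot.p.Fiber A) : Q.tot.p.Fiber (D.T.obj A) :=
  ⟨Q.D.T.obj E.1, by
    have := h.strict.T (show Q.tot.p.IsHomLift (𝟙 A) (𝟙 E.1) from IsHomLift.id E.2)
    exact IsHomLift.domain_eq Q.tot.p (D.T.map (𝟙 A)) (Q.D.T.map (𝟙 E.1))⟩

theorem tan_map (h : Q.IsTangent D) {A A' : X} {f : A ⟶ A'} {E : Q.tot.p.Fiber A} {E' : Q.tot.p.Fiber A'}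
    (φ : (inc _ A).obj E ⟶ (inc _ A').obj E') (hφ : Q.tot.p.IsHomLift f φ) :
    Q.tot.p.IsHomLift (D.T.map f) (Q.D.T.map φ) := h.strict.T hφ

/-- The object `z^* T' E`. -/
def fibreT {A : X} (E : Q.tot.p.Fiber A) : Q.tot.p.Fiber A := Q.cl.pull (D.z A) (h.tan E)

/-- The cartesian morphism `z^* T' E ⟶ T' E`. -/
def zLift {A : X} (E : Q.tot.p.Fiber A) :
    (inc Q.tot.p A).obj (h.fibreT E) ⟶ Q.D.T.obj ((inc Q.tot.p A).obj E) :=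
  Q.cl.lift (D.z A) (h.tan E)

theorem zLift_cartesian {A : X} (E : Q.tot.p.Fiber A) :
    Q.tot.p.IsStronglyCartesian (D.z A) (h.zLift E) := Q.cl.cartesian _ _

theorem zLift_isHomLift {A : X} (E : Q.tot.p.Fiber A) :
    Q.tot.p.IsHomLift (D.z A) (h.zLift E) := (h.zLift_cartesian E).toIsHomLift

/-- The action of `z^* T'` on vertical morphisms. -/
noncomputable def fibreMap {A : X} {E E' : Q.tot.p.Fiber A} (ξ : E ⟶ E') :
    h.fibreT E ⟶ h.fibreT E' :=
  vert (D.z A) (h.zLift E') (h.zLift_cartesian E') (h.zLift E ≫ Q.D.T.map ((inc _ A).map ξ))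
    (isHomLift_comp_eq (h.zLift_isHomLift E) (h.tan_map _ ξ.2)
      (by rw [CategoryTheory.Functor.map_id, Category.comp_id]))

theorem fibreMap_zLift {A : X} {E E' : Q.tot.p.Fiber A} (ξ : E ⟶ E') :
    (inc _ A).map (h.fibreMap ξ) ≫ h.zLift E' = h.zLift E ≫ Q.D.T.map ((inc _ A).map ξ) :=
  vert_fac (D.z A) (h.zLift E') (h.zLift_cartesian E') _ _

/-- The tangent bundle functor `z^* T'` of a fibre. -/
noncomputable def fibreFunctor (A : X) : Q.tot.p.Fiber A ⥤ Q.tot.p.Fiber A where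
  obj E := h.fibreT E
  map ξ := h.fibreMap ξ
  map_id E := vert_ext (D.z A) _ (h.zLift_cartesian E) (by
    rw [fibreMap_zLift, CategoryTheory.Functor.map_id, CategoryTheory.Functor.map_id,
      CategoryTheory.Functor.map_id, Category.id_comp, Category.comp_id])
  map_comp {E E' E''} ξ ξ' := vert_ext (D.z A) _ (h.zLift_cartesian E'') (by
    rw [fibreMap_zLift, CategoryTheory.Functor.map_comp, CategoryTheory.Functor.map_comp,
      CategoryTheory.Functor.map_comp, Category.assoc, fibreMap_zLift, ← Category.assoc,
      ← Category.assoc, fibreMap_zLift])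

/-- The map `A ⟶ P (T'₂ E)` below the pair `(z', z')`. -/
noncomputable def base₂ {A : X} (E : Q.tot.p.Fiber A) : A ⟶ Q.tot.p.obj (Q.D.T₂ E.1) :=
  eqToHom E.2.symm ≫ Q.tot.p.map (h.total.zz E.1)

/-- The object `⟨z, z⟩^* T'₂ E`. -/
noncomputable def fibreT₂ {A : X} (E : Q.tot.p.Fiber A) : Q.tot.p.Fiber A :=
  Q.cl.pull (h.base₂ E) ⟨Q.D.T₂ E.1, rfl⟩

/-- The cartesian morphism `⟨z, z⟩^* T'₂ E ⟶ T'₂ E`. -/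
noncomputable def zzLift {A : X} (E : Q.tot.p.Fiber A) :
    (inc Q.tot.p A).obj (h.fibreT₂ E) ⟶ Q.D.T₂ E.1 :=
  Q.cl.lift (h.base₂ E) ⟨Q.D.T₂ E.1, rfl⟩

theorem zzLift_isHomLift {A : X} (E : Q.tot.p.Fiber A) (m : Q.D.T₂ E.1 ⟶ Q.D.T.obj E.1)
    (hm : h.total.zz E.1 ≫ m = Q.D.z E.1) :
    Q.tot.p.IsHomLift (D.z A) (h.zzLift E ≫ m) :=
  isHomLift_factor E.2.symm (hm ▸ h.strict.z E) (Q.cl.isHomLift _ _)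

/-- The tangent structure of the fibre over `A`. -/
noncomputable def fibreTangent (A : X) : TangentData (Q.tot.p.Fiber A) where
  T := h.fibreFunctor A
  T₂ E := h.fibreT₂ E
  π₁ E := vert (D.z A) (h.zLift E) (h.zLift_cartesian E) (h.zzLift E ≫ Q.D.π₁ E.1)
    (h.zzLift_isHomLift E _ (h.total.zz_fst E.1))
  π₂ E := vert (D.z A) (h.zLift E) (h.zLift_cartesian E) (h.zzLift E ≫ Q.D.π₂ E.1)
    (h.zzLift_isHomLift E _ (h.total.zz_snd E.1))
  p E := ⟨h.zLift E ≫ Q.D.p E.1,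
    isHomLift_comp_eq (h.zLift_isHomLift E) (h.strict.p E) (h.base.z_p A)⟩
  z E := vert (D.z A) (h.zLift E) (h.zLift_cartesian E) (Q.D.z E.1) (h.strict.z E)
  s E := vert (D.z A) (h.zLift E) (h.zLift_cartesian E) (h.zzLift E ≫ Q.D.s E.1)
    (h.zzLift_isHomLift E _ (h.total.zz_s E.1))
  l E := vert (D.z A ≫ D.T.map (D.z A)) (h.zLift (h.fibreT E) ≫ Q.D.T.map (h.zLift E))
    (isStronglyCartesian_comp (h.zLift_cartesian _) (h.cartesian (h.zLift_cartesian E)))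
    (h.zLift E ≫ Q.D.l E.1)
    (isHomLift_comp_eq (h.zLift_isHomLift E) (h.strict.l E) (h.base.z_l A))
  c E := vert (D.z A ≫ D.T.map (D.z A)) (h.zLift (h.fibreT E) ≫ Q.D.T.map (h.zLift E))
    (isStronglyCartesian_comp (h.zLift_cartesian _) (h.cartesian (h.zLift_cartesian E)))
    ((h.zLift (h.fibreT E) ≫ Q.D.T.map (h.zLift E)) ≫ Q.D.c E.1)
    (isHomLift_comp_eq (isHomLift_comp (h.zLift_isHomLift _) (h.tan_map _ (h.zLift_isHomLift E)))
      (h.strict.c E) (h.base.z_z_c A))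

/-- The distributive law of a substitution functor. -/
noncomputable def fibreLaw {A A' : X} (f : A ⟶ A') :
    Law true (h.fibreTangent A') (h.fibreTangent A) (Q.cl.pullFunctor f) := fun E =>
  vert (f ≫ D.z A') (Q.cl.lift f (h.fibreT E) ≫ h.zLift E)
    (isStronglyCartesian_comp (Q.cl.cartesian _ _) (h.zLift_cartesian E))
    (h.zLift (Q.cl.pull f E) ≫ Q.D.T.map (Q.cl.lift f E))
    (isHomLift_comp_eq (h.zLift_isHomLift _) (h.tan_map _ (Q.cl.isHomLift f E))
      (h.base.z_nat f).symm)

end RawFibration.IsTangent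

end Fibres

/-! ### Indexed tangent categories -/

/-- Indexed categories over `X`. -/
abbrev Indx (X : Type u) [Category.{v} X] := Pseudofunctor (LocallyDiscrete Xᵒᵖ) Cat.{v', u'}

section Indexed

variable {X : Type u} [Category.{v} X]

/-- The fibre of an indexed category. -/
abbrev Indx.fib (J : Indx.{v, v', u, u'} X) (A : X) : Type u' := J.obj ⟨op A⟩

/-- The substitution functor `f^*` of an indexed category. -/
abbrev Indx.sub (J : Indx.{v, v', u, u'} X) {A A' : X} (f : A ⟶ A') : J.fib A' ⥤ J.fib A :=
  (J.map f.op.toLoc).toFunctor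

/-- The components of a pseudonatural transformation of indexed categories. -/
abbrev Indx.functor {J J' : Indx.{v, v', u, u'} X} (κ : J ⟶ J') (A : X) : J.fib A ⥤ J'.fib A :=
  (κ.app ⟨op A⟩).toFunctor

/-- The distributors `F f^* ≅ f^* F` of a pseudonatural transformation of indexed categories. -/
abbrev Indx.distributor {J J' : Indx.{v, v', u, u'} X} (κ : J ⟶ J') {A A' : X} (f : A ⟶ A')
    (E : J.fib A') :
    (Indx.functor κ A).obj ((J.sub f).obj E) ≅ (J'.sub f).obj ((Indx.functor κ A').obj E) :=
  (Cat.Hom.toNatIso (κ.naturality f.op.toLoc)).app E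

/-- The components of a modification. -/
abbrev Indx.component {J J' : Indx.{v, v', u, u'} X} {κ κ' : J ⟶ J'} (m : κ ⟶ κ') (A : X) :
    Indx.functor κ A ⟶ Indx.functor κ' A :=
  (m.as.app ⟨op A⟩).toNatTrans

end Indexed

/-- An indexed category with tangent data on its fibres and distributive laws for its substitution
functors. -/
structure RawIndexed (X : Type u) [Category.{v} X] where
  J : Indx.{v, v', u, u'} X
  D : ∀ A : X, TangentData (J.fib A)
  α : ∀ {A A' : X} (f : A ⟶ A'), Law true (D A') (D A) (J.sub f)

/-- Indexed tangent categories over `(X, D)`: pseudofunctors from `Xᵒᵖ` to the 2-category of tangent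
categories and strong tangent morphisms. -/
structure RawIndexed.IsTangent {X : Type u} [Category.{v} X] (D : TangentData X)
    (R : RawIndexed.{v, v', u, u'} X) : Prop where
  base : D.IsTangent
  fibre : ∀ A : X, (R.D A).IsTangent
  strong : ∀ {A A' : X} (f : A ⟶ A'),
    IsTangentMorphism (R.D A') (R.D A) (R.J.sub f) .strong (R.α f)
  mapId : ∀ A : X,
    Law.Compat (R.α (𝟙 A)) (Law.id true (R.D A)) (R.J.mapId ⟨op A⟩).hom.toNatTrans
  mapComp : ∀ {A A' A'' : X} (f : A ⟶ A') (g : A' ⟶ A''),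
    Law.Compat (R.α (f ≫ g)) ((R.α g).comp (R.α f))
      (R.J.mapComp g.op.toLoc f.op.toLoc).hom.toNatTrans

section IndexedTwoCategory

variable {X : Type u} [Category.{v} X]

/-- Indexed tangent categories over `(X, D)`, pseudonatural transformations with distributive laws
on the fibres, and modifications. -/
def indDisplayed (o : Bool) (D : TangentData X) : Displayed (Indx.{v, v', u, u'} X) where
  Ob := {R : RawIndexed.{v, v', u, u'} X // R.IsTangent D}
  base R := R.1.J
  Str {R R'} κ := {β : ∀ A : X, Law o (R.1.D A) (R'.1.D A) (Indx.functor κ A) //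
    ∀ A, (β A).IsNatural}
  idStr R := ⟨fun A => Law.id o (R.1.D A), fun _ => Law.isNatural_id⟩
  compStr β γ := ⟨fun A => (β.1 A).comp (γ.1 A), fun A => (β.2 A).comp (γ.2 A)⟩
  Two β γ m := ∀ A : X, (β.1 A).Compat (γ.1 A) (Indx.component m A)
  two_id β A := Law.compat_id (β.1 A)
  two_comp h h' A := (h A).vcomp (h' A)
  two_whiskerLeft β _ _ _ h A := (h A).whiskerLeft (β.1 A)
  two_whiskerRight γ _ h A := (h A).whiskerRight (γ.2 A)
  two_associator a b c :=
    ⟨fun A => Law.compat_of_eq (Law.comp_assoc (a.1 A) (b.1 A) (c.1 A)),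
      fun A => Law.compat_of_eq (Law.comp_assoc (a.1 A) (b.1 A) (c.1 A)).symm⟩
  two_leftUnitor a :=
    ⟨fun A => Law.compat_of_eq (Law.id_comp (a.1 A)),
      fun A => Law.compat_of_eq (Law.id_comp (a.1 A)).symm⟩
  two_rightUnitor a :=
    ⟨fun A => Law.compat_of_eq (Law.comp_id (a.1 A)),
      fun A => Law.compat_of_eq (Law.comp_id (a.1 A)).symm⟩

/-- Compatibility of the distributors of a pseudonatural transformation with the distributive laws
of the substitution functors. -/
def IsCoherentLaw {R R' : RawIndexed.{v, v', u, u'} X} (κ : R.J ⟶ R'.J) :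
    ∀ {o : Bool}, (∀ A : X, Law o (R.D A) (R'.D A) (Indx.functor κ A)) → Prop
  | false, β => ∀ {A A' : X} (f : A ⟶ A') (E : R.J.fib A'),
      (Indx.functor κ A).map (R.α f E) ≫ (Indx.distributor κ f ((R.D A').T.obj E)).hom ≫
        (R'.J.sub f).map (β A' E) =
      β A ((R.J.sub f).obj E) ≫ (R'.D A).T.map (Indx.distributor κ f E).hom ≫
        R'.α f ((Indx.functor κ A').obj E)
  | true, β => ∀ {A A' : X} (f : A ⟶ A') (E : R.J.fib A'),
      β A ((R.J.sub f).obj E) ≫ (Indx.functor κ A).map (R.α f E) ≫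
        (Indx.distributor κ f ((R.D A').T.obj E)).hom =
      (R'.D A).T.map (Indx.distributor κ f E).hom ≫ R'.α f ((Indx.functor κ A').obj E) ≫
        (R'.J.sub f).map (β A' E)

/-- Morphisms of indexed tangent categories of each flavour. -/
structure IsIndexedMorphism {R R' : RawIndexed.{v, v', u, u'} X} (fl : Flavour) (κ : R.J ⟶ R'.J)
    (β : ∀ A : X, Law fl.isColax (R.D A) (R'.D A) (Indx.functor κ A)) : Prop where
  fibre : ∀ A : X, IsTangentMorphism (R.D A) (R'.D A) (Indx.functor κ A) fl (β A)
  coherent : IsCoherentLaw κ β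

/-- The 2-categories of indexed tangent categories over `(X, D)` with 1-cells generated by the lax,
colax, strong or strict morphisms. -/
abbrev IndxTng (fl : Flavour) (D : TangentData X) :=
  (indDisplayed.{v, v', u, u'} fl.isColax D).Total
    (fun {R R' κ} β => IsIndexedMorphism (R := R.1) (R' := R'.1) fl κ β.1)

end IndexedTwoCategory

/-! ### From tangent fibrations to indexed tangent categories -/

section FibreFunctor

variable {X : Type u} [Category.{u} X]

/-- The restriction of a functor over `X` to the fibres over `A`. -/
def fibreRestrict {𝒳 𝒴 : BasedCategory.{u, u} X} (F : BasedFunctor 𝒳 𝒴) (A : X) :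
    𝒳.p.Fiber A ⥤ 𝒴.p.Fiber A where
  obj E := ⟨F.obj E.1, (F.w_obj E.1).trans E.2⟩
  map ξ := ⟨F.map ξ.1, haveI := ξ.2; F.preserves_isHomLift _ _⟩
  map_id E := Subtype.ext (F.map_id E.1)
  map_comp ξ ξ' := Subtype.ext (F.map_comp ξ.1 ξ'.1)

/-- The action of a functor over `X` on a morphism between objects of two fibres. -/
def fibreMap {𝒳 𝒴 : BasedCategory.{u, u} X} (F : BasedFunctor 𝒳 𝒴) {A A' : X}
    {E : 𝒳.p.Fiber A} {E' : 𝒳.p.Fiber A'} (φ : (inc 𝒳.p A).obj E ⟶ (inc 𝒳.p A').obj E') :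
    (inc 𝒴.p A).obj ((fibreRestrict F A).obj E) ⟶ (inc 𝒴.p A').obj ((fibreRestrict F A').obj E') :=
  F.map φ

theorem fibreMap_comp {𝒳 𝒴 : BasedCategory.{u, u} X} (F : BasedFunctor 𝒳 𝒴) {A A' A'' : X}
    {E : 𝒳.p.Fiber A} {E' : 𝒳.p.Fiber A'} {E'' : 𝒳.p.Fiber A''}
    (φ : (inc 𝒳.p A).obj E ⟶ (inc 𝒳.p A').obj E')
    (ψ : (inc 𝒳.p A').obj E' ⟶ (inc 𝒳.p A'').obj E'') :
    fibreMap F φ ≫ fibreMap F ψ = fibreMap F (φ ≫ ψ) :=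
  (F.map_comp φ ψ).symm

theorem fibreRestrict_inc {𝒳 𝒴 : BasedCategory.{u, u} X} (F : BasedFunctor 𝒳 𝒴) {A : X}
    {E E' : 𝒳.p.Fiber A} (ξ : E ⟶ E') :
    (inc 𝒴.p A).map ((fibreRestrict F A).map ξ) = fibreMap F ((inc 𝒳.p A).map ξ) := rfl

variable {𝒳 𝒴 : BasedCategory.{u, u} X} (cl : Cleavage 𝒳.p) (cl' : Cleavage 𝒴.p)
  (F : BasedFunctor 𝒳 𝒴)
  (hF : ∀ {A A' : X} {f : A ⟶ A'} {E E' : 𝒳.obj} {φ : E ⟶ E'},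
    𝒳.p.IsStronglyCartesian f φ → 𝒴.p.IsStronglyCartesian f (F.map φ))

/-- The comparison `F f^* ≅ f^* F`, compatible with the cartesian morphisms to `F E`. -/
noncomputable def fibreDistributor {A A' : X} (f : A ⟶ A') (E : 𝒳.p.Fiber A') :
    (fibreRestrict F A).obj (cl.pull f E) ≅ cl'.pull f ((fibreRestrict F A').obj E) :=
  vertIso f (fibreMap F (cl.lift f E)) (hF (cl.cartesian f E)) (cl'.lift f ((fibreRestrict F A').obj E))
    (cl'.cartesian _ _)

theorem fibreDistributor_hom {A A' : X} (f : A ⟶ A') (E : 𝒳.p.Fiber A') :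
    (inc 𝒴.p A).map (fibreDistributor cl cl' F hF f E).hom ≫
      cl'.lift f ((fibreRestrict F A').obj E) = fibreMap F (cl.lift f E) :=
  vert_fac f (cl'.lift f ((fibreRestrict F A').obj E)) (cl'.cartesian _ _) (fibreMap F (cl.lift f E))
    (hF (cl.cartesian f E)).toIsHomLift

theorem fibreDistributor_naturality {A A' : X} (f : A ⟶ A') {E E' : 𝒳.p.Fiber A'} (ξ : E ⟶ E') :
    (fibreRestrict F A).map (cl.pullMap f ξ) ≫ (fibreDistributor cl cl' F hF f E').hom =
      (fibreDistributor cl cl' F hF f E).hom ≫ cl'.pullMap f ((fibreRestrict F A').map ξ) :=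
  vert_ext f _ (cl'.cartesian f _) (by
    rw [Functor.map_comp, Functor.map_comp, Category.assoc, Category.assoc, fibreDistributor_hom,
      Cleavage.pullMap_lift, ← Category.assoc, fibreDistributor_hom, fibreRestrict_inc,
      fibreRestrict_inc, fibreMap_comp, fibreMap_comp, Cleavage.pullMap_lift])

theorem fibreDistributor_id {A : X} (E : 𝒳.p.Fiber A) :
    (fibreDistributor cl cl' F hF (𝟙 A) E).hom ≫ (cl'.unit ((fibreRestrict F A).obj E)).hom =
      (fibreRestrict F A).map (cl.unit E).hom :=
  (inc 𝒴.p A).map_injective (by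
    rw [Functor.map_comp, Cleavage.unit_hom, fibreDistributor_hom, fibreRestrict_inc,
      Cleavage.unit_hom])

theorem fibreDistributor_comp {A A' A'' : X} (f : A ⟶ A') (g : A' ⟶ A'') (E : 𝒳.p.Fiber A'') :
    (fibreDistributor cl cl' F hF (f ≫ g) E).hom ≫
        (cl'.compositor f g ((fibreRestrict F A'').obj E)).hom =
      (fibreRestrict F A).map (cl.compositor f g E).hom ≫
        (fibreDistributor cl cl' F hF f (cl.pull g E)).hom ≫
          cl'.pullMap f (fibreDistributor cl cl' F hF g E).hom :=
  vert_ext (f ≫ g) _ (isStronglyCartesian_comp (cl'.cartesian f _) (cl'.cartesian g _)) (by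
    rw [Functor.map_comp, Functor.map_comp, Functor.map_comp]
    simp only [Category.assoc]
    rw [Cleavage.compositor_hom, fibreDistributor_hom,
      ← Category.assoc ((inc 𝒴.p A).map (cl'.pullMap _ _)), Cleavage.pullMap_lift,
      Category.assoc, fibreDistributor_hom,
      ← Category.assoc ((inc 𝒴.p A).map (fibreDistributor cl cl' F _ f _).hom),
      fibreDistributor_hom, fibreRestrict_inc, fibreMap_comp, fibreMap_comp,
      Cleavage.compositor_hom])

/-- The pseudonatural transformation of a functor over `X` that preserves cartesian morphisms. -/
noncomputable def fibreTrans : cl.fibres ⟶ cl'.fibres :=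
  Pseudofunctor.StrongTrans.mk (F := cl.fibres) (G := cl'.fibres)
    (fun A => (fibreRestrict F A.as.unop).toCatHom)
    (fun f => Cat.Hom.isoMk (NatIso.ofComponents
      (fun E => fibreDistributor cl cl' F hF f.as.unop E)
      (fun ξ => fibreDistributor_naturality cl cl' F hF f.as.unop ξ)))
    (fun {A A'} f g η => by
      obtain rfl := LocallyDiscrete.eq_of_hom η
      have e : η = 𝟙 f := Subsingleton.elim _ _
      subst e
      rw [cl.fibres.map₂_id, cl'.fibres.map₂_id]
      refine ((congrArg (· ≫ _) (id_whiskerRight _ _)).trans (Category.id_comp _)).trans ?_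
      exact ((congrArg (_ ≫ ·) (whiskerLeft_id _ _)).trans (Category.comp_id _)).symm)
    (fun A => by
      apply Cat.Hom₂.ext
      ext E
      refine Eq.trans (fibreDistributor_id cl cl' F hF E) ?_
      exact ((congrArg _ (Category.comp_id _)).trans (Category.comp_id _)).symm)
    (fun f g => by
      apply Cat.Hom₂.ext
      ext E
      refine Eq.trans (fibreDistributor_comp cl cl' F hF g.as.unop f.as.unop E) ?_
      change _ = (fibreRestrict F _).map (cl.compositor g.as.unop f.as.unop E).hom ≫ 𝟙 _ ≫
        (fibreDistributor cl cl' F hF g.as.unop (cl.pull f.as.unop E)).hom ≫ 𝟙 _ ≫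
        cl'.pullMap g.as.unop (fibreDistributor cl cl' F hF f.as.unop E).hom ≫ 𝟙 _
      rw [Category.id_comp, Category.id_comp]
      refine congrArg (_ ≫ ·) (congrArg (_ ≫ ·) (Category.comp_id _).symm))

end FibreFunctor

section FibreTwoFunctor

variable {X : Type u} [Category.{u} X] {D : TangentData X}

theorem IsFibrationLaw.isHomLift_lax {Q Q' : RawFibration.{u, u, u, u} X}
    {F : BasedFunctor Q.tot Q'.tot} {β : Law false Q.D Q'.D F.toFunctor}
    (hF : IsFibrationLaw D F β) {A : X} (E : Q.tot.p.Fiber A) :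
    Q'.tot.p.IsHomLift (𝟙 (D.T.obj A)) (β ((inc Q.tot.p A).obj E)) := by
  obtain ⟨e, rfl⟩ := E
  exact hF.vertical e

theorem IsFibrationLaw.isHomLift_colax {Q Q' : RawFibration.{u, u, u, u} X}
    {F : BasedFunctor Q.tot Q'.tot} {β : Law true Q.D Q'.D F.toFunctor}
    (hF : IsFibrationLaw D F β) {A : X} (E : Q.tot.p.Fiber A) :
    Q'.tot.p.IsHomLift (𝟙 (D.T.obj A)) (β ((inc Q.tot.p A).obj E)) := by
  obtain ⟨e, rfl⟩ := E
  exact hF.vertical e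

variable {Q Q' : RawFibration.{u, u, u, u} X} (h : Q.IsTangent D) (h' : Q'.IsTangent D)

/-- The image of the cartesian morphism `z^* T E ⟶ T E`. -/
def mapZLift (F : BasedFunctor Q.tot Q'.tot) {A : X} (E : Q.tot.p.Fiber A) :
    (inc Q'.tot.p A).obj ((fibreRestrict F A).obj (h.fibreT E)) ⟶
      F.obj (Q.D.T.obj ((inc Q.tot.p A).obj E)) :=
  F.map (h.zLift E)

theorem mapZLift_isHomLift (F : BasedFunctor Q.tot Q'.tot) {A : X} (E : Q.tot.p.Fiber A) :
    Q'.tot.p.IsHomLift (D.z A) (mapZLift h F E) :=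
  @BasedFunctor.preserves_isHomLift _ _ _ _ F _ _ _ _ (D.z A) (h.zLift E) (h.zLift_isHomLift E)

/-- The distributive laws on the fibres. -/
noncomputable def fibreMorphismLaw : ∀ {o : Bool} {F : BasedFunctor Q.tot Q'.tot}
    {β : Law o Q.D Q'.D F.toFunctor}, IsFibrationLaw D F β → ∀ A : X,
    Law o (h.fibreTangent A) (h'.fibreTangent A) (fibreRestrict F A)
  | false, F, β, hF, A => fun E =>
    vert (D.z A) (h'.zLift ((fibreRestrict F A).obj E)) (h'.zLift_cartesian _)
      (mapZLift h F E ≫ β ((inc _ A).obj E))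
      (isHomLift_comp_eq (mapZLift_isHomLift h F E) (hF.isHomLift_lax E) (Category.comp_id _))
  | true, F, β, hF, A => fun E =>
    vert (D.z A) (mapZLift h F E) (hF.cartesian (h.zLift_cartesian E))
      (h'.zLift ((fibreRestrict F A).obj E) ≫ β ((inc _ A).obj E))
      (isHomLift_comp_eq (h'.zLift_isHomLift _) (hF.isHomLift_colax E) (Category.comp_id _))

theorem mapZLift_naturality (F : BasedFunctor Q.tot Q'.tot) {A : X} {E E' : Q.tot.p.Fiber A}
    (ξ : E ⟶ E') :
    (inc Q'.tot.p A).map ((fibreRestrict F A).map (h.fibreMap ξ)) ≫ mapZLift h F E' =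
      mapZLift h F E ≫ F.map (Q.D.T.map ((inc _ A).map ξ)) :=
  (F.map_comp _ _).symm.trans ((congrArg F.map (h.fibreMap_zLift ξ)).trans (F.map_comp _ _))

theorem fibreMorphismLaw_natural_lax {F : BasedFunctor Q.tot Q'.tot} {A : X}
    {β : ∀ E, F.obj (Q.D.T.obj ((inc Q.tot.p A).obj E)) ⟶
      Q'.D.T.obj ((inc Q'.tot.p A).obj ((fibreRestrict F A).obj E))}
    (hβ : ∀ {E E'} (ξ : E ⟶ E'), F.map (Q.D.T.map ((inc Q.tot.p A).map ξ)) ≫ β E' =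
      β E ≫ Q'.D.T.map ((inc Q'.tot.p A).map ((fibreRestrict F A).map ξ)))
    {μ : ∀ E, (fibreRestrict F A).obj (h.fibreT E) ⟶ h'.fibreT ((fibreRestrict F A).obj E)}
    (hμ : ∀ E, (inc Q'.tot.p A).map (μ E) ≫ h'.zLift ((fibreRestrict F A).obj E) =
      mapZLift h F E ≫ β E) {E E' : Q.tot.p.Fiber A} (ξ : E ⟶ E') :
    (fibreRestrict F A).map (h.fibreMap ξ) ≫ μ E' =
      μ E ≫ h'.fibreMap ((fibreRestrict F A).map ξ) := by
  refine vert_ext (D.z A) _ (h'.zLift_cartesian ((fibreRestrict F A).obj E')) ?_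
  rw [CategoryTheory.Functor.map_comp, CategoryTheory.Functor.map_comp, Category.assoc,
    Category.assoc, hμ, h'.fibreMap_zLift, ← Category.assoc, mapZLift_naturality,
    ← Category.assoc, hμ, Category.assoc, Category.assoc, hβ]

theorem fibreMorphismLaw_natural_colax {F : BasedFunctor Q.tot Q'.tot} {A : X}
    {β : ∀ E, Q'.D.T.obj ((inc Q'.tot.p A).obj ((fibreRestrict F A).obj E)) ⟶
      F.obj (Q.D.T.obj ((inc Q.tot.p A).obj E))}
    (hβ : ∀ {E E'} (ξ : E ⟶ E'),
      Q'.D.T.map ((inc Q'.tot.p A).map ((fibreRestrict F A).map ξ)) ≫ β E' =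
        β E ≫ F.map (Q.D.T.map ((inc Q.tot.p A).map ξ)))
    {μ : ∀ E, h'.fibreT ((fibreRestrict F A).obj E) ⟶ (fibreRestrict F A).obj (h.fibreT E)}
    (hF : ∀ E : Q.tot.p.Fiber A, Q'.tot.p.IsStronglyCartesian (D.z A) (mapZLift h F E))
    (hμ : ∀ E, (inc Q'.tot.p A).map (μ E) ≫ mapZLift h F E =
      h'.zLift ((fibreRestrict F A).obj E) ≫ β E) {E E' : Q.tot.p.Fiber A} (ξ : E ⟶ E') :
    h'.fibreMap ((fibreRestrict F A).map ξ) ≫ μ E' =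
      μ E ≫ (fibreRestrict F A).map (h.fibreMap ξ) := by
  refine vert_ext (D.z A) _ (hF E') ?_
  rw [CategoryTheory.Functor.map_comp, CategoryTheory.Functor.map_comp, Category.assoc,
    Category.assoc, hμ, mapZLift_naturality, ← Category.assoc, h'.fibreMap_zLift,
    ← Category.assoc, hμ, Category.assoc, Category.assoc, hβ]

theorem fibreMorphismLaw_isNatural : ∀ {o : Bool} {F : BasedFunctor Q.tot Q'.tot}
    {β : Law o Q.D Q'.D F.toFunctor} (hF : IsFibrationLaw D F β) (A : X),
    (fibreMorphismLaw h h' hF A).IsNatural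
  | false, F, β, hF, A => fun ξ => fibreMorphismLaw_natural_lax h h'
    (β := fun E => β ((inc Q.tot.p A).obj E)) (fun ξ => hF.natural ((inc Q.tot.p A).map ξ))
    (fun _ => vert_fac (D.z A) _ (h'.zLift_cartesian _) _ _) ξ
  | true, F, β, hF, A => fun ξ => fibreMorphismLaw_natural_colax h h'
    (β := fun E => β ((inc Q.tot.p A).obj E)) (fun ξ => hF.natural ((inc Q.tot.p A).map ξ))
    (fun E => hF.cartesian (h.zLift_cartesian E))
    (fun E => vert_fac (D.z A) _ (hF.cartesian (h.zLift_cartesian E)) _ _) ξ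

/-- The indexed tangent category of a tangent fibration: the fibre over `A` carries the tangent
bundle functor `z^* T'`. -/
noncomputable def fibreIndexed (h : Q.IsTangent D) : RawIndexed.{u, u, u, u} X where
  J := Q.cl.fibres
  D A := h.fibreTangent A
  α f := h.fibreLaw f

/-- The restriction of a vertical natural transformation to the fibres over `A`. -/
def fibreNat {𝒳 𝒴 : BasedCategory.{u, u} X} {F G : 𝒳 ⟶ 𝒴} (θ : F ⟶ G) (A : X) :
    fibreRestrict F A ⟶ fibreRestrict G A where
  app E := ⟨θ.toNatTrans.app E.1, θ.isHomLift E.2⟩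
  naturality _ _ ξ := Subtype.ext (θ.toNatTrans.naturality ξ.1)

theorem fibreNat_naturality {𝒳 𝒴 : BasedCategory.{u, u} X} (cl : Cleavage 𝒳.p)
    (cl' : Cleavage 𝒴.p) {F G : BasedFunctor 𝒳 𝒴}
    (hF : ∀ {A A' : X} {f : A ⟶ A'} {E E' : 𝒳.obj} {φ : E ⟶ E'},
      𝒳.p.IsStronglyCartesian f φ → 𝒴.p.IsStronglyCartesian f (F.map φ))
    (hG : ∀ {A A' : X} {f : A ⟶ A'} {E E' : 𝒳.obj} {φ : E ⟶ E'},
      𝒳.p.IsStronglyCartesian f φ → 𝒴.p.IsStronglyCartesian f (G.map φ)) (θ : F ⟶ G)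
    {A A' : X} (f : A ⟶ A') (E : 𝒳.p.Fiber A') :
    (fibreNat θ A).app (cl.pull f E) ≫ (fibreDistributor cl cl' G hG f E).hom =
      (fibreDistributor cl cl' F hF f E).hom ≫ cl'.pullMap f ((fibreNat θ A').app E) := by
  refine vert_ext f _ (cl'.cartesian _ _) ?_
  rw [CategoryTheory.Functor.map_comp, CategoryTheory.Functor.map_comp, Category.assoc,
    Category.assoc, fibreDistributor_hom, Cleavage.pullMap_lift, ← Category.assoc,
    fibreDistributor_hom]
  exact (θ.toNatTrans.naturality (cl.lift f E)).symm

/-- The modification of a vertical natural transformation. -/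
noncomputable def fibreModification {𝒳 𝒴 : BasedCategory.{u, u} X} (cl : Cleavage 𝒳.p)
    (cl' : Cleavage 𝒴.p) {F G : 𝒳 ⟶ 𝒴}
    (hF : ∀ {A A' : X} {f : A ⟶ A'} {E E' : 𝒳.obj} {φ : E ⟶ E'},
      𝒳.p.IsStronglyCartesian f φ → 𝒴.p.IsStronglyCartesian f (F.map φ))
    (hG : ∀ {A A' : X} {f : A ⟶ A'} {E E' : 𝒳.obj} {φ : E ⟶ E'},
      𝒳.p.IsStronglyCartesian f φ → 𝒴.p.IsStronglyCartesian f (G.map φ)) (θ : F ⟶ G) :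
    fibreTrans cl cl' F hF ⟶ fibreTrans cl cl' G hG :=
  ⟨{app := fun A => (fibreNat θ A.as.unop).toCatHom₂
    naturality := fun f => by
      apply Cat.Hom₂.ext
      ext E
      exact fibreNat_naturality cl cl' hF hG θ f.as.unop E}⟩

variable (D) (fl : Flavour)

/-- The 2-functor `𝓘` that sends a tangent fibration to its fibres, as assignments on objects,
1-cells and 2-cells. The hypotheses state that the assignments are well defined. -/
noncomputable def fibreStruct
    (hobj : ∀ {Q : RawFibration.{u, u, u, u} X} (h : Q.IsTangent D), (fibreIndexed h).IsTangent D)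
    (hgen : ∀ {Q Q' : TngFib.{u, u, u, u} fl D} (F : Q ⟶ Q'),
      (indDisplayed.{u, u, u, u} fl.isColax D).Generated
        (fun {R R' κ} β => IsIndexedMorphism (R := R.1) (R' := R'.1) fl κ β.1)
        (x := ⟨_, hobj Q.obj.2⟩) (y := ⟨_, hobj Q'.obj.2⟩)
        (f := fibreTrans Q.obj.1.cl Q'.obj.1.cl F.hom F.str.2.cartesian)
        ⟨fibreMorphismLaw Q.obj.2 Q'.obj.2 F.str.2,
          fibreMorphismLaw_isNatural Q.obj.2 Q'.obj.2 F.str.2⟩)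
    (htwo : ∀ {Q Q' : TngFib.{u, u, u, u} fl D} {F G : Q ⟶ Q'} (θ : F ⟶ G) (A : X),
      (fibreMorphismLaw Q.obj.2 Q'.obj.2 F.str.2 A).Compat
        (fibreMorphismLaw Q.obj.2 Q'.obj.2 G.str.2 A) (fibreNat θ.cell A)) :
    PrelaxFunctorStruct (TngFib.{u, u, u, u} fl D) (IndxTng.{u, u, u, u} fl D) where
  obj Q := ⟨⟨fibreIndexed Q.obj.2, hobj Q.obj.2⟩⟩
  map {Q Q'} F := Displayed.Total.Hom.mk
    (fibreTrans Q.obj.1.cl Q'.obj.1.cl F.hom F.str.2.cartesian)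
    ⟨fibreMorphismLaw Q.obj.2 Q'.obj.2 F.str.2,
      fibreMorphismLaw_isNatural Q.obj.2 Q'.obj.2 F.str.2⟩ (hgen F)
  map₂ {Q Q' F G} θ := Displayed.Total.Hom₂.mk
    (fibreModification Q.obj.1.cl Q'.obj.1.cl F.str.2.cartesian G.str.2.cartesian θ.cell)
    (fun A => htwo θ A)

/-- The strict 2-functor `I` sends a tangent fibration to its fibres. -/
def IsFibreFunctor
    (I : StrictPseudofunctor (TngFib.{u, u, u, u} fl D) (IndxTng.{u, u, u, u} fl D)) : Prop :=
  ∃ hobj hgen htwo, I.toPrelaxFunctorStruct = fibreStruct D fl hobj hgen htwo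

end FibreTwoFunctor

/-! ### From indexed tangent categories to tangent fibrations -/

section Induced

variable {X : Type u} [Category.{v} X] {C : Type u'} [Category.{v'} C]

/-- The morphism over `g` induced by a cartesian morphism `χ` over `k` and a morphism over
`g ≫ k`. -/
noncomputable def induced (P : C ⥤ X) {A A' A'' : X} (g : A ⟶ A') (k : A' ⟶ A'') {e e₁ e₂ : C}
    {χ : e₁ ⟶ e₂} (hχ : P.IsStronglyCartesian k χ) (φ : e ⟶ e₂) (hφ : P.IsHomLift (g ≫ k) φ) :
    e ⟶ e₁ :=
  @Functor.IsStronglyCartesian.map _ _ _ _ P _ _ _ _ k χ hχ _ _ g (g ≫ k) rfl φ hφ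

theorem induced_isHomLift (P : C ⥤ X) {A A' A'' : X} (g : A ⟶ A') (k : A' ⟶ A'')
    {e e₁ e₂ : C} {χ : e₁ ⟶ e₂} (hχ : P.IsStronglyCartesian k χ) (φ : e ⟶ e₂)
    (hφ : P.IsHomLift (g ≫ k) φ) : P.IsHomLift g (induced P g k hχ φ hφ) :=
  @Functor.IsStronglyCartesian.map_isHomLift _ _ _ _ P _ _ _ _ k χ hχ _ _ g (g ≫ k) rfl φ hφ

theorem induced_fac (P : C ⥤ X) {A A' A'' : X} (g : A ⟶ A') (k : A' ⟶ A'') {e e₁ e₂ : C}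
    {χ : e₁ ⟶ e₂} (hχ : P.IsStronglyCartesian k χ) (φ : e ⟶ e₂) (hφ : P.IsHomLift (g ≫ k) φ) :
    induced P g k hχ φ hφ ≫ χ = φ :=
  @Functor.IsStronglyCartesian.fac _ _ _ _ P _ _ _ _ k χ hχ _ _ g (g ≫ k) rfl φ hφ

theorem induced_ext (P : C ⥤ X) {A A' A'' : X} (g : A ⟶ A') (k : A' ⟶ A'') {e e₁ e₂ : C}
    {χ : e₁ ⟶ e₂} (hχ : P.IsStronglyCartesian k χ) {φ ψ : e ⟶ e₁} (hφ : P.IsHomLift g φ)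
    (hψ : P.IsHomLift g ψ) (h : φ ≫ χ = ψ ≫ χ) : φ = ψ :=
  @Functor.IsStronglyCartesian.ext _ _ _ _ P _ _ _ _ k χ hχ _ _ g _ _ hφ hψ h

end Induced

section Elements

open Pseudofunctor CoGrothendieck

variable {X : Type u} [Category.{v} X]

/-- The category of elements. -/
abbrev El (J : Indx.{v, v', u, u'} X) := CoGrothendieck J

/-- The object `(A, E)`. -/
abbrev El.mk (J : Indx.{v, v', u, u'} X) (A : X) (E : J.fib A) : El J := ⟨A, E⟩

/-- The cartesian morphism `(A, f^* E) ⟶ (A', E)`. -/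
def El.lift (J : Indx.{v, v', u, u'} X) {A A' : X} (f : A ⟶ A') (E : J.fib A') :
    El.mk J A ((J.sub f).obj E) ⟶ El.mk J A' E :=
  cartesianLift E f

theorem El.lift_cartesian (J : Indx.{v, v', u, u'} X) {A A' : X} (f : A ⟶ A') (E : J.fib A') :
    (forget J).IsStronglyCartesian f (El.lift J f E) :=
  isStronglyCartesian_homCartesianLift E f

theorem El.lift_isHomLift (J : Indx.{v, v', u, u'} X) {A A' : X} (f : A ⟶ A') (E : J.fib A') :
    (forget J).IsHomLift f (El.lift J f E) :=
  (El.lift_cartesian J f E).toIsHomLift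

/-- The morphism `(A, E) ⟶ (A, E')` of a morphism `E ⟶ E'` of the fibre over `A`. -/
def El.vert (J : Indx.{v, v', u, u'} X) {A : X} {E E' : J.fib A} (ξ : E ⟶ E') :
    El.mk J A E ⟶ El.mk J A E' :=
  (ι J A).map ξ

theorem El.vert_isHomLift (J : Indx.{v, v', u, u'} X) {A : X} {E E' : J.fib A} (ξ : E ⟶ E') :
    (forget J).IsHomLift (𝟙 A) (El.vert J ξ) :=
  IsHomLift.map (forget J) (El.vert J ξ)

theorem El.vert_cartesian (J : Indx.{v, v', u, u'} X) {A : X} {E E' : J.fib A} (ξ : E ⟶ E')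
    [IsIso ξ] : (forget J).IsStronglyCartesian (𝟙 A) (El.vert J ξ) :=
  haveI := El.vert_isHomLift J ξ
  haveI : IsIso (El.vert J ξ) := inferInstanceAs (IsIso ((ι J A).map ξ))
  Functor.IsStronglyCartesian.of_isIso (forget J) (𝟙 A) _

/-- The object `f^* e`. -/
def El.pull (J : Indx.{v, v', u, u'} X) {A : X} (e : El J) :
    ∀ {A' : X}, (A ⟶ A') → e.base = A' → El J
  | _, f, rfl => El.mk J A ((J.sub f).obj e.fiber)

theorem El.pull_base (J : Indx.{v, v', u, u'} X) {A : X} (e : El J) :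
    ∀ {A' : X} (f : A ⟶ A') (h : e.base = A'), (El.pull J e f h).base = A
  | _, _, rfl => rfl

/-- The cartesian morphism `f^* e ⟶ e`. -/
def El.pullLift (J : Indx.{v, v', u, u'} X) {A : X} (e : El J) :
    ∀ {A' : X} (f : A ⟶ A') (h : e.base = A'), El.pull J e f h ⟶ e
  | _, f, rfl => El.lift J f e.fiber

theorem El.pullLift_cartesian (J : Indx.{v, v', u, u'} X) {A : X} (e : El J) :
    ∀ {A' : X} (f : A ⟶ A') (h : e.base = A'),
      (forget J).IsStronglyCartesian f (El.pullLift J e f h)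
  | _, f, rfl => El.lift_cartesian J f e.fiber

/-- The cleavage of the category of elements. -/
def El.cleavage (J : Indx.{v, v', u, u'} X) : Cleavage (forget J) where
  pull f E := ⟨El.pull J E.1 f E.2, El.pull_base J E.1 f E.2⟩
  lift f E := El.pullLift J E.1 f E.2
  cartesian f E := El.pullLift_cartesian J E.1 f E.2

namespace RawIndexed.IsTangent

variable {D : TangentData X} {R : RawIndexed.{v, v', u, u'} X} (h : R.IsTangent D)

/-- The invertible distributive law `T^A f^* E ≅ f^* T^A' E`. -/
noncomputable def lawIso {A A' : X} (f : A ⟶ A') (E : R.J.fib A') :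
    (R.D A).T.obj ((R.J.sub f).obj E) ≅ (R.J.sub f).obj ((R.D A').T.obj E) :=
  @asIso _ _ _ _ (R.α f E) ((h.strong f).2 E)

/-- The tangent bundle functors of the fibres, as a pseudonatural transformation. -/
noncomputable def trans : R.J ⟶ R.J :=
  StrongTrans.mk (F := R.J) (G := R.J)
    (fun A => ((R.D A.as.unop).T).toCatHom)
    (fun f => Cat.Hom.isoMk (NatIso.ofComponents
      (fun E => h.lawIso f.as.unop E)
      (fun ξ => (h.strong f.as.unop).1.natural ξ)))
    (fun {A A'} f g η => by
      obtain rfl := LocallyDiscrete.eq_of_hom η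
      have e : η = 𝟙 f := Subsingleton.elim _ _
      subst e
      rw [R.J.map₂_id]
      refine ((congrArg (· ≫ _) (id_whiskerRight _ _)).trans (Category.id_comp _)).trans ?_
      exact ((congrArg (_ ≫ ·) (whiskerLeft_id _ _)).trans (Category.comp_id _)).symm)
    (fun A => by
      apply Cat.Hom₂.ext
      ext E
      refine Eq.trans (h.mapId A.as.unop E) ?_
      exact congrArg (_ ≫ ·) (Category.comp_id _).symm)
    (fun f g => by
      apply Cat.Hom₂.ext
      ext E
      refine Eq.trans (h.mapComp g.as.unop f.as.unop E) ?_
      change (R.D _).T.map _ ≫ R.α g.as.unop _ ≫ _ = (R.D _).T.map _ ≫ 𝟙 _ ≫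
        R.α g.as.unop _ ≫ 𝟙 _ ≫ (R.J.sub g.as.unop).map (R.α f.as.unop E) ≫ 𝟙 _
      rw [Category.id_comp, Category.id_comp]
      exact congrArg (_ ≫ ·) (congrArg (_ ≫ ·) (Category.comp_id _).symm))

/-- The functor `(A, E) ↦ (A, T^A E)`. -/
noncomputable def fibrewise : El R.J ⥤ El R.J := CoGrothendieck.map h.trans

theorem fibrewise_isHomLift {e e' : El R.J} (φ : e ⟶ e') :
    (forget R.J).IsHomLift φ.base (h.fibrewise.map φ) :=
  IsHomLift.map (forget R.J) (h.fibrewise.map φ)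

end RawIndexed.IsTangent

end Elements

section ElementsTangent

open Pseudofunctor CoGrothendieck

variable {X : Type u} [Category.{v} X]

theorem isStronglyCartesian_of_eq {C : Type u'} [Category.{v'} C] {P : C ⥤ X} {A A' : X}
    {f g : A ⟶ A'} {E E' : C} {φ : E ⟶ E'} (hφ : P.IsStronglyCartesian f φ) (h : f = g) :
    P.IsStronglyCartesian g φ := h ▸ hφ

namespace TangentData.IsTangent

variable {D : TangentData X} (h : D.IsTangent)

theorem π₂_p (h : D.IsTangent) (A : X) : D.π₂ A ≫ D.p A = D.π₁ A ≫ D.p A := (h.additive A).isPullback.w.symm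

theorem s_p (h : D.IsTangent) (A : X) : D.s A ≫ D.p A = D.π₁ A ≫ D.p A := (h.additive A).sum_q

theorem l_p_p (h : D.IsTangent) (A : X) : D.l A ≫ D.p (D.T.obj A) ≫ D.p A = D.p A := by
  have h1 : D.l A ≫ D.T.map (D.p A) = D.p A ≫ D.z A := (h.l_additive A).q
  rw [← h.p_nat, ← Category.assoc, h1, Category.assoc, h.z_p, Category.comp_id]

theorem c_p_p (h : D.IsTangent) (A : X) :
    D.c A ≫ D.p (D.T.obj A) ≫ D.p A = D.p (D.T.obj A) ≫ D.p A := by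
  have h1 : D.c A ≫ D.p (D.T.obj A) = D.T.map (D.p A) ≫ 𝟙 _ := (h.c_additive A).q
  rw [← Category.assoc, h1, Category.comp_id, h.p_nat]

end TangentData.IsTangent

namespace RawIndexed.IsTangent

variable {D : TangentData X} {R : RawIndexed.{v, v', u, u'} X} (h : R.IsTangent D)

/-- The object `(T A, p^* T^A E)`. -/
def hatT (_ : R.IsTangent D) (e : El R.J) : El R.J :=
  El.mk R.J (D.T.obj e.base) ((R.J.sub (D.p e.base)).obj ((R.D e.base).T.obj e.fiber))

/-- The cartesian morphism `(T A, p^* T^A E) ⟶ (A, T^A E)`. -/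
def pLift (e : El R.J) : h.hatT e ⟶ h.fibrewise.obj e :=
  El.lift R.J (D.p e.base) ((R.D e.base).T.obj e.fiber)

theorem pLift_cartesian (e : El R.J) :
    (forget R.J).IsStronglyCartesian (D.p e.base) (h.pLift e) :=
  El.lift_cartesian R.J _ _

theorem pLift_isHomLift (e : El R.J) : (forget R.J).IsHomLift (D.p e.base) (h.pLift e) :=
  (h.pLift_cartesian e).toIsHomLift

theorem hatMap_aux {e e' : El R.J} (φ : e ⟶ e') : (forget R.J).IsHomLift
    (D.T.map φ.base ≫ D.p e'.base) (h.pLift e ≫ h.fibrewise.map φ) :=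
  isHomLift_comp_eq (h.pLift_isHomLift e) (h.fibrewise_isHomLift φ) (h.base.p_nat φ.base).symm

/-- The morphism over `T f` induced by `(f, T^A ξ ≫ α^f)`. -/
noncomputable def hatMap {e e' : El R.J} (φ : e ⟶ e') : h.hatT e ⟶ h.hatT e' :=
  induced (forget R.J) (D.T.map φ.base) (D.p e'.base) (h.pLift_cartesian e')
    (h.pLift e ≫ h.fibrewise.map φ) (h.hatMap_aux φ)

theorem hatMap_isHomLift {e e' : El R.J} (φ : e ⟶ e') :
    (forget R.J).IsHomLift (D.T.map φ.base) (h.hatMap φ) :=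
  induced_isHomLift (forget R.J) (D.T.map φ.base) (D.p e'.base) (h.pLift_cartesian e')
    (h.pLift e ≫ h.fibrewise.map φ) (h.hatMap_aux φ)

theorem hatMap_pLift {e e' : El R.J} (φ : e ⟶ e') :
    h.hatMap φ ≫ h.pLift e' = h.pLift e ≫ h.fibrewise.map φ :=
  induced_fac (forget R.J) (D.T.map φ.base) (D.p e'.base) (h.pLift_cartesian e')
    (h.pLift e ≫ h.fibrewise.map φ) (h.hatMap_aux φ)

theorem hatT_id_isHomLift (e : El R.J) :
    (forget R.J).IsHomLift (D.T.map (𝟙 e.base)) (𝟙 (h.hatT e)) := by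
  rw [CategoryTheory.Functor.map_id]
  exact IsHomLift.id rfl

/-- The tangent bundle functor of the category of elements. -/
noncomputable def hatFunctor : El R.J ⥤ El R.J where
  obj e := h.hatT e
  map φ := h.hatMap φ
  map_id e := induced_ext (forget R.J) (D.T.map (𝟙 e.base)) (D.p e.base) (h.pLift_cartesian e)
    (h.hatMap_isHomLift (𝟙 e)) (h.hatT_id_isHomLift e) (by
      rw [hatMap_pLift, CategoryTheory.Functor.map_id, Category.comp_id, Category.id_comp])
  map_comp {e e' e''} φ ψ :=
    induced_ext (forget R.J) (D.T.map (φ.base ≫ ψ.base)) (D.p e''.base) (h.pLift_cartesian e'')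
    (h.hatMap_isHomLift (φ ≫ ψ))
    (isHomLift_comp_eq (h.hatMap_isHomLift φ) (h.hatMap_isHomLift ψ) (D.T.map_comp _ _).symm) (by
      rw [hatMap_pLift, CategoryTheory.Functor.map_comp, Category.assoc, hatMap_pLift,
        ← Category.assoc, ← Category.assoc, hatMap_pLift])

/-- The object `(T₂ A, π₁^* p^* T₂^A E)`. -/
def hatT₂ (_ : R.IsTangent D) (e : El R.J) : El R.J :=
  El.mk R.J (D.T₂ e.base) ((R.J.sub (D.π₁ e.base)).obj
    ((R.J.sub (D.p e.base)).obj ((R.D e.base).T₂ e.fiber)))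

/-- The cartesian morphism `(T₂ A, π₁^* p^* T₂^A E) ⟶ (A, T₂^A E)`. -/
def pLift₂ (e : El R.J) : h.hatT₂ e ⟶ El.mk R.J e.base ((R.D e.base).T₂ e.fiber) :=
  El.lift R.J (D.π₁ e.base) _ ≫ El.lift R.J (D.p e.base) _

theorem pLift₂_isHomLift (e : El R.J) :
    (forget R.J).IsHomLift (D.π₁ e.base ≫ D.p e.base) (h.pLift₂ e) :=
  isHomLift_comp (El.lift_isHomLift R.J _ _) (El.lift_isHomLift R.J _ _)

/-- The morphism `T̂₂ e ⟶ T̂ e` over `k` induced by `ξ : T₂^A E ⟶ T^A E`. -/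
noncomputable def hat₂ (e : El R.J) (k : D.T₂ e.base ⟶ D.T.obj e.base)
    (hk : k ≫ D.p e.base = D.π₁ e.base ≫ D.p e.base)
    (ξ : (R.D e.base).T₂ e.fiber ⟶ (R.D e.base).T.obj e.fiber) : h.hatT₂ e ⟶ h.hatT e :=
  induced (forget R.J) k (D.p e.base) (h.pLift_cartesian e) (h.pLift₂ e ≫ El.vert R.J ξ)
    (isHomLift_comp_eq (h.pLift₂_isHomLift e) (El.vert_isHomLift R.J ξ)
      ((Category.comp_id _).trans hk.symm))

/-- The object `(A, T^A T^A E)`. -/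
def fibreTT (_ : R.IsTangent D) (e : El R.J) : El R.J :=
  El.mk R.J e.base ((R.D e.base).T.obj ((R.D e.base).T.obj e.fiber))

/-- The cartesian morphism `T̂ T̂ (A, E) ⟶ (A, T^A T^A E)`. -/
noncomputable def ppLift (e : El R.J) : h.hatT (h.hatT e) ⟶ h.fibreTT e :=
  (h.pLift (h.hatT e) ≫ El.vert R.J (h.lawIso (D.p e.base) ((R.D e.base).T.obj e.fiber)).hom) ≫
    El.lift R.J (D.p e.base) _

theorem ppLift_cartesian (e : El R.J) : (forget R.J).IsStronglyCartesian
    (D.p (D.T.obj e.base) ≫ D.p e.base) (h.ppLift e) := by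
  have h1 := isStronglyCartesian_comp (isStronglyCartesian_comp (h.pLift_cartesian (h.hatT e))
    (El.vert_cartesian R.J (h.lawIso (D.p e.base) ((R.D e.base).T.obj e.fiber)).hom))
    (El.lift_cartesian R.J (D.p e.base) ((R.D e.base).T.obj ((R.D e.base).T.obj e.fiber)))
  exact isStronglyCartesian_of_eq h1 (congrArg (· ≫ _) (Category.comp_id _))

theorem ppLift_isHomLift (e : El R.J) : (forget R.J).IsHomLift
    (D.p (D.T.obj e.base) ≫ D.p e.base) (h.ppLift e) :=
  (h.ppLift_cartesian e).toIsHomLift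

/-- The tangent structure of the category of elements. -/
noncomputable def hatTangent : TangentData (El R.J) where
  T := h.hatFunctor
  T₂ e := h.hatT₂ e
  π₁ e := h.hat₂ e (D.π₁ e.base) rfl ((R.D e.base).π₁ e.fiber)
  π₂ e := h.hat₂ e (D.π₂ e.base) (h.base.π₂_p e.base) ((R.D e.base).π₂ e.fiber)
  p e := h.pLift e ≫ El.vert R.J ((R.D e.base).p e.fiber)
  z e := induced (forget R.J) (D.z e.base) (D.p e.base) (h.pLift_cartesian e)
    (El.vert R.J ((R.D e.base).z e.fiber))
    (isHomLift_of_eq (El.vert_isHomLift R.J _) (h.base.z_p e.base).symm)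
  s e := h.hat₂ e (D.s e.base) (h.base.s_p e.base) ((R.D e.base).s e.fiber)
  l e := induced (forget R.J) (D.l e.base) (D.p (D.T.obj e.base) ≫ D.p e.base)
    (h.ppLift_cartesian e) (h.pLift e ≫ El.vert R.J ((R.D e.base).l e.fiber))
    (isHomLift_comp_eq (h.pLift_isHomLift e) (El.vert_isHomLift R.J _)
      ((Category.comp_id _).trans (h.base.l_p_p e.base).symm))
  c e := induced (forget R.J) (D.c e.base) (D.p (D.T.obj e.base) ≫ D.p e.base)
    (h.ppLift_cartesian e) (h.ppLift e ≫ El.vert R.J ((R.D e.base).c e.fiber))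
    (isHomLift_comp_eq (h.ppLift_isHomLift e) (El.vert_isHomLift R.J _)
      ((Category.comp_id _).trans (h.base.c_p_p e.base).symm))

end RawIndexed.IsTangent

end ElementsTangent

section ElementsCalculus

open Pseudofunctor CoGrothendieck

variable {X : Type u} [Category.{v} X]

theorem El.vert_comp (J : Indx.{v, v', u, u'} X) {A : X} {E E' : J.fib A} (ξ : E ⟶ E') {e : El J}
    (ψ : El.mk J A E' ⟶ e) :
    El.vert J ξ ≫ ψ = (⟨ψ.base, ξ ≫ ψ.fiber⟩ : CoGrothendieck.Hom (El.mk J A E) e) := by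
  have h : ∀ χ : El.mk J A E' ⟶ e, χ = ψ →
      (⟨χ.base, ξ ≫ χ.fiber⟩ : CoGrothendieck.Hom (El.mk J A E) e) = ⟨ψ.base, ξ ≫ ψ.fiber⟩ := by
    rintro χ rfl
    rfl
  refine Eq.trans ?_ (h (𝟙 _ ≫ ψ) (Category.id_comp ψ))
  exact congrArg (CoGrothendieck.Hom.mk _) (Category.assoc _ _ _)

theorem El.comp_vert (J : Indx.{v, v', u, u'} X) {e : El J} {A : X} {E E' : J.fib A}
    (ψ : e ⟶ El.mk J A E) (ξ : E ⟶ E') :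
    ψ ≫ El.vert J ξ =
      (⟨ψ.base, ψ.fiber ≫ (J.sub ψ.base).map ξ⟩ : CoGrothendieck.Hom e (El.mk J A E')) := by
  refine Eq.trans ?_ (Category.comp_id
    (show e ⟶ El.mk J A E' from ⟨ψ.base, ψ.fiber ≫ (J.sub ψ.base).map ξ⟩))
  refine congrArg (CoGrothendieck.Hom.mk _) ?_
  refine Eq.trans ?_ (Category.assoc _ _ _).symm
  refine congrArg (ψ.fiber ≫ ·) ?_
  refine (congrArg (· ≫ _) ((J.sub ψ.base).map_comp ξ _)).trans (Category.assoc _ _ _)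

theorem El.map₂_naturality {J J' : Indx.{v, v', u, u'} X} {κ κ' : J ⟶ J'} (m : κ ⟶ κ')
    {e e' : El J} (φ : e ⟶ e') :
    (CoGrothendieck.map κ).map φ ≫ El.vert J' ((Indx.component m e'.base).app e'.fiber) =
      El.vert J' ((Indx.component m e.base).app e.fiber) ≫ (CoGrothendieck.map κ').map φ := by
  refine (El.comp_vert J' _ _).trans (Eq.trans ?_ (El.vert_comp J' _ _).symm)
  refine congrArg (CoGrothendieck.Hom.mk _) ?_
  have h1 : (Indx.component m e.base).app ((J.sub φ.base).obj e'.fiber) ≫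
      (Indx.distributor κ' φ.base e'.fiber).hom = (Indx.distributor κ φ.base e'.fiber).hom ≫
        (J'.sub φ.base).map ((Indx.component m e'.base).app e'.fiber) :=
    congrArg (fun t => t.toNatTrans.app e'.fiber) (m.as.naturality φ.base.op.toLoc)
  have h2 := (Indx.component m e.base).naturality φ.fiber
  exact (Category.assoc _ _ _).trans ((congrArg (_ ≫ ·) h1.symm).trans
    ((Category.assoc _ _ _).symm.trans ((congrArg (· ≫ _) h2).trans (Category.assoc _ _ _))))

end ElementsCalculus

section ElementsTwoFunctor

open Pseudofunctor CoGrothendieck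

variable {X : Type u} [Category.{u} X] {D : TangentData X}

/-- The category of elements as a category over `X`. -/
def El.based (J : Indx.{u, u, u, u} X) : BasedCategory.{u, u} X := .ofFunctor (forget J)

/-- The functor `(A, E) ↦ (A, F E)` between categories of elements. -/
def El.map {J J' : Indx.{u, u, u, u} X} (κ : J ⟶ J') : BasedFunctor (El.based J) (El.based J') where
  toFunctor := CoGrothendieck.map κ
  w := map_comp_forget κ

/-- The transformation with components `(A, F E) ⟶ (A, G E)`. -/
def El.map₂ {J J' : Indx.{u, u, u, u} X} {κ κ' : J ⟶ J'} (m : κ ⟶ κ') :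
    El.map κ ⟶ El.map κ' where
  app e := El.vert J' ((Indx.component m e.base).app e.fiber)
  naturality e e' φ := by
    exact El.map₂_naturality m φ
  isHomLift' e := El.vert_isHomLift J' _

/-- The fibration of elements of an indexed tangent category: the total tangent bundle functor sends
`(A, E)` to `(T A, p^* T^A E)`. -/
noncomputable def elements {R : RawIndexed.{u, u, u, u} X} (h : R.IsTangent D) :
    RawFibration.{u, u, u, u} X where
  tot := El.based R.J
  cl := El.cleavage R.J
  D := h.hatTangent

/-- The distributive laws between categories of elements. -/
noncomputable def elementsLaw {R R' : RawIndexed.{u, u, u, u} X} (h : R.IsTangent D)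
    (h' : R'.IsTangent D) {κ : R.J ⟶ R'.J} :
    ∀ {o : Bool}, (∀ A : X, Law o (R.D A) (R'.D A) (Indx.functor κ A)) →
      Law o (elements h).D (elements h').D (El.map κ).toFunctor
  | false, β => fun e => El.vert R'.J
      ((Indx.distributor κ (D.p e.base) ((R.D e.base).T.obj e.fiber)).hom ≫
        (R'.J.sub (D.p e.base)).map (β e.base e.fiber))
  | true, β => fun e => El.vert R'.J
      ((R'.J.sub (D.p e.base)).map (β e.base e.fiber) ≫
        (Indx.distributor κ (D.p e.base) ((R.D e.base).T.obj e.fiber)).inv)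

variable (D) (fl : Flavour)

/-- The 2-functor `𝓕` that sends an indexed tangent category to its category of elements, as
assignments on objects, 1-cells and 2-cells. The hypotheses state that the assignments are well
defined. -/
noncomputable def elementsStruct
    (hobj : ∀ {R : RawIndexed.{u, u, u, u} X} (h : R.IsTangent D), (elements h).IsTangent D)
    (hlaw : ∀ {R R' : IndxTng.{u, u, u, u} fl D} (κ : R ⟶ R'),
      IsFibrationLaw D (Q := elements R.obj.2) (Q' := elements R'.obj.2) (El.map κ.hom)
        (elementsLaw R.obj.2 R'.obj.2 κ.str.1))
    (hgen : ∀ {R R' : IndxTng.{u, u, u, u} fl D} (κ : R ⟶ R'),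
      (fibDisplayed.{u, u, u, u} fl.isColax D).Generated
        (fun {Q Q' F} β => IsTangentMorphism Q.1.D Q'.1.D F.toFunctor fl β.1)
        (x := ⟨_, hobj R.obj.2⟩) (y := ⟨_, hobj R'.obj.2⟩) (f := El.map κ.hom)
        ⟨elementsLaw R.obj.2 R'.obj.2 κ.str.1, hlaw κ⟩)
    (htwo : ∀ {R R' : IndxTng.{u, u, u, u} fl D} {κ κ' : R ⟶ R'} (m : κ ⟶ κ'),
      (elementsLaw R.obj.2 R'.obj.2 κ.str.1).Compat (elementsLaw R.obj.2 R'.obj.2 κ'.str.1)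
        (El.map₂ m.cell).toNatTrans) :
    PrelaxFunctorStruct (IndxTng.{u, u, u, u} fl D) (TngFib.{u, u, u, u} fl D) where
  obj R := ⟨⟨elements R.obj.2, hobj R.obj.2⟩⟩
  map {R R'} κ := Displayed.Total.Hom.mk (El.map κ.hom)
    ⟨elementsLaw R.obj.2 R'.obj.2 κ.str.1, hlaw κ⟩ (hgen κ)
  map₂ {R R' κ κ'} m := Displayed.Total.Hom₂.mk (El.map₂ m.cell) (htwo m)

/-- The strict 2-functor `F` sends an indexed tangent category to its category of elements. -/
def IsElementsFunctor
    (F : StrictPseudofunctor (IndxTng.{u, u, u, u} fl D) (TngFib.{u, u, u, u} fl D)) : Prop :=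
  ∃ hobj hlaw hgen htwo, F.toPrelaxFunctorStruct = elementsStruct D fl hobj hlaw hgen htwo

end ElementsTwoFunctor

/-! ### Tangent objects of a bicategory -/

section LawCells

variable {K : Type u} [Bicategory.{w, v} K] {x x' x'' x''' : K} {T : x ⟶ x} {T' : x' ⟶ x'}
  {T'' : x'' ⟶ x''} {T''' : x''' ⟶ x'''}

/-- The type of a distributive law of a 1-cell along endomorphisms, lax or colax. -/
def LawCell (o : Bool) (T : x ⟶ x) (T' : x' ⟶ x') (F : x ⟶ x') : Type w :=
  match o with
  | false => T ≫ F ⟶ F ≫ T'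
  | true => F ≫ T' ⟶ T ≫ F

namespace LawCell

/-- The identity law. -/
def id (o : Bool) (T : x ⟶ x) : LawCell o T T (𝟙 x) :=
  match o with
  | false => (ρ_ T).hom ≫ (λ_ T).inv
  | true => (λ_ T).hom ≫ (ρ_ T).inv

/-- The composite of lax laws. -/
def compLax {F : x ⟶ x'} {G : x' ⟶ x''} (a : T ≫ F ⟶ F ≫ T') (b : T' ≫ G ⟶ G ≫ T'') :
    T ≫ F ≫ G ⟶ (F ≫ G) ≫ T'' :=
  (α_ T F G).inv ≫ a ▷ G ≫ (α_ F T' G).hom ≫ F ◁ b ≫ (α_ F G T'').inv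

/-- The composite of colax laws. -/
def compColax {F : x ⟶ x'} {G : x' ⟶ x''} (a : F ≫ T' ⟶ T ≫ F) (b : G ≫ T'' ⟶ T' ≫ G) :
    (F ≫ G) ≫ T'' ⟶ T ≫ F ≫ G :=
  (α_ F G T'').hom ≫ F ◁ b ≫ (α_ F T' G).inv ≫ a ▷ G ≫ (α_ T F G).hom

/-- The law of a composite 1-cell. -/
def comp {F : x ⟶ x'} {G : x' ⟶ x''} :
    ∀ {o : Bool}, LawCell o T T' F → LawCell o T' T'' G → LawCell o T T'' (F ≫ G)
  | false, a, b => compLax a b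
  | true, a, b => compColax a b

/-- Compatibility of a 2-cell with distributive laws. -/
def Compat {F G : x ⟶ x'} : ∀ {o : Bool}, LawCell o T T' F → LawCell o T T' G → (F ⟶ G) → Prop
  | false, a, b, θ => a ≫ θ ▷ T' = T ◁ θ ≫ b
  | true, a, b, θ => a ≫ T ◁ θ = θ ▷ T' ≫ b

theorem vcomp_lax {f g h : x ⟶ x'} {a : T ≫ f ⟶ f ≫ T'} {b : T ≫ g ⟶ g ≫ T'}
    {c : T ≫ h ⟶ h ≫ T'} {η : f ⟶ g} {θ : g ⟶ h} (h1 : a ≫ η ▷ T' = T ◁ η ≫ b)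
    (h2 : b ≫ θ ▷ T' = T ◁ θ ≫ c) : a ≫ (η ≫ θ) ▷ T' = T ◁ (η ≫ θ) ≫ c := by
  rw [Bicategory.comp_whiskerRight, Bicategory.whiskerLeft_comp, Category.assoc,
    reassoc_of% h1, h2]

theorem vcomp_colax {f g h : x ⟶ x'} {a : f ≫ T' ⟶ T ≫ f} {b : g ≫ T' ⟶ T ≫ g}
    {c : h ≫ T' ⟶ T ≫ h} {η : f ⟶ g} {θ : g ⟶ h} (h1 : a ≫ T ◁ η = η ▷ T' ≫ b)
    (h2 : b ≫ T ◁ θ = θ ▷ T' ≫ c) : a ≫ T ◁ (η ≫ θ) = (η ≫ θ) ▷ T' ≫ c := by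
  rw [Bicategory.comp_whiskerRight, Bicategory.whiskerLeft_comp, Category.assoc,
    reassoc_of% h1, h2]

theorem whiskerLeft_lax {f : x ⟶ x'} {g h : x' ⟶ x''} (a : T ≫ f ⟶ f ≫ T')
    {b : T' ≫ g ⟶ g ≫ T''} {c : T' ≫ h ⟶ h ≫ T''} {η : g ⟶ h}
    (H : b ≫ η ▷ T'' = T' ◁ η ≫ c) :
    compLax a b ≫ (f ◁ η) ▷ T'' = T ◁ f ◁ η ≫ compLax a c := by
  calc _ = (α_ T f g).inv ≫ a ▷ g ≫ (α_ f T' g).hom ≫ f ◁ (b ≫ η ▷ T'') ≫ (α_ f h T'').inv := by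
        simp [compLax]
    _ = (α_ T f g).inv ≫ (a ▷ g ≫ (f ≫ T') ◁ η) ≫ (α_ f T' h).hom ≫ f ◁ c ≫
          (α_ f h T'').inv := by rw [H]; simp
    _ = _ := by rw [← whisker_exchange]; simp [compLax]

theorem whiskerLeft_colax {f : x ⟶ x'} {g h : x' ⟶ x''} (a : f ≫ T' ⟶ T ≫ f)
    {b : g ≫ T'' ⟶ T' ≫ g} {c : h ≫ T'' ⟶ T' ≫ h} {η : g ⟶ h}
    (H : b ≫ T' ◁ η = η ▷ T'' ≫ c) :
    compColax a b ≫ T ◁ f ◁ η = (f ◁ η) ▷ T'' ≫ compColax a c := by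
  calc _ = (α_ f g T'').hom ≫ f ◁ b ≫ (α_ f T' g).inv ≫ (a ▷ g ≫ (T ≫ f) ◁ η) ≫
          (α_ T f h).hom := by simp [compColax]
    _ = (α_ f g T'').hom ≫ f ◁ (b ≫ T' ◁ η) ≫ (α_ f T' h).inv ≫ a ▷ h ≫ (α_ T f h).hom := by
        rw [← whisker_exchange]; simp
    _ = _ := by rw [H]; simp [compColax]

theorem whiskerRight_lax {f g : x ⟶ x'} {h : x' ⟶ x''} {a : T ≫ f ⟶ f ≫ T'}
    {b : T ≫ g ⟶ g ≫ T'} (c : T' ≫ h ⟶ h ≫ T'') {η : f ⟶ g} (H : a ≫ η ▷ T' = T ◁ η ≫ b) :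
    compLax a c ≫ (η ▷ h) ▷ T'' = T ◁ (η ▷ h) ≫ compLax b c := by
  calc _ = (α_ T f h).inv ≫ a ▷ h ≫ (α_ f T' h).hom ≫ (f ◁ c ≫ η ▷ (h ≫ T'')) ≫
          (α_ g h T'').inv := by simp [compLax]
    _ = (α_ T f h).inv ≫ (a ≫ η ▷ T') ▷ h ≫ (α_ g T' h).hom ≫ g ◁ c ≫ (α_ g h T'').inv := by
        rw [whisker_exchange]; simp
    _ = _ := by rw [H]; simp [compLax]

theorem whiskerRight_colax {f g : x ⟶ x'} {h : x' ⟶ x''} {a : f ≫ T' ⟶ T ≫ f}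
    {b : g ≫ T' ⟶ T ≫ g} (c : h ≫ T'' ⟶ T' ≫ h) {η : f ⟶ g} (H : a ≫ T ◁ η = η ▷ T' ≫ b) :
    compColax a c ≫ T ◁ (η ▷ h) = (η ▷ h) ▷ T'' ≫ compColax b c := by
  calc _ = (α_ f h T'').hom ≫ f ◁ c ≫ (α_ f T' h).inv ≫ (a ≫ T ◁ η) ▷ h ≫ (α_ T g h).hom := by
        simp [compColax]
    _ = (α_ f h T'').hom ≫ (f ◁ c ≫ η ▷ (T' ≫ h)) ≫ (α_ g T' h).inv ≫ b ▷ h ≫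
          (α_ T g h).hom := by rw [H]; simp
    _ = _ := by rw [whisker_exchange]; simp [compColax]

theorem assoc_lax {f : x ⟶ x'} {g : x' ⟶ x''} {h : x'' ⟶ x'''} (a : T ≫ f ⟶ f ≫ T')
    (b : T' ≫ g ⟶ g ≫ T'') (c : T'' ≫ h ⟶ h ≫ T''') :
    compLax (compLax a b) c ≫ (α_ f g h).hom ▷ T''' =
      T ◁ (α_ f g h).hom ≫ compLax a (compLax b c) := by
  simp only [compLax]; bicategory

theorem assoc_colax {f : x ⟶ x'} {g : x' ⟶ x''} {h : x'' ⟶ x'''} (a : f ≫ T' ⟶ T ≫ f)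
    (b : g ≫ T'' ⟶ T' ≫ g) (c : h ≫ T''' ⟶ T'' ≫ h) :
    compColax (compColax a b) c ≫ T ◁ (α_ f g h).hom =
      (α_ f g h).hom ▷ T''' ≫ compColax a (compColax b c) := by
  simp only [compColax]; bicategory

theorem left_lax {f : x ⟶ x'} (a : T ≫ f ⟶ f ≫ T') :
    compLax ((ρ_ T).hom ≫ (λ_ T).inv) a ≫ (λ_ f).hom ▷ T' = T ◁ (λ_ f).hom ≫ a := by
  simp only [compLax]; bicategory

theorem left_colax {f : x ⟶ x'} (a : f ≫ T' ⟶ T ≫ f) :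
    compColax ((λ_ T).hom ≫ (ρ_ T).inv) a ≫ T ◁ (λ_ f).hom = (λ_ f).hom ▷ T' ≫ a := by
  simp only [compColax]; bicategory

theorem right_lax {f : x ⟶ x'} (a : T ≫ f ⟶ f ≫ T') :
    compLax a ((ρ_ T').hom ≫ (λ_ T').inv) ≫ (ρ_ f).hom ▷ T' = T ◁ (ρ_ f).hom ≫ a := by
  simp only [compLax]; bicategory

theorem right_colax {f : x ⟶ x'} (a : f ≫ T' ⟶ T ≫ f) :
    compColax a ((λ_ T').hom ≫ (ρ_ T').inv) ≫ T ◁ (ρ_ f).hom = (ρ_ f).hom ▷ T' ≫ a := by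
  simp only [compColax]; bicategory

theorem inv_lax {f g : x ⟶ x'} {a : T ≫ f ⟶ f ≫ T'} {b : T ≫ g ⟶ g ≫ T'} {e : f ≅ g}
    (h : a ≫ e.hom ▷ T' = T ◁ e.hom ≫ b) : b ≫ e.inv ▷ T' = T ◁ e.inv ≫ a := by
  rw [← cancel_epi (T ◁ e.hom), ← reassoc_of% h]
  simp

theorem inv_colax {f g : x ⟶ x'} {a : f ≫ T' ⟶ T ≫ f} {b : g ≫ T' ⟶ T ≫ g} {e : f ≅ g}
    (h : a ≫ T ◁ e.hom = e.hom ▷ T' ≫ b) : b ≫ T ◁ e.inv = e.inv ▷ T' ≫ a := by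
  rw [← cancel_epi (e.hom ▷ T'), ← reassoc_of% h]
  simp

end LawCell

end LawCells

/-- The data of a tangent structure on an object of a bicategory. -/
structure RawTangentObject (K : Type u) [Bicategory.{w, v} K] where
  x : K
  T : x ⟶ x
  T₂ : x ⟶ x
  π₁ : T₂ ⟶ T
  π₂ : T₂ ⟶ T
  p : T ⟶ 𝟙 x
  z : 𝟙 x ⟶ T
  s : T₂ ⟶ T
  l : T ⟶ T ≫ T
  c : T ≫ T ⟶ T ≫ T

section TangentObjects

variable {K : Type u} [Bicategory.{w, v} K]

/-- The tangent data induced on the category of 1-cells `y ⟶ x` by composition. -/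
def RawTangentObject.rep (M : RawTangentObject K) (y : K) : TangentData (y ⟶ M.x) where
  T := postcomp y M.T
  T₂ g := g ≫ M.T₂
  π₁ g := g ◁ M.π₁
  π₂ g := g ◁ M.π₂
  p g := g ◁ M.p ≫ (ρ_ g).hom
  z g := (ρ_ g).inv ≫ g ◁ M.z
  s g := g ◁ M.s
  l g := g ◁ M.l ≫ (α_ g M.T M.T).inv
  c g := (α_ g M.T M.T).hom ≫ g ◁ M.c ≫ (α_ g M.T M.T).inv

/-- Tangent objects: the axioms of a tangent category hold in all categories of 1-cells into `x`,
and the fibre powers of the projection are given by 1-cells `x ⟶ x` and preserved by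
precomposition. -/
structure RawTangentObject.IsTangent (M : RawTangentObject K) : Prop where
  rep : ∀ y : K, (M.rep y).IsTangent
  pointwise : ∀ n : ℕ, ∃ (P : M.x ⟶ M.x) (pr : Fin (n + 1) → (P ⟶ M.T)),
    ∀ (y : K) (g : y ⟶ M.x), IsFibrePower ((M.rep y).p g) (fun i => g ◁ pr i)

/-- The law induced on categories of 1-cells by composition. -/
def LawCell.rep {M M' : RawTangentObject K} {F : M.x ⟶ M'.x} :
    ∀ {o : Bool}, LawCell o M.T M'.T F → ∀ y : K, Law o (M.rep y) (M'.rep y) (postcomp y F)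
  | false, a, _ => fun g => (α_ g M.T F).hom ≫ g ◁ a ≫ (α_ g F M'.T).inv
  | true, a, _ => fun g => (α_ g F M'.T).hom ≫ g ◁ a ≫ (α_ g M.T F).inv

/-- Morphisms of tangent objects of each flavour: the axioms of a tangent morphism hold for the
functors induced on categories of 1-cells; the law of a strong morphism is invertible, and the law
of a strict morphism is an identity. -/
def IsTangentCell {M M' : RawTangentObject K} (F : M.x ⟶ M'.x) :
    ∀ fl : Flavour, LawCell fl.isColax M.T M'.T F → Prop
  | .lax, a => ∀ y : K, IsLaxMorphism (M.rep y) (M'.rep y) (postcomp y F) (a.rep y)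
  | .colax, a => ∀ y : K, IsColaxMorphism (M.rep y) (M'.rep y) (postcomp y F) (a.rep y)
  | .strong, a => (∀ y : K, IsColaxMorphism (M.rep y) (M'.rep y) (postcomp y F) (a.rep y)) ∧
      IsIso (show F ≫ M'.T ⟶ M.T ≫ F from a)
  | .strict, a => (∀ y : K, IsColaxMorphism (M.rep y) (M'.rep y) (postcomp y F) (a.rep y)) ∧
      ∃ h : F ≫ M'.T = M.T ≫ F, a = eqToHom h

/-- Tangent objects, 1-cells with a distributive law, and compatible 2-cells. -/
def tngDisplayed (o : Bool) (K : Type u) [Bicategory.{w, v} K] : Displayed K where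
  Ob := {M : RawTangentObject K // M.IsTangent}
  base M := M.1.x
  Str {M M'} F := LawCell o M.1.T M'.1.T F
  idStr M := LawCell.id o M.1.T
  compStr a b := a.comp b
  Two a b θ := a.Compat b θ
  two_id {M M' f} a := by
    cases o
    · exact ((congrArg _ (id_whiskerRight f M'.1.T)).trans (Category.comp_id _)).trans
        ((congrArg (· ≫ _) (whiskerLeft_id M.1.T f)).trans (Category.id_comp _)).symm
    · exact ((congrArg _ (whiskerLeft_id M.1.T f)).trans (Category.comp_id _)).trans
        ((congrArg (· ≫ _) (id_whiskerRight f M'.1.T)).trans (Category.id_comp _)).symm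
  two_comp h h' := by
    cases o
    · exact LawCell.vcomp_lax h h'
    · exact LawCell.vcomp_colax h h'
  two_whiskerLeft a _ _ _ H := by
    cases o
    · exact LawCell.whiskerLeft_lax a H
    · exact LawCell.whiskerLeft_colax a H
  two_whiskerRight c _ H := by
    cases o
    · exact LawCell.whiskerRight_lax c H
    · exact LawCell.whiskerRight_colax c H
  two_associator a b c := by
    cases o
    · exact ⟨LawCell.assoc_lax a b c, LawCell.inv_lax (LawCell.assoc_lax a b c)⟩
    · exact ⟨LawCell.assoc_colax a b c, LawCell.inv_colax (LawCell.assoc_colax a b c)⟩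
  two_leftUnitor a := by
    cases o
    · exact ⟨LawCell.left_lax a, LawCell.inv_lax (LawCell.left_lax a)⟩
    · exact ⟨LawCell.left_colax a, LawCell.inv_colax (LawCell.left_colax a)⟩
  two_rightUnitor a := by
    cases o
    · exact ⟨LawCell.right_lax a, LawCell.inv_lax (LawCell.right_lax a)⟩
    · exact ⟨LawCell.right_colax a, LawCell.inv_colax (LawCell.right_colax a)⟩

/-- The 2-categories of tangent objects of a bicategory with 1-cells generated by the lax, colax,
strong or strict morphisms. -/
abbrev Tng (fl : Flavour) (K : Type u) [Bicategory.{w, v} K] :=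
  (tngDisplayed fl.isColax K).Total
    (fun {M M' F} a => IsTangentCell (M := M.1) (M' := M'.1) F fl a)

end TangentObjects

/-! ### Tangent indexed categories over a fixed base -/

section Extraction

variable {X : Type u} [Category.{u} X]

/-- The components of a tangent object in indexed categories: tangent data on the fibres, and the
distributors of the tangent bundle 1-cell as distributive laws of the substitution functors. -/
def RawTangentObject.components (M : RawTangentObject (Indx.{u, u, u, u} X)) :
    RawIndexed.{u, u, u, u} X where
  J := M.x
  D A :=
    { T := Indx.functor M.T A
      T₂ := fun E => (Indx.functor M.T₂ A).obj E
      π₁ := fun E => (Indx.component M.π₁ A).app E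
      π₂ := fun E => (Indx.component M.π₂ A).app E
      p := fun E => (Indx.component M.p A).app E
      z := fun E => (Indx.component M.z A).app E
      s := fun E => (Indx.component M.s A).app E
      l := fun E => (Indx.component M.l A).app E
      c := fun E => (Indx.component M.c A).app E }
  α f := fun E => (Indx.distributor M.T f E).hom

/-- The components of the distributive law of a 1-cell between tangent objects in indexed
categories. -/
def LawCell.components {M M' : RawTangentObject (Indx.{u, u, u, u} X)} {κ : M.x ⟶ M'.x} :
    ∀ {o : Bool}, LawCell o M.T M'.T κ → ∀ A : X,
      Law o (M.components.D A) (M'.components.D A) (Indx.functor κ A)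
  | false, a, A => fun E => (Indx.component a A).app E
  | true, a, A => fun E => (Indx.component a A).app E

variable (X) (fl : Flavour)

/-- The 2-functor that sends a tangent object in indexed categories over `X` to its components, as
assignments on objects, 1-cells and 2-cells. The hypotheses state that the assignments are well
defined. -/
def componentsStruct
    (hobj : ∀ {M : RawTangentObject (Indx.{u, u, u, u} X)}, M.IsTangent →
      M.components.IsTangent (TangentData.trivial X))
    (hnat : ∀ {M M' : Tng fl (Indx.{u, u, u, u} X)} (κ : M ⟶ M') (A : X),
      (LawCell.components (M := M.obj.1) (M' := M'.obj.1) κ.str A).IsNatural)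
    (hgen : ∀ {M M' : Tng fl (Indx.{u, u, u, u} X)} (κ : M ⟶ M'),
      (indDisplayed.{u, u, u, u} fl.isColax (TangentData.trivial X)).Generated
        (fun {R R' κ} β => IsIndexedMorphism (R := R.1) (R' := R'.1) fl κ β.1)
        (x := ⟨_, hobj M.obj.2⟩) (y := ⟨_, hobj M'.obj.2⟩) (f := κ.hom)
        ⟨LawCell.components (M := M.obj.1) (M' := M'.obj.1) κ.str, hnat κ⟩)
    (htwo : ∀ {M M' : Tng fl (Indx.{u, u, u, u} X)} {κ κ' : M ⟶ M'} (m : κ ⟶ κ') (A : X),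
      (LawCell.components (M := M.obj.1) (M' := M'.obj.1) κ.str A).Compat
        (LawCell.components (M := M.obj.1) (M' := M'.obj.1) κ'.str A) (Indx.component m.cell A)) :
    PrelaxFunctorStruct (Tng fl (Indx.{u, u, u, u} X))
      (IndxTng.{u, u, u, u} fl (TangentData.trivial X)) where
  obj M := ⟨⟨M.obj.1.components, hobj M.obj.2⟩⟩
  map {M M'} κ := Displayed.Total.Hom.mk κ.hom
    ⟨LawCell.components (M := M.obj.1) (M' := M'.obj.1) κ.str, hnat κ⟩ (hgen κ)
  map₂ m := Displayed.Total.Hom₂.mk m.cell (fun A => htwo m A)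

/-- The strict 2-functor `E` sends a tangent object in indexed categories to its components. -/
def IsComponentsFunctor
    (E : StrictPseudofunctor (Tng fl (Indx.{u, u, u, u} X))
      (IndxTng.{u, u, u, u} fl (TangentData.trivial X))) : Prop :=
  ∃ hobj hnat hgen htwo, E.toPrelaxFunctorStruct = componentsStruct X fl hobj hnat hgen htwo

end Extraction

/-- Strict morphisms of tangent fibrations are strong. -/
theorem IsTangentMorphism.strong_of_strict {C : Type u} [Category.{v} C] {C' : Type u'}
    [Category.{v'} C'] {D : TangentData C} {D' : TangentData C'} {F : C ⥤ C'}
    {β : Law true D D' F} (h : IsTangentMorphism D D' F .strict β) :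
    IsTangentMorphism D D' F .strong β := by
  obtain ⟨h1, e, h2⟩ := h
  refine ⟨h1, fun A => ?_⟩
  rw [h2 A]
  infer_instance

/-- The inclusion of strict into strong morphisms of tangent fibrations. -/
def fibInclusion {X : Type u} [Category.{u} X] (D : TangentData X) :
    StrictPseudofunctor (TngFib.{u, u, u, u} .strict D) (TngFib.{u, u, u, u} .strong D) :=
  Displayed.inclusion (D := fibDisplayed true D) fun _ h => h.strong_of_strict

/-- The inclusion of strict into strong morphisms of indexed tangent categories. -/
def indInclusion {X : Type u} [Category.{u} X] (D : TangentData X) :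
    StrictPseudofunctor (IndxTng.{u, u, u, u} .strict D) (IndxTng.{u, u, u, u} .strong D) :=
  Displayed.inclusion (D := indDisplayed true D)
    fun _ h => ⟨fun A => (h.fibre A).strong_of_strict, h.coherent⟩

/-- `L` and `R` are adjoint to each other on both sides, and all adjunctions between them are
equivalences. -/
structure AreAdjointEquivalences {B : Type u} [Bicategory.{w, v} B] {B' : Type u'}
    [Bicategory.{w', v'} B'] (L : StrictPseudofunctor B B') (R : StrictPseudofunctor B' B) :
    Prop where
  left : Nonempty (TwoAdjunction L R)
  left_isEquivalence : ∀ adj : TwoAdjunction L R, adj.IsEquivalence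
  right : Nonempty (TwoAdjunction R L)
  right_isEquivalence : ∀ adj : TwoAdjunction R L, adj.IsEquivalence

end TangentGrothendieck

open TangentGrothendieck

namespace TangentGrothendieck

open CategoryTheory.Category (assoc id_comp comp_id)
open CategoryTheory.Functor renaming map_comp → fmap_comp, map_id → fmap_id
open TangentGrothendieck.TangentData renaming trivial → triv
open Displayed

noncomputable section

section FibrePowers

variable {C : Type u} [Category.{v} C] {C' : Type u'} [Category.{v'} C']

namespace IsFibrePower

variable {E B P : C} {q : E ⟶ B} {n : ℕ} {pr : Fin (n + 1) → (P ⟶ E)}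

theorem hom_ext (h : IsFibrePower q pr) {Y : C} {k k' : Y ⟶ P}
    (e : ∀ i, k ≫ pr i = k' ≫ pr i) : k = k' :=
  (h.lift (fun i => k' ≫ pr i) fun i j => by simp [h.comm i j]).unique e fun _ => rfl

/-- The map into a fibre power with given components. -/
def desc (h : IsFibrePower q pr) {Y : C} (f : Fin (n + 1) → (Y ⟶ E))
    (hf : ∀ i j, f i ≫ q = f j ≫ q) : Y ⟶ P :=
  (h.lift f hf).choose

theorem desc_pr (h : IsFibrePower q pr) {Y : C} (f : Fin (n + 1) → (Y ⟶ E))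
    (hf : ∀ i j, f i ≫ q = f j ≫ q) (i) : h.desc f hf ≫ pr i = f i :=
  (h.lift f hf).choose_spec.1 i

theorem mk_of_ext {E B P : C} {q : E ⟶ B} {n : ℕ} {pr : Fin (n + 1) → (P ⟶ E)}
    (hc : ∀ i j, pr i ≫ q = pr j ≫ q)
    (hl : ∀ {Y : C} (f : Fin (n + 1) → (Y ⟶ E)), (∀ i j, f i ≫ q = f j ≫ q) →
      ∃ k : Y ⟶ P, ∀ i, k ≫ pr i = f i)
    (hu : ∀ {Y : C} {k k' : Y ⟶ P}, (∀ i, k ≫ pr i = k' ≫ pr i) → k = k') :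
    IsFibrePower q pr where
  comm := hc
  lift f hf := by
    obtain ⟨k, hk⟩ := hl f hf
    exact ⟨k, hk, fun k' hk' => hu fun i => (hk' i).trans (hk i).symm⟩

theorem of_iso (h : IsFibrePower q pr) {E' B' P' : C} {q' : E' ⟶ B'}
    {pr' : Fin (n + 1) → (P' ⟶ E')} (e : E ≅ E') (b : B ≅ B') (a : P ≅ P')
    (hq : q ≫ b.hom = e.hom ≫ q') (hpr : ∀ i, pr i ≫ e.hom = a.hom ≫ pr' i) :
    IsFibrePower q' pr' := by
  have hq' : q' = e.inv ≫ q ≫ b.hom := by rw [hq, e.inv_hom_id_assoc]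
  have hpr' : ∀ i, pr' i = a.inv ≫ pr i ≫ e.hom := fun i => by
    rw [hpr, a.inv_hom_id_assoc]
  refine mk_of_ext (fun i j => ?_) (fun {Y} f hf => ?_) (fun {Y k k'} hk => ?_)
  · simp only [hq', hpr', assoc, e.hom_inv_id_assoc]
    rw [reassoc_of% h.comm i j]
  · have hf' : ∀ i j, (f i ≫ e.inv) ≫ q = (f j ≫ e.inv) ≫ q := fun i j => by
      have := hf i j
      rw [hq', ← assoc, ← assoc, ← assoc, ← assoc, cancel_mono] at this
      exact this
    refine ⟨h.desc _ hf' ≫ a.hom, fun i => ?_⟩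
    rw [assoc, ← hpr, ← assoc, h.desc_pr, assoc, e.inv_hom_id, comp_id]
  · rw [← cancel_mono a.inv]
    refine h.hom_ext fun i => ?_
    rw [← cancel_mono e.hom]
    simpa [hpr'] using hk i

/-- Two fibre powers of the same map are isomorphic. -/
def iso (h : IsFibrePower q pr) {P' : C} {pr' : Fin (n + 1) → (P' ⟶ E)}
    (h' : IsFibrePower q pr') : P ≅ P' where
  hom := h'.desc pr h.comm
  inv := h.desc pr' h'.comm
  hom_inv_id := h.hom_ext fun i => by rw [assoc, h.desc_pr, h'.desc_pr, id_comp]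
  inv_hom_id := h'.hom_ext fun i => by rw [assoc, h'.desc_pr, h.desc_pr, id_comp]

theorem iso_hom_pr (h : IsFibrePower q pr) {P' : C} {pr' : Fin (n + 1) → (P' ⟶ E)}
    (h' : IsFibrePower q pr') (i) : (h.iso h').hom ≫ pr' i = pr i := h'.desc_pr _ h.comm _

theorem map_of_map (h : IsFibrePower q pr) {P' : C} {pr' : Fin (n + 1) → (P' ⟶ E)}
    (h' : IsFibrePower q pr') (F : C ⥤ C') (hF : IsFibrePower (F.map q) (fun i => F.map (pr' i))) :
    IsFibrePower (F.map q) (fun i => F.map (pr i)) :=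
  hF.of_iso (Iso.refl _) (Iso.refl _) (F.mapIso (h'.iso h)) (by simp) fun i => by
    rw [Iso.refl_hom, comp_id, Functor.mapIso_hom, ← F.map_comp, iso_hom_pr]

theorem congr_functor {F G : C ⥤ C'} (τ : F ≅ G)
    (hF : IsFibrePower (F.map q) (fun i => F.map (pr i))) :
    IsFibrePower (G.map q) (fun i => G.map (pr i)) :=
  hF.of_iso (τ.app _) (τ.app _) (τ.app _) (τ.hom.naturality _) fun _ => τ.hom.naturality _

end IsFibrePower

theorem isFibrePower_of_isPullback {E B P : C} {q : E ⟶ B} {pr : Fin (1 + 1) → (P ⟶ E)}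
    (h : IsPullback (pr 0) (pr 1) q q) : IsFibrePower q pr := by
  refine .mk_of_ext (fun i j => ?_) (fun {Y} f hf => ?_) (fun {Y k k'} hk => ?_)
  · fin_cases i <;> fin_cases j <;> first | rfl | exact h.w | exact h.w.symm
  · refine ⟨h.lift (f 0) (f 1) (hf 0 1), fun i => ?_⟩
    fin_cases i
    · exact h.lift_fst _ _ _
    · exact h.lift_snd _ _ _
  · exact h.hom_ext (hk 0) (hk 1)

theorem IsFibrePower.isPullback {E B P : C} {q : E ⟶ B} {pr : Fin (1 + 1) → (P ⟶ E)}
    (h : IsFibrePower q pr) : IsPullback (pr 0) (pr 1) q q := by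
  refine ⟨⟨h.comm 0 1⟩, ⟨Limits.PullbackCone.IsLimit.mk _
    (fun s => h.desc (fun i => if i = 0 then s.fst else s.snd) ?_) ?_ ?_ ?_⟩⟩
  · have := s.condition
    intro i j
    fin_cases i <;> fin_cases j <;> simp [this]
  · exact fun s => h.desc_pr _ _ 0
  · exact fun s => h.desc_pr _ _ 1
  · intro s m h1 h2
    refine h.hom_ext fun i => ?_
    rw [h.desc_pr]
    fin_cases i
    · exact h1
    · exact h2

/-- The family of the two projections of a pullback. -/
def pairFam {E P : C} (a b : P ⟶ E) : Fin (1 + 1) → (P ⟶ E) := fun i => if i = 0 then a else b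

theorem isFibrePower_pairFam {E B P : C} {q : E ⟶ B} {a b : P ⟶ E} (h : IsPullback a b q q) :
    IsFibrePower q (pairFam a b) := isFibrePower_of_isPullback h

theorem IsFibrePower.isPullback_map {E B P : C} {q : E ⟶ B} {a b : P ⟶ E} {F : C ⥤ C'}
    (h : IsFibrePower (F.map q) (fun i => F.map (pairFam a b i))) :
    IsPullback (F.map a) (F.map b) (F.map q) (F.map q) := h.isPullback

/-- A family of functors that is jointly faithful and jointly reflects fibre powers and
pullbacks. -/
structure JointlyReflects {ι : Type w} {C' : ι → Type u'} [∀ i, Category.{v'} (C' i)]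
    (F : ∀ i, C ⥤ C' i) : Prop where
  faithful : ∀ {A B : C} {f g : A ⟶ B}, (∀ i, (F i).map f = (F i).map g) → f = g
  power : ∀ {E B P : C} {q : E ⟶ B} {n : ℕ} {pr : Fin (n + 1) → (P ⟶ E)},
    (∀ i, IsFibrePower ((F i).map q) (fun j => (F i).map (pr j))) → IsFibrePower q pr
  square : ∀ {P E E' B : C} {a : P ⟶ E} {b : P ⟶ E'} {f : E ⟶ B} {g : E' ⟶ B},
    (∀ i, IsPullback ((F i).map a) ((F i).map b) ((F i).map f) ((F i).map g)) → IsPullback a b f g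

theorem jointlyReflects_of_fullyFaithful (F : C ⥤ C') [F.Full] [F.Faithful] :
    JointlyReflects (fun _ : Unit => F) where
  faithful h := F.map_injective (h ())
  power {E B P q n pr} h := by
    refine .mk_of_ext (fun i j => F.map_injective ?_) (fun {Y} f hf => ?_)
      (fun {Y k k'} hk => F.map_injective ?_)
    · simpa only [F.map_comp] using (h ()).comm i j
    · refine ⟨F.preimage ((h ()).desc (fun i => F.map (f i)) fun i j => ?_),
        fun i => F.map_injective ?_⟩
      · rw [← F.map_comp, ← F.map_comp, hf i j]
      · rw [F.map_comp, F.map_preimage, (h ()).desc_pr]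
    · exact (h ()).hom_ext fun i => by rw [← F.map_comp, ← F.map_comp, hk i]
  square h := IsPullback.of_map F (F.map_injective (by simpa using (h ()).w)) (h ())

theorem isPullback_congr_functor {P E E' B : C} {a : P ⟶ E} {b : P ⟶ E'} {f : E ⟶ B} {g : E' ⟶ B}
    {F G : C ⥤ C'} (τ : F ≅ G) (h : IsPullback (F.map a) (F.map b) (F.map f) (F.map g)) :
    IsPullback (G.map a) (G.map b) (G.map f) (G.map g) :=
  h.of_iso (τ.app _) (τ.app _) (τ.app _) (τ.app _) (τ.hom.naturality _) (τ.hom.naturality _)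
    (τ.hom.naturality _) (τ.hom.naturality _)

end FibrePowers

section Bundles

variable {C : Type u} [Category.{v} C] {C' : Type u'} [Category.{v'} C']

theorem isAdditive_map {B E E₂ : C} {q : E ⟶ B} {zero : B ⟶ E} {fst snd sum : E₂ ⟶ E}
    (h : BundleData.IsAdditive ⟨B, E, E₂, q, zero, fst, snd, sum⟩) (F : C ⥤ C')
    (hF : ∀ {n : ℕ} {P : C} (pr : Fin (n + 1) → (P ⟶ E)), IsFibrePower q pr →
      IsFibrePower (F.map q) (fun i => F.map (pr i))) :
    BundleData.IsAdditive ⟨F.obj B, F.obj E, F.obj E₂, F.map q, F.map zero, F.map fst, F.map snd,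
      F.map sum⟩ := by
  obtain ⟨hpow, hpb, hzero, hsum, hza, hcomm, hassoc⟩ := h
  dsimp only at hpow hpb hzero hsum hza hcomm hassoc
  have hp : IsPullback (F.map fst) (F.map snd) (F.map q) (F.map q) :=
    (hF _ (isFibrePower_pairFam hpb)).isPullback_map
  refine ⟨fun n => ?_, hp, ?_, ?_, fun k h1 h2 => ?_, fun k h1 h2 => ?_, ?_⟩
  · obtain ⟨P, pr, hpr⟩ := hpow n
    exact ⟨_, _, hF _ hpr⟩
  · dsimp only
    rw [← F.map_comp, hzero, F.map_id]
  · dsimp only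
    rw [← F.map_comp, hsum, F.map_comp]
  · dsimp only at h1 h2 k ⊢
    let k₀ : E ⟶ E₂ := hpb.lift (q ≫ zero) (𝟙 _) (by rw [assoc, hzero, comp_id, id_comp])
    have e1 : k₀ ≫ fst = _ := hpb.lift_fst _ _ _
    have e2 : k₀ ≫ snd = _ := hpb.lift_snd _ _ _
    have e : k = F.map k₀ := hp.hom_ext (by rw [h1, ← F.map_comp, ← F.map_comp, e1])
      (by rw [h2, ← F.map_comp, e2, F.map_id])
    rw [e, ← F.map_comp, hza k₀ e1 e2, F.map_id]
  · dsimp only at h1 h2 k ⊢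
    let k₀ : E₂ ⟶ E₂ := hpb.lift snd fst hpb.w.symm
    have e1 : k₀ ≫ fst = _ := hpb.lift_fst _ _ _
    have e2 : k₀ ≫ snd = _ := hpb.lift_snd _ _ _
    have e : k = F.map k₀ := hp.hom_ext (by rw [h1, ← F.map_comp, e1])
      (by rw [h2, ← F.map_comp, e2])
    rw [e, ← F.map_comp, hcomm k₀ e1 e2]
  · dsimp only
    intro Y xy yz xy_z x_yz h1 h2 h3 h4 h5
    obtain ⟨P, pr, hpr⟩ := hpow 2
    let xy₀ : P ⟶ E₂ := hpb.lift (pr 0) (pr 1) (hpr.comm 0 1)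
    let yz₀ : P ⟶ E₂ := hpb.lift (pr 1) (pr 2) (hpr.comm 1 2)
    have a1 : xy₀ ≫ fst = pr 0 := hpb.lift_fst _ _ _
    have a2 : xy₀ ≫ snd = pr 1 := hpb.lift_snd _ _ _
    have a3 : yz₀ ≫ fst = pr 1 := hpb.lift_fst _ _ _
    have a4 : yz₀ ≫ snd = pr 2 := hpb.lift_snd _ _ _
    let xy_z₀ : P ⟶ E₂ := hpb.lift (xy₀ ≫ sum) (pr 2) (by
      rw [assoc, hsum, ← assoc, a1, hpr.comm 0 2])
    let x_yz₀ : P ⟶ E₂ := hpb.lift (pr 0) (yz₀ ≫ sum) (by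
      rw [assoc, hsum, ← assoc, a3, hpr.comm 0 1])
    have a5 : xy_z₀ ≫ fst = xy₀ ≫ sum := hpb.lift_fst _ _ _
    have a6 : xy_z₀ ≫ snd = pr 2 := hpb.lift_snd _ _ _
    have a7 : x_yz₀ ≫ fst = pr 0 := hpb.lift_fst _ _ _
    have a8 : x_yz₀ ≫ snd = yz₀ ≫ sum := hpb.lift_snd _ _ _
    have key : F.map xy_z₀ ≫ F.map sum = F.map x_yz₀ ≫ F.map sum := by
      rw [← F.map_comp, ← F.map_comp, hassoc xy₀ yz₀ xy_z₀ x_yz₀ (a2.trans a3.symm) a5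
        (a6.trans a4.symm) (a7.trans a1.symm) a8]
    have w1 : ∀ (k : Y ⟶ F.obj E₂), k ≫ F.map snd ≫ F.map q = k ≫ F.map fst ≫ F.map q :=
      fun k => by rw [hp.w]
    let f : Fin (2 + 1) → (Y ⟶ F.obj E) := fun i =>
      if i = 0 then xy ≫ F.map fst else if i = 1 then xy ≫ F.map snd else yz ≫ F.map snd
    have hf0 : ∀ i, f i ≫ F.map q = xy ≫ F.map fst ≫ F.map q := by
      intro i
      fin_cases i
      · exact assoc _ _ _
      · exact (assoc _ _ _).trans (w1 xy)
      · refine (assoc _ _ _).trans ((w1 yz).trans ?_)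
        rw [← assoc, ← h1, assoc, w1 xy]
    have hP := hF _ hpr
    have hf : ∀ i j, f i ≫ F.map q = f j ≫ F.map q := fun i j => (hf0 i).trans (hf0 j).symm
    have d0 : hP.desc f hf ≫ F.map (pr 0) = xy ≫ F.map fst := hP.desc_pr f hf 0
    have d1 : hP.desc f hf ≫ F.map (pr 1) = xy ≫ F.map snd := hP.desc_pr f hf 1
    have d2 : hP.desc f hf ≫ F.map (pr 2) = yz ≫ F.map snd := hP.desc_pr f hf 2
    generalize hP.desc f hf = m at d0 d1 d2
    have m1 : xy = m ≫ F.map xy₀ := hp.hom_ext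
      (by rw [assoc, ← F.map_comp, a1, d0]) (by rw [assoc, ← F.map_comp, a2, d1])
    have m2 : yz = m ≫ F.map yz₀ := hp.hom_ext (by rw [assoc, ← F.map_comp, a3, d1, h1])
      (by rw [assoc, ← F.map_comp, a4, d2])
    have m3 : xy_z = m ≫ F.map xy_z₀ := hp.hom_ext
      (by rw [assoc, ← F.map_comp, a5, F.map_comp, ← assoc, ← m1, h2])
      (by rw [assoc, ← F.map_comp, a6, d2, h3])
    have m4 : x_yz = m ≫ F.map x_yz₀ := hp.hom_ext (by rw [assoc, ← F.map_comp, a7, d0, h4])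
      (by rw [assoc, ← F.map_comp, a8, F.map_comp, ← assoc, ← m2, h5])
    rw [m3, m4, assoc, assoc, key]

end Bundles

section StrongMaps

variable {C : Type u} [Category.{v} C] {C' : Type u'} [Category.{v'} C']

/-- An invertible distributive law of `F` that is compatible with the tangent data, with chosen
comparisons of the fibre squares. No limits are assumed to exist or to be preserved. -/
structure StrongMap (D : TangentData C) (D' : TangentData C') (F : C ⥤ C') where
  b : ∀ A, D'.T.obj (F.obj A) ≅ F.obj (D.T.obj A)
  b₂ : ∀ A, D'.T₂ (F.obj A) ≅ F.obj (D.T₂ A)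
  natural : ∀ {A B : C} (f : A ⟶ B), D'.T.map (F.map f) ≫ (b B).hom = (b A).hom ≫ F.map (D.T.map f)
  π₁ : ∀ A, (b₂ A).hom ≫ F.map (D.π₁ A) = D'.π₁ (F.obj A) ≫ (b A).hom
  π₂ : ∀ A, (b₂ A).hom ≫ F.map (D.π₂ A) = D'.π₂ (F.obj A) ≫ (b A).hom
  p : ∀ A, (b A).hom ≫ F.map (D.p A) = D'.p (F.obj A)
  z : ∀ A, D'.z (F.obj A) ≫ (b A).hom = F.map (D.z A)
  s : ∀ A, (b₂ A).hom ≫ F.map (D.s A) = D'.s (F.obj A) ≫ (b A).hom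
  l : ∀ A, D'.l (F.obj A) ≫ D'.T.map (b A).hom ≫ (b (D.T.obj A)).hom = (b A).hom ≫ F.map (D.l A)
  c : ∀ A, D'.c (F.obj A) ≫ D'.T.map (b A).hom ≫ (b (D.T.obj A)).hom =
    D'.T.map (b A).hom ≫ (b (D.T.obj A)).hom ≫ F.map (D.c A)

theorem TangentData.IsTangent.pb {D : TangentData C} (h : D.IsTangent) (A : C) :
    IsPullback (D.π₁ A) (D.π₂ A) (D.p A) (D.p A) := (h.additive A).isPullback

theorem TangentData.IsTangent.pb_iter {D : TangentData C} (h : D.IsTangent) (m : ℕ) (A : C) :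
    IsPullback ((D.iter m).map (D.π₁ A)) ((D.iter m).map (D.π₂ A)) ((D.iter m).map (D.p A))
      ((D.iter m).map (D.p A)) :=
  (h.preserves m A _ (isFibrePower_pairFam (h.pb A))).isPullback_map

theorem TangentData.IsTangent.pb_T {D : TangentData C} (h : D.IsTangent) (A : C) :
    IsPullback (D.T.map (D.π₁ A)) (D.T.map (D.π₂ A)) (D.T.map (D.p A)) (D.T.map (D.p A)) :=
  h.pb_iter 1 A

theorem TangentData.IsTangent.exists_vertical {D : TangentData C} (h : D.IsTangent) (A : C) :
    ∃ k : D.T₂ A ⟶ D.T.obj (D.T₂ A), k ≫ D.T.map (D.π₁ A) = D.π₁ A ≫ D.l A ∧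
      k ≫ D.T.map (D.π₂ A) = D.π₂ A ≫ D.z (D.T.obj A) := by
  have e : D.l A ≫ D.T.map (D.p A) = D.p A ≫ D.z A := (h.l_additive A).q
  refine ⟨(h.pb_T A).lift (D.π₁ A ≫ D.l A) (D.π₂ A ≫ D.z (D.T.obj A)) ?_,
    (h.pb_T A).lift_fst _ _ _, (h.pb_T A).lift_snd _ _ _⟩
  rw [assoc, e, assoc, ← h.z_nat, ← assoc, (h.pb A).w, assoc]

namespace StrongMap

variable {D : TangentData C} {D' : TangentData C'} {F : C ⥤ C'} (φ : StrongMap D D' F)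

theorem map_T {A B : C} (f : A ⟶ B) :
    F.map (D.T.map f) = (φ.b A).inv ≫ D'.T.map (F.map f) ≫ (φ.b B).hom := by
  rw [φ.natural, Iso.inv_hom_id_assoc]

theorem map_p (A : C) : F.map (D.p A) = (φ.b A).inv ≫ D'.p (F.obj A) := by
  rw [← φ.p, Iso.inv_hom_id_assoc]

theorem map_π₁ (A : C) : F.map (D.π₁ A) = (φ.b₂ A).inv ≫ D'.π₁ (F.obj A) ≫ (φ.b A).hom := by
  rw [← φ.π₁, Iso.inv_hom_id_assoc]

theorem map_π₂ (A : C) : F.map (D.π₂ A) = (φ.b₂ A).inv ≫ D'.π₂ (F.obj A) ≫ (φ.b A).hom := by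
  rw [← φ.π₂, Iso.inv_hom_id_assoc]

theorem map_s (A : C) : F.map (D.s A) = (φ.b₂ A).inv ≫ D'.s (F.obj A) ≫ (φ.b A).hom := by
  rw [← φ.s, Iso.inv_hom_id_assoc]

theorem map_z (A : C) : F.map (D.z A) = D'.z (F.obj A) ≫ (φ.b A).hom := (φ.z A).symm

theorem map_l (A : C) : F.map (D.l A) =
    (φ.b A).inv ≫ D'.l (F.obj A) ≫ D'.T.map (φ.b A).hom ≫ (φ.b (D.T.obj A)).hom := by
  rw [φ.l, Iso.inv_hom_id_assoc]

theorem map_c (A : C) : F.map (D.c A) = (φ.b (D.T.obj A)).inv ≫ D'.T.map (φ.b A).inv ≫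
    D'.c (F.obj A) ≫ D'.T.map (φ.b A).hom ≫ (φ.b (D.T.obj A)).hom := by
  rw [φ.c, ← D'.T.map_comp_assoc, Iso.inv_hom_id, D'.T.map_id, id_comp, Iso.inv_hom_id_assoc]

/-- The law as a natural isomorphism. -/
def natIso : F ⋙ D'.T ≅ D.T ⋙ F := NatIso.ofComponents φ.b fun f => φ.natural f

/-- The induced isomorphism between iterates. -/
def iterIso : ∀ m : ℕ, F ⋙ D'.iter m ≅ D.iter m ⋙ F
  | 0 => Iso.refl F
  | m + 1 => Functor.isoWhiskerRight (iterIso m) D'.T ≪≫ Functor.isoWhiskerLeft (D.iter m) φ.natIso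

/-- The map `⟨l π₁, z π₂⟩` on the other side. -/
def conj {A : C} (k : D.T₂ A ⟶ D.T.obj (D.T₂ A)) : D'.T₂ (F.obj A) ⟶ D'.T.obj (D'.T₂ (F.obj A)) :=
  (φ.b₂ A).hom ≫ F.map k ≫ (φ.b (D.T₂ A)).inv ≫ D'.T.map (φ.b₂ A).inv

theorem conj_T {A : C} (k : D.T₂ A ⟶ D.T.obj (D.T₂ A)) {f : D.T₂ A ⟶ D.T.obj A}
    {f' : D'.T₂ (F.obj A) ⟶ D'.T.obj (F.obj A)}
    (hf : F.map f = (φ.b₂ A).inv ≫ f' ≫ (φ.b A).hom) :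
    φ.conj k ≫ D'.T.map f' = (φ.b₂ A).hom ≫ F.map (k ≫ D.T.map f) ≫
      (φ.b (D.T.obj A)).inv ≫ D'.T.map (φ.b A).inv := by
  have hf' : f' = (φ.b₂ A).hom ≫ F.map f ≫ (φ.b A).inv := by simp [hf]
  rw [F.map_comp, φ.map_T f, hf', conj]
  simp only [assoc, Iso.hom_inv_id_assoc, D'.T.map_comp]
  rw [← D'.T.map_comp_assoc (φ.b₂ A).inv, Iso.inv_hom_id, D'.T.map_id, id_comp]

theorem conj_fst {A : C} {k : D.T₂ A ⟶ D.T.obj (D.T₂ A)}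
    (hk : k ≫ D.T.map (D.π₁ A) = D.π₁ A ≫ D.l A) :
    φ.conj k ≫ D'.T.map (D'.π₁ (F.obj A)) = D'.π₁ (F.obj A) ≫ D'.l (F.obj A) := by
  rw [φ.conj_T k (φ.map_π₁ A), hk, F.map_comp, φ.map_π₁, φ.map_l]
  simp only [assoc, Iso.hom_inv_id_assoc]
  rw [← D'.T.map_comp, Iso.hom_inv_id, D'.T.map_id, comp_id]

theorem conj_snd (h' : D'.IsTangent) {A : C} {k : D.T₂ A ⟶ D.T.obj (D.T₂ A)}
    (hk : k ≫ D.T.map (D.π₂ A) = D.π₂ A ≫ D.z (D.T.obj A)) :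
    φ.conj k ≫ D'.T.map (D'.π₂ (F.obj A)) = D'.π₂ (F.obj A) ≫ D'.z (D'.T.obj (F.obj A)) := by
  rw [φ.conj_T k (φ.map_π₂ A), hk, F.map_comp, φ.map_π₂, φ.map_z]
  have e := h'.z_nat (φ.b A).hom
  simp only [assoc, Iso.hom_inv_id_assoc, Iso.hom_inv_id_assoc]
  rw [reassoc_of% e, ← D'.T.map_comp, Iso.hom_inv_id, D'.T.map_id, comp_id]

theorem conj_s {A : C} (k : D.T₂ A ⟶ D.T.obj (D.T₂ A)) :
    φ.conj k ≫ D'.T.map (D'.s (F.obj A)) = (φ.b₂ A).hom ≫ F.map (k ≫ D.T.map (D.s A)) ≫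
      (φ.b (D.T.obj A)).inv ≫ D'.T.map (φ.b A).inv :=
  φ.conj_T k (φ.map_s A)

/-- The isomorphism `T' T' F ≅ F T T`. -/
def bb (A : C) : D'.T.obj (D'.T.obj (F.obj A)) ≅ F.obj (D.T.obj (D.T.obj A)) :=
  D'.T.mapIso (φ.b A) ≪≫ φ.b (D.T.obj A)

theorem bb_hom (A : C) : (φ.bb A).hom = D'.T.map (φ.b A).hom ≫ (φ.b (D.T.obj A)).hom := rfl

theorem isFibrePower_iff {A : C} {n : ℕ} {P : C} (pr : Fin (n + 1) → (P ⟶ D.T.obj A)) :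
    IsFibrePower (D'.p (F.obj A)) (fun i => F.map (pr i) ≫ (φ.b A).inv) ↔
      IsFibrePower (F.map (D.p A)) (fun i => F.map (pr i)) :=
  ⟨fun h => h.of_iso (φ.b A) (Iso.refl _) (Iso.refl _) (by simp [φ.p]) (by simp),
    fun h => h.of_iso (φ.b A).symm (Iso.refl _) (Iso.refl _) (by simp [φ.map_p]) (by simp)⟩

theorem vertical_conj {E : Type u''} [Category.{v''} E] (H : C' ⥤ E) {A : C}
    (k : D.T₂ A ⟶ D.T.obj (D.T₂ A)) : IsPullback (H.map (φ.conj k ≫ D'.T.map (D'.s (F.obj A))))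
      (H.map (D'.π₁ (F.obj A) ≫ D'.p (F.obj A))) (H.map (D'.T.map (D'.p (F.obj A))))
      (H.map (D'.z (F.obj A))) ↔
    IsPullback (H.map (F.map (k ≫ D.T.map (D.s A)))) (H.map (F.map (D.π₁ A ≫ D.p A)))
      (H.map (F.map (D.T.map (D.p A)))) (H.map (F.map (D.z A))) := by
  have e1 : (φ.conj k ≫ D'.T.map (D'.s (F.obj A))) ≫ (φ.bb A).hom =
      (φ.b₂ A).hom ≫ F.map (k ≫ D.T.map (D.s A)) := by
    rw [conj_s, bb_hom]
    simp [← D'.T.map_comp_assoc]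
  have e2 : (D'.π₁ (F.obj A) ≫ D'.p (F.obj A)) ≫ 𝟙 _ =
      (φ.b₂ A).hom ≫ F.map (D.π₁ A ≫ D.p A) := by
    rw [F.map_comp, φ.map_π₁, φ.map_p]
    simp
  have e3 : D'.T.map (D'.p (F.obj A)) ≫ (φ.b A).hom =
      (φ.bb A).hom ≫ F.map (D.T.map (D.p A)) := by
    rw [bb_hom, assoc, ← φ.natural, ← D'.T.map_comp_assoc, φ.p]
  have e4 : D'.z (F.obj A) ≫ (φ.b A).hom = 𝟙 _ ≫ F.map (D.z A) := by
    rw [φ.z, id_comp]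
  constructor
  · refine fun h => h.of_iso (H.mapIso (φ.b₂ A)) (H.mapIso (φ.bb A)) (Iso.refl _)
      (H.mapIso (φ.b A)) ?_ ?_ ?_ ?_
    · rw [Functor.mapIso_hom, Functor.mapIso_hom, ← H.map_comp, ← H.map_comp, e1]
    · rw [Functor.mapIso_hom, ← H.map_comp, ← e2, Iso.refl_hom, H.map_comp (_ ≫ _) (𝟙 _), H.map_id]
    · rw [Functor.mapIso_hom, Functor.mapIso_hom, ← H.map_comp, ← H.map_comp, e3]
    · rw [Functor.mapIso_hom, ← H.map_comp, e4, Iso.refl_hom, H.map_comp, H.map_id]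
  · refine fun h => h.of_iso (H.mapIso (φ.b₂ A).symm) (H.mapIso (φ.bb A).symm) (Iso.refl _)
      (H.mapIso (φ.b A).symm) ?_ ?_ ?_ ?_
    · rw [Functor.mapIso_hom, Functor.mapIso_hom, ← H.map_comp, ← H.map_comp]
      refine congrArg H.map ?_
      rw [Iso.symm_hom, Iso.symm_hom, Iso.comp_inv_eq, assoc, e1, Iso.inv_hom_id_assoc]
    · rw [Functor.mapIso_hom, ← H.map_comp, Iso.refl_hom, ← H.map_id, ← H.map_comp, Iso.symm_hom]
      refine congrArg H.map ?_
      rw [comp_id, Iso.eq_inv_comp, ← e2, comp_id]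
    · rw [Functor.mapIso_hom, Functor.mapIso_hom, ← H.map_comp, ← H.map_comp]
      refine congrArg H.map ?_
      rw [Iso.symm_hom, Iso.symm_hom, Iso.comp_inv_eq, assoc, e3, Iso.inv_hom_id_assoc]
    · rw [Functor.mapIso_hom, ← H.map_comp, Iso.refl_hom, ← H.map_id, ← H.map_comp, Iso.symm_hom]
      refine congrArg H.map ?_
      rw [id_comp, Iso.comp_inv_eq, e4, id_comp]

end StrongMap

theorem BundleData.IsAdditive.of_iso {B E E₂ E' E₂' : C} {q : E ⟶ B} {zero : B ⟶ E}
    {fst snd sum : E₂ ⟶ E} (h : BundleData.IsAdditive ⟨B, E, E₂, q, zero, fst, snd, sum⟩)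
    {q' : E' ⟶ B} {zero' : B ⟶ E'} {fst' snd' sum' : E₂' ⟶ E'} (e : E ≅ E') (e₂ : E₂ ≅ E₂')
    (hq : q' = e.inv ≫ q) (hz : zero' = zero ≫ e.hom) (hf : fst' = e₂.inv ≫ fst ≫ e.hom)
    (hs : snd' = e₂.inv ≫ snd ≫ e.hom) (hsum : sum' = e₂.inv ≫ sum ≫ e.hom) :
    BundleData.IsAdditive ⟨B, E', E₂', q', zero', fst', snd', sum'⟩ := by
  subst hq hz hf hs hsum
  obtain ⟨hpow, hpb, hzero, hsum, hza, hcomm, hassoc⟩ := h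
  dsimp only at hpow hpb hzero hsum hza hcomm hassoc
  refine ⟨fun n => ?_, ?_, ?_, ?_, fun k h1 h2 => ?_, fun k h1 h2 => ?_, ?_⟩
  · obtain ⟨P, pr, hpr⟩ := hpow n
    exact ⟨P, fun i => pr i ≫ e.hom, hpr.of_iso e (Iso.refl _) (Iso.refl _) (by simp) (by simp)⟩
  · exact hpb.of_iso e₂ e e (Iso.refl _) (by simp) (by simp) (by simp) (by simp)
  · simp [hzero]
  · simp [hsum]
  · dsimp only at h1 h2 k ⊢
    have := hza (e.hom ≫ k ≫ e₂.inv)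
      (by rw [← cancel_mono e.hom, Category.assoc, Category.assoc, Category.assoc, h1]; simp)
      (by rw [← cancel_mono e.hom, Category.assoc, Category.assoc, Category.assoc, h2]; simp)
    rw [← cancel_epi e.hom, ← cancel_mono e.inv]
    simpa using this
  · dsimp only at h1 h2 k ⊢
    have := hcomm (e₂.hom ≫ k ≫ e₂.inv)
      (by rw [← cancel_mono e.hom, Category.assoc, Category.assoc, Category.assoc, h1]; simp)
      (by rw [← cancel_mono e.hom, Category.assoc, Category.assoc, Category.assoc, h2]; simp)
    rw [← cancel_epi e₂.hom, ← cancel_mono e.inv]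
    simpa using this
  · dsimp only
    intro Y xy yz xy_z x_yz h1 h2 h3 h4 h5
    have := hassoc (xy ≫ e₂.inv) (yz ≫ e₂.inv) (xy_z ≫ e₂.inv) (x_yz ≫ e₂.inv)
      (by rw [← cancel_mono e.hom]; simpa using h1) (by rw [← cancel_mono e.hom]; simpa using h2)
      (by rw [← cancel_mono e.hom]; simpa using h3) (by rw [← cancel_mono e.hom]; simpa using h4)
      (by rw [← cancel_mono e.hom]; simpa using h5)
    rw [← cancel_mono e.inv]
    simpa using this

theorem BundleData.IsAdditive.of_jointlyReflects {ι : Type w} {C' : ι → Type u'}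
    [∀ i, Category.{v'} (C' i)] {F : ∀ i, C ⥤ C' i} (hF : JointlyReflects F) {B E E₂ : C}
    {q : E ⟶ B} {zero : B ⟶ E} {fst snd sum : E₂ ⟶ E}
    (h : ∀ i, BundleData.IsAdditive ⟨(F i).obj B, (F i).obj E, (F i).obj E₂, (F i).map q,
      (F i).map zero, (F i).map fst, (F i).map snd, (F i).map sum⟩)
    (hpow : ∀ n : ℕ, ∃ (P : C) (pr : Fin (n + 1) → (P ⟶ E)), IsFibrePower q pr) :
    BundleData.IsAdditive ⟨B, E, E₂, q, zero, fst, snd, sum⟩ := by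
  refine ⟨hpow, hF.square fun i => (h i).isPullback, hF.faithful fun i => ?_, hF.faithful fun i =>
    ?_, fun k h1 h2 => hF.faithful fun i => ?_, fun k h1 h2 => hF.faithful fun i => ?_, ?_⟩
  · simpa using (h i).zero_q
  · simpa using (h i).sum_q
  · dsimp only at h1 h2 k ⊢
    rw [(F i).map_comp, (F i).map_id]
    exact (h i).zero_add ((F i).map k) (by simp only [← (F i).map_comp, h1])
      (by simp only [← (F i).map_comp, h2, (F i).map_id])
  · dsimp only at h1 h2 k ⊢
    rw [(F i).map_comp]
    exact (h i).comm ((F i).map k) (by simp only [← (F i).map_comp, h1])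
      (by simp only [← (F i).map_comp, h2])
  · dsimp only
    intro Y xy yz xy_z x_yz h1 h2 h3 h4 h5
    refine hF.faithful fun i => ?_
    rw [(F i).map_comp, (F i).map_comp]
    exact (h i).assoc ((F i).map xy) ((F i).map yz) ((F i).map xy_z) ((F i).map x_yz)
      (by simp only [← (F i).map_comp, h1]) (by simp only [← (F i).map_comp, h2])
      (by simp only [← (F i).map_comp, h3]) (by simp only [← (F i).map_comp, h4])
      (by simp only [← (F i).map_comp, h5])

end StrongMaps

section Reflection

variable {C : Type u} [Category.{v} C] {C' : Type u'} [Category.{v'} C']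

namespace StrongMap

variable {D : TangentData C} {D' : TangentData C'} {F : C ⥤ C'} (φ : StrongMap D D' F)
  (h' : D'.IsTangent)

include φ h'

theorem map_isPullback (A : C) : IsPullback (F.map (D.π₁ A)) (F.map (D.π₂ A)) (F.map (D.p A))
    (F.map (D.p A)) :=
  (h'.pb (F.obj A)).of_iso (φ.b₂ A) (φ.b A) (φ.b A) (Iso.refl _) (φ.π₁ A).symm (φ.π₂ A).symm
    (by simp [φ.p]) (by simp [φ.p])

theorem map_p_nat {A B : C} (f : A ⟶ B) :
    F.map (D.T.map f ≫ D.p B) = F.map (D.p A ≫ f) := by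
  simp [φ.map_T, φ.map_p, h'.p_nat]

theorem map_z_nat {A B : C} (f : A ⟶ B) : F.map (f ≫ D.z B) = F.map (D.z A ≫ D.T.map f) := by
  simp [φ.map_T, φ.map_z, reassoc_of% h'.z_nat]

theorem map_s_nat {A B : C} (f : A ⟶ B) (f₂ : D.T₂ A ⟶ D.T₂ B)
    (h1 : f₂ ≫ D.π₁ B = D.π₁ A ≫ D.T.map f) (h2 : f₂ ≫ D.π₂ B = D.π₂ A ≫ D.T.map f) :
    F.map (D.s A ≫ D.T.map f) = F.map (f₂ ≫ D.s B) := by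
  have := h'.s_nat (F.map f) ((φ.b₂ A).hom ≫ F.map f₂ ≫ (φ.b₂ B).inv)
    (by
      have e := congrArg F.map h1
      simp only [F.map_comp, φ.map_T, φ.map_π₁, assoc, Iso.hom_inv_id_assoc] at e
      rw [← cancel_mono (φ.b B).hom]
      simp [e])
    (by
      have e := congrArg F.map h2
      simp only [F.map_comp, φ.map_T, φ.map_π₂, assoc, Iso.hom_inv_id_assoc] at e
      rw [← cancel_mono (φ.b B).hom]
      simp [e])
  simp [φ.map_T, φ.map_s, reassoc_of% this]

theorem map_l_nat {A B : C} (f : A ⟶ B) :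
    F.map (D.T.map f ≫ D.l B) = F.map (D.l A ≫ D.T.map (D.T.map f)) := by
  simp [φ.map_T, φ.map_l, reassoc_of% h'.l_nat (F.map f)]

theorem map_c_nat {A B : C} (f : A ⟶ B) : F.map (D.T.map (D.T.map f) ≫ D.c B) =
    F.map (D.c A ≫ D.T.map (D.T.map f)) := by
  simp [φ.map_T, φ.map_c, reassoc_of% h'.c_nat (F.map f)]

theorem map_l_additive (A : C) : F.map (D.l A ≫ D.T.map (D.p A)) = F.map (D.p A ≫ D.z A) ∧
    F.map (D.z A ≫ D.l A) = F.map (D.z A ≫ D.T.map (D.z A)) ∧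
    ∀ g₂ : D.T₂ A ⟶ D.T.obj (D.T₂ A), g₂ ≫ D.T.map (D.π₁ A) = D.π₁ A ≫ D.l A →
      g₂ ≫ D.T.map (D.π₂ A) = D.π₂ A ≫ D.l A →
      F.map (D.s A ≫ D.l A) = F.map (g₂ ≫ D.T.map (D.s A)) := by
  have q := (h'.l_additive (F.obj A)).q
  have ze := (h'.l_additive (F.obj A)).zero
  have su := (h'.l_additive (F.obj A)).sum
  dsimp only [TangentData.bundle, BundleData.map] at q ze su
  refine ⟨?_, ?_, fun g₂ h1 h2 => ?_⟩
  · simp [φ.map_T, φ.map_l, φ.map_p, φ.map_z, reassoc_of% q]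
  · simp [φ.map_T, φ.map_l, φ.map_z, reassoc_of% ze]
  · have e := su (φ.conj g₂) (by rw [φ.conj_T g₂ (φ.map_π₁ A), h1]; simp [φ.map_π₁, φ.map_l])
      (by rw [φ.conj_T g₂ (φ.map_π₂ A), h2]; simp [φ.map_π₂, φ.map_l])
    rw [φ.conj_T g₂ (φ.map_s A)] at e
    rw [F.map_comp, φ.map_s, φ.map_l]
    simp only [assoc, Iso.hom_inv_id_assoc, reassoc_of% e]
    simp

theorem map_c_additive (A : C) : F.map (D.c A ≫ D.p (D.T.obj A)) = F.map (D.T.map (D.p A) ≫ 𝟙 _) ∧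
    F.map (D.T.map (D.z A) ≫ D.c A) = F.map (𝟙 _ ≫ D.z (D.T.obj A)) ∧
    ∀ g₂ : D.T.obj (D.T₂ A) ⟶ D.T₂ (D.T.obj A), g₂ ≫ D.π₁ (D.T.obj A) = D.T.map (D.π₁ A) ≫ D.c A →
      g₂ ≫ D.π₂ (D.T.obj A) = D.T.map (D.π₂ A) ≫ D.c A →
      F.map (D.T.map (D.s A) ≫ D.c A) = F.map (g₂ ≫ D.s (D.T.obj A)) := by
  have q := (h'.c_additive (F.obj A)).q
  have ze := (h'.c_additive (F.obj A)).zero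
  have su := (h'.c_additive (F.obj A)).sum
  dsimp only [TangentData.bundle, BundleData.map] at q ze su
  simp only [id_comp, comp_id] at q ze
  refine ⟨?_, ?_, fun g₂ h1 h2 => ?_⟩
  · simp [φ.map_T, φ.map_c, φ.map_p, h'.p_nat, reassoc_of% q]
  · simp [φ.map_T, φ.map_c, φ.map_z, reassoc_of% ze, ← reassoc_of% h'.z_nat (φ.b A).hom]
  · have pbA := h'.pb (F.obj (D.T.obj A))
    have pbT := h'.pb (D'.T.obj (F.obj A))
    let m : D'.T₂ (F.obj (D.T.obj A)) ⟶ D'.T₂ (D'.T.obj (F.obj A)) :=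
      pbT.lift (D'.π₁ _ ≫ D'.T.map (φ.b A).inv) (D'.π₂ _ ≫ D'.T.map (φ.b A).inv)
        (by rw [assoc, assoc, h'.p_nat, reassoc_of% pbA.w])
    have m₁ : m ≫ D'.π₁ _ = D'.π₁ _ ≫ D'.T.map (φ.b A).inv := pbT.lift_fst _ _ _
    have m₂ : m ≫ D'.π₂ _ = D'.π₂ _ ≫ D'.T.map (φ.b A).inv := pbT.lift_snd _ _ _
    have ms : D'.s _ ≫ D'.T.map (φ.b A).inv = m ≫ D'.s _ := h'.s_nat _ m m₁ m₂
    have w1 := congrArg F.map h1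
    have w2 := congrArg F.map h2
    simp only [F.map_comp, φ.map_T, φ.map_π₁, φ.map_π₂, φ.map_c, assoc,
      Iso.hom_inv_id_assoc, D'.T.map_comp, Iso.map_hom_inv_id_assoc] at w1 w2
    have w1' := w1 =≫ ((φ.b (D.T.obj A)).inv ≫ D'.T.map (φ.b A).inv)
    have w2' := w2 =≫ ((φ.b (D.T.obj A)).inv ≫ D'.T.map (φ.b A).inv)
    simp only [assoc, Iso.hom_inv_id_assoc, Iso.map_hom_inv_id, comp_id] at w1' w2'
    have e := su (D'.T.map (φ.b₂ A).hom ≫ (φ.b (D.T₂ A)).hom ≫ F.map g₂ ≫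
        (φ.b₂ (D.T.obj A)).inv ≫ m)
      (by simp [m₁, w1']) (by simp [m₂, w2'])
    simp only [assoc, ← ms] at e
    simp only [F.map_comp, φ.map_T, φ.map_s, φ.map_c, assoc, D'.T.map_comp,
      Iso.hom_inv_id_assoc, Iso.map_hom_inv_id_assoc, reassoc_of% e]
    simp

theorem map_l_coassoc (A : C) :
    F.map (D.l A ≫ D.T.map (D.l A)) = F.map (D.l A ≫ D.l (D.T.obj A)) := by
  simp [φ.map_T, φ.map_l, reassoc_of% h'.l_coassoc (F.obj A), reassoc_of% h'.l_nat (φ.b A).hom]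

theorem map_c_c (A : C) : F.map (D.c A ≫ D.c A) = F.map (𝟙 _) := by
  simp [φ.map_c, reassoc_of% h'.c_c (F.obj A)]

theorem map_c_braid (A : C) : F.map (D.T.map (D.c A) ≫ D.c (D.T.obj A) ≫ D.T.map (D.c A)) =
    F.map (D.c (D.T.obj A) ≫ D.T.map (D.c A) ≫ D.c (D.T.obj A)) := by
  have n1 := h'.c_nat (φ.b A).hom
  have n2 := h'.c_nat (φ.b A).inv
  have n3 : D'.T.map (D'.T.map (φ.b A).hom) ≫ D'.T.map (D'.T.map (φ.b A).inv) = 𝟙 _ := by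
    rw [← D'.T.map_comp, Iso.map_hom_inv_id, D'.T.map_id]
  simp only [F.map_comp, φ.map_T, φ.map_c, assoc, Iso.hom_inv_id_assoc, D'.T.map_comp,
    Iso.map_hom_inv_id_assoc, reassoc_of% n1, reassoc_of% n3, ← reassoc_of% n2,
    reassoc_of% h'.c_braid (F.obj A)]

theorem map_l_c (A : C) : F.map (D.l A ≫ D.c A) = F.map (D.l A) := by
  simp [φ.map_l, φ.map_c, reassoc_of% h'.l_c (F.obj A)]

theorem map_l_c_c (A : C) : F.map (D.l (D.T.obj A) ≫ D.T.map (D.c A) ≫ D.c (D.T.obj A)) =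
    F.map (D.c A ≫ D.T.map (D.l A)) := by
  have n1 := h'.c_nat (φ.b A).hom
  have n2 := h'.l_nat (φ.b A).inv
  simp only [F.map_comp, φ.map_T, φ.map_c, φ.map_l, assoc, Iso.hom_inv_id_assoc, D'.T.map_comp,
    Iso.map_hom_inv_id_assoc, reassoc_of% n1, ← reassoc_of% n2, reassoc_of% h'.l_c_c (F.obj A)]

end StrongMap

theorem isTangent_of_jointlyReflects {ι : Type w} {C' : ι → Type u'}
    [∀ i, Category.{v'} (C' i)] {F : ∀ i, C ⥤ C' i} (hF : JointlyReflects F) {D : TangentData C}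
    {D' : ∀ i, TangentData (C' i)} (φ : ∀ i, StrongMap D (D' i) (F i))
    (h' : ∀ i, (D' i).IsTangent)
    (hpow : ∀ (A : C) (n : ℕ), ∃ (P : C) (pr : Fin (n + 1) → (P ⟶ D.T.obj A)),
      ∀ i, IsFibrePower ((F i).map (D.p A)) (fun j => (F i).map (pr j))) : D.IsTangent where
  p_nat f := hF.faithful fun i => (φ i).map_p_nat (h' i) f
  z_nat f := hF.faithful fun i => (φ i).map_z_nat (h' i) f
  s_nat f f₂ h1 h2 := hF.faithful fun i => (φ i).map_s_nat (h' i) f f₂ h1 h2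
  l_nat f := hF.faithful fun i => (φ i).map_l_nat (h' i) f
  c_nat f := hF.faithful fun i => (φ i).map_c_nat (h' i) f
  additive A := BundleData.IsAdditive.of_jointlyReflects hF (fun i =>
      BundleData.IsAdditive.of_iso ((h' i).additive ((F i).obj A)) ((φ i).b A) ((φ i).b₂ A)
        ((φ i).map_p A) ((φ i).map_z A) ((φ i).map_π₁ A) ((φ i).map_π₂ A) ((φ i).map_s A))
    fun n => by
      obtain ⟨P, pr, h⟩ := hpow A n
      exact ⟨P, pr, hF.power h⟩
  preserves m A n P pr hpr := hF.power fun i => by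
    obtain ⟨P₀, pr₀, h₀⟩ := hpow A n
    have h1 := (h' i).preserves m _ _
      (((φ i).isFibrePower_iff pr).2 (hpr.map_of_map (hF.power h₀) (F i) (h₀ i)))
    have h2 : IsFibrePower (((F i) ⋙ (D' i).iter m).map (D.p A))
        (fun j => ((F i) ⋙ (D' i).iter m).map (pr j)) :=
      h1.of_iso (((D' i).iter m).mapIso ((φ i).b A)) (Iso.refl _) (Iso.refl _)
        (by simp only [Functor.mapIso_hom, Iso.refl_hom, comp_id, Functor.comp_map]
            rw [← Functor.map_comp, (φ i).p])
        (fun j => by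
          simp only [Functor.mapIso_hom, Iso.refl_hom, id_comp, Functor.comp_map]
          rw [← Functor.map_comp, assoc, Iso.inv_hom_id, comp_id])
    exact IsFibrePower.congr_functor (q := D.p A) (pr := pr) ((φ i).iterIso m) h2
  l_additive A := ⟨hF.faithful fun i => ((φ i).map_l_additive (h' i) A).1,
    hF.faithful fun i => ((φ i).map_l_additive (h' i) A).2.1,
    fun g₂ h1 h2 => hF.faithful fun i => ((φ i).map_l_additive (h' i) A).2.2 g₂ h1 h2⟩
  c_additive A := ⟨hF.faithful fun i => ((φ i).map_c_additive (h' i) A).1,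
    hF.faithful fun i => ((φ i).map_c_additive (h' i) A).2.1,
    fun g₂ h1 h2 => hF.faithful fun i => ((φ i).map_c_additive (h' i) A).2.2 g₂ h1 h2⟩
  l_coassoc A := hF.faithful fun i => (φ i).map_l_coassoc (h' i) A
  c_c A := hF.faithful fun i => (φ i).map_c_c (h' i) A
  c_braid A := hF.faithful fun i => (φ i).map_c_braid (h' i) A
  l_c A := hF.faithful fun i => (φ i).map_l_c (h' i) A
  l_c_c A := hF.faithful fun i => (φ i).map_l_c_c (h' i) A
  universal A k h1 h2 := hF.square fun i => ((φ i).vertical_conj (𝟭 _) k).1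
    ((h' i).universal _ _ ((φ i).conj_fst h1) ((φ i).conj_snd (h' i) h2))

end Reflection

section Morphisms

variable {C : Type u} [Category.{v} C] {C' : Type u'} [Category.{v'} C']
  {E : Type u''} [Category.{v''} E] {E' : Type t} [Category.{t'} E']

theorem map_square {F : C ⥤ E} {G : C ⥤ C'} {G' : E ⥤ E'} {F' : C' ⥤ E'}
    (γ : ∀ A, F'.obj (G.obj A) ≅ G'.obj (F.obj A))
    (hγ : ∀ {A B : C} (f : A ⟶ B), F'.map (G.map f) ≫ (γ B).hom = (γ A).hom ≫ G'.map (F.map f))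
    {A B : C} (f : A ⟶ B) :
    G'.map (F.map f) = (γ A).inv ≫ F'.map (G.map f) ≫ (γ B).hom := by
  rw [hγ, Iso.inv_hom_id_assoc]

section Lax

variable {D : TangentData C} {D' : TangentData C'} {K : TangentData E} {K' : TangentData E'}
  {F : C ⥤ E} {G : C ⥤ C'} {G' : E ⥤ E'} {F' : C' ⥤ E'} (φ : StrongMap D D' G)
  (ψ : StrongMap K K' G') (hK : K'.IsTangent)
  (γ : ∀ A, F'.obj (G.obj A) ≅ G'.obj (F.obj A))
  (hγ : ∀ {A B : C} (f : A ⟶ B), F'.map (G.map f) ≫ (γ B).hom = (γ A).hom ≫ G'.map (F.map f))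

theorem TangentData.IsTangent.exists_T₂_map (hK : K'.IsTangent) {A B : E'} (f : A ⟶ B) :
    ∃ m : K'.T₂ A ⟶ K'.T₂ B, m ≫ K'.π₁ B = K'.π₁ A ≫ K'.T.map f ∧
      m ≫ K'.π₂ B = K'.π₂ A ≫ K'.T.map f :=
  ⟨(hK.pb B).lift (K'.π₁ A ≫ K'.T.map f) (K'.π₂ A ≫ K'.T.map f)
    (by rw [assoc, assoc, hK.p_nat, reassoc_of% (hK.pb A).w]),
    (hK.pb B).lift_fst _ _ _, (hK.pb B).lift_snd _ _ _⟩

include ψ hK hγ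

theorem map_isLaxMorphism {α : Law false D K F} {α' : Law false D' K' F'}
    (h : IsLaxMorphism D' K' F' α')
    (hα : ∀ A, G'.map (α A) = (γ (D.T.obj A)).inv ≫ F'.map (φ.b A).inv ≫ α' (G.obj A) ≫
      K'.T.map (γ A).hom ≫ (ψ.b (F.obj A)).hom) : (∀ {A B : C} (f : A ⟶ B),
      G'.map (F.map (D.T.map f) ≫ α B) = G'.map (α A ≫ K.T.map (F.map f))) ∧
    (∀ A, G'.map (α A ≫ K.p (F.obj A)) = G'.map (F.map (D.p A) ≫ 𝟙 _)) ∧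
    (∀ A, G'.map (F.map (D.z A) ≫ α A) = G'.map (𝟙 _ ≫ K.z (F.obj A))) ∧
    (∀ A (g₂ : F.obj (D.T₂ A) ⟶ K.T₂ (F.obj A)), g₂ ≫ K.π₁ _ = F.map (D.π₁ A) ≫ α A →
      g₂ ≫ K.π₂ _ = F.map (D.π₂ A) ≫ α A →
      G'.map (F.map (D.s A) ≫ α A) = G'.map (g₂ ≫ K.s (F.obj A))) ∧
    (∀ A, G'.map (F.map (D.l A) ≫ α (D.T.obj A) ≫ K.T.map (α A)) = G'.map (α A ≫ K.l (F.obj A))) ∧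
    (∀ A, G'.map (F.map (D.c A) ≫ α (D.T.obj A) ≫ K.T.map (α A)) =
      G'.map (α (D.T.obj A) ≫ K.T.map (α A) ≫ K.c (F.obj A))) := by
  have sq := fun {A B : C} (f : A ⟶ B) => map_square γ hγ f
  have nat := fun {A B : C'} (f : A ⟶ B) => h.natural f
  have q := fun A => (h.additive A).q
  have ze := fun A => (h.additive A).zero
  have su := fun A => (h.additive A).sum
  dsimp only [TangentData.bundle, BundleData.map] at q ze su
  simp only [comp_id, id_comp] at q ze
  refine ⟨fun {A B} f => ?_, fun A => ?_, fun A => ?_, fun A g₂ h1 h2 => ?_, fun A => ?_,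
    fun A => ?_⟩
  · have e : K'.T.map (F'.map (G.map f)) ≫ K'.T.map (γ B).hom =
        K'.T.map (γ A).hom ≫ K'.T.map (G'.map (F.map f)) := by
      rw [← K'.T.map_comp, hγ, K'.T.map_comp]
    have e2 : F'.map (D'.T.map (G.map f)) ≫ α' (G.obj B) =
        α' (G.obj A) ≫ K'.T.map (F'.map (G.map f)) := nat (G.map f)
    have e3 : F'.map (G.map (D.T.map f)) ≫ F'.map (φ.b B).inv =
        F'.map (φ.b A).inv ≫ F'.map (D'.T.map (G.map f)) := by
      rw [← F'.map_comp, φ.map_T]; simp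
    simp only [Functor.map_comp, sq, hα, assoc, Iso.hom_inv_id_assoc, ψ.map_T,
      reassoc_of% e3, reassoc_of% e2, Iso.map_hom_inv_id_assoc]
  · simp [sq, hα, ψ.map_p, hK.p_nat, reassoc_of% q, φ.map_p]
  · have e : K'.z _ ≫ K'.T.map (γ A).hom = (γ A).hom ≫ K'.z _ := (hK.z_nat _).symm
    simp [sq, hα, φ.map_z, ψ.map_z, reassoc_of% ze, reassoc_of% e]
  · obtain ⟨m, m₁, m₂⟩ := hK.exists_T₂_map (γ A).inv
    have ms := hK.s_nat _ m m₁ m₂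
    have w1 := congrArg G'.map h1
    have w2 := congrArg G'.map h2
    simp only [G'.map_comp, ψ.map_π₁, ψ.map_π₂, hα, sq, φ.map_π₁, φ.map_π₂, F'.map_comp,
      assoc, Iso.hom_inv_id_assoc, Iso.map_hom_inv_id_assoc] at w1 w2
    have w1' := w1 =≫ ((ψ.b _).inv ≫ K'.T.map (γ A).inv)
    have w2' := w2 =≫ ((ψ.b _).inv ≫ K'.T.map (γ A).inv)
    simp only [assoc, Iso.hom_inv_id_assoc, Iso.map_hom_inv_id, comp_id] at w1' w2'
    have e := su (G.obj A) (F'.map (φ.b₂ A).hom ≫ (γ (D.T₂ A)).hom ≫ G'.map g₂ ≫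
        (ψ.b₂ _).inv ≫ m)
      (by simp [m₁, w1']) (by simp [m₂, w2'])
    simp only [assoc, ← ms] at e
    simp only [G'.map_comp, sq, hα, φ.map_s, ψ.map_s, F'.map_comp, assoc,
      Iso.hom_inv_id_assoc, Iso.map_hom_inv_id_assoc, reassoc_of% e]
    simp
  · have e1 := nat (φ.b A).hom
    have e2 := h.lift (G.obj A)
    have e3 := hK.l_nat (γ A).hom
    simp only [Functor.map_comp, sq, hα, φ.map_l, ψ.map_l, ψ.map_T, assoc,
      Iso.hom_inv_id_assoc, Iso.map_hom_inv_id_assoc, reassoc_of% e1]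
    have e4 : K'.T.map (F'.map (φ.b A).hom) ≫ K'.T.map (F'.map (φ.b A).inv) = 𝟙 _ := by
      rw [← K'.T.map_comp, Iso.map_hom_inv_id, K'.T.map_id]
    simp only [reassoc_of% e4, reassoc_of% e2, reassoc_of% e3]
  · have e1 := nat (φ.b A).hom
    have e1' := nat (φ.b A).inv
    have e2 := h.flip (G.obj A)
    have e3 := hK.c_nat (γ A).hom
    have e4 : K'.T.map (F'.map (φ.b A).hom) ≫ K'.T.map (F'.map (φ.b A).inv) = 𝟙 _ := by
      rw [← K'.T.map_comp, Iso.map_hom_inv_id, K'.T.map_id]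
    simp only [Functor.map_comp, sq, hα, φ.map_c, ψ.map_c, ψ.map_T, assoc,
      Iso.hom_inv_id_assoc, Iso.map_hom_inv_id_assoc, reassoc_of% e1, reassoc_of% e4]
    simp only [reassoc_of% e2, ← reassoc_of% e3, ← reassoc_of% e1']

theorem map_isColaxMorphism {β : Law true D K F} {β' : Law true D' K' F'}
    (h : IsColaxMorphism D' K' F' β')
    (hβ : ∀ A, G'.map (β A) = (ψ.b (F.obj A)).inv ≫ K'.T.map (γ A).inv ≫ β' (G.obj A) ≫
      F'.map (φ.b A).hom ≫ (γ (D.T.obj A)).hom) : (∀ {A B : C} (f : A ⟶ B),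
      G'.map (K.T.map (F.map f) ≫ β B) = G'.map (β A ≫ F.map (D.T.map f))) ∧
    (∀ A, G'.map (β A ≫ F.map (D.p A)) = G'.map (K.p (F.obj A) ≫ 𝟙 _)) ∧
    (∀ A, G'.map (K.z (F.obj A) ≫ β A) = G'.map (𝟙 _ ≫ F.map (D.z A))) ∧
    (∀ A (g₂ : K.T₂ (F.obj A) ⟶ F.obj (D.T₂ A)), g₂ ≫ F.map (D.π₁ A) = K.π₁ _ ≫ β A →
      g₂ ≫ F.map (D.π₂ A) = K.π₂ _ ≫ β A →
      G'.map (K.s (F.obj A) ≫ β A) = G'.map (g₂ ≫ F.map (D.s A))) ∧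
    (∀ A, G'.map (K.l (F.obj A) ≫ K.T.map (β A) ≫ β (D.T.obj A)) = G'.map (β A ≫ F.map (D.l A))) ∧
    (∀ A, G'.map (K.c (F.obj A) ≫ K.T.map (β A) ≫ β (D.T.obj A)) =
      G'.map (K.T.map (β A) ≫ β (D.T.obj A) ≫ F.map (D.c A))) := by
  have sq := fun {A B : C} (f : A ⟶ B) => map_square γ hγ f
  have nat := fun {A B : C'} (f : A ⟶ B) => h.natural f
  have q := fun A => (h.additive A).q
  have ze := fun A => (h.additive A).zero
  have su := fun A => (h.additive A).sum
  dsimp only [TangentData.bundle, BundleData.map] at q ze su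
  simp only [comp_id, id_comp] at q ze
  refine ⟨fun {A B} f => ?_, fun A => ?_, fun A => ?_, fun A g₂ h1 h2 => ?_, fun A => ?_,
    fun A => ?_⟩
  · have e2 : K'.T.map (F'.map (G.map f)) ≫ β' (G.obj B) =
        β' (G.obj A) ≫ F'.map (D'.T.map (G.map f)) := nat (G.map f)
    simp only [Functor.map_comp, sq, hβ, assoc, Iso.hom_inv_id_assoc, ψ.map_T, φ.map_T,
      reassoc_of% e2, Iso.map_hom_inv_id_assoc]
  · have e := hK.p_nat (γ A).inv
    simp [sq, hβ, ψ.map_p, reassoc_of% q, φ.map_p, reassoc_of% e]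
  · have e : K'.z _ ≫ K'.T.map (γ A).inv = (γ A).inv ≫ K'.z _ := (hK.z_nat _).symm
    simp [sq, hβ, φ.map_z, ψ.map_z, reassoc_of% ze, reassoc_of% e]
  · obtain ⟨m, m₁, m₂⟩ := hK.exists_T₂_map (γ A).hom
    obtain ⟨m', m₁', m₂'⟩ := hK.exists_T₂_map (γ A).inv
    have ms := hK.s_nat _ m m₁ m₂
    have mm : m' ≫ m = 𝟙 _ := (hK.pb _).hom_ext (by simp [m₁, reassoc_of% m₁'])
      (by simp [m₂, reassoc_of% m₂'])
    have w1 := congrArg G'.map h1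
    have w2 := congrArg G'.map h2
    simp only [G'.map_comp, ψ.map_π₁, ψ.map_π₂, hβ, sq, φ.map_π₁, φ.map_π₂, F'.map_comp,
      assoc, Iso.hom_inv_id_assoc] at w1 w2
    have w1' := w1 =≫ ((γ _).inv ≫ F'.map (φ.b A).inv)
    have w2' := w2 =≫ ((γ _).inv ≫ F'.map (φ.b A).inv)
    simp only [assoc, Iso.hom_inv_id_assoc, Iso.map_hom_inv_id, comp_id] at w1' w2'
    have e := su (G.obj A) (m ≫ (ψ.b₂ _).hom ≫ G'.map g₂ ≫ (γ (D.T₂ A)).inv ≫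
        F'.map (φ.b₂ A).inv)
      (by simp [reassoc_of% m₁, w1']) (by simp [reassoc_of% m₂, w2'])
    simp only [assoc] at e
    have ms' := hK.s_nat _ m' m₁' m₂'
    simp only [G'.map_comp, sq, hβ, φ.map_s, ψ.map_s, F'.map_comp, assoc, Iso.hom_inv_id_assoc,
      reassoc_of% e, reassoc_of% ms', reassoc_of% mm]
    simp
  · have e1 := nat (φ.b A).hom
    have e2 := h.lift (G.obj A)
    have e3 := hK.l_nat (γ A).inv
    simp only [Functor.map_comp, sq, hβ, φ.map_l, ψ.map_l, ψ.map_T, assoc, Iso.hom_inv_id_assoc,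
      Iso.map_hom_inv_id_assoc, reassoc_of% e1, ← reassoc_of% e3, reassoc_of% e2]
  · have e1 := nat (φ.b A).hom
    have e2 := h.flip (G.obj A)
    have e3 := hK.c_nat (γ A).inv
    have e4 : F'.map (D'.T.map (φ.b A).hom) ≫ F'.map (D'.T.map (φ.b A).inv) = 𝟙 _ := by
      rw [← F'.map_comp, Iso.map_hom_inv_id, F'.map_id]
    simp only [Functor.map_comp, sq, hβ, φ.map_c, ψ.map_c, ψ.map_T, assoc, Iso.hom_inv_id_assoc,
      Iso.map_hom_inv_id_assoc, reassoc_of% e1, ← reassoc_of% e3, reassoc_of% e2, reassoc_of% e4]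

end Lax

theorem isLaxMorphism_of_jointlyReflects {ι : Type w} {C' E' : ι → Type u'}
    [∀ i, Category.{v'} (C' i)] [∀ i, Category.{v'} (E' i)] {G : ∀ i, C ⥤ C' i}
    {G' : ∀ i, E ⥤ E' i} (hG' : JointlyReflects G') {D : TangentData C} {K : TangentData E}
    {D' : ∀ i, TangentData (C' i)} {K' : ∀ i, TangentData (E' i)}
    (φ : ∀ i, StrongMap D (D' i) (G i)) (ψ : ∀ i, StrongMap K (K' i) (G' i))
    (hK : ∀ i, (K' i).IsTangent) {F : C ⥤ E} {F' : ∀ i, C' i ⥤ E' i}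
    (γ : ∀ i A, (F' i).obj ((G i).obj A) ≅ (G' i).obj (F.obj A))
    (hγ : ∀ i {A B : C} (f : A ⟶ B),
      (F' i).map ((G i).map f) ≫ (γ i B).hom = (γ i A).hom ≫ (G' i).map (F.map f))
    {α : Law false D K F} {α' : ∀ i, Law false (D' i) (K' i) (F' i)}
    (h : ∀ i, IsLaxMorphism (D' i) (K' i) (F' i) (α' i))
    (hα : ∀ i A, (G' i).map (α A) = (γ i (D.T.obj A)).inv ≫ (F' i).map ((φ i).b A).inv ≫
      α' i ((G i).obj A) ≫ (K' i).T.map (γ i A).hom ≫ ((ψ i).b (F.obj A)).hom) :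
    IsLaxMorphism D K F α := by
  have H := fun i => map_isLaxMorphism (φ i) (ψ i) (hK i) (γ i) (hγ i) (h i) (hα i)
  exact
    { natural := fun f => hG'.faithful fun i => (H i).1 f
      additive := fun A => ⟨hG'.faithful fun i => (H i).2.1 A,
        hG'.faithful fun i => (H i).2.2.1 A,
        fun g₂ h1 h2 => hG'.faithful fun i => (H i).2.2.2.1 A g₂ h1 h2⟩
      lift := fun A => hG'.faithful fun i => (H i).2.2.2.2.1 A
      flip := fun A => hG'.faithful fun i => (H i).2.2.2.2.2 A }

theorem PreservesTangentLimits.of_jointlyReflects {ι : Type w} {C' E' : ι → Type u'}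
    [∀ i, Category.{v'} (C' i)] [∀ i, Category.{v'} (E' i)] {G : ∀ i, C ⥤ C' i}
    {G' : ∀ i, E ⥤ E' i} (hG' : JointlyReflects G') {D : TangentData C}
    {D' : ∀ i, TangentData (C' i)} (hD : ∀ i, (D' i).IsTangent)
    (φ : ∀ i, StrongMap D (D' i) (G i)) (hG : ∀ i, PreservesTangentLimits D (G i))
    {F : C ⥤ E} {F' : ∀ i, C' i ⥤ E' i}
    (γ : ∀ i A, (F' i).obj ((G i).obj A) ≅ (G' i).obj (F.obj A))
    (hγ : ∀ i {A B : C} (f : A ⟶ B),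
      (F' i).map ((G i).map f) ≫ (γ i B).hom = (γ i A).hom ≫ (G' i).map (F.map f))
    (h : ∀ i, PreservesTangentLimits (D' i) (F' i)) : PreservesTangentLimits D F where
  power A n P pr hpr := hG'.power fun i => by
    have h1 := (h i).power _ _ (((φ i).isFibrePower_iff pr).2 ((hG i).power A pr hpr))
    refine h1.of_iso ((F' i).mapIso ((φ i).b A) ≪≫ γ i _) (γ i A) (γ i P) ?_ fun j => ?_
    · rw [Iso.trans_hom, Functor.mapIso_hom, assoc, ← hγ, ← (φ i).p, Functor.map_comp_assoc]
    · rw [Iso.trans_hom, Functor.mapIso_hom, ← Functor.map_comp_assoc, assoc,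
        Iso.inv_hom_id, comp_id, hγ]
  vertical A k h1 h2 := hG'.square fun i =>
    (((φ i).vertical_conj (F' i) k).1 ((h i).vertical _ _ ((φ i).conj_fst h1) ((φ i).conj_snd (hD i)
      h2))).of_iso (γ i _) (γ i _) (γ i _) (γ i _) (hγ i _) (hγ i _) (hγ i _) (hγ i _)

theorem isColaxMorphism_of_jointlyReflects {ι : Type w} {C' E' : ι → Type u'}
    [∀ i, Category.{v'} (C' i)] [∀ i, Category.{v'} (E' i)] {G : ∀ i, C ⥤ C' i}
    {G' : ∀ i, E ⥤ E' i} (hG' : JointlyReflects G') {D : TangentData C} {K : TangentData E}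
    {D' : ∀ i, TangentData (C' i)} {K' : ∀ i, TangentData (E' i)}
    (hD : ∀ i, (D' i).IsTangent) (φ : ∀ i, StrongMap D (D' i) (G i))
    (hG : ∀ i, PreservesTangentLimits D (G i)) (ψ : ∀ i, StrongMap K (K' i) (G' i))
    (hK : ∀ i, (K' i).IsTangent) {F : C ⥤ E} {F' : ∀ i, C' i ⥤ E' i}
    (γ : ∀ i A, (F' i).obj ((G i).obj A) ≅ (G' i).obj (F.obj A))
    (hγ : ∀ i {A B : C} (f : A ⟶ B),
      (F' i).map ((G i).map f) ≫ (γ i B).hom = (γ i A).hom ≫ (G' i).map (F.map f))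
    {β : Law true D K F} {β' : ∀ i, Law true (D' i) (K' i) (F' i)}
    (h : ∀ i, IsColaxMorphism (D' i) (K' i) (F' i) (β' i))
    (hβ : ∀ i A, (G' i).map (β A) = ((ψ i).b (F.obj A)).inv ≫ (K' i).T.map (γ i A).inv ≫
      β' i ((G i).obj A) ≫ (F' i).map ((φ i).b A).hom ≫ (γ i (D.T.obj A)).hom) :
    IsColaxMorphism D K F β := by
  have H := fun i => map_isColaxMorphism (φ i) (ψ i) (hK i) (γ i) (hγ i) (h i) (hβ i)
  exact
    { natural := fun f => hG'.faithful fun i => (H i).1 f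
      additive := fun A => ⟨hG'.faithful fun i => (H i).2.1 A,
        hG'.faithful fun i => (H i).2.2.1 A,
        fun g₂ h1 h2 => hG'.faithful fun i => (H i).2.2.2.1 A g₂ h1 h2⟩
      lift := fun A => hG'.faithful fun i => (H i).2.2.2.2.1 A
      flip := fun A => hG'.faithful fun i => (H i).2.2.2.2.2 A
      preserves := .of_jointlyReflects hG' hD φ hG γ hγ fun i => (h i).preserves }

namespace StrongMap

variable {D : TangentData C} {D' : TangentData C'} {F : C ⥤ C'} (φ : StrongMap D D' F)
  (h' : D'.IsTangent)

include φ h' in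
theorem preservesTangentLimits (hpow : ∀ (A : C) {n : ℕ} {P : C}
    (pr : Fin (n + 1) → (P ⟶ D.T.obj A)), IsFibrePower (D.p A) pr →
      IsFibrePower (F.map (D.p A)) (fun i => F.map (pr i))) : PreservesTangentLimits D F where
  power := hpow
  vertical _ k h1 h2 := (φ.vertical_conj (𝟭 _) k).1
    (h'.universal _ _ (φ.conj_fst h1) (φ.conj_snd h' h2))

/-- The law of a strong map, in either direction. -/
def law : ∀ o : Bool, Law o D D' F
  | false => fun A => (φ.b A).inv
  | true => fun A => (φ.b A).hom

include h' in
theorem isColaxMorphism (hp : PreservesTangentLimits D F) :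
    IsColaxMorphism D D' F (φ.law true) where
  natural f := φ.natural f
  additive A := ⟨(φ.p A).trans (comp_id _).symm, (φ.z A).trans (id_comp _).symm,
    fun g₂ h1 h2 => by
      have e : g₂ = (φ.b₂ A).hom := (φ.map_isPullback h' A).hom_ext (h1.trans (φ.π₁ A).symm)
        (h2.trans (φ.π₂ A).symm)
      subst e
      exact (φ.s A).symm⟩
  lift A := φ.l A
  flip A := φ.c A
  preserves := hp

include h' in
theorem isLaxMorphism : IsLaxMorphism D D' F (φ.law false) where
  natural f := by
    change F.map (D.T.map f) ≫ (φ.b _).inv = (φ.b _).inv ≫ D'.T.map (F.map f)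
    rw [φ.map_T]; simp
  additive A := ⟨((φ.map_p A).symm).trans (comp_id _).symm, by
      change F.map (D.z A) ≫ (φ.b A).inv = 𝟙 _ ≫ D'.z _
      rw [φ.map_z]; simp,
    fun g₂ h1 h2 => by
      change F.obj (D.T₂ A) ⟶ D'.T₂ (F.obj A) at g₂
      change g₂ ≫ D'.π₁ _ = F.map (D.π₁ A) ≫ (φ.b A).inv at h1
      change g₂ ≫ D'.π₂ _ = F.map (D.π₂ A) ≫ (φ.b A).inv at h2
      change F.map (D.s A) ≫ (φ.b A).inv = g₂ ≫ D'.s _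
      have e : g₂ = (φ.b₂ A).inv := (h'.pb _).hom_ext (by rw [h1, φ.map_π₁]; simp)
        (by rw [h2, φ.map_π₂]; simp)
      rw [e, φ.map_s]; simp⟩
  lift A := by
    change F.map (D.l A) ≫ (φ.b _).inv ≫ D'.T.map (φ.b A).inv = (φ.b A).inv ≫ D'.l _
    rw [φ.map_l]; simp
  flip A := by
    change F.map (D.c A) ≫ (φ.b _).inv ≫ D'.T.map (φ.b A).inv =
      (φ.b _).inv ≫ D'.T.map (φ.b A).inv ≫ D'.c _
    rw [φ.map_c]; simp

include h' in
theorem isTangentMorphism (hp : PreservesTangentLimits D F) (fl : Flavour)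
    (hs : fl = .strict → ∃ h : ∀ A, D'.T.obj (F.obj A) = F.obj (D.T.obj A),
      ∀ A, (φ.b A).hom = eqToHom (h A)) : IsTangentMorphism D D' F fl (φ.law fl.isColax) := by
  cases fl
  · exact φ.isLaxMorphism h'
  · exact φ.isColaxMorphism h' hp
  · exact ⟨φ.isColaxMorphism h' hp, fun A => inferInstanceAs (IsIso (φ.b A).hom)⟩
  · exact ⟨φ.isColaxMorphism h' hp, hs rfl⟩

end StrongMap

/-- A strong tangent morphism is a strong map. -/
def IsTangentMorphism.strongMap {D : TangentData C} {D' : TangentData C'}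
    {F : C ⥤ C'} {β : Law true D D' F} (h : IsTangentMorphism D D' F .strong β)
    (hD : D.IsTangent) (hD' : D'.IsTangent) : StrongMap D D' F :=
  have : ∀ A, IsIso (show D'.T.obj (F.obj A) ⟶ F.obj (D.T.obj A) from β A) := h.2
  have hb : ∀ A, β A ≫ F.map (D.p A) = D'.p (F.obj A) := fun A =>
    ((h.1.additive A).q).trans (comp_id _)
  have hpb : ∀ A, IsPullback (F.map (D.π₁ A)) (F.map (D.π₂ A)) (F.map (D.p A)) (F.map (D.p A)) :=
    fun A => (h.1.preserves.power A _ (isFibrePower_pairFam (hD.pb A))).isPullback_map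
  let b : ∀ A, D'.T.obj (F.obj A) ≅ F.obj (D.T.obj A) := fun A => @asIso _ _ _ _ (β A) (this A)
  let b₂ : ∀ A, D'.T₂ (F.obj A) ≅ F.obj (D.T₂ A) := fun A =>
    { hom := (hpb A).lift (D'.π₁ _ ≫ β A) (D'.π₂ _ ≫ β A) (by
        rw [assoc, assoc, hb, (hD'.pb _).w])
      inv := (hD'.pb _).lift (F.map (D.π₁ A) ≫ (b A).inv) (F.map (D.π₂ A) ≫ (b A).inv) (by
        have : (b A).inv ≫ D'.p _ = F.map (D.p A) := (Iso.inv_comp_eq _).2 (hb A).symm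
        rw [assoc, assoc, this, (hpb A).w])
      hom_inv_id := (hD'.pb _).hom_ext
        (by rw [assoc, IsPullback.lift_fst, IsPullback.lift_fst_assoc, assoc, id_comp]
            exact (congrArg (_ ≫ ·) (b A).hom_inv_id).trans (comp_id _))
        (by rw [assoc, IsPullback.lift_snd, IsPullback.lift_snd_assoc, assoc, id_comp]
            exact (congrArg (_ ≫ ·) (b A).hom_inv_id).trans (comp_id _))
      inv_hom_id := (hpb A).hom_ext
        (by rw [assoc, IsPullback.lift_fst, IsPullback.lift_fst_assoc, assoc, id_comp]
            exact (congrArg (_ ≫ ·) (b A).inv_hom_id).trans (comp_id _))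
        (by rw [assoc, IsPullback.lift_snd, IsPullback.lift_snd_assoc, assoc, id_comp]
            exact (congrArg (_ ≫ ·) (b A).inv_hom_id).trans (comp_id _)) }
  { b := b
    b₂ := b₂
    natural := fun f => h.1.natural f
    π₁ := fun A => (hpb A).lift_fst _ _ _
    π₂ := fun A => (hpb A).lift_snd _ _ _
    p := hb
    z := fun A => ((h.1.additive A).zero).trans (id_comp _)
    s := fun A => ((h.1.additive A).sum (b₂ A).hom ((hpb A).lift_fst _ _ _)
      ((hpb A).lift_snd _ _ _)).symm
    l := fun A => h.1.lift A
    c := fun A => h.1.flip A }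

theorem jointlyReflects_id : JointlyReflects (fun _ : Unit => 𝟭 C) where
  faithful h := h ()
  power h := h ()
  square h := h ()

end Morphisms

section StrictCalculus

variable (B : Type u) [Bicategory.{w, v} B]

/-- The unitors and associators are identities. -/
structure IsStrict : Prop where
  id_comp : ∀ {x y : B} (f : x ⟶ y), 𝟙 x ≫ f = f
  comp_id : ∀ {x y : B} (f : x ⟶ y), f ≫ 𝟙 y = f
  assoc : ∀ {x y s t : B} (f : x ⟶ y) (g : y ⟶ s) (h : s ⟶ t), (f ≫ g) ≫ h = f ≫ g ≫ h
  leftUnitor : ∀ {x y : B} (f : x ⟶ y), λ_ f = eqToIso (id_comp f)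
  rightUnitor : ∀ {x y : B} (f : x ⟶ y), ρ_ f = eqToIso (comp_id f)
  associator : ∀ {x y s t : B} (f : x ⟶ y) (g : y ⟶ s) (h : s ⟶ t), α_ f g h = eqToIso (assoc f g h)

variable {B}

theorem conj_heq {x y : B} {f f' g g' : x ⟶ y} (h : f' = f) (k : g = g') (a : f ⟶ g) :
    HEq (eqToHom h ≫ a ≫ eqToHom k) a := by
  subst h k
  simp

theorem eq_conj_iff_heq {x y : B} {f f' g g' : x ⟶ y} {a : f ⟶ g} {b : f' ⟶ g'} (h : f = f')
    (k : g' = g) : a = eqToHom h ≫ b ≫ eqToHom k ↔ HEq a b := by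
  subst h k
  simp

theorem whiskerLeft_heq {x y t : B} {f f' : x ⟶ y} (e : f = f') {g g' h h' : y ⟶ t}
    (eg : g = g') (eh : h = h') {a : g ⟶ h} {b : g' ⟶ h'} (hab : HEq a b) :
    HEq (f ◁ a) (f' ◁ b) := by
  subst e eg eh hab
  rfl

theorem whiskerRight_heq {x y t : B} {f f' g g' : x ⟶ y} (ef : f = f') (eg : g = g')
    {h h' : y ⟶ t} (e : h = h') {a : f ⟶ g} {b : f' ⟶ g'} (hab : HEq a b) :
    HEq (a ▷ h) (b ▷ h') := by
  subst e ef eg hab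
  rfl

namespace IsStrict

variable (s : IsStrict B)

include s

theorem id_whiskerLeft {x y : B} {f g : x ⟶ y} (a : f ⟶ g) : HEq (𝟙 x ◁ a) a := by
  rw [Bicategory.id_whiskerLeft, s.leftUnitor, s.leftUnitor]
  exact conj_heq (s.id_comp f) (s.id_comp g).symm a

theorem whiskerRight_id {x y : B} {f g : x ⟶ y} (a : f ⟶ g) : HEq (a ▷ 𝟙 y) a := by
  rw [Bicategory.whiskerRight_id, s.rightUnitor, s.rightUnitor]
  exact conj_heq (s.comp_id f) (s.comp_id g).symm a

theorem comp_whiskerLeft {x y r t : B} (f : x ⟶ y) (g : y ⟶ r) {h k : r ⟶ t} (a : h ⟶ k) :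
    HEq ((f ≫ g) ◁ a) (f ◁ g ◁ a) := by
  rw [Bicategory.comp_whiskerLeft, s.associator, s.associator]
  exact conj_heq (s.assoc f g h) (s.assoc f g k).symm _

theorem whiskerRight_comp {x y r t : B} {f g : x ⟶ y} (a : f ⟶ g) (h : y ⟶ r) (k : r ⟶ t) :
    HEq (a ▷ (h ≫ k)) ((a ▷ h) ▷ k) := by
  rw [Bicategory.whiskerRight_comp, s.associator, s.associator]
  exact conj_heq (s.assoc f h k).symm (s.assoc g h k) _

theorem whisker_assoc {x y r t : B} (f : x ⟶ y) {g h : y ⟶ r} (a : g ⟶ h) (k : r ⟶ t) :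
    HEq ((f ◁ a) ▷ k) (f ◁ a ▷ k) := by
  rw [Bicategory.whisker_assoc, s.associator, s.associator]
  exact conj_heq (s.assoc f g k) (s.assoc f h k).symm _

end IsStrict

end StrictCalculus

section StrictFunctors

variable {B : Type u} [Bicategory.{w, v} B] {B' : Type u'} [Bicategory.{w', v'} B']
  (F : StrictPseudofunctor B B')

theorem map₂_whiskerLeft_heq {x y t : B} (f : x ⟶ y) {g h : y ⟶ t} (a : g ⟶ h) :
    HEq (F.map₂ (f ◁ a)) (F.map f ◁ F.map₂ a) := by
  refine (eq_conj_iff_heq (F.map_comp f g) (F.map_comp f h).symm).1 ?_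
  rw [F.map₂_whisker_left, F.mapComp_eq_eqToIso, F.mapComp_eq_eqToIso]
  rfl

theorem map₂_whiskerRight_heq {x y t : B} {f g : x ⟶ y} (a : f ⟶ g) (h : y ⟶ t) :
    HEq (F.map₂ (a ▷ h)) (F.map₂ a ▷ F.map h) := by
  refine (eq_conj_iff_heq (F.map_comp f h) (F.map_comp g h).symm).1 ?_
  rw [F.map₂_whisker_right, F.mapComp_eq_eqToIso, F.mapComp_eq_eqToIso]
  rfl

theorem heq_of_map₂_heq (hF : ∀ {x y : B} {f g : x ⟶ y} {a b : f ⟶ g},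
    F.map₂ a = F.map₂ b → a = b) {x y : B} {f f' g g' : x ⟶ y} (ef : f = f') (eg : g = g')
    {a : f ⟶ g} {b : f' ⟶ g'} (h : HEq (F.map₂ a) (F.map₂ b)) : HEq a b := by
  subst ef eg
  exact heq_of_eq (hF (eq_of_heq h))

/-- A 2-natural transformation from naturality up to heterogeneous equality of 2-cells. -/
def TwoNatTrans.ofHEq {F G : StrictPseudofunctor B B'} (app : ∀ x : B, F.obj x ⟶ G.obj x)
    (nat : ∀ {x y : B} (f : x ⟶ y), F.map f ≫ app y = app x ≫ G.map f)
    (nat₂ : ∀ {x y : B} {f g : x ⟶ y} (η : f ⟶ g), HEq (F.map₂ η ▷ app y) (app x ◁ G.map₂ η)) :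
    TwoNatTrans F G where
  app := app
  naturality := nat
  naturality₂ η := (eq_conj_iff_heq _ _).2 (nat₂ η)

end StrictFunctors

section Equivalences

variable {B : Type u} [Bicategory.{w, v} B] {B' : Type u'} [Bicategory.{w', v'} B']

/-- An invertible 2-natural transformation from the identity to the composite of `L` and `R`. -/
structure UnitData (L : StrictPseudofunctor B B') (R : StrictPseudofunctor B' B) where
  i : ∀ x : B, x ⟶ R.obj (L.obj x)
  j : ∀ x : B, R.obj (L.obj x) ⟶ x
  ij : ∀ x, i x ≫ j x = 𝟙 x
  ji : ∀ x, j x ≫ i x = 𝟙 (R.obj (L.obj x))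
  nat : ∀ {x y : B} (f : x ⟶ y), f ≫ i y = i x ≫ R.map (L.map f)
  nat₂ : ∀ {x y : B} {f g : x ⟶ y} (a : f ⟶ g), HEq (a ▷ i y) (i x ◁ R.map₂ (L.map₂ a))

variable (sB : IsStrict B) {L : StrictPseudofunctor B B'} {R : StrictPseudofunctor B' B}

/-- Unit data from 2-natural transformations in the opposite direction. -/
def UnitData.ofInverse (sB : IsStrict B) (i : ∀ x : B, x ⟶ R.obj (L.obj x))
    (j : ∀ x : B, R.obj (L.obj x) ⟶ x) (ij : ∀ x, i x ≫ j x = 𝟙 x)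
    (ji : ∀ x, j x ≫ i x = 𝟙 (R.obj (L.obj x)))
    (nat : ∀ {x y : B} (f : x ⟶ y), R.map (L.map f) ≫ j y = j x ≫ f)
    (nat₂ : ∀ {x y : B} {f g : x ⟶ y} (a : f ⟶ g), HEq (R.map₂ (L.map₂ a) ▷ j y) (j x ◁ a)) :
    UnitData L R where
  i := i
  j := j
  ij := ij
  ji := ji
  nat {x y} f := by
    calc f ≫ i y = (i x ≫ j x) ≫ f ≫ i y := by rw [ij, sB.id_comp]
      _ = i x ≫ (j x ≫ f) ≫ i y := by simp only [sB.assoc]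
      _ = i x ≫ R.map (L.map f) ≫ j y ≫ i y := by rw [← nat]; simp only [sB.assoc]
      _ = _ := by rw [ji, sB.comp_id]
  nat₂ {x y f g} a := by
    have h1 : HEq ((j x ◁ a) ▷ i y) (R.map₂ (L.map₂ a)) :=
      (whiskerRight_heq (nat f).symm (nat g).symm rfl (nat₂ a).symm).trans ((sB.whiskerRight_comp _
        _ _).symm.trans ((whiskerRight_heq rfl rfl (ji y) HEq.rfl).trans (sB.whiskerRight_id _)))
    have e : ∀ f : x ⟶ y, (j x ≫ f) ≫ i y = R.map (L.map f) := fun f => by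
      rw [← nat, sB.assoc, ji, sB.comp_id]
    have h2 : HEq (i x ◁ (j x ◁ a) ▷ i y) (i x ◁ R.map₂ (L.map₂ a)) :=
      whiskerLeft_heq rfl (e f) (e g) h1
    refine HEq.trans ?_ h2
    have h3 : HEq (i x ◁ (j x ◁ a) ▷ i y) (i x ◁ j x ◁ a ▷ i y) :=
      whiskerLeft_heq rfl (sB.assoc _ _ _) (sB.assoc _ _ _) (sB.whisker_assoc _ _ _)
    refine HEq.trans ?_ h3.symm
    refine HEq.trans ?_ (sB.comp_whiskerLeft _ _ _)
    rw [ij]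
    exact (sB.id_whiskerLeft _).symm

namespace UnitData

variable (η : UnitData L R)

include sB η

theorem inv_nat {x y : B} (f : x ⟶ y) : R.map (L.map f) ≫ η.j y = η.j x ≫ f := by
  calc R.map (L.map f) ≫ η.j y = (η.j x ≫ η.i x) ≫ R.map (L.map f) ≫ η.j y := by
        rw [η.ji, sB.id_comp]
    _ = η.j x ≫ (η.i x ≫ R.map (L.map f)) ≫ η.j y := by simp only [sB.assoc]
    _ = η.j x ≫ f ≫ η.i y ≫ η.j y := by rw [← η.nat]; simp only [sB.assoc]
    _ = _ := by rw [η.ij, sB.comp_id]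

theorem inv_nat₂ {x y : B} {f g : x ⟶ y} (a : f ⟶ g) :
    HEq (R.map₂ (L.map₂ a) ▷ η.j y) (η.j x ◁ a) := by
  have h1 : HEq ((η.i x ◁ R.map₂ (L.map₂ a)) ▷ η.j y) a :=
    (whiskerRight_heq (η.nat f).symm (η.nat g).symm rfl (η.nat₂ a).symm).trans
      ((sB.whiskerRight_comp _ _ _).symm.trans
        ((whiskerRight_heq rfl rfl (η.ij y) HEq.rfl).trans (sB.whiskerRight_id _)))
  have e : ∀ f : x ⟶ y, (η.i x ≫ R.map (L.map f)) ≫ η.j y = f := fun f => by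
    rw [← η.nat, sB.assoc, η.ij, sB.comp_id]
  have h2 : HEq (η.j x ◁ (η.i x ◁ R.map₂ (L.map₂ a)) ▷ η.j y) (η.j x ◁ a) :=
    whiskerLeft_heq rfl (e f) (e g) h1
  refine HEq.trans ?_ h2
  have h3 : HEq (η.j x ◁ (η.i x ◁ R.map₂ (L.map₂ a)) ▷ η.j y)
      (η.j x ◁ η.i x ◁ R.map₂ (L.map₂ a) ▷ η.j y) :=
    whiskerLeft_heq rfl (sB.assoc _ _ _) (sB.assoc _ _ _) (sB.whisker_assoc _ _ _)
  refine HEq.trans ?_ h3.symm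
  refine HEq.trans ?_ (sB.comp_whiskerLeft _ _ _)
  rw [η.ji]
  exact (sB.id_whiskerLeft _).symm

theorem map_injective {x y : B} {f g : x ⟶ y} (h : L.map f = L.map g) : f = g := by
  have e : f ≫ η.i y = g ≫ η.i y := by rw [η.nat, η.nat, h]
  have e' : (f ≫ η.i y) ≫ η.j y = (g ≫ η.i y) ≫ η.j y := by rw [e]
  rwa [sB.assoc, sB.assoc, η.ij, sB.comp_id, sB.comp_id] at e'

theorem map₂_injective {x y : B} {f g : x ⟶ y} {a b : f ⟶ g} (h : L.map₂ a = L.map₂ b) :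
    a = b := by
  have e : a ▷ η.i y = b ▷ η.i y := by
    have h1 := η.nat₂ a
    rw [h] at h1
    exact eq_of_heq (h1.trans (η.nat₂ b).symm)
  have key : ∀ a : f ⟶ g, HEq ((a ▷ η.i y) ▷ η.j y) a := fun a =>
    (sB.whiskerRight_comp _ _ _).symm.trans
      ((whiskerRight_heq rfl rfl (η.ij y) HEq.rfl).trans (sB.whiskerRight_id _))
  exact eq_of_heq ((key a).symm.trans ((heq_of_eq (congrArg (· ▷ η.j y) e)).trans (key b)))

variable (sB' : IsStrict B') (σ : UnitData R L)

include sB' σ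

theorem map_surjective {y y' : B'} (f : R.obj y ⟶ R.obj y') :
    ∃ g : y ⟶ y', R.map g = f := by
  refine ⟨σ.i y ≫ L.map f ≫ σ.j y', η.map_injective sB ?_⟩
  have h1 := σ.nat (σ.i y ≫ L.map f ≫ σ.j y')
  have h2 : σ.i y ≫ L.map (R.map (σ.i y ≫ L.map f ≫ σ.j y')) = σ.i y ≫ L.map f := by
    rw [← h1, sB'.assoc, sB'.assoc, σ.ji, sB'.comp_id]
  have h3 := congrArg (σ.j y ≫ ·) h2
  simpa only [← sB'.assoc, σ.ji, sB'.id_comp] using h3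

theorem nonempty_twoAdjunction : Nonempty (TwoAdjunction L R) := by
  have hf : ∀ {y y' : B'} {f g : y ⟶ y'}, R.map f = R.map g → f = g :=
    fun h => σ.map_injective sB' h
  choose θ hθ using fun y : B' => η.map_surjective sB sB' σ (η.j (R.obj y))
  have nat : ∀ {y y' : B'} (f : y ⟶ y'), L.map (R.map f) ≫ θ y' = θ y ≫ f := fun {y y'} f =>
    hf (by rw [R.map_comp, R.map_comp, hθ, hθ, η.inv_nat sB])
  have nat₂ : ∀ {y y' : B'} {f g : y ⟶ y'} (a : f ⟶ g),
      HEq (L.map₂ (R.map₂ a) ▷ θ y') (θ y ◁ a) := fun {y y' f g} a => by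
    refine heq_of_map₂_heq R (fun h => σ.map₂_injective sB' h) (nat f) (nat g) ?_
    refine (map₂_whiskerRight_heq R _ _).trans (HEq.trans ?_ (map₂_whiskerLeft_heq R _ _).symm)
    rw [hθ, hθ]
    exact η.inv_nat₂ sB (R.map₂ a)
  refine ⟨⟨.ofHEq η.i η.nat η.nat₂, .ofHEq θ nat nat₂, fun x => ?_, fun y => ?_⟩⟩
  · have h2 : R.map (L.map (η.i x)) = η.i (R.obj (L.obj x)) := by
      have e : η.i x ≫ R.map (L.map (η.i x)) = η.i x ≫ η.i (R.obj (L.obj x)) :=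
        (η.nat (η.i x)).symm
      have e' := congrArg (η.j x ≫ ·) e
      simpa only [← sB.assoc, η.ji, sB.id_comp] using e'
    have h3 : L.map (η.i x) ≫ θ (L.obj x) = 𝟙 (L.obj x) :=
      hf (by rw [R.map_comp, R.map_id, hθ, h2, η.ij])
    exact h3
  · have h3 : η.i (R.obj y) ≫ R.map (θ y) = 𝟙 _ := by rw [hθ, η.ij]
    exact h3

theorem isEquivalence_of_triangles (unit : ∀ x, x ⟶ R.obj (L.obj x))
    (counit : ∀ y, L.obj (R.obj y) ⟶ y)
    (unit_nat : ∀ {x y : B} (f : x ⟶ y), f ≫ unit y = unit x ≫ R.map (L.map f))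
    (counit_nat : ∀ {x y : B'} (f : x ⟶ y), L.map (R.map f) ≫ counit y = counit x ≫ f)
    (left : ∀ x, L.map (unit x) ≫ counit (L.obj x) = 𝟙 _)
    (right : ∀ y, unit (R.obj y) ≫ R.map (counit y) = 𝟙 _) :
    (∀ x, ∃ g, unit x ≫ g = 𝟙 _ ∧ g ≫ unit x = 𝟙 _) ∧
      ∀ y, ∃ g, counit y ≫ g = 𝟙 _ ∧ g ≫ counit y = 𝟙 _ := by
  refine ⟨fun x => ?_, fun y => ?_⟩
  · obtain ⟨s, hs⟩ := σ.map_surjective sB' sB η (counit (L.obj x))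
    refine ⟨s, η.map_injective sB ?_, ?_⟩
    · rw [L.map_comp, hs, L.map_id, left]
    · rw [unit_nat, hs, right]
  · obtain ⟨s, hs⟩ := η.map_surjective sB sB' σ (unit (R.obj y))
    refine ⟨s, ?_, σ.map_injective sB' ?_⟩
    · rw [← counit_nat, hs, left]
    · rw [R.map_comp, hs, R.map_id, right]

theorem isEquivalence (adj : TwoAdjunction L R) : adj.IsEquivalence := by
  have H := η.isEquivalence_of_triangles sB sB' σ (fun x => adj.unit.app x)
    (fun y => adj.counit.app y) (fun f => adj.unit.naturality f)
    (fun f => adj.counit.naturality f) adj.left_triangle adj.right_triangle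
  exact ⟨H.1, H.2⟩

theorem areAdjointEquivalences : AreAdjointEquivalences L R where
  left := η.nonempty_twoAdjunction sB sB' σ
  left_isEquivalence := η.isEquivalence sB sB' σ
  right := σ.nonempty_twoAdjunction sB' sB η
  right_isEquivalence := σ.isEquivalence sB' sB η

end UnitData

end Equivalences

theorem isStrict_of_strict (B : Type u) [Bicategory.{w, v} B] [hB : Bicategory.Strict B] :
    IsStrict B where
  id_comp := hB.id_comp
  comp_id := hB.comp_id
  assoc := hB.assoc
  leftUnitor := hB.leftUnitor_eqToIso
  rightUnitor := hB.rightUnitor_eqToIso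
  associator := hB.associator_eqToIso

theorem IsStrict.strict {B : Type u} [Bicategory.{w, v} B] (s : IsStrict B) :
    Bicategory.Strict B where
  id_comp := s.id_comp
  comp_id := s.comp_id
  assoc := s.assoc
  leftUnitor_eqToIso := s.leftUnitor
  rightUnitor_eqToIso := s.rightUnitor
  associator_eqToIso := s.associator

section StrictConstructor

variable {B : Type u} [Bicategory.{w, v} B] {B' : Type u'} [Bicategory.{w', v'} B']

/-- A strict 2-functor between strict bicategories from its assignments. -/
def strictFunctor (sB : IsStrict B) (sB' : IsStrict B') (S : PrelaxFunctorStruct B B')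
    (map₂_id : ∀ {x y : B} (f : x ⟶ y), S.map₂ (𝟙 f) = 𝟙 (S.map f))
    (map₂_comp : ∀ {x y : B} {f g h : x ⟶ y} (a : f ⟶ g) (b : g ⟶ h),
      S.map₂ (a ≫ b) = S.map₂ a ≫ S.map₂ b) (map_id : ∀ x : B, S.map (𝟙 x) = 𝟙 (S.obj x))
    (map_comp : ∀ {x y r : B} (f : x ⟶ y) (g : y ⟶ r), S.map (f ≫ g) = S.map f ≫ S.map g)
    (whiskerLeft : ∀ {x y r : B} (f : x ⟶ y) {g h : y ⟶ r} (a : g ⟶ h),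
      HEq (S.map₂ (f ◁ a)) (S.map f ◁ S.map₂ a))
    (whiskerRight : ∀ {x y r : B} {f g : x ⟶ y} (a : f ⟶ g) (h : y ⟶ r),
      HEq (S.map₂ (a ▷ h)) (S.map₂ a ▷ S.map h)) : StrictPseudofunctor B B' :=
  haveI := sB.strict
  haveI := sB'.strict
  StrictPseudofunctor.mk''
    { toPrelaxFunctorStruct := S
      map₂_id := map₂_id
      map₂_comp := map₂_comp
      map_id := map_id
      map_comp := map_comp
      map₂_whisker_left := fun f _ _ a =>
        (eq_conj_iff_heq (map_comp f _) (map_comp f _).symm).2 (whiskerLeft f a)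
      map₂_whisker_right := fun a h =>
        (eq_conj_iff_heq (map_comp _ h) (map_comp _ h).symm).2 (whiskerRight a h) }

end StrictConstructor

namespace Displayed

variable {B : Type u} [Bicategory.{w, v} B] {D : Displayed.{w, v, v', u, u'} B} {W : D.OneCells}

theorem Total.hom_ext {x y : D.Total W} {f g : x ⟶ y} (h : f.hom = g.hom)
    (h' : HEq f.str g.str) : f = g := by
  obtain ⟨f, a, ha⟩ := f
  obtain ⟨g, b, hb⟩ := g
  dsimp only at h h'
  subst h
  obtain rfl := eq_of_heq h'
  rfl

theorem Total.heq_cell {x y : D.Total W} {f f' g g' : x ⟶ y} (hf : f = f') (hg : g = g')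
    {η : f ⟶ g} {η' : f' ⟶ g'} (h : HEq η.cell η'.cell) : HEq η η' := by
  subst hf hg
  exact heq_of_eq (Total.hom₂_ext (eq_of_heq h))

theorem Total.eqToHom_cell {x y : D.Total W} {f g : x ⟶ y} (h : f = g) :
    (eqToHom h : f ⟶ g).cell = eqToHom (congrArg Total.Hom.hom h) := by
  subst h
  rfl

theorem Total.eqToIso_ext {x y : D.Total W} {f g : x ⟶ y} (h : f = g) (e : f ≅ g)
    (he : e.hom.cell = eqToHom (congrArg Total.Hom.hom h)) : e = eqToIso h :=
  Iso.ext (Total.hom₂_ext (he.trans (Total.eqToHom_cell h).symm))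

theorem Total.isStrict (s : IsStrict B)
    (id_comp : ∀ {x y : D.Ob} {f : D.base x ⟶ D.base y} (a : D.Str f),
      HEq (D.compStr (D.idStr x) a) a)
    (comp_id : ∀ {x y : D.Ob} {f : D.base x ⟶ D.base y} (a : D.Str f),
      HEq (D.compStr a (D.idStr y)) a)
    (assoc : ∀ {x y r t : D.Ob} {f : D.base x ⟶ D.base y} {g : D.base y ⟶ D.base r}
      {h : D.base r ⟶ D.base t} (a : D.Str f) (b : D.Str g) (c : D.Str h),
      HEq (D.compStr (D.compStr a b) c) (D.compStr a (D.compStr b c))) :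
    IsStrict (D.Total W) where
  id_comp f := Total.hom_ext (s.id_comp f.hom) (id_comp f.str)
  comp_id f := Total.hom_ext (s.comp_id f.hom) (comp_id f.str)
  assoc f g h := Total.hom_ext (s.assoc f.hom g.hom h.hom) (assoc f.str g.str h.str)
  leftUnitor f := Total.eqToIso_ext _ _ (congrArg Iso.hom (s.leftUnitor f.hom))
  rightUnitor f := Total.eqToIso_ext _ _ (congrArg Iso.hom (s.rightUnitor f.hom))
  associator f g h := Total.eqToIso_ext _ _ (congrArg Iso.hom (s.associator f.hom g.hom h.hom))

theorem Generated.map {B' : Type u''} [Bicategory.{w', v''} B']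
    {D' : Displayed.{w', v'', t, u'', t'} B'} {W' : D'.OneCells} (ob : D.Ob → D'.Ob)
    (m : ∀ {x y : D.Ob} {f : D.base x ⟶ D.base y}, D.Str f →
      (g : D'.base (ob x) ⟶ D'.base (ob y)) × D'.Str g)
    (hW : ∀ {x y : D.Ob} {f : D.base x ⟶ D.base y} (a : D.Str f), W a → D'.Generated W' (m a).2)
    (hid : ∀ x : D.Ob, m (D.idStr x) = ⟨𝟙 _, D'.idStr (ob x)⟩)
    (hcomp : ∀ {x y r : D.Ob} {f : D.base x ⟶ D.base y} {g : D.base y ⟶ D.base r} (a : D.Str f)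
      (b : D.Str g), m (D.compStr a b) = ⟨(m a).1 ≫ (m b).1, D'.compStr (m a).2 (m b).2⟩)
    {x y : D.Ob} {f : D.base x ⟶ D.base y} {a : D.Str f} (ha : D.Generated W a) :
    D'.Generated W' (m a).2 := by
  induction ha with
  | of a ha => exact hW a ha
  | id x =>
    rw [hid]
    exact .id _
  | comp _ _ h1 h2 =>
    rw [hcomp]
    exact .comp h1 h2

end Displayed

section Trivial

variable (o : Bool) (fl : Flavour) (X : Type u) [Category.{u} X]

/-- Tangent fibrations over the trivial base. -/
abbrev FibDisp := fibDisplayed.{u, u, u, u} o (triv X)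

/-- Indexed tangent categories over the trivial base. -/
abbrev IndDisp := indDisplayed.{u, u, u, u} o (triv X)

/-- Small indexed categories. -/
abbrev SIndx := Indx.{u, u, u, u} X

/-- Tangent objects in indexed categories. -/
abbrev TngDisp := tngDisplayed fl.isColax (SIndx X)

variable {X}

/-- Generated morphisms of tangent fibrations. -/
abbrev FibGen {x y : (FibDisp fl.isColax X).Ob} {f : x.1.tot ⟶ y.1.tot}
    (a : (FibDisp fl.isColax X).Str (x := x) (y := y) f) : Prop :=
  (FibDisp fl.isColax X).Generated
    (fun {Q Q' F} β => IsTangentMorphism Q.1.D Q'.1.D F.toFunctor fl β.1) a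

/-- Generated morphisms of indexed tangent categories. -/
abbrev IndGen {x y : (IndDisp fl.isColax X).Ob} {f : x.1.J ⟶ y.1.J}
    (a : (IndDisp fl.isColax X).Str (x := x) (y := y) f) : Prop :=
  (IndDisp fl.isColax X).Generated
    (fun {R R' κ} β => IsIndexedMorphism (R := R.1) (R' := R'.1) fl κ β.1) a

/-- Generated morphisms of tangent objects. -/
abbrev TngGen {x y : (TngDisp fl X).Ob} {f : x.1.x ⟶ y.1.x}
    (a : (TngDisp fl X).Str (x := x) (y := y) f) : Prop :=
  (TngDisp fl X).Generated (fun {M M' F} a => IsTangentCell (M := M.1) (M' := M'.1) F fl a) a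

end Trivial

section Based

variable {X : Type u} [Category.{v} X]

theorem based_ext {𝒳 𝒴 : BasedCategory.{v', u'} X} {F G : 𝒳 ⟶ 𝒴}
    (h : F.toFunctor = G.toFunctor) : F = G := by
  have key : ∀ F G : BasedFunctor 𝒳 𝒴, F.toFunctor = G.toFunctor → F = G := by
    rintro ⟨F, hF⟩ ⟨G, hG⟩ rfl
    rfl
  exact key F G h

theorem based_heq {𝒳 𝒴 : BasedCategory.{v', u'} X} {F F' G G' : 𝒳 ⟶ 𝒴} (hF : F = F') (hG : G = G')
    {θ : F ⟶ G} {θ' : F' ⟶ G'} (h : ∀ A, HEq (θ.toNatTrans.app A) (θ'.toNatTrans.app A)) :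
    HEq θ θ' := by
  subst hF hG
  exact heq_of_eq (BasedNatTrans.homCategory.ext _ _
    (NatTrans.ext (funext fun A => eq_of_heq (h A))))

theorem based_isStrict : IsStrict (BasedCategory.{v', u'} X) := isStrict_of_strict _

theorem fibDisplayed_isStrict (o : Bool) (D : TangentData X) (W) :
    IsStrict ((fibDisplayed.{v, v', u, u'} o D).Total W) :=
  Total.isStrict based_isStrict (fun a => heq_of_eq (Subtype.ext (Law.id_comp a.1))) (fun a =>
    heq_of_eq (Subtype.ext (Law.comp_id a.1))) (fun a b c => heq_of_eq (Subtype.ext (Law.comp_assoc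
    a.1 b.1 c.1)))

theorem fib_str_heq_lax {D : TangentData X} {Q Q' : (fibDisplayed.{v, v', u, u'} false D).Ob}
    {F G : Q.1.tot ⟶ Q'.1.tot} (h : F = G) {a : (fibDisplayed false D).Str (x := Q) (y := Q') F}
    {b : (fibDisplayed false D).Str (x := Q) (y := Q') G} (hab : ∀ A, HEq (a.1 A) (b.1 A)) :
    HEq a b := by
  subst h
  exact heq_of_eq (Subtype.ext (funext fun A => eq_of_heq (hab A)))

theorem fib_str_heq_colax {D : TangentData X} {Q Q' : (fibDisplayed.{v, v', u, u'} true D).Ob}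
    {F G : Q.1.tot ⟶ Q'.1.tot} (h : F = G) {a : (fibDisplayed true D).Str (x := Q) (y := Q') F}
    {b : (fibDisplayed true D).Str (x := Q) (y := Q') G} (hab : ∀ A, HEq (a.1 A) (b.1 A)) :
    HEq a b := by
  subst h
  exact heq_of_eq (Subtype.ext (funext fun A => eq_of_heq (hab A)))

end Based

section Indexed

variable {X : Type u} [Category.{v} X] {J J' J'' : Indx.{v, v', u, u'} X}

theorem indx_ext {κ κ' : J ⟶ J'} (h : ∀ A, Indx.functor κ A = Indx.functor κ' A)
    (hd : ∀ {A A' : X} (f : A ⟶ A') (E : J.fib A'),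
      HEq (Indx.distributor κ f E).hom (Indx.distributor κ' f E).hom) : κ = κ' := by
  obtain ⟨app, nat, h1, h2, h3⟩ := κ
  obtain ⟨app', nat', h1', h2', h3'⟩ := κ'
  obtain rfl : app = app' := funext fun A => Cat.Hom.ext (h A.as.unop)
  obtain rfl : @nat = @nat' := by
    funext A A' f
    refine Iso.ext (Cat.Hom₂.ext (NatTrans.ext (funext fun E => ?_)))
    exact eq_of_heq (hd f.as.unop E)
  rfl

theorem modification_ext {κ κ' : J ⟶ J'} {m m' : κ ⟶ κ'}
    (h : ∀ A E, (Indx.component m A).app E = (Indx.component m' A).app E) : m = m' :=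
  Pseudofunctor.StrongTrans.homCategory.ext
    (fun A => Cat.Hom₂.ext (NatTrans.ext (funext fun E => h A.as.unop E)))

theorem modification_heq {κ κ' κ₁ κ₁' : J ⟶ J'} (h : κ = κ₁) (h' : κ' = κ₁') {m : κ ⟶ κ'}
    {m' : κ₁ ⟶ κ₁'}
    (hm : ∀ A E, HEq ((Indx.component m A).app E) ((Indx.component m' A).app E)) : HEq m m' := by
  subst h h'
  exact heq_of_eq (modification_ext fun A E => eq_of_heq (hm A E))

theorem Indx.distributor_comp (κ : J ⟶ J') (κ' : J' ⟶ J'') {A A' : X} (f : A ⟶ A')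
    (E : J.fib A') : (Indx.distributor (κ ≫ κ') f E).hom =
      (Indx.functor κ' A).map (Indx.distributor κ f E).hom ≫
        (Indx.distributor κ' f ((Indx.functor κ A').obj E)).hom := by
  change 𝟙 _ ≫ (Indx.functor κ' A).map (Indx.distributor κ f E).hom ≫ 𝟙 _ ≫
    (Indx.distributor κ' f ((Indx.functor κ A').obj E)).hom ≫ 𝟙 _ = _
  rw [id_comp, id_comp, comp_id]

theorem Indx.distributor_id {A A' : X} (f : A ⟶ A') (E : J.fib A') :
    (Indx.distributor (𝟙 J) f E).hom = 𝟙 ((J.sub f).obj E) := by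
  change 𝟙 ((J.sub f).obj E) ≫ 𝟙 ((J.sub f).obj E) = _
  rw [id_comp]

theorem Indx.component_eqToHom {κ κ' : J ⟶ J'} (h : κ = κ') (A : X) (E : J.fib A) :
    (Indx.component (eqToHom h) A).app E =
      eqToHom (congrArg (fun κ => (Indx.functor κ A).obj E) h) := by
  subst h
  rfl

theorem indx_id_comp (κ : J ⟶ J') : 𝟙 J ≫ κ = κ :=
  indx_ext (fun A => rfl) (fun {A A'} f E => by
    rw [Indx.distributor_comp, Indx.distributor_id]
    refine heq_of_eq ?_
    exact (congrArg (· ≫ _) (fmap_id _ _)).trans (id_comp _))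

theorem indx_comp_id (κ : J ⟶ J') : κ ≫ 𝟙 J' = κ :=
  indx_ext (fun A => rfl) (fun {A A'} f E => by
    rw [Indx.distributor_comp, Indx.distributor_id]
    exact heq_of_eq (comp_id _))

theorem indx_assoc {J₃ : Indx.{v, v', u, u'} X} (κ : J ⟶ J') (κ' : J' ⟶ J'') (κ'' : J'' ⟶ J₃) :
    (κ ≫ κ') ≫ κ'' = κ ≫ κ' ≫ κ'' :=
  indx_ext (fun A => rfl) (fun {A A'} f E => by
    rw [Indx.distributor_comp, Indx.distributor_comp, Indx.distributor_comp, Indx.distributor_comp]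
    refine heq_of_eq ?_
    exact (congrArg (· ≫ _) (fmap_comp _ _ _)).trans (assoc _ _ _))

theorem indx_isStrict : IsStrict (Indx.{v, v', u, u'} X) where
  id_comp κ := indx_id_comp κ
  comp_id κ := indx_comp_id κ
  assoc κ κ' κ'' := indx_assoc κ κ' κ''
  leftUnitor κ := Iso.ext (modification_ext fun A E =>
    Eq.trans (by rfl) (Indx.component_eqToHom (indx_id_comp κ) A E).symm)
  rightUnitor κ := Iso.ext (modification_ext fun A E =>
    Eq.trans (by rfl) (Indx.component_eqToHom (indx_comp_id κ) A E).symm)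
  associator κ κ' κ'' := Iso.ext (modification_ext fun A E =>
    Eq.trans (by rfl) (Indx.component_eqToHom (indx_assoc κ κ' κ'') A E).symm)

variable {D : TangentData X}

theorem ind_str_heq_lax {R R' : (indDisplayed.{v, v', u, u'} false D).Ob} {κ κ' : R.1.J ⟶ R'.1.J}
    (h : κ = κ') {a : (indDisplayed false D).Str (x := R) (y := R') κ}
    {b : (indDisplayed false D).Str (x := R) (y := R') κ'}
    (hab : ∀ A E, HEq (a.1 A E) (b.1 A E)) : HEq a b := by
  subst h
  exact heq_of_eq (Subtype.ext (funext fun A => funext fun E => eq_of_heq (hab A E)))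

theorem ind_str_heq_colax {R R' : (indDisplayed.{v, v', u, u'} true D).Ob} {κ κ' : R.1.J ⟶ R'.1.J}
    (h : κ = κ') {a : (indDisplayed true D).Str (x := R) (y := R') κ}
    {b : (indDisplayed true D).Str (x := R) (y := R') κ'}
    (hab : ∀ A E, HEq (a.1 A E) (b.1 A E)) : HEq a b := by
  subst h
  exact heq_of_eq (Subtype.ext (funext fun A => funext fun E => eq_of_heq (hab A E)))

theorem indDisplayed_isStrict (o : Bool) (D : TangentData X) (W) :
    IsStrict ((indDisplayed.{v, v', u, u'} o D).Total W) := by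
  cases o
  · exact Total.isStrict indx_isStrict (fun a => ind_str_heq_lax (indx_isStrict.id_comp _) (fun A E
      => heq_of_eq (congrFun (Law.id_comp (a.1 A)) E))) (fun a => ind_str_heq_lax
      (indx_isStrict.comp_id _) (fun A E => heq_of_eq (congrFun (Law.comp_id (a.1 A)) E))) (fun a b
      c => ind_str_heq_lax (indx_isStrict.assoc _ _ _) (fun A E => heq_of_eq (congrFun
      (Law.comp_assoc (a.1 A) (b.1 A) (c.1 A)) E)))
  · exact Total.isStrict indx_isStrict (fun a => ind_str_heq_colax (indx_isStrict.id_comp _) (fun A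
      E => heq_of_eq (congrFun (Law.id_comp (a.1 A)) E))) (fun a => ind_str_heq_colax
      (indx_isStrict.comp_id _) (fun A E => heq_of_eq (congrFun (Law.comp_id (a.1 A)) E))) (fun a b
      c => ind_str_heq_colax (indx_isStrict.assoc _ _ _) (fun A E => heq_of_eq (congrFun
      (Law.comp_assoc (a.1 A) (b.1 A) (c.1 A)) E)))

end Indexed

section FibreLimits

variable {X : Type u} [Category.{v} X] {C : Type u'} [Category.{v'} C] {P : C ⥤ X}

theorem isHomLift_cancel {A A' : X} {f : A ⟶ A'} {e e' e'' : C} {k : e ⟶ e'} {χ : e' ⟶ e''}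
    (hχ : P.IsHomLift (𝟙 A') χ) (h : P.IsHomLift f (k ≫ χ)) : P.IsHomLift f k := by
  refine IsHomLift.of_fac P f k (IsHomLift.domain_eq P f (k ≫ χ)) (IsHomLift.domain_eq P (𝟙 A') χ) ?_
  have h1 := IsHomLift.fac P f (k ≫ χ)
  have h2 := IsHomLift.fac' P (𝟙 A') χ
  rw [P.map_comp, h2] at h1
  simpa using h1

theorem jointlyReflects_inc (A : X) : JointlyReflects (fun _ : Unit => inc P A) where
  faithful h := (inc P A).map_injective (h ())
  power {E B R q n pr} h := by
    refine .mk_of_ext (fun i j => (inc P A).map_injective ?_) (fun {Y} f hf => ?_)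
      (fun {Y k k'} hk => (inc P A).map_injective ?_)
    · simpa only [Functor.map_comp] using (h ()).comm i j
    · have hf' : ∀ i j, (inc P A).map (f i) ≫ (inc P A).map q =
          (inc P A).map (f j) ≫ (inc P A).map q := fun i j => by
        rw [← Functor.map_comp, ← Functor.map_comp, hf i j]
      have e := (h ()).desc_pr (fun i => (inc P A).map (f i)) hf'
      refine ⟨⟨(h ()).desc (fun i => (inc P A).map (f i)) hf',
        isHomLift_cancel (pr 0).2 ((e 0).symm ▸ (f 0).2)⟩, fun i => Subtype.ext (e i)⟩
    · exact (h ()).hom_ext fun i => by rw [← Functor.map_comp, ← Functor.map_comp, hk i]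
  square {R E E' B a b f g} h := by
    have w : a ≫ f = b ≫ g := (inc P A).map_injective (by
      rw [Functor.map_comp, Functor.map_comp, (h ()).w])
    refine ⟨⟨w⟩, ⟨Limits.PullbackCone.IsLimit.mk w (fun s => ?_) ?_ ?_ ?_⟩⟩
    · refine ⟨(h ()).lift ((inc P A).map s.fst) ((inc P A).map s.snd)
        (congrArg (inc P A).map s.condition), ?_⟩
      exact isHomLift_cancel a.2 (((h ()).lift_fst _ _ _).symm ▸ s.fst.2)
    · exact fun s => Subtype.ext ((h ()).lift_fst _ _ _)
    · exact fun s => Subtype.ext ((h ()).lift_snd _ _ _)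
    · intro s m h1 h2
      refine (inc P A).map_injective ((h ()).hom_ext ?_ ?_)
      · rw [← Functor.map_comp, h1]
        exact ((h ()).lift_fst _ _ _).symm
      · rw [← Functor.map_comp, h2]
        exact ((h ()).lift_snd _ _ _).symm

variable (cl : Cleavage P)

/-- The morphism into the domain of a chosen cartesian lift. -/
def Cleavage.vert {A A' : X} (f : A ⟶ A') {Y : P.Fiber A} {E : P.Fiber A'}
    (φ : (inc P A).obj Y ⟶ (inc P A').obj E) (h : P.IsHomLift f φ) : Y ⟶ cl.pull f E :=
  TangentGrothendieck.vert f (cl.lift f E) (cl.cartesian f E) φ h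

theorem Cleavage.vert_lift {A A' : X} (f : A ⟶ A') {Y : P.Fiber A} {E : P.Fiber A'}
    (φ : (inc P A).obj Y ⟶ (inc P A').obj E) (h : P.IsHomLift f φ) :
    (inc P A).map (cl.vert f φ h) ≫ cl.lift f E = φ := vert_fac _ _ _ _ _

theorem Cleavage.hom_ext {A A' : X} (f : A ⟶ A') {Y : P.Fiber A} {E : P.Fiber A'}
    {k k' : Y ⟶ cl.pull f E}
    (h : (inc P A).map k ≫ cl.lift f E = (inc P A).map k' ≫ cl.lift f E) : k = k' :=
  vert_ext f _ (cl.cartesian f E) h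

theorem Cleavage.comp_isHomLift {A A' : X} (f : A ⟶ A') {Y : P.Fiber A} {E : P.Fiber A'}
    (k : Y ⟶ cl.pull f E) : P.IsHomLift f ((inc P A).map k ≫ cl.lift f E) :=
  isHomLift_comp_eq k.2 (cl.isHomLift f E) (id_comp f)

theorem Cleavage.comp_pullMap_lift {A A' : X} (f : A ⟶ A') {Y : P.Fiber A} {E E' : P.Fiber A'}
    (k : Y ⟶ cl.pull f E) (ξ : E ⟶ E') : (inc P A).map (k ≫ cl.pullMap f ξ) ≫ cl.lift f E' =
      ((inc P A).map k ≫ cl.lift f E) ≫ (inc P A').map ξ := by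
  rw [Functor.map_comp, assoc, cl.pullMap_lift, assoc]

theorem Cleavage.pullMap_comm {A A' : X} (f : A ⟶ A') {R E E' B : P.Fiber A'} {a : R ⟶ E}
    {b : R ⟶ E'} {q : E ⟶ B} {q' : E' ⟶ B}
    (h : (inc P A').map a ≫ (inc P A').map q = (inc P A').map b ≫ (inc P A').map q') :
    cl.pullMap f a ≫ cl.pullMap f q = cl.pullMap f b ≫ cl.pullMap f q' := by
  have e : a ≫ q = b ≫ q' := (inc P A').map_injective (by
    rw [Functor.map_comp, Functor.map_comp, h])
  exact ((cl.pullFunctor f).map_comp a q).symm.trans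
    ((congrArg (cl.pullFunctor f).map e).trans ((cl.pullFunctor f).map_comp b q'))

theorem Cleavage.isFibrePower_pullMap {A A' : X} (f : A ⟶ A') {E B R : P.Fiber A'} {q : E ⟶ B}
    {n : ℕ} {pr : Fin (n + 1) → (R ⟶ E)}
    (h : IsFibrePower ((inc P A').map q) (fun i => (inc P A').map (pr i))) :
    IsFibrePower (cl.pullMap f q) (fun i => cl.pullMap f (pr i)) := by
  refine .mk_of_ext (fun i j => cl.pullMap_comm f (h.comm i j)) (fun {Y} g hg => ?_)
    (fun {Y k k'} hk => cl.hom_ext f (h.hom_ext fun i => ?_))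
  · have hf' : ∀ i j, ((inc P A).map (g i) ≫ cl.lift f E) ≫ (inc P A').map q =
        ((inc P A).map (g j) ≫ cl.lift f E) ≫ (inc P A').map q := fun i j => by
      rw [← cl.comp_pullMap_lift, ← cl.comp_pullMap_lift, hg i j]
    have e := h.desc_pr (fun i => (inc P A).map (g i) ≫ cl.lift f E) hf'
    refine ⟨cl.vert f (h.desc _ hf') (isHomLift_cancel (pr 0).2
      ((e 0).symm ▸ cl.comp_isHomLift f (g 0))), fun i => cl.hom_ext f ?_⟩
    rw [cl.comp_pullMap_lift, cl.vert_lift]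
    exact e i
  · rw [← cl.comp_pullMap_lift, ← cl.comp_pullMap_lift, hk i]

theorem Cleavage.isPullback_pullMap {A A' : X} (f : A ⟶ A') {R E E' B : P.Fiber A'} {a : R ⟶ E}
    {b : R ⟶ E'} {q : E ⟶ B} {q' : E' ⟶ B}
    (h : IsPullback ((inc P A').map a) ((inc P A').map b) ((inc P A').map q) ((inc P A').map q')) :
    IsPullback (cl.pullMap f a) (cl.pullMap f b) (cl.pullMap f q) (cl.pullMap f q') := by
  have w := cl.pullMap_comm f h.w
  have hw : ∀ {Y : P.Fiber A} (k : Y ⟶ cl.pull f E) (k' : Y ⟶ cl.pull f E'), k ≫ cl.pullMap f q = k'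
      ≫ cl.pullMap f q' → ((inc P A).map k ≫ cl.lift f E) ≫ (inc P A').map q =
        ((inc P A).map k' ≫ cl.lift f E') ≫ (inc P A').map q' := fun k k' hk => by
    rw [← cl.comp_pullMap_lift, ← cl.comp_pullMap_lift, hk]
  refine ⟨⟨w⟩, ⟨Limits.PullbackCone.IsLimit.mk w (fun s => ?_) ?_ ?_ ?_⟩⟩
  · refine cl.vert f (h.lift _ _ (hw s.fst s.snd s.condition)) (isHomLift_cancel a.2 ?_)
    exact (h.lift_fst _ _ (hw s.fst s.snd s.condition)).symm ▸ cl.comp_isHomLift f s.fst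
  · exact fun s => cl.hom_ext f (by rw [cl.comp_pullMap_lift, cl.vert_lift, h.lift_fst])
  · exact fun s => cl.hom_ext f (by rw [cl.comp_pullMap_lift, cl.vert_lift, h.lift_snd])
  · intro s m h1 h2
    refine cl.hom_ext f ?_
    rw [cl.vert_lift]
    refine h.hom_ext ?_ ?_
    · rw [← cl.comp_pullMap_lift, h1, h.lift_fst]
    · rw [← cl.comp_pullMap_lift, h2, h.lift_snd]

theorem isIso_pr {E B R : C} {q : E ⟶ B} [IsIso q] {n : ℕ} {pr : Fin (n + 1) → (R ⟶ E)}
    (h : IsFibrePower q pr) (i : Fin (n + 1)) : IsIso (pr i) := by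
  have e : ∀ j, pr j = pr i := fun j => by
    rw [← cancel_mono q]
    exact h.comm j i
  refine ⟨h.desc (fun _ => 𝟙 E) (fun _ _ => rfl), h.hom_ext fun j => ?_, h.desc_pr _ _ i⟩
  rw [assoc, h.desc_pr, id_comp, comp_id, e j]

include cl in
theorem Cleavage.exists_fibre {A : X} {E : P.Fiber A} {e : C} (φ : e ⟶ E.1) [IsIso (P.map φ)] :
    ∃ (E' : P.Fiber A) (a : E'.1 ≅ e), P.IsHomLift (𝟙 A) (a.hom ≫ φ) := by
  have hE : P.obj E.1 = A := E.2
  let g : A ⟶ P.obj e := eqToHom hE.symm ≫ inv (P.map φ)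
  have hc : P.IsStronglyCartesian g (cl.lift g ⟨e, rfl⟩) := cl.cartesian g ⟨e, rfl⟩
  have hi := Functor.IsStronglyCartesian.isIso_of_base_isIso P g (cl.lift g ⟨e, rfl⟩)
  refine ⟨cl.pull g ⟨e, rfl⟩, @asIso _ _ _ _ (cl.lift g ⟨e, rfl⟩) hi, ?_⟩
  have h1 : P.IsHomLift (P.map φ ≫ eqToHom hE) φ := inferInstance
  exact isHomLift_comp_eq hc.toIsHomLift h1 (by simp [g])

end FibreLimits

section StrictFibres

variable {X : Type u} [Category.{v} X] {Q : RawFibration.{v, v', u, u'} X}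

namespace RawFibration.IsTangent

variable (h : Q.IsTangent (triv X))

/-- `T' E`, in the fibre over `A`. -/
abbrev tObj {A : X} (E : Q.tot.p.Fiber A) : Q.tot.p.Fiber A := h.tan E

/-- The action of `T'` on morphisms between objects of two fibres. -/
def tArr {A A' : X} {E : Q.tot.p.Fiber A} {E' : Q.tot.p.Fiber A'}
    (φ : (inc Q.tot.p A).obj E ⟶ (inc Q.tot.p A').obj E') :
    (inc Q.tot.p A).obj (h.tObj E) ⟶ (inc Q.tot.p A').obj (h.tObj E') := Q.D.T.map φ

theorem tArr_id {A : X} (E : Q.tot.p.Fiber A) :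
    h.tArr (𝟙 ((inc Q.tot.p A).obj E)) = 𝟙 ((inc Q.tot.p A).obj (h.tObj E)) :=
  Q.D.T.map_id _

theorem tArr_comp {A A' A'' : X} {E : Q.tot.p.Fiber A} {E' : Q.tot.p.Fiber A'}
    {E'' : Q.tot.p.Fiber A''} (φ : (inc Q.tot.p A).obj E ⟶ (inc Q.tot.p A').obj E')
    (ψ : (inc Q.tot.p A').obj E' ⟶ (inc Q.tot.p A'').obj E'') :
    h.tArr (φ ≫ ψ) = h.tArr φ ≫ h.tArr ψ :=
  Q.D.T.map_comp _ _

/-- The action of `T'` on morphisms of a fibre. -/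
def tMap {A : X} {E E' : Q.tot.p.Fiber A} (ξ : E ⟶ E') : h.tObj E ⟶ h.tObj E' :=
  ⟨Q.D.T.map ξ.1, h.strict.T ξ.2⟩

theorem inc_tMap {A : X} {E E' : Q.tot.p.Fiber A} (ξ : E ⟶ E') :
    (inc Q.tot.p A).map (h.tMap ξ) = h.tArr ((inc Q.tot.p A).map ξ) := rfl

/-- The projection, in a fibre. -/
def vp {A : X} (E : Q.tot.p.Fiber A) : h.tObj E ⟶ E := ⟨Q.D.p E.1, h.strict.p E⟩

/-- The zero, in a fibre. -/
def vz {A : X} (E : Q.tot.p.Fiber A) : E ⟶ h.tObj E := ⟨Q.D.z E.1, h.strict.z E⟩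

/-- The vertical lift, in a fibre. -/
def vl {A : X} (E : Q.tot.p.Fiber A) : h.tObj E ⟶ h.tObj (h.tObj E) :=
  ⟨Q.D.l E.1, h.strict.l E⟩

/-- The canonical flip, in a fibre. -/
def vc {A : X} (E : Q.tot.p.Fiber A) : h.tObj (h.tObj E) ⟶ h.tObj (h.tObj E) :=
  ⟨Q.D.c E.1, h.strict.c E⟩

/-- A morphism `T'₂ E ⟶ T' E` under the zeros, in a fibre. -/
def vert₂ {A : X} (E : Q.tot.p.Fiber A) (m : Q.D.T₂ E.1 ⟶ Q.D.T.obj E.1)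
    (hm : h.total.zz E.1 ≫ m = Q.D.z E.1) : h.fibreT₂ E ⟶ h.tObj E :=
  ⟨h.zzLift E ≫ m, h.zzLift_isHomLift E m hm⟩

/-- The tangent structure of a fibre, given by the restriction of `T'`. -/
def vertTangent (A : X) : TangentData (Q.tot.p.Fiber A) where
  T :=
    { obj := fun E => h.tObj E
      map := fun ξ => h.tMap ξ
      map_id := fun E => Subtype.ext (Q.D.T.map_id E.1)
      map_comp := fun ξ ξ' => Subtype.ext (Q.D.T.map_comp ξ.1 ξ'.1) }
  T₂ E := h.fibreT₂ E
  π₁ E := h.vert₂ E (Q.D.π₁ E.1) (h.total.zz_fst E.1)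
  π₂ E := h.vert₂ E (Q.D.π₂ E.1) (h.total.zz_snd E.1)
  p E := h.vp E
  z E := h.vz E
  s E := h.vert₂ E (Q.D.s E.1) (h.total.zz_s E.1)
  l E := h.vl E
  c E := h.vc E

section

variable {A A' : X} {E : Q.tot.p.Fiber A} {E' : Q.tot.p.Fiber A'}
  (φ : (inc Q.tot.p A).obj E ⟶ (inc Q.tot.p A').obj E')

theorem tArr_vp : h.tArr φ ≫ (inc Q.tot.p A').map (h.vp E') = (inc Q.tot.p A).map (h.vp E) ≫ φ :=
  h.total.p_nat φ

theorem vz_tArr : (inc Q.tot.p A).map (h.vz E) ≫ h.tArr φ = φ ≫ (inc Q.tot.p A').map (h.vz E') :=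
  (h.total.z_nat φ).symm

theorem vl_tArr : (inc Q.tot.p A).map (h.vl E) ≫ h.tArr (h.tArr φ) =
    h.tArr φ ≫ (inc Q.tot.p A').map (h.vl E') :=
  (h.total.l_nat φ).symm

theorem vc_tArr : (inc Q.tot.p A).map (h.vc E) ≫ h.tArr (h.tArr φ) =
    h.tArr (h.tArr φ) ≫ (inc Q.tot.p A').map (h.vc E') :=
  (h.total.c_nat φ).symm

end

theorem isIso_map_of_vertical {A : X} {e e' : Q.tot.obj} {φ : e ⟶ e'}
    (hφ : Q.tot.p.IsHomLift (𝟙 A) φ) : IsIso (Q.tot.p.map φ) := by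
  rw [IsHomLift.fac' Q.tot.p (𝟙 A) φ]
  infer_instance

include h in
theorem isIso_map_pr {A : X} (E : Q.tot.p.Fiber A) {n : ℕ} {P : Q.tot.obj}
    {pr : Fin (n + 1) → (P ⟶ Q.D.T.obj E.1)} (hpr : IsFibrePower (Q.D.p E.1) pr)
    (i : Fin (n + 1)) : IsIso (Q.tot.p.map (pr i)) := by
  have := isIso_map_of_vertical (h.strict.p E)
  exact isIso_pr (h.strict.preserves.power E.1 pr hpr) i

theorem isIso_zzLift {A : X} (E : Q.tot.p.Fiber A) : IsIso (h.zzLift E) := by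
  have h1 : IsIso (Q.tot.p.map (Q.D.π₁ E.1)) := h.isIso_map_pr E
    (isFibrePower_pairFam (h.total.pb E.1)) 0
  have h2 : IsIso (Q.tot.p.map (Q.D.z E.1)) := isIso_map_of_vertical (h.vz E).2
  have h3 : Q.tot.p.map (h.total.zz E.1) ≫ Q.tot.p.map (Q.D.π₁ E.1) =
      Q.tot.p.map (Q.D.z E.1) := by rw [← Functor.map_comp, h.total.zz_fst]
  have h4 : IsIso (Q.tot.p.map (h.total.zz E.1)) := by
    have : IsIso (Q.tot.p.map (h.total.zz E.1) ≫ Q.tot.p.map (Q.D.π₁ E.1)) := h3 ▸ h2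
    exact IsIso.of_isIso_comp_right _ (Q.tot.p.map (Q.D.π₁ E.1))
  have h5 : IsIso (h.base₂ E) := IsIso.comp_isIso' inferInstance h4
  have hc : Q.tot.p.IsStronglyCartesian (h.base₂ E) (h.zzLift E) := Q.cl.cartesian _ _
  exact Functor.IsStronglyCartesian.isIso_of_base_isIso Q.tot.p (h.base₂ E) (h.zzLift E)

/-- The isomorphism `⟨z, z⟩^* T'₂ E ≅ T'₂ E`. -/
def zzIso {A : X} (E : Q.tot.p.Fiber A) :
    (inc Q.tot.p A).obj (h.fibreT₂ E) ≅ Q.D.T₂ ((inc Q.tot.p A).obj E) :=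
  @asIso _ _ _ _ (h.zzLift E) (h.isIso_zzLift E)

/-- The inclusion of a fibre, as a strong map. -/
def incStrong (A : X) : StrongMap (h.vertTangent A) Q.D (inc Q.tot.p A) where
  b E := Iso.refl (Q.D.T.obj ((inc Q.tot.p A).obj E))
  b₂ E := (h.zzIso E).symm
  natural f := (comp_id _).trans (id_comp (Q.D.T.map f.1)).symm
  π₁ E := ((h.zzIso E).inv_hom_id_assoc (Q.D.π₁ E.1)).trans (comp_id _).symm
  π₂ E := ((h.zzIso E).inv_hom_id_assoc (Q.D.π₂ E.1)).trans (comp_id _).symm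
  p E := id_comp (Q.D.p E.1)
  z E := comp_id (Q.D.z E.1)
  s E := ((h.zzIso E).inv_hom_id_assoc (Q.D.s E.1)).trans (comp_id _).symm
  l E := by
    change Q.D.l E.1 ≫ Q.D.T.map (𝟙 _) ≫ 𝟙 _ = 𝟙 _ ≫ Q.D.l E.1
    exact ((congrArg (_ ≫ ·) ((comp_id _).trans (Q.D.T.map_id _))).trans
      (comp_id _)).trans (id_comp _).symm
  c E := by
    change Q.D.c E.1 ≫ Q.D.T.map (𝟙 _) ≫ 𝟙 _ = Q.D.T.map (𝟙 _) ≫ 𝟙 _ ≫ Q.D.c E.1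
    exact ((congrArg (_ ≫ ·) ((comp_id _).trans (Q.D.T.map_id _))).trans
      (comp_id _)).trans (((congrArg (fun t => t ≫ 𝟙 _ ≫ Q.D.c E.1) (Q.D.T.map_id _)).trans
        (id_comp _)).trans (id_comp _)).symm

theorem exists_power {A : X} (E : Q.tot.p.Fiber A) (n : ℕ) :
    ∃ (P : Q.tot.p.Fiber A) (pr : Fin (n + 1) → (P ⟶ (h.vertTangent A).T.obj E)),
      IsFibrePower ((inc Q.tot.p A).map ((h.vertTangent A).p E))
        (fun i => (inc Q.tot.p A).map (pr i)) := by
  obtain ⟨P, pr, hpr⟩ := (h.total.additive E.1).powers n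
  have hpr' : IsFibrePower (Q.D.p E.1) pr := hpr
  have hi : IsIso (Q.tot.p.map (pr 0)) := h.isIso_map_pr E hpr' 0
  obtain ⟨E', a, ha⟩ := @Cleavage.exists_fibre _ _ _ _ _ Q.cl A (h.tObj E) P (pr 0) hi
  have hv : ∀ i, Q.tot.p.IsHomLift (𝟙 A) (a.hom ≫ pr i) := fun i =>
    isHomLift_cancel (h.strict.p E) (by
      have h1 : Q.tot.p.IsHomLift (𝟙 A ≫ 𝟙 A) ((a.hom ≫ pr 0) ≫ Q.D.p E.1) :=
        isHomLift_comp ha (h.strict.p E)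
      rw [id_comp (𝟙 A)] at h1
      have e : (a.hom ≫ pr i) ≫ Q.D.p E.1 = (a.hom ≫ pr 0) ≫ Q.D.p E.1 :=
        (assoc _ _ _).trans ((congrArg (a.hom ≫ ·) (hpr'.comm i 0)).trans (assoc _ _ _).symm)
      exact e ▸ h1)
  refine ⟨E', fun i => ⟨a.hom ≫ pr i, hv i⟩, ?_⟩
  exact hpr'.of_iso (Iso.refl _) (Iso.refl _) a.symm ((comp_id _).trans (id_comp _).symm) (fun i =>
    (comp_id _).trans (a.inv_hom_id_assoc (pr i)).symm)

theorem vertTangent_isTangent (A : X) : (h.vertTangent A).IsTangent :=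
  isTangent_of_jointlyReflects (jointlyReflects_inc A) (fun _ => h.incStrong A)
    (fun _ => h.total) (fun E n => by
      obtain ⟨P, pr, hpr⟩ := h.exists_power E n
      exact ⟨P, pr, fun _ => hpr⟩)

theorem inc_isFibrePower {A : X} (E : Q.tot.p.Fiber A) {n : ℕ} {P : Q.tot.p.Fiber A}
    (pr : Fin (n + 1) → (P ⟶ (h.vertTangent A).T.obj E))
    (hpr : IsFibrePower ((h.vertTangent A).p E) pr) :
    IsFibrePower ((inc Q.tot.p A).map ((h.vertTangent A).p E))
      (fun i => (inc Q.tot.p A).map (pr i)) := by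
  obtain ⟨P', pr', hpr'⟩ := h.exists_power E n
  exact hpr.map_of_map ((jointlyReflects_inc A).power fun _ => hpr') (inc Q.tot.p A) hpr'

theorem inc_preserves (A : X) : PreservesTangentLimits (h.vertTangent A) (inc Q.tot.p A) :=
  (h.incStrong A).preservesTangentLimits h.total (fun E _ _ pr hpr => h.inc_isFibrePower E pr hpr)

theorem pullFunctor_preserves {A A' : X} (f : A ⟶ A') :
    PreservesTangentLimits (h.vertTangent A') (Q.cl.pullFunctor f) where
  power E _ _ pr hpr := Q.cl.isFibrePower_pullMap f (h.inc_isFibrePower E pr hpr)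
  vertical E k h1 h2 := Q.cl.isPullback_pullMap f ((h.inc_preserves A').vertical E k h1 h2)

theorem tArr_lift_cartesian {A A' : X} (f : A ⟶ A') (E : Q.tot.p.Fiber A') :
    Q.tot.p.IsStronglyCartesian f (h.tArr (Q.cl.lift f E)) :=
  h.cartesian (Q.cl.cartesian f E)

/-- The comparison `T' f^* E ≅ f^* T' E`. -/
def vertLawIso {A A' : X} (f : A ⟶ A') (E : Q.tot.p.Fiber A') :
    h.tObj (Q.cl.pull f E) ≅ Q.cl.pull f (h.tObj E) :=
  vertIso f (h.tArr (Q.cl.lift f E)) (h.tArr_lift_cartesian f E)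
    (Q.cl.lift f (h.tObj E)) (Q.cl.cartesian _ _)

/-- The distributive law of a substitution functor. -/
def vertLaw {A A' : X} (f : A ⟶ A') :
    Law true (h.vertTangent A') (h.vertTangent A) (Q.cl.pullFunctor f) :=
  fun E => (h.vertLawIso f E).hom

section

variable {A A' : X} (f : A ⟶ A') (E : Q.tot.p.Fiber A')

theorem vertLaw_lift : (inc Q.tot.p A).map (h.vertLawIso f E).hom ≫ Q.cl.lift f (h.tObj E) =
      h.tArr (Q.cl.lift f E) :=
  vert_fac _ _ _ _ _

theorem comp_vertLaw_lift {Y : Q.tot.p.Fiber A} (k : Y ⟶ h.tObj (Q.cl.pull f E)) :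
    (inc Q.tot.p A).map (k ≫ (h.vertLawIso f E).hom) ≫ Q.cl.lift f (h.tObj E) =
      (inc Q.tot.p A).map k ≫ h.tArr (Q.cl.lift f E) := by
  rw [fmap_comp, assoc, vertLaw_lift]

theorem vertLaw_natural {E E' : Q.tot.p.Fiber A'} (ξ : E ⟶ E') :
    h.tMap (Q.cl.pullMap f ξ) ≫ (h.vertLawIso f E').hom =
      (h.vertLawIso f E).hom ≫ Q.cl.pullMap f (h.tMap ξ) := by
  refine Q.cl.hom_ext f ?_
  rw [comp_vertLaw_lift, Q.cl.comp_pullMap_lift, vertLaw_lift, inc_tMap, inc_tMap, ← tArr_comp,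
    ← tArr_comp, Q.cl.pullMap_lift]

theorem vertLaw_p : (h.vertLawIso f E).hom ≫ Q.cl.pullMap f (h.vp E) = h.vp (Q.cl.pull f E) := by
  refine Q.cl.hom_ext f ?_
  rw [Q.cl.comp_pullMap_lift, vertLaw_lift, tArr_vp]

theorem vertLaw_z : h.vz (Q.cl.pull f E) ≫ (h.vertLawIso f E).hom = Q.cl.pullMap f (h.vz E) := by
  refine Q.cl.hom_ext f ?_
  rw [Q.cl.pullMap_lift, comp_vertLaw_lift, vz_tArr]

theorem vertLaw₂_lift {Y : Q.tot.p.Fiber A} (k : Y ⟶ h.tObj (h.tObj (Q.cl.pull f E))) :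
    (inc Q.tot.p A).map (k ≫ h.tMap (h.vertLawIso f E).hom ≫
        (h.vertLawIso f (h.tObj E)).hom) ≫ Q.cl.lift f (h.tObj (h.tObj E)) =
      (inc Q.tot.p A).map k ≫ h.tArr (h.tArr (Q.cl.lift f E)) := by
  rw [← assoc k, comp_vertLaw_lift, fmap_comp, assoc, inc_tMap, ← tArr_comp, vertLaw_lift]

theorem vertLaw_l : h.vl (Q.cl.pull f E) ≫ h.tMap (h.vertLawIso f E).hom ≫
      (h.vertLawIso f (h.tObj E)).hom = (h.vertLawIso f E).hom ≫ Q.cl.pullMap f (h.vl E) := by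
  refine Q.cl.hom_ext f ?_
  rw [vertLaw₂_lift, Q.cl.comp_pullMap_lift, vertLaw_lift, vl_tArr]

theorem vertLaw_c : h.vc (Q.cl.pull f E) ≫ h.tMap (h.vertLawIso f E).hom ≫
      (h.vertLawIso f (h.tObj E)).hom = h.tMap (h.vertLawIso f E).hom ≫
        (h.vertLawIso f (h.tObj E)).hom ≫ Q.cl.pullMap f (h.vc E) := by
  refine Q.cl.hom_ext f ?_
  rw [vertLaw₂_lift, ← assoc (h.tMap _), Q.cl.comp_pullMap_lift, comp_vertLaw_lift,
    inc_tMap, ← tArr_comp, vertLaw_lift, vc_tArr]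

theorem comp_vert₂_lift {Y : Q.tot.p.Fiber A} (g₂ : Y ⟶ Q.cl.pull f (h.fibreT₂ E))
    (m : Q.D.T₂ E.1 ⟶ Q.D.T.obj E.1) (hm : h.total.zz E.1 ≫ m = Q.D.z E.1)
    (k : Y ⟶ h.tObj (Q.cl.pull f E))
    (hk : g₂ ≫ Q.cl.pullMap f (h.vert₂ E m hm) = k ≫ (h.vertLawIso f E).hom) :
    ((inc Q.tot.p A).map g₂ ≫ Q.cl.lift f (h.fibreT₂ E)) ≫ h.zzLift E ≫ m =
      (inc Q.tot.p A).map k ≫ h.tArr (Q.cl.lift f E) :=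
  (Q.cl.comp_pullMap_lift f g₂ (h.vert₂ E m hm)).symm.trans ((congrArg (fun k => (inc Q.tot.p A).map
    k ≫ Q.cl.lift f (h.tObj E)) hk).trans (h.comp_vertLaw_lift f E k))

theorem vertLaw_s (g₂ : h.fibreT₂ (Q.cl.pull f E) ⟶ Q.cl.pull f (h.fibreT₂ E))
    (h1 : g₂ ≫ Q.cl.pullMap f ((h.vertTangent A').π₁ E) =
      (h.vertTangent A).π₁ (Q.cl.pull f E) ≫ (h.vertLawIso f E).hom)
    (h2 : g₂ ≫ Q.cl.pullMap f ((h.vertTangent A').π₂ E) =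
      (h.vertTangent A).π₂ (Q.cl.pull f E) ≫ (h.vertLawIso f E).hom) :
    h.vert₂ (Q.cl.pull f E) (Q.D.s _) (h.total.zz_s _) ≫ (h.vertLawIso f E).hom =
      g₂ ≫ Q.cl.pullMap f (h.vert₂ E (Q.D.s E.1) (h.total.zz_s E.1)) := by
  refine Q.cl.hom_ext f ?_
  rw [comp_vertLaw_lift, Q.cl.comp_pullMap_lift]
  have e1 := h.comp_vert₂_lift f E g₂ _ (h.total.zz_fst E.1) _ h1
  have e2 := h.comp_vert₂_lift f E g₂ _ (h.total.zz_snd E.1) _ h2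
  have key := h.total.s_nat (Q.cl.lift f E) ((h.zzIso (Q.cl.pull f E)).inv ≫
    ((inc Q.tot.p A).map g₂ ≫ Q.cl.lift f (h.fibreT₂ E)) ≫ h.zzLift E)
    (by
      refine (assoc _ _ _).trans ((Iso.inv_comp_eq _).2 ?_)
      exact (assoc _ _ _).trans (e1.trans (assoc _ _ _)))
    (by
      refine (assoc _ _ _).trans ((Iso.inv_comp_eq _).2 ?_)
      exact (assoc _ _ _).trans (e2.trans (assoc _ _ _)))
  refine (assoc (h.zzLift (Q.cl.pull f E)) _ _).trans ?_
  refine (congrArg (h.zzLift (Q.cl.pull f E) ≫ ·) (key.trans (assoc _ _ _))).trans ?_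
  exact (Iso.hom_inv_id_assoc (h.zzIso (Q.cl.pull f E)) _).trans (assoc _ _ _)

theorem vertLaw_isTangentMorphism :
    IsTangentMorphism (h.vertTangent A') (h.vertTangent A) (Q.cl.pullFunctor f) .strong
      (h.vertLaw f) := by
  refine ⟨⟨fun ξ => h.vertLaw_natural f ξ, fun E => ⟨?_, ?_, ?_⟩, fun E => h.vertLaw_l f E,
    fun E => h.vertLaw_c f E, h.pullFunctor_preserves f⟩,
    fun E => inferInstanceAs (IsIso (h.vertLawIso f E).hom)⟩
  · exact (h.vertLaw_p f E).trans (comp_id _).symm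
  · exact (h.vertLaw_z f E).trans (id_comp _).symm
  · exact fun g₂ h1 h2 => h.vertLaw_s f E g₂ h1 h2

end

theorem vertLaw_mapId (A : X) (E : Q.tot.p.Fiber A) :
    (h.vertLawIso (𝟙 A) E).hom ≫ (Q.cl.unit (h.tObj E)).hom = h.tMap (Q.cl.unit E).hom := by
  refine (inc Q.tot.p A).map_injective ?_
  rw [fmap_comp, Q.cl.unit_hom, vertLaw_lift, inc_tMap, Q.cl.unit_hom]

theorem vertLaw_mapComp {A A' A'' : X} (f : A ⟶ A') (g : A' ⟶ A'') (E : Q.tot.p.Fiber A'') :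
    (h.vertLawIso (f ≫ g) E).hom ≫ (Q.cl.compositor f g (h.tObj E)).hom =
      h.tMap (Q.cl.compositor f g E).hom ≫ (h.vertLawIso f (Q.cl.pull g E)).hom ≫
        Q.cl.pullMap f (h.vertLawIso g E).hom := by
  refine vert_ext (f ≫ g) _ (isStronglyCartesian_comp (Q.cl.cartesian f (Q.cl.pull g (h.tObj E)))
    (Q.cl.cartesian g (h.tObj E))) ?_
  rw [fmap_comp, assoc, Q.cl.compositor_hom, vertLaw_lift, ← assoc, ← assoc (h.tMap _),
    Q.cl.comp_pullMap_lift, comp_vertLaw_lift, assoc, assoc, vertLaw_lift, inc_tMap, ← tArr_comp, ←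
    tArr_comp, Q.cl.compositor_hom]

end RawFibration.IsTangent

end StrictFibres

section StrictFibreFunctor

variable {X : Type u} [Category.{u} X] {Q Q' Q'' : RawFibration.{u, u, u, u} X}
  (h : Q.IsTangent (triv X)) (h' : Q'.IsTangent (triv X))

/-- The indexed tangent category of fibres, with the restrictions of `T'`. -/
def vertIndexed (h : Q.IsTangent (triv X)) :
    RawIndexed.{u, u, u, u} X where
  J := Q.cl.fibres
  D A := h.vertTangent A
  α f := h.vertLaw f

theorem vertIndexed_isTangent : (vertIndexed h).IsTangent (triv X) where
  base := h.base
  fibre A := h.vertTangent_isTangent A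
  strong f := h.vertLaw_isTangentMorphism f
  mapId A E := (h.vertLaw_mapId A E).trans (comp_id _).symm
  mapComp f g E := h.vertLaw_mapComp f g E

/-- The restrictions of a distributive law to the fibres. -/
def vertMorphismLaw : ∀ {o : Bool} {F : BasedFunctor Q.tot Q'.tot}
    {β : Law o Q.D Q'.D F.toFunctor}, IsFibrationLaw (triv X) F β → ∀ A : X,
    Law o (h.vertTangent A) (h'.vertTangent A) (fibreRestrict F A)
  | false, _, β, hF, _ => fun E => ⟨β E.1, hF.isHomLift_lax E⟩
  | true, _, β, hF, _ => fun E => ⟨β E.1, hF.isHomLift_colax E⟩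

theorem vertMorphismLaw_isNatural : ∀ {o : Bool} {F : BasedFunctor Q.tot Q'.tot}
    {β : Law o Q.D Q'.D F.toFunctor} (hF : IsFibrationLaw (triv X) F β) (A : X),
    (vertMorphismLaw h h' hF A).IsNatural
  | false, _, _, hF, _ => fun ξ => Subtype.ext (hF.natural ξ.1)
  | true, _, _, hF, _ => fun ξ => Subtype.ext (hF.natural ξ.1)

theorem vertMorphismLaw_isLax {F : BasedFunctor Q.tot Q'.tot}
    {β : Law false Q.D Q'.D F.toFunctor} (hF : IsFibrationLaw (triv X) F β) (A : X)
    (H : IsLaxMorphism Q.D Q'.D F.toFunctor β) :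
    IsLaxMorphism (h.vertTangent A) (h'.vertTangent A) (fibreRestrict F A)
      (vertMorphismLaw h h' hF A) :=
  isLaxMorphism_of_jointlyReflects (F := fibreRestrict F A) (jointlyReflects_inc A)
    (fun _ => h.incStrong A) (fun _ => h'.incStrong A) (fun _ => h'.total) (F' := fun _ => F.toFunctor)
    (fun _ E => Iso.refl (F.obj E.1))
    (fun _ {E E'} f => (comp_id (F.map f.1)).trans (id_comp (F.map f.1)).symm)
    (fun _ => H) (fun _ E => by
      change β E.1 = 𝟙 _ ≫ F.map (𝟙 _) ≫ β E.1 ≫ Q'.D.T.map (𝟙 _) ≫ 𝟙 _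
      refine Eq.symm ((id_comp _).trans ?_)
      refine (congrArg (fun t => t ≫ β E.1 ≫ Q'.D.T.map (𝟙 _) ≫ 𝟙 _) (F.map_id _)).trans ?_
      refine (id_comp _).trans ((congrArg (β E.1 ≫ ·) ?_).trans (comp_id _))
      exact (comp_id _).trans (Q'.D.T.map_id _))

theorem vertMorphismLaw_isColax {F : BasedFunctor Q.tot Q'.tot}
    {β : Law true Q.D Q'.D F.toFunctor} (hF : IsFibrationLaw (triv X) F β) (A : X)
    (H : IsColaxMorphism Q.D Q'.D F.toFunctor β) :
    IsColaxMorphism (h.vertTangent A) (h'.vertTangent A) (fibreRestrict F A)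
      (vertMorphismLaw h h' hF A) :=
  isColaxMorphism_of_jointlyReflects (F := fibreRestrict F A) (jointlyReflects_inc A) (fun _ =>
    h.total) (fun _ => h.incStrong A) (fun _ => h.inc_preserves A) (fun _ => h'.incStrong A) (fun _
    => h'.total) (F' := fun _ => F.toFunctor) (fun _ E => Iso.refl (F.obj E.1)) (fun _ {E E'} f =>
    (comp_id (F.map f.1)).trans (id_comp (F.map f.1)).symm)
    (fun _ => H) (fun _ E => by
      change β E.1 = 𝟙 _ ≫ Q'.D.T.map (𝟙 _) ≫ β E.1 ≫ F.map (𝟙 _) ≫ 𝟙 _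
      refine Eq.symm ((id_comp _).trans ?_)
      refine (congrArg (fun t => t ≫ β E.1 ≫ F.map (𝟙 _) ≫ 𝟙 _) (Q'.D.T.map_id _)).trans ?_
      refine (id_comp _).trans ((congrArg (β E.1 ≫ ·) ?_).trans (comp_id _))
      exact (comp_id _).trans (F.map_id _))

theorem isIso_of_isIso_inc {C : Type u} [Category.{u} C] {P : C ⥤ X} {A : X} {E E' : P.Fiber A}
    (ξ : E ⟶ E') (hξ : IsIso ((inc P A).map ξ)) : IsIso ξ := by
  have := ξ.2
  have : IsIso ξ.1 := hξ
  exact ⟨⟨inv ξ.1, IsHomLift.lift_id_inv_isIso P A ξ.1⟩, Subtype.ext (IsIso.hom_inv_id ξ.1),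
    Subtype.ext (IsIso.inv_hom_id ξ.1)⟩

theorem vertMorphismLaw_isTangentMorphism : ∀ {fl : Flavour} {F : BasedFunctor Q.tot Q'.tot}
    {β : Law fl.isColax Q.D Q'.D F.toFunctor} (hF : IsFibrationLaw (triv X) F β)
    (A : X), IsTangentMorphism Q.D Q'.D F.toFunctor fl β →
    IsTangentMorphism (h.vertTangent A) (h'.vertTangent A) (fibreRestrict F A) fl
      (vertMorphismLaw h h' hF A)
  | .lax, _, _, hF, A, H => vertMorphismLaw_isLax h h' hF A H
  | .colax, _, _, hF, A, H => vertMorphismLaw_isColax h h' hF A H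
  | .strong, _, _, hF, A, H => ⟨vertMorphismLaw_isColax h h' hF A H.1,
      fun E => isIso_of_isIso_inc _ (H.2 E.1)⟩
  | .strict, F, β, hF, A, H => by
    obtain ⟨H, e, he⟩ := H
    refine ⟨vertMorphismLaw_isColax h h' hF A H, fun E => Subtype.ext (e E.1), fun E => ?_⟩
    refine Subtype.ext ((he E.1).trans ?_)
    have key : ∀ {Y Z : Q'.tot.p.Fiber A} (w : Y = Z) (w' : Y.1 = Z.1),
        eqToHom w' = (eqToHom w).1 := by
      rintro Y _ rfl w'
      rfl
    exact @key (h'.tObj ((fibreRestrict F A).obj E)) ((fibreRestrict F A).obj (h.tObj E)) _ _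

section

variable {F : BasedFunctor Q.tot Q'.tot}
  (hc : ∀ {A A' : X} {f : A ⟶ A'} {E E' : Q.tot.obj} {φ : E ⟶ E'},
    Q.tot.p.IsStronglyCartesian f φ → Q'.tot.p.IsStronglyCartesian f (F.map φ))

theorem vertMorphismLaw_coherent_lax (μ : ∀ {A : X} (E : Q.tot.p.Fiber A),
      (fibreRestrict F A).obj (h.tObj E) ⟶ h'.tObj ((fibreRestrict F A).obj E))
    (hμ : ∀ {A A' : X} {E : Q.tot.p.Fiber A} {E' : Q.tot.p.Fiber A'}
      (φ : (inc Q.tot.p A).obj E ⟶ (inc Q.tot.p A').obj E'),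
      fibreMap F (h.tArr φ) ≫ (inc _ A').map (μ E') =
        (inc _ A).map (μ E) ≫ h'.tArr (fibreMap F φ)) {A A' : X} (f : A ⟶ A')
    (E : Q.tot.p.Fiber A') : (fibreRestrict F A).map (h.vertLawIso f E).hom ≫
        (fibreDistributor Q.cl Q'.cl F hc f (h.tObj E)).hom ≫ Q'.cl.pullMap f (μ E) =
      μ (Q.cl.pull f E) ≫ h'.tMap (fibreDistributor Q.cl Q'.cl F hc f E).hom ≫
        (h'.vertLawIso f ((fibreRestrict F A').obj E)).hom := by
  refine Q'.cl.hom_ext f ?_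
  rw [← assoc, ← assoc, Q'.cl.comp_pullMap_lift, h'.comp_vertLaw_lift, fmap_comp, fmap_comp, assoc,
    assoc, ← assoc ((inc Q'.tot.p A).map (fibreDistributor _ _ _ _ _ _).hom), fibreDistributor_hom,
    ← assoc, fibreRestrict_inc, fibreMap_comp, h.vertLaw_lift, hμ, h'.inc_tMap, assoc, ←
    h'.tArr_comp, fibreDistributor_hom]

theorem vertMorphismLaw_coherent_colax (μ : ∀ {A : X} (E : Q.tot.p.Fiber A),
      h'.tObj ((fibreRestrict F A).obj E) ⟶ (fibreRestrict F A).obj (h.tObj E))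
    (hμ : ∀ {A A' : X} {E : Q.tot.p.Fiber A} {E' : Q.tot.p.Fiber A'}
      (φ : (inc Q.tot.p A).obj E ⟶ (inc Q.tot.p A').obj E'),
      h'.tArr (fibreMap F φ) ≫ (inc _ A').map (μ E') =
        (inc _ A).map (μ E) ≫ fibreMap F (h.tArr φ)) {A A' : X} (f : A ⟶ A')
    (E : Q.tot.p.Fiber A') : μ (Q.cl.pull f E) ≫ (fibreRestrict F A).map (h.vertLawIso f E).hom ≫
        (fibreDistributor Q.cl Q'.cl F hc f (h.tObj E)).hom =
      h'.tMap (fibreDistributor Q.cl Q'.cl F hc f E).hom ≫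
        (h'.vertLawIso f ((fibreRestrict F A').obj E)).hom ≫ Q'.cl.pullMap f (μ E) := by
  refine Q'.cl.hom_ext f ?_
  rw [← assoc (h'.tMap _), Q'.cl.comp_pullMap_lift, h'.comp_vertLaw_lift, fmap_comp, fmap_comp,
    assoc, assoc, fibreDistributor_hom, fibreRestrict_inc, fibreMap_comp, h.vertLaw_lift, ← hμ,
    h'.inc_tMap, ← h'.tArr_comp, fibreDistributor_hom]

end

theorem vertMorphismLaw_coherent : ∀ {o : Bool} {F : BasedFunctor Q.tot Q'.tot}
    {β : Law o Q.D Q'.D F.toFunctor} (hF : IsFibrationLaw (triv X) F β),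
    IsCoherentLaw (R := vertIndexed h) (R' := vertIndexed h')
      (fibreTrans Q.cl Q'.cl F hF.cartesian) (vertMorphismLaw h h' hF)
  | false, _, _, hF => fun f E => vertMorphismLaw_coherent_lax h h' hF.cartesian
    (fun {A} E => vertMorphismLaw h h' hF A E) (fun φ => hF.natural φ) f E
  | true, _, _, hF => fun f E => vertMorphismLaw_coherent_colax h h' hF.cartesian
    (fun {A} E => vertMorphismLaw h h' hF A E) (fun φ => hF.natural φ) f E

theorem fibreTrans_id (cl : Cleavage Q.tot.p) (hc) :
    fibreTrans cl cl (𝟙 Q.tot : BasedFunctor Q.tot Q.tot) hc = 𝟙 cl.fibres := by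
  refine indx_ext (fun A => rfl) (fun {A A'} f E => ?_)
  rw [Indx.distributor_id]
  refine heq_of_eq (cl.hom_ext f ?_)
  refine (fibreDistributor_hom cl cl (𝟙 Q.tot : BasedFunctor Q.tot Q.tot) hc f E).trans ?_
  exact (id_comp _).symm

theorem fibreTrans_comp (cl : Cleavage Q.tot.p) (cl' : Cleavage Q'.tot.p)
    (cl'' : Cleavage Q''.tot.p) (F : BasedFunctor Q.tot Q'.tot) (G : BasedFunctor Q'.tot Q''.tot)
    (hF) (hG) (hFG) : fibreTrans cl cl'' (F.comp G) hFG =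
      fibreTrans cl cl' F hF ≫ fibreTrans cl' cl'' G hG := by
  refine indx_ext (fun A => rfl) (fun {A A'} f E => ?_)
  rw [Indx.distributor_comp]
  refine heq_of_eq (cl''.hom_ext f ?_)
  refine (fibreDistributor_hom cl cl'' (F.comp G) hFG f E).trans ?_
  have e := fibreDistributor_hom cl' cl'' G hG f ((fibreRestrict F A').obj E)
  refine Eq.trans ?_ (assoc _ _ _).symm
  refine Eq.trans ?_ (congrArg (_ ≫ ·) e.symm)
  exact ((congrArg G.map (fibreDistributor_hom cl cl' F hF f E)).symm).trans (G.map_comp _ _)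

theorem vertMorphismLaw_compat : ∀ {o : Bool} {F G : Q.tot ⟶ Q'.tot}
    {β : Law o Q.D Q'.D F.toFunctor} {γ : Law o Q.D Q'.D G.toFunctor}
    (hF : IsFibrationLaw (triv X) (Q := Q) (Q' := Q') F β)
    (hG : IsFibrationLaw (triv X) (Q := Q) (Q' := Q') G γ) (θ : F ⟶ G),
    β.Compat γ θ.toNatTrans → ∀ A : X,
    (vertMorphismLaw h h' hF A).Compat (vertMorphismLaw h h' hG A) (fibreNat θ A)
  | false, _, _, _, _, _, _, _, H, _ => fun E => Subtype.ext (H E.1)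
  | true, _, _, _, _, _, _, _, H, _ => fun E => Subtype.ext (H E.1)

theorem vertMorphismLaw_id : ∀ {o : Bool} (hF : IsFibrationLaw (triv X) (Q := Q)
    (Q' := Q) (𝟙 Q.tot : BasedFunctor Q.tot Q.tot) (Law.id o Q.D)) (A : X),
    vertMorphismLaw h h hF A = Law.id o (h.vertTangent A)
  | false, _, _ => rfl
  | true, _, _ => rfl

theorem vertMorphismLaw_comp (h'' : Q''.IsTangent (triv X)) : ∀ {o : Bool}
    {F : BasedFunctor Q.tot Q'.tot} {G : BasedFunctor Q'.tot Q''.tot}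
    {β : Law o Q.D Q'.D F.toFunctor} {γ : Law o Q'.D Q''.D G.toFunctor}
    (hF : IsFibrationLaw (triv X) F β)
    (hG : IsFibrationLaw (triv X) G γ)
    (hFG : IsFibrationLaw (triv X) (Q := Q) (Q' := Q'') (F.comp G) (β.comp γ))
    (A : X), vertMorphismLaw h h'' hFG A =
      (vertMorphismLaw h h' hF A).comp (vertMorphismLaw h' h'' hG A)
  | false, _, _, _, _, _, _, _, _ => rfl
  | true, _, _, _, _, _, _, _, _ => rfl

variable {o : Bool}

/-- The fibres of a tangent fibration, as an object of `indDisplayed`. -/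
abbrev vertOb (x : (FibDisp o X).Ob) : (IndDisp o X).Ob :=
  ⟨vertIndexed x.2, vertIndexed_isTangent x.2⟩

variable {x y r : (FibDisp o X).Ob}

/-- The pseudonatural transformation of fibres of a 1-cell. -/
abbrev vertHom {F : x.1.tot ⟶ y.1.tot} (a : (FibDisp o X).Str (x := x) (y := y) F) :
    x.1.cl.fibres ⟶ y.1.cl.fibres :=
  fibreTrans x.1.cl y.1.cl F a.2.cartesian

/-- The distributive laws on the fibres of a 1-cell. -/
abbrev vertStr {F : x.1.tot ⟶ y.1.tot} (a : (FibDisp o X).Str (x := x) (y := y) F) :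
    (IndDisp o X).Str (x := vertOb x) (y := vertOb y) (vertHom a) :=
  ⟨vertMorphismLaw x.2 y.2 a.2, vertMorphismLaw_isNatural x.2 y.2 a.2⟩

theorem vertHom_id (x : (FibDisp o X).Ob) : vertHom ((FibDisp o X).idStr x) = 𝟙 x.1.cl.fibres :=
  fibreTrans_id x.1.cl _

theorem vertStr_id (x : (FibDisp o X).Ob) : HEq (vertStr ((FibDisp o X).idStr x))
      ((IndDisp o X).idStr (vertOb x)) := by
  have k := vertMorphismLaw_id x.2 ((FibDisp o X).idStr x).2
  cases o
  · exact ind_str_heq_lax (R := vertOb x) (R' := vertOb x) (vertHom_id x)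
      (fun A E => heq_of_eq (congrFun (k A) E))
  · exact ind_str_heq_colax (R := vertOb x) (R' := vertOb x) (vertHom_id x)
      (fun A E => heq_of_eq (congrFun (k A) E))

variable {F : x.1.tot ⟶ y.1.tot} {G : y.1.tot ⟶ r.1.tot} (a : (FibDisp o X).Str (x := x) (y := y) F)
  (b : (FibDisp o X).Str (x := y) (y := r) G)

theorem vertHom_comp : vertHom ((FibDisp o X).compStr a b) = vertHom a ≫ vertHom b :=
  fibreTrans_comp x.1.cl y.1.cl r.1.cl F G a.2.cartesian b.2.cartesian _

theorem vertStr_comp : HEq (vertStr ((FibDisp o X).compStr a b))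
      ((IndDisp o X).compStr (x := vertOb x)
        (y := vertOb y) (t := vertOb r) (vertStr a) (vertStr b)) := by
  have k := vertMorphismLaw_comp x.2 y.2 r.2 a.2 b.2
    ((FibDisp o X).compStr a b).2
  cases o
  · exact ind_str_heq_lax (R := vertOb x) (R' := vertOb r) (vertHom_comp a b)
      (fun A E => heq_of_eq (congrFun (k A) E))
  · exact ind_str_heq_colax (R := vertOb x) (R' := vertOb r) (vertHom_comp a b)
      (fun A E => heq_of_eq (congrFun (k A) E))

theorem vertStr_generated (fl : Flavour)
    {x y : (FibDisp fl.isColax X).Ob}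
    {F : x.1.tot ⟶ y.1.tot}
    {a : (FibDisp fl.isColax X).Str (x := x) (y := y) F}
    (ha : FibGen fl a) :
    IndGen fl (x := vertOb x) (y := vertOb y) (vertStr a) :=
  Generated.map (D := FibDisp fl.isColax X) (D' := IndDisp fl.isColax X) (W' := fun {R R' κ} β =>
    IsIndexedMorphism (R := R.1) (R' := R'.1) fl κ β.1) vertOb (fun a => ⟨vertHom a, vertStr a⟩)
    (fun {x y _} a ha => .of _ ⟨fun A => vertMorphismLaw_isTangentMorphism x.2 y.2 a.2 A ha,
    vertMorphismLaw_coherent x.2 y.2 a.2⟩) (fun x => Sigma.ext (vertHom_id x) (vertStr_id x)) (fun a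
    b => Sigma.ext (vertHom_comp a b) (vertStr_comp a b)) ha

variable (X) (fl : Flavour)

/-- The strict 2-functor of fibres, with the restrictions of the total tangent bundle functor. -/
def vertFunctor : StrictPseudofunctor (TngFib.{u, u, u, u} fl (triv X))
      (IndxTng.{u, u, u, u} fl (triv X)) :=
  strictFunctor (fibDisplayed_isStrict _ _ _) (indDisplayed_isStrict _ _ _)
    { obj := fun Q => ⟨vertOb Q.obj⟩
      map := fun F => Total.Hom.mk (vertHom F.str) (vertStr F.str)
        (vertStr_generated fl F.gen)
      map₂ := fun {Q Q' F G} θ => Total.Hom₂.mk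
        (fibreModification Q.obj.1.cl Q'.obj.1.cl F.str.2.cartesian G.str.2.cartesian θ.cell)
        (fun A => vertMorphismLaw_compat Q.obj.2 Q'.obj.2 F.str.2 G.str.2 θ.cell θ.two A) }
    (fun _ => Total.hom₂_ext (modification_ext fun _ _ => rfl))
    (fun _ _ => Total.hom₂_ext (modification_ext fun _ _ => rfl))
    (fun Q => Total.hom_ext (vertHom_id Q.obj) (vertStr_id Q.obj))
    (fun F G => Total.hom_ext (vertHom_comp F.str G.str) (vertStr_comp F.str G.str))
    (fun F G H _ => Total.heq_cell (Total.hom_ext (vertHom_comp F.str G.str) (vertStr_comp F.str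
      G.str)) (Total.hom_ext (vertHom_comp F.str H.str) (vertStr_comp F.str H.str))
      (modification_heq (vertHom_comp F.str G.str) (vertHom_comp F.str H.str) (fun _ _ => HEq.rfl)))
    (fun {_ _ _ F G} _ H => Total.heq_cell (Total.hom_ext (vertHom_comp F.str H.str) (vertStr_comp
      F.str H.str)) (Total.hom_ext (vertHom_comp G.str H.str) (vertStr_comp G.str H.str))
      (modification_heq (vertHom_comp F.str H.str) (vertHom_comp G.str H.str) (fun _ _ => HEq.rfl)))

end StrictFibreFunctor

section IndxConstructors

variable {X : Type u} [Category.{v} X] {J J' : Indx.{v, v', u, u'} X}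

/-- The natural transformation `𝟙^* ⟶ 𝟭` of an indexed category. -/
abbrev Indx.unit (J : Indx.{v, v', u, u'} X) {A : X} (E : J.fib A) : (J.sub (𝟙 A)).obj E ⟶ E :=
  (J.mapId ⟨op A⟩).hom.toNatTrans.app E

/-- The natural transformation `(f ≫ g)^* ⟶ f^* g^*` of an indexed category. -/
abbrev Indx.compositor (J : Indx.{v, v', u, u'} X) {A A' A'' : X} (f : A ⟶ A') (g : A' ⟶ A'')
    (E : J.fib A'') : (J.sub (f ≫ g)).obj E ⟶ (J.sub f).obj ((J.sub g).obj E) :=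
  (J.mapComp g.op.toLoc f.op.toLoc).hom.toNatTrans.app E

/-- A pseudonatural transformation of indexed categories from its components. -/
def Indx.mkTrans (F : ∀ A : X, J.fib A ⥤ J'.fib A) (d : ∀ {A A' : X} (f : A ⟶ A') (E : J.fib A'),
      (F A).obj ((J.sub f).obj E) ≅ (J'.sub f).obj ((F A').obj E))
    (d_nat : ∀ {A A' : X} (f : A ⟶ A') {E E' : J.fib A'} (ξ : E ⟶ E'),
      (F A).map ((J.sub f).map ξ) ≫ (d f E').hom = (d f E).hom ≫ (J'.sub f).map ((F A').map ξ))
    (d_id : ∀ {A : X} (E : J.fib A), (d (𝟙 A) E).hom ≫ J'.unit ((F A).obj E) = (F A).map (J.unit E))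
    (d_comp : ∀ {A A' A'' : X} (f : A ⟶ A') (g : A' ⟶ A'') (E : J.fib A''),
      (d (f ≫ g) E).hom ≫ J'.compositor f g ((F A'').obj E) =
        (F A).map (J.compositor f g E) ≫ (d f ((J.sub g).obj E)).hom ≫
          (J'.sub f).map (d g E).hom) : J ⟶ J' :=
  Pseudofunctor.StrongTrans.mk (F := J) (G := J') (fun A => (F A.as.unop).toCatHom) (fun f =>
    Cat.Hom.isoMk (NatIso.ofComponents (fun E => d f.as.unop E) (fun ξ => d_nat f.as.unop ξ)))
    (fun {A A'} f g η => by
      obtain rfl := LocallyDiscrete.eq_of_hom η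
      have e : η = 𝟙 f := Subsingleton.elim _ _
      subst e
      rw [J.map₂_id, J'.map₂_id]
      refine ((congrArg (· ≫ _) (id_whiskerRight _ _)).trans (id_comp _)).trans ?_
      exact ((congrArg (_ ≫ ·) (whiskerLeft_id _ _)).trans (comp_id _)).symm)
    (fun A => by
      apply Cat.Hom₂.ext
      ext E
      refine Eq.trans (d_id E) ?_
      exact ((congrArg _ (comp_id _)).trans (comp_id _)).symm)
    (fun f g => by
      apply Cat.Hom₂.ext
      ext E
      refine Eq.trans (d_comp g.as.unop f.as.unop E) ?_
      change _ = (F _).map (J.compositor g.as.unop f.as.unop E) ≫ 𝟙 _ ≫ (d g.as.unop ((J.sub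
        f.as.unop).obj E)).hom ≫ 𝟙 _ ≫ (J'.sub g.as.unop).map (d f.as.unop E).hom ≫ 𝟙 _
      rw [id_comp, id_comp]
      refine congrArg (_ ≫ ·) (congrArg (_ ≫ ·) (comp_id _).symm))

/-- A modification of pseudonatural transformations of indexed categories from its components. -/
def Indx.mkModification {κ κ' : J ⟶ J'}
    (m : ∀ A : X, ∀ E : J.fib A, (Indx.functor κ A).obj E ⟶ (Indx.functor κ' A).obj E)
    (m_nat : ∀ (A : X) {E E' : J.fib A} (ξ : E ⟶ E'),
      (Indx.functor κ A).map ξ ≫ m A E' = m A E ≫ (Indx.functor κ' A).map ξ)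
    (m_sub : ∀ {A A' : X} (f : A ⟶ A') (E : J.fib A'),
      m A ((J.sub f).obj E) ≫ (Indx.distributor κ' f E).hom =
        (Indx.distributor κ f E).hom ≫ (J'.sub f).map (m A' E)) : κ ⟶ κ' :=
  ⟨{app := fun A => ({ app := fun E => m A.as.unop E
                       naturality := fun _ _ ξ => m_nat A.as.unop ξ } :
        Indx.functor κ A.as.unop ⟶ Indx.functor κ' A.as.unop).toCatHom₂
    naturality := fun f => by
      apply Cat.Hom₂.ext
      ext E
      exact m_sub f.as.unop E}⟩

theorem Indx.component_naturality {κ κ' : J ⟶ J'} (m : κ ⟶ κ') {A A' : X} (f : A ⟶ A')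
    (E : J.fib A') : (Indx.component m A).app ((J.sub f).obj E) ≫ (Indx.distributor κ' f E).hom =
      (Indx.distributor κ f E).hom ≫ (J'.sub f).map ((Indx.component m A').app E) :=
  congrArg (fun t => t.toNatTrans.app E) (m.as.naturality f.op.toLoc)

theorem Indx.distributor_naturality (κ : J ⟶ J') {A A' : X} (f : A ⟶ A') {E E' : J.fib A'}
    (ξ : E ⟶ E') : (Indx.functor κ A).map ((J.sub f).map ξ) ≫ (Indx.distributor κ f E').hom =
      (Indx.distributor κ f E).hom ≫ (J'.sub f).map ((Indx.functor κ A').map ξ) :=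
  (Cat.Hom.toNatIso (κ.naturality f.op.toLoc)).hom.naturality ξ

theorem Indx.distributor_unit (κ : J ⟶ J') {A : X} (E : J.fib A) :
    (Indx.distributor κ (𝟙 A) E).hom ≫ J'.unit ((Indx.functor κ A).obj E) =
      (Indx.functor κ A).map (J.unit E) := by
  have h := congrArg (fun t => t.toNatTrans.app E) (κ.naturality_id ⟨op A⟩)
  refine h.trans ?_
  change (Indx.functor κ A).map (J.unit E) ≫ 𝟙 _ ≫ 𝟙 _ = _
  exact (congrArg _ (comp_id _)).trans (comp_id _)

theorem Indx.distributor_compositor (κ : J ⟶ J') {A A' A'' : X} (f : A ⟶ A') (g : A' ⟶ A'')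
    (E : J.fib A'') :
    (Indx.distributor κ (f ≫ g) E).hom ≫ J'.compositor f g ((Indx.functor κ A'').obj E) =
      (Indx.functor κ A).map (J.compositor f g E) ≫ (Indx.distributor κ f ((J.sub g).obj E)).hom ≫
          (J'.sub f).map (Indx.distributor κ g E).hom := by
  have h := congrArg (fun t => t.toNatTrans.app E) (κ.naturality_comp g.op.toLoc f.op.toLoc)
  refine h.trans ?_
  change (Indx.functor κ A).map (J.compositor f g E) ≫ 𝟙 _ ≫ (Indx.distributor κ f ((J.sub g).obj
        E)).hom ≫ 𝟙 _ ≫ (J'.sub f).map (Indx.distributor κ g E).hom ≫ 𝟙 _ = _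
  rw [id_comp, id_comp, comp_id]

end IndxConstructors

section FibrePowerTransformation

variable {X : Type u} [Category.{v} X] {D : TangentData X} {R : RawIndexed.{v, v', u, u'} X}

namespace RawIndexed.IsTangent

theorem law_nat (h : R.IsTangent D) {A A' : X} (f : A ⟶ A') {E E' : R.J.fib A'} (ξ : E ⟶ E') :
    (R.D A).T.map ((R.J.sub f).map ξ) ≫ (h.lawIso f E').hom =
      (h.lawIso f E).hom ≫ (R.J.sub f).map ((R.D A').T.map ξ) :=
  (h.strong f).1.natural ξ

theorem law_p (h : R.IsTangent D) {A A' : X} (f : A ⟶ A') (E : R.J.fib A') :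
    (h.lawIso f E).hom ≫ (R.J.sub f).map ((R.D A').p E) = (R.D A).p ((R.J.sub f).obj E) :=
  ((h.strong f).1.additive E).q.trans (comp_id _)

theorem law_unit (h : R.IsTangent D) {A : X} (E : R.J.fib A) :
    (h.lawIso (𝟙 A) E).hom ≫ R.J.unit ((R.D A).T.obj E) = (R.D A).T.map (R.J.unit E) :=
  (h.mapId A E).trans (comp_id _)

theorem law_compositor (h : R.IsTangent D) {A A' A'' : X} (f : A ⟶ A') (g : A' ⟶ A'')
    (E : R.J.fib A'') : (h.lawIso (f ≫ g) E).hom ≫ R.J.compositor f g ((R.D A'').T.obj E) =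
      (R.D A).T.map (R.J.compositor f g E) ≫ (h.lawIso f ((R.J.sub g).obj E)).hom ≫
        (R.J.sub f).map (h.lawIso g E).hom :=
  h.mapComp f g E

variable {n : ℕ} {P : ∀ A : X, R.J.fib A → R.J.fib A}
  {pr : ∀ (A : X) (E : R.J.fib A), Fin (n + 1) → (P A E ⟶ (R.D A).T.obj E)}
  (h : R.IsTangent D) (hP : ∀ A E, IsFibrePower ((R.D A).p E) (pr A E))

theorem isFibrePower_sub (h : R.IsTangent D)
    (hP : ∀ A E, IsFibrePower ((R.D A).p E) (pr A E)) {A A' : X} (f : A ⟶ A') (E : R.J.fib A') :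
    IsFibrePower ((R.D A).p ((R.J.sub f).obj E))
      (fun i => (R.J.sub f).map (pr A' E i) ≫ (h.lawIso f E).inv) :=
  ((h.strong f).1.preserves.power E _ (hP A' E)).of_iso (h.lawIso f E).symm (Iso.refl _) (Iso.refl
    _) ((comp_id _).trans ((Iso.eq_inv_comp _).2 (h.law_p f E))) (fun _ => (id_comp _).symm)

include h hP in
theorem power_map_comm {A : X} {E E' : R.J.fib A} (ξ : E ⟶ E') (i j) :
    (pr A E i ≫ (R.D A).T.map ξ) ≫ (R.D A).p E' = (pr A E j ≫ (R.D A).T.map ξ) ≫ (R.D A).p E' := by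
  rw [assoc, assoc, (h.fibre A).p_nat, ← assoc, (hP A E).comm i j, assoc]

/-- The functor of fibre powers. -/
def powerFunctor (A : X) : R.J.fib A ⥤ R.J.fib A where
  obj E := P A E
  map {E E'} ξ := (hP A E').desc (fun i => pr A E i ≫ (R.D A).T.map ξ) (h.power_map_comm hP ξ)
  map_id E := (hP A E).hom_ext fun i => by
    rw [(hP A E).desc_pr, fmap_id, comp_id, id_comp]
  map_comp {E E' E''} ξ ξ' := (hP A E'').hom_ext fun i => by
    rw [(hP A E'').desc_pr, assoc, (hP A E'').desc_pr, ← assoc, (hP A E').desc_pr, assoc, fmap_comp]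

/-- The projections of the functor of fibre powers. -/
def prj {A : X} (E : R.J.fib A) (i : Fin (n + 1)) :
    (h.powerFunctor hP A).obj E ⟶ (R.D A).T.obj E := pr A E i

theorem prj_ext {A : X} {E Y : R.J.fib A} {k k' : Y ⟶ (h.powerFunctor hP A).obj E}
    (e : ∀ i, k ≫ h.prj hP E i = k' ≫ h.prj hP E i) : k = k' :=
  (hP A E).hom_ext e

theorem powerFunctor_prj {A : X} {E E' : R.J.fib A} (ξ : E ⟶ E') (i) :
    (h.powerFunctor hP A).map ξ ≫ h.prj hP E' i = h.prj hP E i ≫ (R.D A).T.map ξ :=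
  (hP A E').desc_pr (fun i => pr A E i ≫ (R.D A).T.map ξ) (h.power_map_comm hP ξ) i

theorem isFibrePower_prj {A : X} (E : R.J.fib A) : IsFibrePower ((R.D A).p E) (h.prj hP E) :=
  hP A E

/-- The distributors of the functors of fibre powers. -/
def powerIso {A A' : X} (f : A ⟶ A') (E : R.J.fib A') :
    (h.powerFunctor hP A).obj ((R.J.sub f).obj E) ≅
      (R.J.sub f).obj ((h.powerFunctor hP A').obj E) :=
  (hP A ((R.J.sub f).obj E)).iso (h.isFibrePower_sub hP f E)

theorem powerIso_prj {A A' : X} (f : A ⟶ A') (E : R.J.fib A') (i) :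
    (h.powerIso hP f E).hom ≫ (R.J.sub f).map (h.prj hP E i) =
      h.prj hP ((R.J.sub f).obj E) i ≫ (h.lawIso f E).hom := by
  have e : (h.powerIso hP f E).hom ≫ (R.J.sub f).map (h.prj hP E i) ≫ (h.lawIso f E).inv =
      h.prj hP ((R.J.sub f).obj E) i :=
    (hP A ((R.J.sub f).obj E)).iso_hom_pr (h.isFibrePower_sub hP f E) i
  rw [← e, assoc, assoc, Iso.inv_hom_id, comp_id]

theorem power_sub_ext {A A' : X} (f : A ⟶ A') (E : R.J.fib A') {Y : R.J.fib A}
    {k k' : Y ⟶ (R.J.sub f).obj ((h.powerFunctor hP A').obj E)}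
    (e : ∀ i, k ≫ (R.J.sub f).map (h.prj hP E i) = k' ≫ (R.J.sub f).map (h.prj hP E i)) :
    k = k' :=
  ((h.strong f).1.preserves.power E _ (hP A' E)).hom_ext e

theorem power_sub_sub_ext {A A' A'' : X} (f : A ⟶ A') (g : A' ⟶ A'') (E : R.J.fib A'')
    {Y : R.J.fib A}
    {k k' : Y ⟶ (R.J.sub f).obj ((R.J.sub g).obj ((h.powerFunctor hP A'').obj E))}
    (e : ∀ i, k ≫ (R.J.sub f).map ((R.J.sub g).map (h.prj hP E i)) =
      k' ≫ (R.J.sub f).map ((R.J.sub g).map (h.prj hP E i))) : k = k' := by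
  have hp : IsFibrePower _
      (fun i => (R.J.sub f).map ((R.J.sub g).map (h.prj hP E i) ≫ (h.lawIso g E).inv)) :=
    (h.strong f).1.preserves.power _ _ (h.isFibrePower_sub hP g E)
  refine hp.hom_ext fun i => ?_
  rw [fmap_comp, ← assoc, e i, assoc]

theorem powerIso_unit {A : X} (E : R.J.fib A) :
    (h.powerIso hP (𝟙 A) E).hom ≫ R.J.unit ((h.powerFunctor hP A).obj E) =
      (h.powerFunctor hP A).map (R.J.unit E) := by
  refine h.prj_ext hP fun i => ?_
  have n : (R.J.sub (𝟙 A)).map (h.prj hP E i) ≫ R.J.unit ((R.D A).T.obj E) =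
      R.J.unit ((h.powerFunctor hP A).obj E) ≫ h.prj hP E i :=
    (R.J.mapId ⟨op A⟩).hom.toNatTrans.naturality (h.prj hP E i)
  rw [powerFunctor_prj, assoc, ← n, ← assoc, powerIso_prj, assoc, law_unit]

theorem powerIso_compositor {A A' A'' : X} (f : A ⟶ A') (g : A' ⟶ A'') (E : R.J.fib A'') :
    (h.powerIso hP (f ≫ g) E).hom ≫ R.J.compositor f g ((h.powerFunctor hP A'').obj E) =
      (h.powerFunctor hP A).map (R.J.compositor f g E) ≫
        (h.powerIso hP f ((R.J.sub g).obj E)).hom ≫ (R.J.sub f).map (h.powerIso hP g E).hom := by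
  refine h.power_sub_sub_ext hP f g E fun i => ?_
  have n : (R.J.sub (f ≫ g)).map (h.prj hP E i) ≫ R.J.compositor f g ((R.D A'').T.obj E) =
      R.J.compositor f g ((h.powerFunctor hP A'').obj E) ≫
        (R.J.sub f).map ((R.J.sub g).map (h.prj hP E i)) :=
    (R.J.mapComp g.op.toLoc f.op.toLoc).hom.toNatTrans.naturality (h.prj hP E i)
  rw [assoc, assoc, assoc, ← fmap_comp, powerIso_prj, fmap_comp, ← assoc (h.powerIso hP f _).hom,
    powerIso_prj, assoc, ← assoc ((h.powerFunctor hP A).map _), powerFunctor_prj, assoc, ← n, ←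
    assoc, powerIso_prj, assoc, law_compositor]

theorem powerIso_naturality {A A' : X} (f : A ⟶ A') {E E' : R.J.fib A'} (ξ : E ⟶ E') :
    (h.powerFunctor hP A).map ((R.J.sub f).map ξ) ≫ (h.powerIso hP f E').hom =
      (h.powerIso hP f E).hom ≫ (R.J.sub f).map ((h.powerFunctor hP A').map ξ) :=
  h.power_sub_ext hP f E' fun i => by
    rw [assoc, powerIso_prj, ← assoc, powerFunctor_prj, assoc, law_nat, assoc, ← fmap_comp,
      powerFunctor_prj, fmap_comp, ← assoc, ← assoc, powerIso_prj]

/-- The pseudonatural transformation of fibre powers. -/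
def powerTrans : R.J ⟶ R.J :=
  Indx.mkTrans (h.powerFunctor hP) (h.powerIso hP) (h.powerIso_naturality hP)
    (h.powerIso_unit hP) (h.powerIso_compositor hP)

/-- The projections of the pseudonatural transformation of fibre powers. -/
def powerProj (i : Fin (n + 1)) : h.powerTrans hP ⟶ h.trans :=
  Indx.mkModification (κ := h.powerTrans hP) (κ' := h.trans) (fun _ E => h.prj hP E i)
    (fun _ {_ _} ξ => h.powerFunctor_prj hP ξ i) (fun f E => (h.powerIso_prj hP f E i).symm)

end RawIndexed.IsTangent

end FibrePowerTransformation

section Assemble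

variable {X : Type u} [Category.{v} X] {D : TangentData X} {R : RawIndexed.{v, v', u, u'} X}

namespace RawIndexed.IsTangent

variable (h : R.IsTangent D)

theorem isFibrePower_T₂ (h : R.IsTangent D) (A : X) (E : R.J.fib A) :
    IsFibrePower ((R.D A).p E) (pairFam ((R.D A).π₁ E) ((R.D A).π₂ E)) :=
  isFibrePower_pairFam ((h.fibre A).pb E)

/-- The objects `T₂ E`, as a pseudonatural transformation. -/
def trans₂ : R.J ⟶ R.J := h.powerTrans h.isFibrePower_T₂

/-- The projections `p`, as a modification. -/
def pMod : h.trans ⟶ 𝟙 R.J :=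
  Indx.mkModification (κ := h.trans) (κ' := 𝟙 R.J) (fun A E => (R.D A).p E)
    (fun A {_ _} ξ => (h.fibre A).p_nat ξ) (fun {A A'} f E => by
      rw [Indx.distributor_id]
      exact (comp_id _).trans (h.law_p f E).symm)

/-- The zero sections, as a modification. -/
def zMod : 𝟙 R.J ⟶ h.trans :=
  Indx.mkModification (κ := 𝟙 R.J) (κ' := h.trans) (fun A E => (R.D A).z E)
    (fun A {_ _} ξ => (h.fibre A).z_nat ξ) (fun {A A'} f E => by
      rw [Indx.distributor_id]
      exact ((h.strong f).1.additive E).zero)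

/-- The sums, as a modification. -/
def sMod : h.trans₂ ⟶ h.trans :=
  Indx.mkModification (κ := h.trans₂) (κ' := h.trans) (fun A E => (R.D A).s E)
    (fun A {_ _} ξ => ((h.fibre A).s_nat ξ _ (h.powerFunctor_prj h.isFibrePower_T₂ ξ 0)
      (h.powerFunctor_prj h.isFibrePower_T₂ ξ 1)).symm)
    (fun f E => ((h.strong f).1.additive E).sum (h.powerIso h.isFibrePower_T₂ f E).hom
      (h.powerIso_prj h.isFibrePower_T₂ f E 0) (h.powerIso_prj h.isFibrePower_T₂ f E 1))

/-- The vertical lifts, as a modification. -/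
def lMod : h.trans ⟶ h.trans ≫ h.trans :=
  Indx.mkModification (κ := h.trans) (κ' := h.trans ≫ h.trans) (fun A E => (R.D A).l E)
    (fun A {_ _} ξ => (h.fibre A).l_nat ξ) (fun f E => by
      rw [Indx.distributor_comp]
      exact (h.strong f).1.lift E)

/-- The canonical flips, as a modification. -/
def cMod : h.trans ≫ h.trans ⟶ h.trans ≫ h.trans :=
  Indx.mkModification (κ := h.trans ≫ h.trans) (κ' := h.trans ≫ h.trans) (fun A E => (R.D A).c E)
    (fun A {_ _} ξ => (h.fibre A).c_nat ξ) (fun {A A'} f E => by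
      rw [Indx.distributor_comp]
      exact ((h.strong f).1.flip E).trans (assoc _ _ _).symm)

/-- The tangent indexed category of an indexed tangent category. -/
def tangentObject : RawTangentObject (Indx.{v, v', u, u'} X) where
  x := R.J
  T := h.trans
  T₂ := h.trans₂
  π₁ := h.powerProj h.isFibrePower_T₂ 0
  π₂ := h.powerProj h.isFibrePower_T₂ 1
  p := h.pMod
  z := h.zMod
  s := h.sMod
  l := h.lMod
  c := h.cMod

end RawIndexed.IsTangent

end Assemble

section ElementsCalculus

open Pseudofunctor CoGrothendieck

variable {X : Type u} [Category.{v} X] {J J' : Indx.{v, v', u, u'} X}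

theorem El.vert_vert (J : Indx.{v, v', u, u'} X) {A : X} {E E' E'' : J.fib A} (ξ : E ⟶ E')
    (ξ' : E' ⟶ E'') : El.vert J ξ ≫ El.vert J ξ' = El.vert J (ξ ≫ ξ') :=
  ((ι J A).map_comp ξ ξ').symm

theorem El.vert_id (J : Indx.{v, v', u, u'} X) {A : X} (E : J.fib A) :
    El.vert J (𝟙 E) = 𝟙 (El.mk J A E) :=
  (ι J A).map_id E

theorem El.map_vert (κ : J ⟶ J') {A : X} {E E' : J.fib A} (ξ : E ⟶ E') :
    (CoGrothendieck.map κ).map (El.vert J ξ) = El.vert J' ((Indx.functor κ A).map ξ) := by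
  have e1 : El.vert J ξ = (⟨𝟙 A, ξ ≫ Hom.fiber (𝟙 (El.mk J A E'))⟩ :
      CoGrothendieck.Hom (El.mk J A E) (El.mk J A E')) :=
    (comp_id _).symm.trans (El.vert_comp J ξ (𝟙 (El.mk J A E')))
  refine (congrArg (CoGrothendieck.map κ).map e1).trans ?_
  refine Eq.trans ?_ ((congrArg (El.vert J' ((Indx.functor κ A).map ξ) ≫ ·)
    ((CoGrothendieck.map κ).map_id (El.mk J A E'))).trans (comp_id _))
  refine Eq.trans ?_ (El.vert_comp J' _ _).symm
  exact congrArg (CoGrothendieck.Hom.mk _)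
    ((congrArg (· ≫ _) ((Indx.functor κ A).map_comp _ _)).trans (assoc _ _ _))

theorem El.map_lift (κ : J ⟶ J') {A A' : X} (f : A ⟶ A') (E : J.fib A') :
    (CoGrothendieck.map κ).map (El.lift J f E) =
      El.vert J' (Indx.distributor κ f E).hom ≫ El.lift J' f ((Indx.functor κ A').obj E) := by
  refine Eq.trans ?_ (El.vert_comp J' _ _).symm
  refine congrArg (CoGrothendieck.Hom.mk _) ?_
  refine ((congrArg (· ≫ _) ((Indx.functor κ A).map_id _)).trans (id_comp _)).trans ?_
  exact (comp_id _).symm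

theorem El.lift_vert (J : Indx.{v, v', u, u'} X) {A A' : X} (f : A ⟶ A') {E E' : J.fib A'}
    (ξ : E ⟶ E') :
    El.lift J f E ≫ El.vert J ξ = El.vert J ((J.sub f).map ξ) ≫ El.lift J f E' := by
  refine (El.comp_vert J _ _).trans (Eq.trans ?_ (El.vert_comp J _ _).symm)
  exact congrArg (CoGrothendieck.Hom.mk _) ((id_comp _).trans (comp_id _).symm)

theorem El.vert_fiber_lift (J : Indx.{v, v', u, u'} X) {e e' : El J} (φ : e ⟶ e') :
    El.vert J φ.fiber ≫ El.lift J φ.base e'.fiber = φ :=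
  (El.vert_comp J _ _).trans (congrArg (CoGrothendieck.Hom.mk _) (comp_id _))

theorem El.exists_hom_of_base {e : El J} {A : X} {E : J.fib A} (φ : e ⟶ El.mk J A E)
    {f : e.base ⟶ A} (hf : φ.base = f) : ∃ y : e.fiber ⟶ (J.sub f).obj E,
      φ = (⟨f, y⟩ : CoGrothendieck.Hom e (El.mk J A E)) := by
  subst hf
  exact ⟨φ.fiber, rfl⟩

theorem El.hom_mk_inj {e : El J} {A : X} {E : J.fib A} {f : e.base ⟶ A}
    {y y' : e.fiber ⟶ (J.sub f).obj E}
    (h : (⟨f, y⟩ : CoGrothendieck.Hom e (El.mk J A E)) = ⟨f, y'⟩) : y = y' := by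
  injection h

theorem El.mk_vert (J : Indx.{v, v', u, u'} X) {e : El J} {A : X} {E E' : J.fib A}
    {f : e.base ⟶ A} (y : e.fiber ⟶ (J.sub f).obj E) (ξ : E ⟶ E') :
    (show e ⟶ El.mk J A E from ⟨f, y⟩) ≫ El.vert J ξ =
      (⟨f, y ≫ (J.sub f).map ξ⟩ : CoGrothendieck.Hom e (El.mk J A E')) :=
  El.comp_vert J _ _

theorem El.isFibrePower_vert {A : X} {E B P : J.fib A} {q : E ⟶ B} {n : ℕ}
    {pr : Fin (n + 1) → (P ⟶ E)}
    (H : ∀ {A' : X} (f : A' ⟶ A), IsFibrePower ((J.sub f).map q) (fun i => (J.sub f).map (pr i)))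
    (h : IsFibrePower q pr) :
    IsFibrePower (El.vert J q) (fun i => El.vert J (pr i)) := by
  refine .mk_of_ext (fun i j => ?_) (fun {e} φ hφ => ?_) (fun {e k k'} hk => ?_)
  · rw [El.vert_vert, El.vert_vert, h.comm i j]
  · have hb : ∀ i, (φ i).base = (φ 0).base := fun i => by
      have := hφ i 0
      rw [El.comp_vert, El.comp_vert] at this
      exact congrArg (fun t : CoGrothendieck.Hom e (El.mk J A B) => t.base) this
    choose y hy using fun i => El.exists_hom_of_base (φ i) (hb i)
    have hyq : ∀ i j, y i ≫ (J.sub (φ 0).base).map q = y j ≫ (J.sub (φ 0).base).map q :=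
      fun i j => El.hom_mk_inj ((El.mk_vert J _ _).symm.trans
        (((congrArg (· ≫ El.vert J q) (hy i)).symm.trans ((hφ i j).trans
          (congrArg (· ≫ El.vert J q) (hy j)))).trans (El.mk_vert J _ _)))
    refine ⟨⟨(φ 0).base, (H (φ 0).base).desc y hyq⟩, fun i => ?_⟩
    exact (El.mk_vert J _ _).trans ((congrArg (CoGrothendieck.Hom.mk _)
      ((H (φ 0).base).desc_pr y hyq i)).trans (hy i).symm)
  · have hb : k'.base = k.base := by
      have := hk 0
      rw [El.comp_vert, El.comp_vert] at this
      exact congrArg (fun t : CoGrothendieck.Hom e (El.mk J A E) => t.base) this.symm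
    obtain ⟨y, hy⟩ := El.exists_hom_of_base k rfl
    obtain ⟨y', hy'⟩ := El.exists_hom_of_base k' hb
    refine hy.trans (Eq.trans ?_ hy'.symm)
    refine congrArg (CoGrothendieck.Hom.mk _) ((H k.base).hom_ext fun i => ?_)
    exact El.hom_mk_inj ((El.mk_vert J _ _).symm.trans
      (((congrArg (· ≫ El.vert J (pr i)) hy).symm.trans ((hk i).trans
        (congrArg (· ≫ El.vert J (pr i)) hy'))).trans (El.mk_vert J _ _)))

theorem isPullback_of_existsUnique {C : Type u} [Category.{v} C] {E E' B P : C} {a : P ⟶ E}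
    {b : P ⟶ E'} {f : E ⟶ B} {g : E' ⟶ B} (w : a ≫ f = b ≫ g)
    (H : ∀ {Y : C} (s : Y ⟶ E) (t : Y ⟶ E'), s ≫ f = t ≫ g →
      ∃! k : Y ⟶ P, k ≫ a = s ∧ k ≫ b = t) : IsPullback a b f g :=
  ⟨⟨w⟩, ⟨Limits.PullbackCone.IsLimit.mk _ (fun s => (H s.fst s.snd s.condition).choose) (fun s => (H
    s.fst s.snd s.condition).choose_spec.1.1) (fun s => (H s.fst s.snd s.condition).choose_spec.1.2)
    (fun s _ h1 h2 => (H s.fst s.snd s.condition).choose_spec.2 _ ⟨h1, h2⟩)⟩⟩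

theorem El.isPullback_vert {A : X} {E E' B P : J.fib A} {a : P ⟶ E} {b : P ⟶ E'} {f : E ⟶ B}
    {g : E' ⟶ B}
    (H : ∀ {A' : X} (k : A' ⟶ A), IsPullback ((J.sub k).map a) ((J.sub k).map b)
      ((J.sub k).map f) ((J.sub k).map g)) (h : a ≫ f = b ≫ g) :
    IsPullback (El.vert J a) (El.vert J b) (El.vert J f) (El.vert J g) := by
  refine isPullback_of_existsUnique (by rw [El.vert_vert, El.vert_vert, h]) fun {e} s t hs => ?_
  have hb : t.base = s.base := by
    have hs' := hs
    rw [El.comp_vert, El.comp_vert] at hs'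
    exact congrArg (fun t : CoGrothendieck.Hom e (El.mk J A B) => t.base) hs'.symm
  obtain ⟨y, hy⟩ := El.exists_hom_of_base s rfl
  obtain ⟨y', hy'⟩ := El.exists_hom_of_base t hb
  have hyy : y ≫ (J.sub s.base).map f = y' ≫ (J.sub s.base).map g :=
    El.hom_mk_inj ((El.mk_vert J _ _).symm.trans (((congrArg (· ≫ El.vert J f) hy).symm.trans
      (hs.trans (congrArg (· ≫ El.vert J g) hy'))).trans (El.mk_vert J _ _)))
  refine ⟨⟨s.base, (H s.base).lift _ _ hyy⟩, ⟨?_, ?_⟩, fun m hm => ?_⟩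
  · exact (El.mk_vert J _ _).trans ((congrArg (CoGrothendieck.Hom.mk _)
      ((H s.base).lift_fst _ _ hyy)).trans hy.symm)
  · exact (El.mk_vert J _ _).trans ((congrArg (CoGrothendieck.Hom.mk _)
      ((H s.base).lift_snd _ _ hyy)).trans hy'.symm)
  · have hmb : m.base = s.base := by
      have h3 := hm.1
      rw [El.comp_vert] at h3
      exact congrArg CoGrothendieck.Hom.base h3
    obtain ⟨y'', hmy⟩ := El.exists_hom_of_base m hmb
    refine hmy.trans (congrArg (CoGrothendieck.Hom.mk _) ((H s.base).hom_ext ?_ ?_))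
    · refine Eq.trans ?_ ((H s.base).lift_fst _ _ hyy).symm
      exact El.hom_mk_inj ((El.mk_vert J _ _).symm.trans
        (((congrArg (· ≫ El.vert J a) hmy).symm.trans hm.1).trans hy))
    · refine Eq.trans ?_ ((H s.base).lift_snd _ _ hyy).symm
      exact El.hom_mk_inj ((El.mk_vert J _ _).symm.trans
        (((congrArg (· ≫ El.vert J b) hmy).symm.trans hm.2).trans hy'))

theorem El.map_lift_cartesian (κ : J ⟶ J') {A A' : X} (f : A ⟶ A') (E : J.fib A') :
    (forget J').IsStronglyCartesian f ((CoGrothendieck.map κ).map (El.lift J f E)) := by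
  rw [El.map_lift]
  exact isStronglyCartesian_of_eq (isStronglyCartesian_comp (El.vert_cartesian J' _)
    (El.lift_cartesian J' f _)) (id_comp f)

theorem El.isIso_vert_fiber {e e' : El J} {φ : e ⟶ e'}
    (hφ : (forget J).IsStronglyCartesian φ.base φ) : IsIso (El.vert J φ.fiber) := by
  have h2 := El.lift_cartesian J φ.base e'.fiber
  have h3 : (forget J).IsStronglyCartesian (𝟙 e.base ≫ φ.base)
      (El.vert J φ.fiber ≫ El.lift J φ.base e'.fiber) := by
    rw [El.vert_fiber_lift]
    exact isStronglyCartesian_of_eq hφ (id_comp _).symm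
  have h4 := El.vert_isHomLift J φ.fiber
  have h5 : (forget J).IsStronglyCartesian (𝟙 e.base) (El.vert J φ.fiber) :=
    @Functor.IsStronglyCartesian.of_comp _ _ _ _ (forget J) _ _ _ _ _ _ (𝟙 e.base) φ.base
      (El.vert J φ.fiber) (El.lift J φ.base e'.fiber) h2 h3 h4
  exact @Functor.IsStronglyCartesian.isIso_of_base_isIso _ _ _ _ (forget J) _ _ _ _ (𝟙 e.base)
    (El.vert J φ.fiber) h5 inferInstance

theorem El.map_cartesian (κ : J ⟶ J') {A A' : X} {f : A ⟶ A'} {e e' : El J} {φ : e ⟶ e'}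
    (hφ : (forget J).IsStronglyCartesian f φ) :
    (forget J').IsStronglyCartesian f ((CoGrothendieck.map κ).map φ) := by
  have h1 := hφ.toIsHomLift
  cases h1
  have h6 := El.isIso_vert_fiber hφ
  have h7 : IsIso (El.vert J' ((Indx.functor κ e.base).map φ.fiber)) := by
    rw [← El.map_vert]
    exact @CategoryTheory.Functor.map_isIso _ _ _ _ _ _ (CoGrothendieck.map κ) _ h6
  have h8 := El.vert_isHomLift J' ((Indx.functor κ e.base).map φ.fiber)
  have h9 : (forget J').IsStronglyCartesian (𝟙 e.base)
      (El.vert J' ((Indx.functor κ e.base).map φ.fiber)) :=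
    Functor.IsStronglyCartesian.of_isIso (forget J') (𝟙 e.base) _
  have key : (CoGrothendieck.map κ).map φ = El.vert J' ((Indx.functor κ e.base).map φ.fiber) ≫
      (CoGrothendieck.map κ).map (El.lift J φ.base e'.fiber) := by
    rw [← El.map_vert]
    exact ((congrArg (CoGrothendieck.map κ).map (El.vert_fiber_lift J φ)).symm).trans
      ((CoGrothendieck.map κ).map_comp _ _)
  rw [key]
  exact isStronglyCartesian_of_eq (isStronglyCartesian_comp h9 (El.map_lift_cartesian κ _ _))
    (id_comp _)

end ElementsCalculus

theorem StrongMap.isFibrePower_iter {C : Type u} [Category.{v} C] {C' : Type u'}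
    [Category.{v'} C'] {D : TangentData C} {D' : TangentData C'} {F : C ⥤ C'}
    (φ : StrongMap D D' F) (h' : D'.IsTangent) (m : ℕ) {A : C} {n : ℕ} {P : C}
    {pr : Fin (n + 1) → (P ⟶ D.T.obj A)}
    (hpr : IsFibrePower (F.map (D.p A)) (fun i => F.map (pr i))) :
    IsFibrePower (F.map ((D.iter m).map (D.p A))) (fun i => F.map ((D.iter m).map (pr i))) := by
  have h1 := h'.preserves m (F.obj A) _ ((φ.isFibrePower_iff pr).2 hpr)
  have h2 : IsFibrePower ((F ⋙ D'.iter m).map (D.p A)) (fun i => (F ⋙ D'.iter m).map (pr i)) :=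
    h1.of_iso ((D'.iter m).mapIso (φ.b A)) (Iso.refl _) (Iso.refl _)
      (by
        simp only [Iso.refl_hom, comp_id, Functor.mapIso_hom, Functor.comp_map]
        rw [← fmap_comp, φ.p])
      (fun i => by
        simp only [Iso.refl_hom, id_comp, Functor.mapIso_hom, Functor.comp_map]
        rw [← fmap_comp, assoc, Iso.inv_hom_id, comp_id])
  have h3 : IsFibrePower ((D.iter m ⋙ F).map (D.p A)) (fun i => (D.iter m ⋙ F).map (pr i)) :=
    h2.congr_functor (φ.iterIso m)
  exact h3

theorem isPullback_congr {C : Type u} [Category.{v} C] {P E E' B : C} {a a' : P ⟶ E}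
    {b b' : P ⟶ E'} {f f' : E ⟶ B} {g g' : E' ⟶ B} (h : IsPullback a b f g) (ha : a' = a)
    (hb : b' = b) (hf : f' = f) (hg : g' = g) : IsPullback a' b' f' g' := by
  subst ha hb hf hg
  exact h

section StrictElements

open Pseudofunctor CoGrothendieck

variable {X : Type u} [Category.{v} X] {J J' J'' : Indx.{v, v', u, u'} X}

theorem El.map_id_map (J : Indx.{v, v', u, u'} X) {e e' : El J} (φ : e ⟶ e') :
    (CoGrothendieck.map (𝟙 J)).map φ = φ := by
  refine congrArg (CoGrothendieck.Hom.mk φ.base) ?_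
  refine (congrArg (φ.fiber ≫ ·) ?_).trans (comp_id _)
  exact Indx.distributor_id φ.base e'.fiber

theorem El.map_comp_map (κ : J ⟶ J') (κ' : J' ⟶ J'') {e e' : El J} (φ : e ⟶ e') :
    (CoGrothendieck.map (κ ≫ κ')).map φ =
      (CoGrothendieck.map κ').map ((CoGrothendieck.map κ).map φ) := by
  have key : ∀ y y' : (Indx.functor κ' e.base).obj ((Indx.functor κ e.base).obj e.fiber) ⟶ (J''.sub
      φ.base).obj ((Indx.functor κ' e'.base).obj ((Indx.functor κ e'.base).obj e'.fiber)), y = y' →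
      (⟨φ.base, y⟩ : CoGrothendieck.Hom ((CoGrothendieck.map κ').obj ((CoGrothendieck.map κ).obj e))
        ((CoGrothendieck.map κ').obj ((CoGrothendieck.map κ).obj e'))) = ⟨φ.base, y'⟩ := by
    rintro y _ rfl
    rfl
  refine key _ _ ?_
  refine (congrArg (_ ≫ ·) (Indx.distributor_comp κ κ' φ.base e'.fiber)).trans ?_
  refine (assoc _ _ _).symm.trans (congrArg (· ≫ _) ?_)
  exact ((Indx.functor κ' e.base).map_comp _ _).symm

variable {D : TangentData X} {R : RawIndexed.{v, v', u, u'} X} 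

namespace RawIndexed.IsTangent

variable (h : R.IsTangent D)

theorem fib_vert {A : X} {E E' : R.J.fib A} (ξ : E ⟶ E') :
    h.fibrewise.map (El.vert R.J ξ) = El.vert R.J ((R.D A).T.map ξ) :=
  El.map_vert h.trans ξ

theorem vert_fib {A : X} {E E' E'' : R.J.fib A} (ξ : E ⟶ (R.D A).T.obj E') (ξ' : E' ⟶ E'') :
    El.vert R.J ξ ≫ h.fibrewise.map (El.vert R.J ξ') = El.vert R.J (ξ ≫ (R.D A).T.map ξ') :=
  (congrArg (El.vert R.J ξ ≫ ·) (h.fib_vert ξ')).trans (El.vert_vert _ _ _)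

theorem fib_vert_vert {A : X} {E E' E'' : R.J.fib A} (ξ : E ⟶ E') (ξ' : (R.D A).T.obj E' ⟶ E'') :
    h.fibrewise.map (El.vert R.J ξ) ≫ El.vert R.J ξ' = El.vert R.J ((R.D A).T.map ξ ≫ ξ') :=
  (congrArg (· ≫ El.vert R.J ξ') (h.fib_vert ξ)).trans (El.vert_vert _ _ _)

/-- The functor `(A, E) ↦ (A, T^A E)`. -/
abbrev elFunctor : El R.J ⥤ El R.J where
  obj e := El.mk R.J e.base ((R.D e.base).T.obj e.fiber)
  map φ := h.fibrewise.map φ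
  map_id e := h.fibrewise.map_id e
  map_comp φ ψ := h.fibrewise.map_comp φ ψ

/-- The fibrewise tangent structure of the category of elements. -/
def elTangent : TangentData (El R.J) where
  T := h.elFunctor
  T₂ e := El.mk R.J e.base ((R.D e.base).T₂ e.fiber)
  π₁ e := El.vert R.J ((R.D e.base).π₁ e.fiber)
  π₂ e := El.vert R.J ((R.D e.base).π₂ e.fiber)
  p e := El.vert R.J ((R.D e.base).p e.fiber)
  z e := El.vert R.J ((R.D e.base).z e.fiber)
  s e := El.vert R.J ((R.D e.base).s e.fiber)
  l e := El.vert R.J ((R.D e.base).l e.fiber)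
  c e := El.vert R.J ((R.D e.base).c e.fiber)

include h in
theorem isFibrePower_el {A : X} (E : R.J.fib A) {n : ℕ} {P : R.J.fib A}
    {pr : Fin (n + 1) → (P ⟶ (R.D A).T.obj E)} (H : IsFibrePower ((R.D A).p E) pr) :
    IsFibrePower (El.vert R.J ((R.D A).p E)) (fun i => El.vert R.J (pr i)) :=
  El.isFibrePower_vert (fun f => (h.strong f).1.preserves.power E pr H) H

include h in
theorem pb_el {A : X} (E : R.J.fib A) :
    IsPullback (El.vert R.J ((R.D A).π₁ E)) (El.vert R.J ((R.D A).π₂ E))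
      (El.vert R.J ((R.D A).p E)) (El.vert R.J ((R.D A).p E)) :=
  (h.isFibrePower_el E (h.isFibrePower_T₂ A E)).isPullback

/-- Iterating the fibrewise tangent bundle functor on a fibre. -/
def elIter (A : X) : ∀ m : ℕ, (R.D A).iter m ⋙ ι R.J A ≅ ι R.J A ⋙ h.elTangent.iter m
  | 0 => Iso.refl _
  | m + 1 =>
    NatIso.ofComponents (F := ((R.D A).iter m ⋙ (R.D A).T) ⋙ ι R.J A)
      (G := (ι R.J A ⋙ h.elTangent.iter m) ⋙ h.elFunctor)
      (fun E => h.fibrewise.mapIso ((elIter A m).app E)) (fun {E E'} ξ => by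
        have := (elIter A m).hom.naturality ξ
        refine Eq.trans ?_ ((h.fibrewise.map_comp _ _).symm.trans ((congrArg h.fibrewise.map this).trans
          (h.fibrewise.map_comp _ _)))
        exact congrArg (· ≫ _) (h.fib_vert _).symm)

theorem isFibrePower_el_iter {A : X} (E : R.J.fib A) (m : ℕ) {n : ℕ} {P : R.J.fib A}
    {pr : Fin (n + 1) → (P ⟶ (R.D A).T.obj E)} (H : IsFibrePower ((R.D A).p E) pr) :
    IsFibrePower ((h.elTangent.iter m).map (El.vert R.J ((R.D A).p E)))
      (fun i => (h.elTangent.iter m).map (El.vert R.J (pr i))) := by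
  have h1 : IsFibrePower (((R.D A).iter m ⋙ ι R.J A).map ((R.D A).p E))
      (fun i => ((R.D A).iter m ⋙ ι R.J A).map (pr i)) :=
    El.isFibrePower_vert (fun f => ((h.strong f).strongMap (h.fibre _) (h.fibre _)).isFibrePower_iter
      (h.fibre _) m ((h.strong f).1.preserves.power E pr H)) ((h.fibre A).preserves m E pr H)
  have h2 : IsFibrePower ((ι R.J A ⋙ h.elTangent.iter m).map ((R.D A).p E))
      (fun i => (ι R.J A ⋙ h.elTangent.iter m).map (pr i)) := h1.congr_functor (h.elIter A m)
  exact h2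

theorem pb_el_T {A : X} (E : R.J.fib A) : IsPullback (h.fibrewise.map (El.vert R.J ((R.D A).π₁ E)))
      (h.fibrewise.map (El.vert R.J ((R.D A).π₂ E))) (h.fibrewise.map (El.vert R.J ((R.D A).p E)))
      (h.fibrewise.map (El.vert R.J ((R.D A).p E))) :=
  (h.isFibrePower_el_iter E 1 (h.isFibrePower_T₂ A E)).isPullback

theorem el_preserves (e : El R.J) {n : ℕ} {P : El R.J}
    (pr : Fin (n + 1) → (P ⟶ h.elTangent.T.obj e)) (H : IsFibrePower (h.elTangent.p e) pr)
    {C : Type u''} [Category.{v''} C] (F : El R.J ⥤ C)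
    (hF : ∀ {P' : R.J.fib e.base} (pr' : Fin (n + 1) → (P' ⟶ (R.D e.base).T.obj e.fiber)),
      IsFibrePower ((R.D e.base).p e.fiber) pr' → IsFibrePower (F.map (El.vert R.J ((R.D e.base).p
      e.fiber))) (fun i => F.map (El.vert R.J (pr' i)))) :
    IsFibrePower (F.map (h.elTangent.p e)) (fun i => F.map (pr i)) := by
  obtain ⟨P', pr', H'⟩ := ((h.fibre e.base).additive e.fiber).powers n
  exact H.map_of_map (h.isFibrePower_el e.fiber H') F (hF pr' H')

theorem elTangent_isTangent : h.elTangent.IsTangent where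
  p_nat {e e'} φ := (El.map₂_naturality h.pMod φ).trans (congrArg (_ ≫ ·) (El.map_id_map _ φ))
  z_nat {e e'} φ := (congrArg (· ≫ _) (El.map_id_map _ φ)).symm.trans (El.map₂_naturality h.zMod φ)
  s_nat {e e'} φ f₂ h1 h2 := by
    have e1 : f₂ = (CoGrothendieck.map h.trans₂).map φ := (h.pb_el e'.fiber).hom_ext
      (h1.trans (El.map₂_naturality (h.powerProj h.isFibrePower_T₂ 0) φ).symm)
      (h2.trans (El.map₂_naturality (h.powerProj h.isFibrePower_T₂ 1) φ).symm)
    subst e1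
    exact (El.map₂_naturality h.sMod φ).symm
  l_nat {e e'} φ := (El.map₂_naturality h.lMod φ).trans
    (congrArg (_ ≫ ·) (El.map_comp_map h.trans h.trans φ))
  c_nat {e e'} φ := (congrArg (· ≫ _) (El.map_comp_map h.trans h.trans φ)).symm.trans
    ((El.map₂_naturality h.cMod φ).trans (congrArg (_ ≫ ·) (El.map_comp_map h.trans h.trans φ)))
  additive e := isAdditive_map ((h.fibre e.base).additive e.fiber) (ι R.J e.base)
    (fun _ H => h.isFibrePower_el e.fiber H)
  preserves m e _ _ pr H := h.el_preserves e pr H (h.elTangent.iter m)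
    (fun _ H' => h.isFibrePower_el_iter e.fiber m H')
  l_additive e := by
    have H := (h.fibre e.base).l_additive e.fiber
    refine ⟨?_, ?_, fun g₂ h1 h2 => ?_⟩
    · exact (h.vert_fib _ _).trans ((congrArg _ H.q).trans (El.vert_vert _ _ _).symm)
    · exact (El.vert_vert _ _ _).trans ((congrArg _ H.zero).trans (h.vert_fib _ _).symm)
    · have hp : ((R.D e.base).π₁ e.fiber ≫ (R.D e.base).l e.fiber) ≫ (R.D e.base).T.map ((R.D
          e.base).p e.fiber) = ((R.D e.base).π₂ e.fiber ≫ (R.D e.base).l e.fiber) ≫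
          (R.D e.base).T.map ((R.D e.base).p e.fiber) := by
        have q : (R.D e.base).l e.fiber ≫ (R.D e.base).T.map ((R.D e.base).p e.fiber) =
          (R.D e.base).p e.fiber ≫ (R.D e.base).z e.fiber := H.q
        rw [assoc, assoc, q, reassoc_of% ((h.fibre e.base).pb e.fiber).w]
      have T := (h.fibre e.base).pb_T e.fiber
      have e1 : g₂ = El.vert R.J (T.lift _ _ hp) := (h.pb_el_T e.fiber).hom_ext (h1.trans
        ((El.vert_vert _ _ _).trans ((congrArg _ (T.lift_fst _ _ hp).symm).trans (h.vert_fib _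
        _).symm))) (h2.trans ((El.vert_vert _ _ _).trans ((congrArg _ (T.lift_snd _ _
        hp).symm).trans (h.vert_fib _ _).symm)))
      subst e1
      exact (El.vert_vert _ _ _).trans ((congrArg _
        (H.sum _ (T.lift_fst _ _ hp) (T.lift_snd _ _ hp))).trans (h.vert_fib _ _).symm)
  c_additive e := by
    have H := (h.fibre e.base).c_additive e.fiber
    refine ⟨?_, ?_, fun g₂ h1 h2 => ?_⟩
    · exact (El.vert_vert _ _ _).trans ((congrArg _ (H.q.trans (comp_id _))).trans
        ((h.fib_vert _).symm.trans (comp_id _).symm))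
    · exact (h.fib_vert_vert _ _).trans ((congrArg _ (H.zero.trans (id_comp _))).trans
        (id_comp _).symm)
    · have hp : ((R.D e.base).T.map ((R.D e.base).π₁ e.fiber) ≫ (R.D e.base).c e.fiber) ≫
          (R.D e.base).p ((R.D e.base).T.obj e.fiber) =
          ((R.D e.base).T.map ((R.D e.base).π₂ e.fiber) ≫ (R.D e.base).c e.fiber) ≫
          (R.D e.base).p ((R.D e.base).T.obj e.fiber) := by
        have q : (R.D e.base).c e.fiber ≫ (R.D e.base).p ((R.D e.base).T.obj e.fiber) =
          (R.D e.base).T.map ((R.D e.base).p e.fiber) := H.q.trans (comp_id _)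
        rw [assoc, assoc, q, ((h.fibre e.base).pb_T e.fiber).w]
      have T := (h.fibre e.base).pb ((R.D e.base).T.obj e.fiber)
      have e1 : g₂ = El.vert R.J (T.lift _ _ hp) :=
        (h.pb_el ((R.D e.base).T.obj e.fiber)).hom_ext
        (h1.trans ((h.fib_vert_vert _ _).trans ((congrArg _ (T.lift_fst _ _ hp).symm).trans
          (El.vert_vert _ _ _).symm)))
        (h2.trans ((h.fib_vert_vert _ _).trans ((congrArg _ (T.lift_snd _ _ hp).symm).trans
          (El.vert_vert _ _ _).symm)))
      subst e1
      exact (h.fib_vert_vert _ _).trans ((congrArg _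
        (H.sum _ (T.lift_fst _ _ hp) (T.lift_snd _ _ hp))).trans (El.vert_vert _ _ _).symm)
  l_coassoc e := (h.vert_fib _ _).trans
    ((congrArg _ ((h.fibre e.base).l_coassoc e.fiber)).trans (El.vert_vert _ _ _).symm)
  c_c e := (El.vert_vert _ _ _).trans ((congrArg _ ((h.fibre e.base).c_c e.fiber)).trans
    (El.vert_id _ _))
  c_braid e := by
    have H := (h.fibre e.base).c_braid e.fiber
    let k := (R.D e.base).c e.fiber
    let k' := (R.D e.base).c ((R.D e.base).T.obj e.fiber)
    refine ((congrArg (h.fibrewise.map (El.vert R.J k) ≫ ·) (h.vert_fib k' k)).trans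
      (h.fib_vert_vert k (k' ≫ (R.D e.base).T.map k))).trans ?_
    exact (congrArg _ H).trans ((El.vert_vert R.J k' ((R.D e.base).T.map k ≫ k')).symm.trans
      (congrArg (El.vert R.J k' ≫ ·) (h.fib_vert_vert k k').symm))
  l_c e := (El.vert_vert _ _ _).trans (congrArg _ ((h.fibre e.base).l_c e.fiber))
  l_c_c e := by
    have H := (h.fibre e.base).l_c_c e.fiber
    let k := (R.D e.base).c e.fiber
    let k' := (R.D e.base).c ((R.D e.base).T.obj e.fiber)
    let i := (R.D e.base).l ((R.D e.base).T.obj e.fiber)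
    refine ((congrArg (El.vert R.J i ≫ ·) (h.fib_vert_vert k k')).trans
      (El.vert_vert R.J i ((R.D e.base).T.map k ≫ k'))).trans ?_
    exact (congrArg _ H).trans (h.vert_fib _ _).symm
  universal e k h1 h2 := by
    obtain ⟨k', h1', h2'⟩ := (h.fibre e.base).exists_vertical e.fiber
    have e1 : k = El.vert R.J k' := (h.pb_el_T e.fiber).hom_ext
      (h1.trans ((El.vert_vert _ _ _).trans ((congrArg _ h1'.symm).trans (h.vert_fib _ _).symm)))
      (h2.trans ((El.vert_vert _ _ _).trans ((congrArg _ h2'.symm).trans (h.vert_fib _ _).symm)))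
    subst e1
    have H := (h.fibre e.base).universal e.fiber k' h1' h2'
    exact isPullback_congr (El.isPullback_vert (fun f => (h.strong f).1.preserves.vertical e.fiber
      k' h1' h2') H.w) (h.vert_fib _ _) (El.vert_vert _ _ _) (h.fib_vert _) rfl

end RawIndexed.IsTangent

end StrictElements

theorem comp_eq_of_squares {C : Type u} [Category.{v} C] {A₀ A₁ A₂ A₃ A₄ A₅ B₁ B₂ B₃ : C}
    {E₁ E₂ E₃ : C} {g₁ : A₀ ⟶ A₁} {k₁ : A₁ ⟶ A₂} {k₂ : A₂ ⟶ A₃} {k₃ : A₃ ⟶ A₄} {x : A₄ ⟶ A₅}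
    {m₁ : A₁ ⟶ B₁} {m₂ : B₁ ⟶ B₂} {m₃ : B₂ ⟶ A₄} {y : B₂ ⟶ B₃} {w : B₃ ⟶ A₅} {t₁ : A₀ ⟶ E₁}
    {g₂ : E₁ ⟶ B₁} {s₁ : E₁ ⟶ E₂} {s₂ : E₂ ⟶ E₃} {s₃ : E₃ ⟶ B₃}
    (h₁ : k₁ ≫ k₂ ≫ k₃ = m₁ ≫ m₂ ≫ m₃) (h₂ : g₂ ≫ m₂ ≫ y = s₁ ≫ s₂ ≫ s₃) (h₃ : m₃ ≫ x = y ≫ w)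
    (h₄ : t₁ ≫ g₂ = g₁ ≫ m₁) :
    g₁ ≫ k₁ ≫ k₂ ≫ k₃ ≫ x = t₁ ≫ s₁ ≫ s₂ ≫ s₃ ≫ w := by
  rw [reassoc_of% h₁, h₃, ← reassoc_of% h₄, reassoc_of% h₂]

section ElementsMorphisms

open Pseudofunctor CoGrothendieck

variable {X : Type u} [Category.{v} X]

theorem IsCoherentLaw.id (R : RawIndexed.{v, v', u, u'} X) (o : Bool) :
    IsCoherentLaw (R := R) (R' := R) (𝟙 R.J) (fun A => Law.id o (R.D A)) := by
  cases o
  · intro A A' f E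
    have e1 := Indx.distributor_id (J := R.J) f E
    have e2 := Indx.distributor_id (J := R.J) f ((R.D A').T.obj E)
    have e3 := congrArg (fun t => (R.D A).T.map t) e1
    have e4 : R.α f E ≫ 𝟙 _ ≫ (R.J.sub f).map (𝟙 ((R.D A').T.obj E)) =
        𝟙 _ ≫ (R.D A).T.map (𝟙 ((R.J.sub f).obj E)) ≫ R.α f E := by simp
    exact ((congrArg (fun t => R.α f E ≫ t ≫ (R.J.sub f).map (𝟙 ((R.D A').T.obj E))) e2).trans
      e4).trans (congrArg (fun t => 𝟙 _ ≫ t ≫ R.α f E) e3.symm)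
  · intro A A' f E
    have e1 := Indx.distributor_id (J := R.J) f E
    have e2 := Indx.distributor_id (J := R.J) f ((R.D A').T.obj E)
    have e3 := congrArg (fun t => (R.D A).T.map t) e1
    have e4 : 𝟙 _ ≫ R.α f E ≫ 𝟙 _ = (R.D A).T.map (𝟙 ((R.J.sub f).obj E)) ≫ R.α f E ≫
          (R.J.sub f).map (𝟙 ((R.D A').T.obj E)) := by simp
    exact ((congrArg (fun t => 𝟙 _ ≫ R.α f E ≫ t) e2).trans
      e4).trans (congrArg (fun t => t ≫ R.α f E ≫ (R.J.sub f).map (𝟙 ((R.D A').T.obj E))) e3.symm)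

variable {R R' R'' : RawIndexed.{v, v', u, u'} X} {κ : R.J ⟶ R'.J} {κ' : R'.J ⟶ R''.J}

theorem IsCoherentLaw.comp {o : Bool} {β : ∀ A, Law o (R.D A) (R'.D A) (Indx.functor κ A)}
    {γ : ∀ A, Law o (R'.D A) (R''.D A) (Indx.functor κ' A)} (hβ : IsCoherentLaw κ β)
    (hγ : IsCoherentLaw κ' γ) (nγ : ∀ A, (γ A).IsNatural) :
    IsCoherentLaw (R := R) (R' := R'') (κ ≫ κ') (fun A => (β A).comp (γ A)) := by
  cases o
  · intro A A' f E
    have d1 := Indx.distributor_comp κ κ' f E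
    have d2 := Indx.distributor_comp κ κ' f ((R.D A').T.obj E)
    have h1 := congrArg (Indx.functor κ' A).map (hβ f E)
    have h2 := hγ f ((Indx.functor κ A').obj E)
    have h3 := Indx.distributor_naturality κ' f (β A' E)
    have h4 := nγ A (Indx.distributor κ f E).hom
    simp only [fmap_comp] at h1
    refine (congrArg (fun t => (Indx.functor κ' A).map ((Indx.functor κ A).map (R.α f E)) ≫ t ≫
      (R''.J.sub f).map ((Indx.functor κ' A').map (β A' E) ≫ γ A' ((Indx.functor κ A').obj E)))
      d2).trans (Eq.trans ?_ (congrArg (fun t => ((Indx.functor κ' A).map (β A ((R.J.sub f).obj E))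
      ≫ γ A ((Indx.functor κ A).obj ((R.J.sub f).obj E))) ≫ (R''.D A).T.map t ≫ R''.α f
      ((Indx.functor κ' A').obj ((Indx.functor κ A').obj E))) d1.symm))
    simp only [fmap_comp, assoc]
    rw [← reassoc_of% h3, reassoc_of% h1, h2, reassoc_of% h4]
  · intro A A' f E
    have d1 := Indx.distributor_comp κ κ' f E
    have d2 := Indx.distributor_comp κ κ' f ((R.D A').T.obj E)
    have h1 := congrArg (Indx.functor κ' A).map (hβ f E)
    have h2 := hγ f ((Indx.functor κ A').obj E)
    have h3 := Indx.distributor_naturality κ' f (β A' E)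
    have h4 := nγ A (Indx.distributor κ f E).hom
    simp only [fmap_comp] at h1
    refine (congrArg (fun t => (γ A ((Indx.functor κ A).obj ((R.J.sub f).obj E)) ≫ (Indx.functor κ'
      A).map (β A ((R.J.sub f).obj E))) ≫ (Indx.functor κ' A).map ((Indx.functor κ A).map (R.α f E))
      ≫ t) d2).trans (Eq.trans ?_ (congrArg (fun t => (R''.D A).T.map t ≫ R''.α f ((Indx.functor κ'
      A').obj ((Indx.functor κ A').obj E)) ≫ (R''.J.sub f).map (γ A' ((Indx.functor κ A').obj E) ≫
      (Indx.functor κ' A').map (β A' E))) d1.symm))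
    simp only [fmap_comp, assoc]
    exact comp_eq_of_squares h1 h2 h3 h4

theorem isCoherentLaw_of_generated {fl : Flavour} {D : TangentData X}
    {x y : (indDisplayed.{v, v', u, u'} fl.isColax D).Ob} {κ : x.1.J ⟶ y.1.J}
    {a : (indDisplayed fl.isColax D).Str (x := x) (y := y) κ}
    (ha : (indDisplayed.{v, v', u, u'} fl.isColax D).Generated
      (fun {R R' κ} β => IsIndexedMorphism (R := R.1) (R' := R'.1) fl κ β.1) a) :
    IsCoherentLaw (R := x.1) (R' := y.1) κ a.1 := by
  induction ha with
  | of a ha => exact ha.coherent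
  | id x => exact IsCoherentLaw.id x.1 _
  | comp _ _ h1 h2 => rename_i b _ _; exact IsCoherentLaw.comp h1 h2 b.2

variable {D : TangentData X} (h : R.IsTangent D) (h' : R'.IsTangent D)

/-- The 2-cell of a coherent law. -/
def lawCell : ∀ {o : Bool} (β : ∀ A, Law o (R.D A) (R'.D A) (Indx.functor κ A))
    (_ : ∀ A, (β A).IsNatural) (_ : IsCoherentLaw κ β), LawCell o h.trans h'.trans κ
  | false, β, hn, hc => Indx.mkModification (κ := h.trans ≫ κ) (κ' := κ ≫ h'.trans)
      (fun A E => β A E) (fun A {_ _} ξ => hn A ξ) (fun f E => by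
        rw [Indx.distributor_comp, Indx.distributor_comp]
        exact (hc f E).symm.trans (assoc _ _ _).symm)
  | true, β, hn, hc => Indx.mkModification (κ := κ ≫ h'.trans) (κ' := h.trans ≫ κ)
      (fun A E => β A E) (fun A {_ _} ξ => hn A ξ) (fun f E => by
        rw [Indx.distributor_comp, Indx.distributor_comp]
        exact (hc f E).trans (assoc _ _ _).symm)

variable (κ) in
/-- The law between categories of elements of laws on the fibres. -/
def elLaw : ∀ {o : Bool}, (∀ A, Law o (R.D A) (R'.D A) (Indx.functor κ A)) →
    Law o h.elTangent h'.elTangent (CoGrothendieck.map κ)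
  | false, β => fun e => El.vert R'.J (β e.base e.fiber)
  | true, β => fun e => El.vert R'.J (β e.base e.fiber)

theorem elLaw_isNatural : ∀ {o : Bool} {β : ∀ A, Law o (R.D A) (R'.D A) (Indx.functor κ A)}
    (_ : ∀ A, (β A).IsNatural) (_ : IsCoherentLaw κ β), (elLaw κ h h' β).IsNatural
  | false, β, hn, hc => fun φ => (congrArg (· ≫ _) (El.map_comp_map h.trans κ φ)).symm.trans
      ((El.map₂_naturality (lawCell h h' β hn hc) φ).trans
        (congrArg (_ ≫ ·) (El.map_comp_map κ h'.trans φ)))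
  | true, β, hn, hc => fun φ => (congrArg (· ≫ _) (El.map_comp_map κ h'.trans φ)).symm.trans
      ((El.map₂_naturality (lawCell h h' β hn hc) φ).trans
        (congrArg (_ ≫ ·) (El.map_comp_map h.trans κ φ)))

theorem El.map_vert_vert {J J' : Indx.{v, v', u, u'} X} (κ : J ⟶ J') {A : X} {E E' : J.fib A}
    {E'' : J'.fib A} (ξ : E ⟶ E') (ξ' : (Indx.functor κ A).obj E' ⟶ E'') :
    (CoGrothendieck.map κ).map (El.vert J ξ) ≫ El.vert J' ξ' =
      El.vert J' ((Indx.functor κ A).map ξ ≫ ξ') :=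
  (congrArg (· ≫ El.vert J' ξ') (El.map_vert κ ξ)).trans (El.vert_vert _ _ _)

theorem El.vert_map_vert {J J' : Indx.{v, v', u, u'} X} (κ : J ⟶ J') {A : X} {E E' : J.fib A}
    {E'' : J'.fib A} (ξ' : E'' ⟶ (Indx.functor κ A).obj E) (ξ : E ⟶ E') :
    El.vert J' ξ' ≫ (CoGrothendieck.map κ).map (El.vert J ξ) =
      El.vert J' (ξ' ≫ (Indx.functor κ A).map ξ) :=
  (congrArg (El.vert J' ξ' ≫ ·) (El.map_vert κ ξ)).trans (El.vert_vert _ _ _)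

theorem elLaw_isLax {β : ∀ A, Law false (R.D A) (R'.D A) (Indx.functor κ A)}
    (hf : ∀ A, IsLaxMorphism (R.D A) (R'.D A) (Indx.functor κ A) (β A)) (hc : IsCoherentLaw κ β) :
    IsLaxMorphism h.elTangent h'.elTangent (CoGrothendieck.map κ) (elLaw κ h h' β) where
  natural := elLaw_isNatural h h' (β := β) (fun A => (hf A).natural) hc
  additive e := by
    have H := (hf e.base).additive e.fiber
    refine ⟨?_, ?_, fun g₂ h1 h2 => ?_⟩
    · exact (El.vert_vert _ _ _).trans ((congrArg _ (H.q.trans (comp_id _))).trans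
        ((El.map_vert κ _).symm.trans (comp_id _).symm))
    · exact (El.map_vert_vert κ _ _).trans ((congrArg _ (H.zero.trans (id_comp _))).trans
        (id_comp _).symm)
    · have q : β e.base e.fiber ≫ (R'.D e.base).p _ =
          (Indx.functor κ e.base).map ((R.D e.base).p e.fiber) := H.q.trans (comp_id _)
      have hp : ((Indx.functor κ e.base).map ((R.D e.base).π₁ e.fiber) ≫ β e.base e.fiber) ≫ (R'.D
          e.base).p _ = ((Indx.functor κ e.base).map ((R.D e.base).π₂ e.fiber) ≫ β e.base e.fiber) ≫
          (R'.D e.base).p _ := by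
        rw [assoc, assoc, q, ← fmap_comp, ← fmap_comp, ((h.fibre e.base).pb e.fiber).w]
      have T := (h'.fibre e.base).pb ((Indx.functor κ e.base).obj e.fiber)
      have e1 : g₂ = El.vert R'.J (T.lift _ _ hp) := (h'.pb_el _).hom_ext (h1.trans
        ((El.map_vert_vert κ _ _).trans ((congrArg _ (T.lift_fst _ _ hp).symm).trans (El.vert_vert _
        _ _).symm))) (h2.trans ((El.map_vert_vert κ _ _).trans ((congrArg _ (T.lift_snd _ _
        hp).symm).trans (El.vert_vert _ _ _).symm)))
      subst e1
      exact (El.map_vert_vert κ _ _).trans ((congrArg _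
        (H.sum _ (T.lift_fst _ _ hp) (T.lift_snd _ _ hp))).trans (El.vert_vert _ _ _).symm)
  lift e := by
    have H := (hf e.base).lift e.fiber
    let β₀ := β e.base e.fiber
    let β₁ := β e.base ((R.D e.base).T.obj e.fiber)
    exact (congrArg (_ ≫ ·) (h'.vert_fib β₁ β₀)).trans ((El.map_vert_vert κ _ _).trans
      ((congrArg _ H).trans (El.vert_vert _ _ _).symm))
  flip e := by
    have H := (hf e.base).flip e.fiber
    let β₀ := β e.base e.fiber
    let β₁ := β e.base ((R.D e.base).T.obj e.fiber)
    refine (congrArg (_ ≫ ·) (h'.vert_fib β₁ β₀)).trans ((El.map_vert_vert κ _ _).trans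
      ((congrArg _ H).trans ?_))
    exact (El.vert_vert R'.J _ _).symm.trans
      (congrArg (El.vert R'.J β₁ ≫ ·) (h'.fib_vert_vert β₀ _).symm)

include h in
theorem El.isFibrePower_map_vert (κ : R.J ⟶ R'.J)
    (hκ : ∀ A, PreservesTangentLimits (R.D A) (Indx.functor κ A)) {A : X} {E : R.J.fib A} {n : ℕ}
    {P : R.J.fib A} {pr : Fin (n + 1) → (P ⟶ (R.D A).T.obj E)}
    (H : IsFibrePower ((R.D A).p E) pr) :
    IsFibrePower ((CoGrothendieck.map κ).map (El.vert R.J ((R.D A).p E)))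
      (fun i => (CoGrothendieck.map κ).map (El.vert R.J (pr i))) := by
  simp only [El.map_vert]
  refine El.isFibrePower_vert (fun {A'} f => ?_) ((hκ A).power E pr H)
  let φ := (h.strong f).strongMap (h.fibre A) (h.fibre A')
  have h1 := (hκ A').power _ _ ((φ.isFibrePower_iff pr).2 ((h.strong f).1.preserves.power E pr H))
  have h2 : IsFibrePower ((R.J.sub f ⋙ Indx.functor κ A').map ((R.D A).p E))
      (fun i => (R.J.sub f ⋙ Indx.functor κ A').map (pr i)) :=
    h1.of_iso ((Indx.functor κ A').mapIso (φ.b E)) (Iso.refl _) (Iso.refl _)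
      (by
        simp only [Iso.refl_hom, comp_id, Functor.mapIso_hom, Functor.comp_map]
        rw [← fmap_comp, φ.p])
      (fun i => by
        simp only [Iso.refl_hom, id_comp, Functor.mapIso_hom, Functor.comp_map]
        rw [← fmap_comp, assoc, Iso.inv_hom_id, comp_id])
  have h3 : IsFibrePower ((Indx.functor κ A ⋙ R'.J.sub f).map ((R.D A).p E))
      (fun i => (Indx.functor κ A ⋙ R'.J.sub f).map (pr i)) :=
    h2.congr_functor (Cat.Hom.toNatIso (κ.naturality f.op.toLoc))
  exact h3

theorem El.preservesTangentLimits_map (κ : R.J ⟶ R'.J)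
    (hκ : ∀ A, PreservesTangentLimits (R.D A) (Indx.functor κ A)) :
    PreservesTangentLimits h.elTangent (CoGrothendieck.map κ) where
  power e _ _ pr H := h.el_preserves e pr H (CoGrothendieck.map κ)
    fun _ H' => El.isFibrePower_map_vert h κ hκ H'
  vertical e k h1 h2 := by
    obtain ⟨k', h1', h2'⟩ := (h.fibre e.base).exists_vertical e.fiber
    have e1 : k = El.vert R.J k' := (h.pb_el_T e.fiber).hom_ext
      (h1.trans ((El.vert_vert _ _ _).trans ((congrArg _ h1'.symm).trans (h.vert_fib _ _).symm)))
      (h2.trans ((El.vert_vert _ _ _).trans ((congrArg _ h2'.symm).trans (h.vert_fib _ _).symm)))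
    subst e1
    have H := (hκ e.base).vertical e.fiber k' h1' h2'
    refine isPullback_congr (El.isPullback_vert (fun {A'} f => ?_) H.w) ((congrArg _ (h.vert_fib _
      _)).trans (El.map_vert κ _)) ((congrArg _ (El.vert_vert _ _ _)).trans (El.map_vert κ _))
      ((congrArg _ (h.fib_vert _)).trans (El.map_vert κ _)) (El.map_vert κ _)
    let φ := (h.strong f).strongMap (h.fibre e.base) (h.fibre A')
    have h3 := (φ.vertical_conj (Indx.functor κ A') k').1 ((hκ A').vertical _ _ (φ.conj_fst h1')
      (φ.conj_snd (h.fibre A') h2'))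
    exact isPullback_congr_functor (F := R.J.sub f ⋙ Indx.functor κ A')
      (G := Indx.functor κ e.base ⋙ R'.J.sub f) (Cat.Hom.toNatIso (κ.naturality f.op.toLoc)) h3

theorem elLaw_isColax {β : ∀ A, Law true (R.D A) (R'.D A) (Indx.functor κ A)}
    (hf : ∀ A, IsColaxMorphism (R.D A) (R'.D A) (Indx.functor κ A) (β A)) (hc : IsCoherentLaw κ β) :
    IsColaxMorphism h.elTangent h'.elTangent (CoGrothendieck.map κ) (elLaw κ h h' β) where
  natural := elLaw_isNatural h h' (β := β) (fun A => (hf A).natural) hc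
  additive e := by
    have H := (hf e.base).additive e.fiber
    have hP := El.isFibrePower_map_vert h κ (fun A => (hf A).preserves)
      (isFibrePower_pairFam ((h.fibre e.base).pb e.fiber))
    refine ⟨?_, ?_, fun g₂ h1 h2 => ?_⟩
    · exact (El.vert_map_vert κ _ _).trans ((congrArg _ (H.q.trans (comp_id _))).trans
        (comp_id _).symm)
    · exact (El.vert_vert _ _ _).trans ((congrArg _ (H.zero.trans (id_comp _))).trans
        ((El.map_vert κ _).symm.trans (id_comp _).symm))
    · have q : β e.base e.fiber ≫ (Indx.functor κ e.base).map ((R.D e.base).p e.fiber) =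
          (R'.D e.base).p _ := H.q.trans (comp_id _)
      have hp : ((R'.D e.base).π₁ _ ≫ β e.base e.fiber) ≫ (Indx.functor κ e.base).map ((R.D
          e.base).p e.fiber) = ((R'.D e.base).π₂ _ ≫ β e.base e.fiber) ≫
          (Indx.functor κ e.base).map ((R.D e.base).p e.fiber) := by
        rw [assoc, assoc, q, ((h'.fibre e.base).pb _).w]
      have T := ((hf e.base).preserves.power e.fiber _
        (isFibrePower_pairFam ((h.fibre e.base).pb e.fiber))).isPullback_map
      have e1 : g₂ = El.vert R'.J (T.lift _ _ hp) := hP.isPullback.hom_ext (h1.trans ((El.vert_vert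
        _ _ _).trans ((congrArg _ (T.lift_fst _ _ hp).symm).trans (El.vert_map_vert κ _ _).symm)))
        (h2.trans ((El.vert_vert _ _ _).trans ((congrArg _ (T.lift_snd _ _ hp).symm).trans
        (El.vert_map_vert κ _ _).symm)))
      subst e1
      exact (El.vert_vert _ _ _).trans ((congrArg _
        (H.sum _ (T.lift_fst _ _ hp) (T.lift_snd _ _ hp))).trans (El.vert_map_vert κ _ _).symm)
  lift e := by
    have H := (hf e.base).lift e.fiber
    let β₀ := β e.base e.fiber
    let β₁ := β e.base ((R.D e.base).T.obj e.fiber)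
    exact (congrArg (_ ≫ ·) (h'.fib_vert_vert β₀ β₁)).trans ((El.vert_vert R'.J _ _).trans
      ((congrArg _ H).trans (El.vert_map_vert κ _ _).symm))
  flip e := by
    have H := (hf e.base).flip e.fiber
    let β₀ := β e.base e.fiber
    let β₁ := β e.base ((R.D e.base).T.obj e.fiber)
    refine (congrArg (_ ≫ ·) (h'.fib_vert_vert β₀ β₁)).trans ((El.vert_vert R'.J _ _).trans
      ((congrArg _ H).trans ?_))
    exact (h'.fib_vert_vert _ _).symm.trans (congrArg (h'.fibrewise.map (El.vert R'.J β₀) ≫ ·)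
      (El.vert_map_vert κ β₁ ((R.D e.base).c e.fiber)).symm)
  preserves := El.preservesTangentLimits_map h κ fun A => (hf A).preserves

theorem elLaw_isTangentMorphism {fl : Flavour}
    {β : ∀ A, Law fl.isColax (R.D A) (R'.D A) (Indx.functor κ A)}
    (hβ : IsIndexedMorphism fl κ β) :
    IsTangentMorphism h.elTangent h'.elTangent (CoGrothendieck.map κ) fl (elLaw κ h h' β) := by
  cases fl
  · exact elLaw_isLax h h' hβ.fibre hβ.coherent
  · exact elLaw_isColax h h' hβ.fibre hβ.coherent
  · refine ⟨elLaw_isColax h h' (fun A => (hβ.fibre A).1) hβ.coherent, fun e => ?_⟩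
    have := (hβ.fibre e.base).2 e.fiber
    exact @CategoryTheory.Functor.map_isIso _ _ _ _ _ _ (ι R'.J e.base) _ this
  · refine ⟨elLaw_isColax h h' (fun A => (hβ.fibre A).1) hβ.coherent,
      fun e => congrArg (El.mk R'.J e.base) ((hβ.fibre e.base).2.choose e.fiber), fun e => ?_⟩
    refine (congrArg (El.vert R'.J) ((hβ.fibre e.base).2.choose_spec e.fiber)).trans ?_
    exact eqToHom_map (ι R'.J e.base) _

end ElementsMorphisms

section StrictElementsFunctor

open Pseudofunctor CoGrothendieck

variable {X : Type u} [Category.{u} X] {R R' R'' : RawIndexed.{u, u, u, u} X}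

/-- The fibration of elements with the fibrewise tangent structure. -/
def elFibration (h : R.IsTangent (triv X)) :
    RawFibration.{u, u, u, u} X where
  tot := El.based R.J
  cl := El.cleavage R.J
  D := h.elTangent

theorem isFibrePower_of_isIso {C : Type u} [Category.{v} C] {E B P : C} {q : E ⟶ B} {n : ℕ}
    {pr : Fin (n + 1) → (P ⟶ E)} (hq : IsIso q) (h0 : IsIso (pr 0)) (h : ∀ i, pr i = pr 0) :
    IsFibrePower q pr := by
  refine .mk_of_ext (fun i j => by rw [h i, h j]) (fun f hf => ?_) (fun {Y k k'} hk => ?_)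
  · refine ⟨f 0 ≫ inv (pr 0), fun i => ?_⟩
    rw [h i, assoc, IsIso.inv_hom_id, comp_id, ← cancel_mono q, hf i 0]
  · rw [← cancel_mono (pr 0), hk 0]

theorem elFibration_isTangent (h : R.IsTangent (triv X)) :
    (elFibration h).IsTangent (triv X) where
  base := h.base
  total := h.elTangent_isTangent
  strict :=
    { T := fun {A A' f E E' φ} H => by
        cases H
        exact h.fibrewise_isHomLift φ
      p := by
        rintro A ⟨E, rfl⟩
        exact El.vert_isHomLift R.J _
      z := by
        rintro A ⟨E, rfl⟩
        exact El.vert_isHomLift R.J _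
      s := by
        rintro A ⟨E, rfl⟩ k h1 h2
        have e1 : k ≫ 𝟙 E.base = 𝟙 E.base :=
          @IsHomLift.eq_of_isHomLift _ _ _ _ (forget R.J) _ _ _ _ h1
        exact isHomLift_of_eq (P := forget R.J) (El.vert_isHomLift R.J _) e1.symm
      l := by
        rintro A ⟨E, rfl⟩
        exact El.vert_isHomLift R.J _
      c := by
        rintro A ⟨E, rfl⟩
        exact El.vert_isHomLift R.J _
      preserves :=
        { power := fun e _ _ pr H => h.el_preserves e pr H (forget R.J) fun {P'} pr' _ =>
            isFibrePower_of_isIso (inferInstanceAs (IsIso (𝟙 e.base)))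
              (inferInstanceAs (IsIso (𝟙 e.base))) (fun _ => rfl)
          vertical := fun e k h1 h2 => by
            obtain ⟨k', h1', h2'⟩ := (h.fibre e.base).exists_vertical e.fiber
            have e1 : k = El.vert R.J k' := (h.pb_el_T e.fiber).hom_ext (h1.trans ((El.vert_vert _ _
              _).trans ((congrArg _ h1'.symm).trans (h.vert_fib _ _).symm))) (h2.trans
              ((El.vert_vert _ _ _).trans ((congrArg _ h2'.symm).trans (h.vert_fib _ _).symm)))
            subst e1
            have H : IsPullback (𝟙 e.base) (𝟙 e.base) (𝟙 e.base) (𝟙 e.base) :=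
              IsPullback.of_vert_isIso ⟨rfl⟩
            exact isPullback_congr H (congrArg _ (h.vert_fib _ _))
              (congrArg _ (El.vert_vert _ _ _)) (congrArg _ (h.fib_vert _)) rfl } }
  cartesian H := El.map_cartesian h.trans H

theorem elLaw_isFibrationLaw (h : R.IsTangent (triv X))
    (h' : R'.IsTangent (triv X)) {κ : R.J ⟶ R'.J} {o : Bool}
    {β : ∀ A, Law o (R.D A) (R'.D A) (Indx.functor κ A)} (hn : ∀ A, (β A).IsNatural)
    (hc : IsCoherentLaw κ β) :
    IsFibrationLaw (triv X) (Q := elFibration h) (Q' := elFibration h') (El.map κ)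
      (elLaw κ h h' β) where
  natural := elLaw_isNatural h h' hn hc
  vertical e := by
    cases o
    · exact El.vert_isHomLift R'.J _
    · exact El.vert_isHomLift R'.J _
  cartesian H := El.map_cartesian κ H

theorem El.map_id (J : SIndx X) : El.map (𝟙 J) = 𝟙 (El.based J) := by
  refine based_ext (CategoryTheory.Functor.hext (fun _ => rfl) fun e e' φ => ?_)
  exact heq_of_eq (El.map_id_map J φ)

theorem El.map_comp {J J' J'' : SIndx X} (κ : J ⟶ J') (κ' : J' ⟶ J'') :
    El.map (κ ≫ κ') = (show El.based J ⟶ El.based J' from El.map κ) ≫ El.map κ' := by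
  refine based_ext (CategoryTheory.Functor.hext (fun _ => rfl) fun e e' φ => ?_)
  exact heq_of_eq (El.map_comp_map κ κ' φ)

variable {o : Bool}

/-- The fibration of elements of an indexed tangent category. -/
abbrev elOb (x : (IndDisp o X).Ob) : (FibDisp o X).Ob :=
  ⟨elFibration x.2, elFibration_isTangent x.2⟩

/-- The functor between categories of elements of a coherent morphism. -/
abbrev elStr {x y : (IndDisp o X).Ob}
    {κ : x.1.J ⟶ y.1.J} (a : (IndDisp o X).Str (x := x) (y := y) κ)
    (ha : IsCoherentLaw (R := x.1) (R' := y.1) κ a.1) :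
    (FibDisp o X).Str (x := elOb x) (y := elOb y) (El.map κ) :=
  ⟨elLaw κ x.2 y.2 a.1, elLaw_isFibrationLaw x.2 y.2 a.2 ha⟩

theorem elStr_id (x : (IndDisp o X).Ob) (ha : IsCoherentLaw (R := x.1) (R' := x.1) (𝟙 x.1.J)
      ((IndDisp o X).idStr x).1) : HEq (elStr ((IndDisp o X).idStr x) ha)
      ((FibDisp o X).idStr (elOb x)) := by
  cases o
  · exact fib_str_heq_lax (Q := elOb x) (Q' := elOb x) (El.map_id x.1.J)
      (fun e => heq_of_eq (El.vert_id x.1.J _))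
  · exact fib_str_heq_colax (Q := elOb x) (Q' := elOb x) (El.map_id x.1.J)
      (fun e => heq_of_eq (El.vert_id x.1.J _))

theorem elStr_comp {x y r : (IndDisp o X).Ob}
    {κ : x.1.J ⟶ y.1.J} {κ' : y.1.J ⟶ r.1.J}
    (a : (IndDisp o X).Str (x := x) (y := y) κ)
    (b : (IndDisp o X).Str (x := y) (y := r) κ')
    (ha : IsCoherentLaw (R := x.1) (R' := y.1) κ a.1)
    (hb : IsCoherentLaw (R := y.1) (R' := r.1) κ' b.1)
    (hab : IsCoherentLaw (R := x.1) (R' := r.1) (κ ≫ κ')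
      ((IndDisp o X).compStr (x := x) (y := y) (t := r) a b).1) :
    HEq (elStr (x := x) (y := r) ((IndDisp o X).compStr (x := x) (y := y) (t := r) a b) hab)
      ((FibDisp o X).compStr (x := elOb x) (y := elOb y) (t := elOb r)
        (elStr a ha) (elStr b hb)) := by
  cases o
  · exact fib_str_heq_lax (Q := elOb x) (Q' := elOb r) (El.map_comp κ κ')
      (fun e => heq_of_eq (El.map_vert_vert κ' _ _).symm)
  · exact fib_str_heq_colax (Q := elOb x) (Q' := elOb r) (El.map_comp κ κ')
      (fun e => heq_of_eq (El.vert_map_vert κ' _ _).symm)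

theorem Displayed.Generated.of_heq {B : Type u} [Bicategory.{w, v} B]
    {D : Displayed.{w, v, v', u, u'} B} {W : D.OneCells} {x y : D.Ob} {f g : D.base x ⟶ D.base y}
    {a : D.Str f} {b : D.Str g} (h : f = g) (hab : HEq a b) (hb : D.Generated W b) :
    D.Generated W a := by
  subst h
  obtain rfl := eq_of_heq hab
  exact hb

theorem elStr_generated (fl : Flavour)
    {x y : (IndDisp fl.isColax X).Ob}
    {κ : x.1.J ⟶ y.1.J}
    {a : (IndDisp fl.isColax X).Str (x := x) (y := y) κ}
    (ha : IndGen fl a) :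
    ∀ hc : IsCoherentLaw (R := x.1) (R' := y.1) κ a.1,
    FibGen fl
      (x := elOb x) (y := elOb y) (elStr a hc) := by
  induction ha with
  | @of x y _ a ha => exact fun _ => .of _ (elLaw_isTangentMorphism x.2 y.2 ha)
  | id x => exact fun hc => .of_heq (El.map_id x.1.J) (elStr_id x hc) (.id (elOb x))
  | @comp x y r κ κ' a b ha hb h1 h2 =>
    exact fun hc => .of_heq (El.map_comp κ κ') (elStr_comp a b
      (isCoherentLaw_of_generated ha) (isCoherentLaw_of_generated hb) hc)
      (.comp (h1 (isCoherentLaw_of_generated ha)) (h2 (isCoherentLaw_of_generated hb)))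

theorem elLaw_compat (h : R.IsTangent (triv X)) (h' : R'.IsTangent (triv X)) {κ κ' : R.J ⟶ R'.J}
    {β : ∀ A, Law o (R.D A) (R'.D A) (Indx.functor κ A)}
    {γ : ∀ A, Law o (R.D A) (R'.D A) (Indx.functor κ' A)} (m : κ ⟶ κ')
    (H : ∀ A, (β A).Compat (γ A) (Indx.component m A)) :
    (elLaw κ h h' β).Compat (elLaw κ' h h' γ) (El.map₂ m).toNatTrans := by
  cases o
  · intro e
    exact (h'.vert_fib _ _).trans ((congrArg _ (H e.base e.fiber)).trans (El.vert_vert _ _ _).symm)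
  · intro e
    exact (El.vert_vert _ _ _).trans
      ((congrArg _ (H e.base e.fiber)).trans (h'.fib_vert_vert _ _).symm)

variable {fl : Flavour} {x y r : IndxTng.{u, u, u, u} fl (triv X)}

/-- The functor between categories of elements of a 1-cell. -/
abbrev elHom (κ : x ⟶ y) : (⟨elOb x.obj⟩ : TngFib.{u, u, u, u} fl (triv X)) ⟶ ⟨elOb y.obj⟩ :=
  Total.Hom.mk (El.map κ.hom) (elStr κ.str (isCoherentLaw_of_generated κ.gen))
    (elStr_generated fl κ.gen _)

theorem elHom_id (x : IndxTng.{u, u, u, u} fl (triv X)) : elHom (𝟙 x) = 𝟙 _ :=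
  Total.hom_ext (El.map_id x.obj.1.J)
    (elStr_id x.obj (isCoherentLaw_of_generated (𝟙 x : x ⟶ x).gen))

theorem elHom_comp (κ : x ⟶ y) (κ' : y ⟶ r) : elHom (κ ≫ κ') = elHom κ ≫ elHom κ' :=
  Total.hom_ext (El.map_comp κ.hom κ'.hom) (elStr_comp κ.str κ'.str (isCoherentLaw_of_generated
    κ.gen) (isCoherentLaw_of_generated κ'.gen) (isCoherentLaw_of_generated (κ ≫ κ').gen))

variable (X) (fl)

/-- The strict 2-functor of elements, with the fibrewise tangent structures. -/
def elFunctor : StrictPseudofunctor (IndxTng.{u, u, u, u} fl (triv X))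
      (TngFib.{u, u, u, u} fl (triv X)) :=
  strictFunctor (indDisplayed_isStrict _ _ _) (fibDisplayed_isStrict _ _ _)
    { obj := fun R => ⟨elOb R.obj⟩
      map := fun κ => elHom κ
      map₂ := fun {R R' _ _} m => Total.Hom₂.mk (El.map₂ m.cell)
        (elLaw_compat R.obj.2 R'.obj.2 m.cell m.two) }
    (fun _ => Total.hom₂_ext (BasedNatTrans.homCategory.ext _ _
      (NatTrans.ext (funext fun _ => El.vert_id _ _))))
    (fun _ _ => Total.hom₂_ext (BasedNatTrans.homCategory.ext _ _
      (NatTrans.ext (funext fun _ => (El.vert_vert _ _ _).symm))))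
    elHom_id elHom_comp
    (fun κ κ₁ κ₂ _ => Total.heq_cell (elHom_comp κ κ₁) (elHom_comp κ κ₂)
      (based_heq (El.map_comp κ.hom κ₁.hom) (El.map_comp κ.hom κ₂.hom) (fun _ => HEq.rfl)))
    (fun {_ _ _ κ₁ κ₂} _ κ => Total.heq_cell (elHom_comp κ₁ κ) (elHom_comp κ₂ κ)
      (based_heq (El.map_comp κ₁.hom κ.hom) (El.map_comp κ₂.hom κ.hom)
        (fun _ => heq_of_eq (El.map_vert κ.hom _).symm)))

end StrictElementsFunctor

section EqLaw

variable {C : Type u} [Category.{v} C] {C' : Type u'} [Category.{v'} C'] {D : TangentData C}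
  {D' : TangentData C'} {F : C ⥤ C'}

/-- The distributive law of a functor that preserves the tangent bundle functor on the nose. -/
def eqLaw (h : ∀ A, D'.T.obj (F.obj A) = F.obj (D.T.obj A)) : ∀ o : Bool, Law o D D' F
  | false => fun A => eqToHom (h A).symm
  | true => fun A => eqToHom (h A)

theorem isTangentMorphism_eqLaw (hD : D.IsTangent) (hD' : D'.IsTangent)
    {h : ∀ A, D'.T.obj (F.obj A) = F.obj (D.T.obj A)}
    (hc : IsColaxMorphism D D' F (eqLaw h true)) (fl : Flavour) :
    IsTangentMorphism D D' F fl (eqLaw h fl.isColax) := by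
  have hs : IsTangentMorphism D D' F .strict (eqLaw h true) := ⟨hc, h, fun _ => rfl⟩
  cases fl
  · have e : (hs.strong_of_strict.strongMap hD hD').law false = eqLaw h false := by
      funext A
      have : IsIso (eqToHom (h A)) := inferInstance
      exact inv_eqToHom (h A)
    exact e ▸ (hs.strong_of_strict.strongMap hD hD').isLaxMorphism hD'
  · exact hc
  · exact hs.strong_of_strict
  · exact hs

/-- The identity, as a strong map. -/
def StrongMap.id (D : TangentData C) : StrongMap D D (𝟭 C) where
  b _ := Iso.refl _
  b₂ _ := Iso.refl _
  natural f := (comp_id _).trans (id_comp _).symm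
  π₁ _ := (id_comp _).trans (comp_id _).symm
  π₂ _ := (id_comp _).trans (comp_id _).symm
  p _ := id_comp _
  z _ := comp_id _
  s _ := (id_comp _).trans (comp_id _).symm
  l A := by
    change D.l A ≫ D.T.map (𝟙 (D.T.obj A)) ≫ 𝟙 _ = 𝟙 _ ≫ D.l A
    simp
  c A := by
    change D.c A ≫ D.T.map (𝟙 (D.T.obj A)) ≫ 𝟙 _ = D.T.map (𝟙 (D.T.obj A)) ≫ 𝟙 _ ≫ D.c A
    simp

theorem PreservesTangentLimits.id (hD : D.IsTangent) : PreservesTangentLimits D (𝟭 C) where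
  power _ _ _ _ h := h
  vertical A k h1 h2 := hD.universal A k h1 h2

theorem IsColaxMorphism.id (hD : D.IsTangent) :
    IsColaxMorphism D D (𝟭 C) ((StrongMap.id D).law true) :=
  (StrongMap.id D).isColaxMorphism hD (.id hD)

end EqLaw

section Inverse

variable {C : Type u} [Category.{v} C] {C' : Type u} [Category.{v} C'] {D : TangentData C}
  {D' : TangentData C'} {F : C ⥤ C'}

theorem isColaxMorphism_of_inverse [F.Full] [F.Faithful] (φ : StrongMap D D' F)
    (hD' : D'.IsTangent) {G : C' ⥤ C} (γ : ∀ y, y ≅ F.obj (G.obj y))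
    (hγ : ∀ {y y' : C'} (f : y ⟶ y'), f ≫ (γ y').hom = (γ y).hom ≫ F.map (G.map f))
    {δ : Law true D' D G} (hδ : ∀ y, F.map (δ y) = (φ.b (G.obj y)).inv ≫
      D'.T.map (γ y).inv ≫ (γ (D'.T.obj y)).hom) : IsColaxMorphism D' D G δ :=
  isColaxMorphism_of_jointlyReflects (F := G) (jointlyReflects_of_fullyFaithful F)
    (fun _ => hD') (fun _ => StrongMap.id D') (fun _ => .id hD') (fun _ => φ) (fun _ => hD')
    (F' := fun _ => 𝟭 C') (fun _ => γ) (fun _ {_ _} f => hγ f) (fun _ => .id hD') (fun _ y => by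
      refine (hδ y).trans (congrArg (_ ≫ ·) (congrArg (_ ≫ ·) ?_))
      change _ = 𝟙 _ ≫ 𝟙 _ ≫ _
      rw [id_comp, id_comp])

end Inverse

section UnitTransformation

open Pseudofunctor CoGrothendieck

variable {X : Type u} [Category.{u} X] (J : SIndx X)

theorem El.id_fiber_unit {A : X} (E : J.fib A) :
    CoGrothendieck.Hom.fiber (𝟙 (El.mk J A E)) ≫ J.unit E = 𝟙 E :=
  congrArg (fun t => t.toNatTrans.app E) (J.mapId ⟨op A⟩).inv_hom_id

theorem El.unit_id_fiber {A : X} (E : J.fib A) :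
    J.unit E ≫ CoGrothendieck.Hom.fiber (𝟙 (El.mk J A E)) = 𝟙 _ :=
  congrArg (fun t => t.toNatTrans.app E) (J.mapId ⟨op A⟩).hom_inv_id

theorem El.vert_eq {A : X} {E E' : J.fib A} (ξ : E ⟶ E') :
    El.vert J ξ = (⟨𝟙 A, ξ ≫ CoGrothendieck.Hom.fiber (𝟙 (El.mk J A E'))⟩ :
      CoGrothendieck.Hom (El.mk J A E) (El.mk J A E')) :=
  (comp_id _).symm.trans (El.vert_comp J ξ (𝟙 (El.mk J A E')))

theorem El.vert_injective {A : X} {E E' : J.fib A} {ξ ξ' : E ⟶ E'}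
    (h : El.vert J ξ = El.vert J ξ') : ξ = ξ' := by
  rw [El.vert_eq, El.vert_eq] at h
  have h1 := congrArg (· ≫ J.unit E') (El.hom_mk_inj h)
  have key : ∀ ξ : E ⟶ E',
      (ξ ≫ CoGrothendieck.Hom.fiber (𝟙 (El.mk J A E'))) ≫ J.unit E' = ξ := fun ξ =>
    (assoc _ _ _).trans ((congrArg (ξ ≫ ·) (El.id_fiber_unit J E')).trans (comp_id ξ))
  exact (key ξ).symm.trans (h1.trans (key ξ'))

theorem El.vert_comp_unit {A : X} {E E' : J.fib A} (y : E ⟶ (J.sub (𝟙 A)).obj E') :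
    El.vert J (y ≫ J.unit E') = (⟨𝟙 A, y⟩ : CoGrothendieck.Hom (El.mk J A E) (El.mk J A E')) :=
  (El.vert_eq J _).trans (congrArg (CoGrothendieck.Hom.mk _) ((assoc _ _ _).trans
    ((congrArg (y ≫ ·) (El.unit_id_fiber J E')).trans (comp_id y))))

theorem El.exists_vert {A : X} {E E' : J.fib A} (χ : El.mk J A E ⟶ El.mk J A E')
    (h : (forget J).IsHomLift (𝟙 A) χ) : ∃ ξ : E ⟶ E', El.vert J ξ = χ := by
  obtain ⟨y, hy⟩ := El.exists_hom_of_base χ (f := 𝟙 A)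
    (@IsHomLift.eq_of_isHomLift _ _ _ _ (forget J) (El.mk J A E) (El.mk J A E') (𝟙 A) χ h).symm
  exact ⟨y ≫ J.unit E', (El.vert_comp_unit J y).trans hy.symm⟩

theorem El.vert_unit {A : X} (E : J.fib A) : El.vert J (J.unit E) = El.lift J (𝟙 A) E := by
  have h := El.vert_comp_unit J (𝟙 ((J.sub (𝟙 A)).obj E))
  rw [id_comp] at h
  exact h

theorem El.lift_lift {A A' A'' : X} (f : A ⟶ A') (g : A' ⟶ A'') (E : J.fib A'') :
    El.vert J (J.compositor f g E) ≫ El.lift J f ((J.sub g).obj E) ≫ El.lift J g E =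
      El.lift J (f ≫ g) E := by
  refine (El.vert_comp J _ _).trans (congrArg (CoGrothendieck.Hom.mk _) ?_)
  have h1 : J.compositor f g E ≫ (J.mapComp g.op.toLoc f.op.toLoc).inv.toNatTrans.app E = 𝟙 _ :=
    congrArg (fun t => t.toNatTrans.app E) (J.mapComp g.op.toLoc f.op.toLoc).hom_inv_id
  refine Eq.trans (congrArg (_ ≫ ·) ?_) h1
  exact (id_comp _).trans ((congrArg (· ≫ _) ((J.sub f).map_id _)).trans (id_comp _))

/-- The functor from a fibre to the fibre of the category of elements. -/
def unitFunctor (A : X) : J.fib A ⥤ (forget J).Fiber A where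
  obj E := ⟨El.mk J A E, rfl⟩
  map ξ := ⟨El.vert J ξ, El.vert_isHomLift J ξ⟩
  map_id E := Subtype.ext (El.vert_id J E)
  map_comp ξ ξ' := Subtype.ext (El.vert_vert J ξ ξ').symm

instance (A : X) : (unitFunctor J A).Faithful where
  map_injective h := El.vert_injective J (congrArg Subtype.val h)

instance (A : X) : (unitFunctor J A).Full where
  map_surjective χ :=
    ⟨(El.exists_vert J χ.1 χ.2).choose, Subtype.ext (El.exists_vert J χ.1 χ.2).choose_spec⟩

theorem unitFunctor_pullMap {A A' : X} (f : A ⟶ A') {E E' : J.fib A'} (ξ : E ⟶ E') :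
    (El.cleavage J).pullMap f ((unitFunctor J A').map ξ) =
      (unitFunctor J A).map ((J.sub f).map ξ) :=
  (El.cleavage J).hom_ext f (((El.cleavage J).pullMap_lift f _).trans (El.lift_vert J f ξ))

theorem unitFunctor_unit {A : X} (E : J.fib A) :
    ((El.cleavage J).unit ((unitFunctor J A).obj E)).hom = (unitFunctor J A).map (J.unit E) :=
  (inc (forget J) A).map_injective (((El.cleavage J).unit_hom _).trans (El.vert_unit J E).symm)

theorem unitFunctor_compositor {A A' A'' : X} (f : A ⟶ A') (g : A' ⟶ A'') (E : J.fib A'') :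
    ((El.cleavage J).compositor f g ((unitFunctor J A'').obj E)).hom =
      (unitFunctor J A).map (J.compositor f g E) :=
  vert_ext (f ≫ g) _ (isStronglyCartesian_comp ((El.cleavage J).cartesian f _) ((El.cleavage
    J).cartesian g _)) (((El.cleavage J).compositor_hom f g _).trans (El.lift_lift J f g E).symm)

/-- An indexed category is isomorphic to the fibres of its category of elements. -/
def unitTrans : J ⟶ (El.cleavage J).fibres :=
  Indx.mkTrans (J := J) (J' := (El.cleavage J).fibres) (unitFunctor J) (fun _ _ => Iso.refl _) (fun
    {_ _} f {_ _} ξ => (comp_id _).trans ((unitFunctor_pullMap J f ξ).symm.trans (id_comp _).symm))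
    (fun E => (id_comp _).trans (unitFunctor_unit J E)) (fun f g E => (id_comp _).trans
    ((unitFunctor_compositor J f g E).trans (Eq.symm ((congrArg (fun t => (unitFunctor J _).map
    (J.compositor f g E) ≫ t) ((id_comp _).trans (((El.cleavage J).pullFunctor f).map_id _))).trans
    (comp_id _)))))

/-- The underlying object of a fibre of the category of elements. -/
def fibInv {A : X} : (forget J).Fiber A → J.fib A
  | ⟨⟨_, E⟩, rfl⟩ => E

theorem unitFunctor_fibInv {A : X} :
    ∀ e : (forget J).Fiber A, (unitFunctor J A).obj (fibInv J e) = e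
  | ⟨⟨_, _⟩, rfl⟩ => rfl

theorem exists_unitFunctor {A : X} (e : (forget J).Fiber A) :
    ∃ E, e = (unitFunctor J A).obj E := ⟨_, (unitFunctor_fibInv J e).symm⟩

/-- The functor from the fibre of the category of elements to a fibre. -/
def fibInvFunctor (A : X) : (forget J).Fiber A ⥤ J.fib A where
  obj := fibInv J
  map {e e'} ξ := (unitFunctor J A).preimage
    (eqToHom (unitFunctor_fibInv J e) ≫ ξ ≫ eqToHom (unitFunctor_fibInv J e').symm)
  map_id e := (unitFunctor J A).map_injective (by
    rw [Functor.map_preimage, fmap_id, id_comp, eqToHom_trans, eqToHom_refl])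
  map_comp ξ ξ' := (unitFunctor J A).map_injective (by
    rw [fmap_comp, Functor.map_preimage, Functor.map_preimage, Functor.map_preimage]
    simp only [assoc, eqToHom_trans_assoc, eqToHom_refl, id_comp])

theorem fibInvFunctor_map {A : X} {E E' : J.fib A} (ξ : E ⟶ E') :
    (fibInvFunctor J A).map ((unitFunctor J A).map ξ) = ξ := by
  refine (unitFunctor J A).map_injective (((unitFunctor J A).map_preimage _).trans ?_)
  exact (id_comp _).trans (comp_id _)

theorem fibInv_pull {A A' : X} (f : A ⟶ A') : ∀ e : (forget J).Fiber A',
    fibInv J ((El.cleavage J).pull f e) = (J.sub f).obj (fibInv J e)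
  | ⟨⟨_, _⟩, rfl⟩ => rfl

/-- The inverse of `unitTrans`. -/
def unitInv : (El.cleavage J).fibres ⟶ J :=
  Indx.mkTrans (J := (El.cleavage J).fibres) (J' := J) (fibInvFunctor J)
    (fun f e => eqToIso (fibInv_pull J f e))
    (fun {A A'} f {e e'} ξ => by
      obtain ⟨E, rfl⟩ := exists_unitFunctor J e
      obtain ⟨E', rfl⟩ := exists_unitFunctor J e'
      obtain ⟨ξ, rfl⟩ := (unitFunctor J A').map_surjective ξ
      refine (comp_id _).trans (Eq.trans ?_ (id_comp _).symm)
      refine (congrArg (fibInvFunctor J A).map (unitFunctor_pullMap J f ξ)).trans ?_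
      exact (fibInvFunctor_map J _).trans (congrArg (J.sub f).map (fibInvFunctor_map J ξ)).symm)
    (fun {A} e => by
      obtain ⟨E, rfl⟩ := exists_unitFunctor J e
      refine (id_comp _).trans (Eq.symm ?_)
      exact (congrArg (fibInvFunctor J A).map (unitFunctor_unit J E)).trans (fibInvFunctor_map J _))
    (fun {A A' A''} f g e => by
      obtain ⟨E, rfl⟩ := exists_unitFunctor J e
      refine (id_comp _).trans (Eq.symm ?_)
      refine (congrArg (_ ≫ ·) ((id_comp _).trans ((J.sub f).map_id _))).trans
        ((comp_id _).trans ?_)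
      exact (congrArg (fibInvFunctor J A).map (unitFunctor_compositor J f g E)).trans
        (fibInvFunctor_map J _))

theorem unitTrans_inv : unitTrans J ≫ unitInv J = 𝟙 J := by
  refine indx_ext (fun A => CategoryTheory.Functor.hext (fun _ => rfl)
    (fun _ _ ξ => heq_of_eq (fibInvFunctor_map J ξ))) (fun {A A'} f E => ?_)
  rw [Indx.distributor_comp, Indx.distributor_id]
  refine heq_of_eq ((comp_id _).trans ?_)
  exact (fibInvFunctor J A).map_id _

theorem unitInv_trans : unitInv J ≫ unitTrans J = 𝟙 (El.cleavage J).fibres := by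
  refine indx_ext (fun A => CategoryTheory.Functor.hext (unitFunctor_fibInv J)
    (fun e e' ξ => ?_)) (fun {A A'} f e => ?_)
  · obtain ⟨E, rfl⟩ := exists_unitFunctor J e
    obtain ⟨E', rfl⟩ := exists_unitFunctor J e'
    obtain ⟨ξ, rfl⟩ := (unitFunctor J A).map_surjective ξ
    exact heq_of_eq (congrArg (unitFunctor J A).map (fibInvFunctor_map J ξ))
  · obtain ⟨E, rfl⟩ := exists_unitFunctor J e
    refine (heq_of_eq (Indx.distributor_comp (unitInv J) (unitTrans J) f _)).trans
      (HEq.trans ?_ (heq_of_eq (Indx.distributor_id (J := (El.cleavage J).fibres) f _)).symm)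
    exact heq_of_eq ((comp_id _).trans ((unitFunctor J A).map_id _))

end UnitTransformation

theorem IsTangentMorphism.isNatural {C : Type u} [Category.{v} C] {C' : Type u'} [Category.{v'} C']
    {D : TangentData C} {D' : TangentData C'} {F : C ⥤ C'} :
    ∀ {fl : Flavour} {β : Law fl.isColax D D' F}, IsTangentMorphism D D' F fl β → β.IsNatural
  | .lax, _, h => h.natural
  | .colax, _, h => h.natural
  | .strong, _, h => h.1.natural
  | .strict, _, h => h.1.natural

section CoherentEqLaw

variable {X : Type u} [Category.{v} X] {R R' : RawIndexed.{v, v', u, u'} X}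

theorem eqToHom_square_symm {C : Type u} [Category.{v} C] {E : Type u'} [Category.{v'} E] {G : E ⥤ C}
    {x y m k : C} {r t : E} (e : x = y) (e' : r = t) {a : y ⟶ m} {d : m ⟶ G.obj t} {a' : x ⟶ k}
    {d' : k ⟶ G.obj r} (H : eqToHom e ≫ a ≫ d = a' ≫ d' ≫ G.map (eqToHom e')) :
    a ≫ d ≫ G.map (eqToHom e'.symm) = eqToHom e.symm ≫ a' ≫ d' := by
  subst e e'
  simp only [eqToHom_refl, fmap_id, comp_id, id_comp] at H ⊢
  exact H

theorem isCoherentLaw_eqLaw {κ : R.J ⟶ R'.J}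
    {h : ∀ A E, (R'.D A).T.obj ((Indx.functor κ A).obj E) =
      (Indx.functor κ A).obj ((R.D A).T.obj E)}
    (H : IsCoherentLaw κ (fun A => eqLaw (h A) true)) :
    ∀ o, IsCoherentLaw κ (fun A => eqLaw (h A) o)
  | true => H
  | false => fun f E => eqToHom_square_symm (h _ _) (h _ E) (H f E)

end CoherentEqLaw

theorem id_comp_comp_id_eq {C : Type u} [Category.{v} C] {C' : Type u'} [Category.{v'} C']
    {C'' : Type u''} [Category.{v''} C''] {x : C} {x' : C'} {F : C ⥤ C''} {G : C' ⥤ C''}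
    {a b : F.obj x ⟶ G.obj x'} (h : a = b) :
    𝟙 _ ≫ a ≫ 𝟙 _ = F.map (𝟙 x) ≫ b ≫ G.map (𝟙 x') := by
  rw [h, id_comp, comp_id, fmap_id, fmap_id, id_comp, comp_id]

section UnitMorphism

open Pseudofunctor CoGrothendieck

variable {X : Type u} [Category.{u} X] {R R' : RawIndexed.{u, u, u, u} X}
  (h : R.IsTangent (triv X)) (h' : R'.IsTangent (triv X))

/-- The functor from a fibre to the category of elements, as a strong map. -/
def RawIndexed.IsTangent.elStrong (A : X) : StrongMap (R.D A) h.elTangent (ι R.J A) where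
  b E := Iso.refl (El.mk R.J A ((R.D A).T.obj E))
  b₂ E := Iso.refl (El.mk R.J A ((R.D A).T₂ E))
  natural ξ := (comp_id _).trans ((h.fib_vert ξ).trans (id_comp _).symm)
  π₁ _ := (id_comp _).trans (comp_id _).symm
  π₂ _ := (id_comp _).trans (comp_id _).symm
  p _ := id_comp _
  z _ := comp_id _
  s _ := (id_comp _).trans (comp_id _).symm
  l _ := ((congrArg (_ ≫ ·) ((comp_id _).trans (h.elTangent.T.map_id _))).trans
      (comp_id _)).trans (id_comp _).symm
  c _ := ((congrArg (_ ≫ ·) ((comp_id _).trans (h.elTangent.T.map_id _))).trans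
      (comp_id _)).trans (((congrArg (· ≫ 𝟙 _ ≫ _) (h.elTangent.T.map_id _)).trans
        (id_comp _)).trans (id_comp _)).symm

include h in
theorem RawIndexed.IsTangent.el_preservesTangentLimits (A : X) : PreservesTangentLimits (R.D A) (ι R.J A) :=
  (h.elStrong A).preservesTangentLimits h.elTangent_isTangent
    (fun E _ _ _ H => h.isFibrePower_el E H)

/-- The distributive laws of `unitTrans`: identities. -/
abbrev unitLaw (o : Bool) (A : X) :
    Law o (R.D A) ((elFibration_isTangent h).vertTangent A) (unitFunctor R.J A) :=
  eqLaw (D := R.D A) (D' := (elFibration_isTangent h).vertTangent A) (F := unitFunctor R.J A)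
    (fun _ => rfl) o

theorem unitFunctor_isColaxMorphism (A : X) :
    IsColaxMorphism (R.D A) ((elFibration_isTangent h).vertTangent A) (unitFunctor R.J A)
      (unitLaw h true A) :=
  isColaxMorphism_of_jointlyReflects (G := fun _ : Unit => 𝟭 (R.J.fib A))
    (F := unitFunctor R.J A) (D' := fun _ => R.D A) (K' := fun _ => h.elTangent)
    (jointlyReflects_inc (P := forget R.J) A) (fun _ => h.fibre A)
    (fun _ => StrongMap.id _) (fun _ => .id (h.fibre A))
    (fun _ => (elFibration_isTangent h).incStrong A) (fun _ => h.elTangent_isTangent)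
    (F' := fun _ => ι R.J A) (fun _ E => Iso.refl (El.mk R.J A E))
    (fun _ {_ _} _ => (comp_id _).trans (id_comp _).symm)
    (β' := fun _ => (h.elStrong A).law true)
    (fun _ => (h.elStrong A).isColaxMorphism h.elTangent_isTangent (h.el_preservesTangentLimits A))
    (fun _ _ => Eq.symm ((id_comp _).trans ((congrArg (· ≫ _)
      (h.elTangent.T.map_id _)).trans ((id_comp _).trans ((id_comp _).trans
        ((comp_id _).trans ((ι R.J A).map_id _)))))))

theorem unitFunctor_vertLaw {A A' : X} (f : A ⟶ A') (E : R.J.fib A') :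
    ((elFibration_isTangent h).vertLawIso f ((unitFunctor R.J A').obj E)).hom =
      (unitFunctor R.J A).map (R.α f E) :=
  (El.cleavage R.J).hom_ext f (((elFibration_isTangent h).vertLaw_lift f
    ((unitFunctor R.J A').obj E)).trans (El.map_lift h.trans f E))

theorem unitTrans_coherent (o : Bool) :
    IsCoherentLaw (R := R) (R' := vertIndexed (elFibration_isTangent h)) (unitTrans R.J)
      (unitLaw h o) :=
  isCoherentLaw_eqLaw (R := R) (R' := vertIndexed (elFibration_isTangent h))
    (κ := unitTrans R.J) (h := fun _ _ => rfl)
    (fun {A A'} f E => id_comp_comp_id_eq (F := (elFibration_isTangent h).vertTangent A |>.T)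
      (x := (unitFunctor R.J A).obj ((R.J.sub f).obj E))
      (x' := (unitFunctor R.J A').obj ((R.D A').T.obj E))
      (G := (El.cleavage R.J).pullFunctor f) (unitFunctor_vertLaw h f E).symm) o

theorem unitTrans_isIndexedMorphism (fl : Flavour) :
    IsIndexedMorphism (R := R) (R' := vertIndexed (elFibration_isTangent h)) fl (unitTrans R.J)
      (unitLaw h fl.isColax) where
  fibre A := isTangentMorphism_eqLaw (h.fibre A) ((elFibration_isTangent h).vertTangent_isTangent A)
    (unitFunctor_isColaxMorphism h A) fl
  coherent := unitTrans_coherent h fl.isColax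

theorem fibInv_tObj {A : X} : ∀ e : (forget R.J).Fiber A,
    (R.D A).T.obj (fibInv R.J e) = fibInv R.J ((elFibration_isTangent h).tObj e)
  | ⟨⟨_, _⟩, rfl⟩ => rfl

/-- The distributive laws of `unitInv`: identities. -/
abbrev unitInvLaw (o : Bool) (A : X) :
    Law o ((elFibration_isTangent h).vertTangent A) (R.D A) (fibInvFunctor R.J A) :=
  eqLaw (D' := R.D A) (D := (elFibration_isTangent h).vertTangent A)
    (F := fibInvFunctor R.J A) (fibInv_tObj h) o

theorem fibInvFunctor_isColaxMorphism (A : X) :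
    IsColaxMorphism ((elFibration_isTangent h).vertTangent A) (R.D A) (fibInvFunctor R.J A)
      (unitInvLaw h true A) := by
  have hs : IsTangentMorphism (R.D A) ((elFibration_isTangent h).vertTangent A)
      (unitFunctor R.J A) .strong (unitLaw h true A) :=
    isTangentMorphism_eqLaw (h.fibre A) ((elFibration_isTangent h).vertTangent_isTangent A)
      (unitFunctor_isColaxMorphism h A) .strong
  refine isColaxMorphism_of_inverse (F := unitFunctor R.J A)
    (hs.strongMap (h.fibre A) ((elFibration_isTangent h).vertTangent_isTangent A))
    ((elFibration_isTangent h).vertTangent_isTangent A)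
    (fun e => eqToIso (unitFunctor_fibInv R.J e).symm) (fun {e e'} ξ => ?_) (fun e => ?_)
  · obtain ⟨E, rfl⟩ := exists_unitFunctor R.J e
    obtain ⟨E', rfl⟩ := exists_unitFunctor R.J e'
    obtain ⟨ξ, rfl⟩ := (unitFunctor R.J A).map_surjective ξ
    exact ((comp_id _).trans (congrArg (unitFunctor R.J A).map
      (fibInvFunctor_map R.J ξ)).symm).trans (id_comp _).symm
  · obtain ⟨E, rfl⟩ := exists_unitFunctor R.J e
    refine ((unitFunctor R.J A).map_id _).trans (Eq.symm ?_)
    refine (congrArg (_ ≫ ·) ((comp_id _).trans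
      (((elFibration_isTangent h).vertTangent A).T.map_id _))).trans ((comp_id _).trans ?_)
    exact IsIso.inv_id

theorem unitInv_coherent (o : Bool) :
    IsCoherentLaw (R := vertIndexed (elFibration_isTangent h)) (R' := R) (unitInv R.J)
      (unitInvLaw h o) :=
  isCoherentLaw_eqLaw (R := vertIndexed (elFibration_isTangent h)) (R' := R)
    (κ := unitInv R.J) (h := fun A => fibInv_tObj h)
    (fun {A A'} f e => by
      obtain ⟨E, rfl⟩ := exists_unitFunctor R.J e
      exact id_comp_comp_id_eq (F := (R.D A).T) (G := R.J.sub f) (x := (R.J.sub f).obj E) (x' :=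
        (R.D A').T.obj E) ((congrArg (fibInvFunctor R.J A).map (unitFunctor_vertLaw h f E)).trans
        (fibInvFunctor_map R.J _))) o

theorem unitInv_isIndexedMorphism (fl : Flavour) :
    IsIndexedMorphism (R := vertIndexed (elFibration_isTangent h)) (R' := R) fl (unitInv R.J)
      (unitInvLaw h fl.isColax) where
  fibre A := isTangentMorphism_eqLaw ((elFibration_isTangent h).vertTangent_isTangent A) (h.fibre A)
    (fibInvFunctor_isColaxMorphism h A) fl
  coherent := unitInv_coherent h fl.isColax

theorem unitTrans_natural {J J' : SIndx X} (κ : J ⟶ J')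
    (hc : ∀ {A A' : X} {f : A ⟶ A'} {e e' : El J} {φ : e ⟶ e'},
      (forget J).IsStronglyCartesian f φ → (forget J').IsStronglyCartesian f ((El.map κ).map φ)) :
    κ ≫ unitTrans J' =
      unitTrans J ≫ fibreTrans (El.cleavage J) (El.cleavage J') (El.map κ) hc := by
  refine indx_ext (fun A => CategoryTheory.Functor.hext (fun _ => rfl) (fun E E' ξ => ?_))
    (fun {A A'} f E => ?_)
  · exact heq_of_eq (Subtype.ext (El.map_vert κ ξ).symm)
  · refine (heq_of_eq (Indx.distributor_comp κ (unitTrans J') f E)).trans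
      (HEq.trans (heq_of_eq ?_) (heq_of_eq (Indx.distributor_comp (unitTrans J)
        (fibreTrans (El.cleavage J) (El.cleavage J') (El.map κ) hc) f E)).symm)
    refine (comp_id _).trans (Eq.trans ?_ ((congrArg (fun t => t ≫ (fibreDistributor (El.cleavage J)
      (El.cleavage J') (El.map κ) hc f ((unitFunctor J A').obj E)).hom) ((fibreRestrict (El.map κ)
      A).map_id ((unitFunctor J A).obj ((J.sub f).obj E)))).trans (id_comp _)).symm)
    exact (El.cleavage J').hom_ext f (E := (unitFunctor J' A').obj ((Indx.functor κ A').obj E))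
      (k := (unitFunctor J' A).map (Indx.distributor κ f E).hom)
      (k' := (fibreDistributor (𝒳 := El.based J) (𝒴 := El.based J') (El.cleavage J) (El.cleavage J') (El.map κ) hc f
        ((unitFunctor J A').obj E)).hom) ((El.map_lift κ f E).symm.trans
      (fibreDistributor_hom (𝒳 := El.based J) (𝒴 := El.based J') (El.cleavage J)
        (El.cleavage J') (El.map κ) hc f ((unitFunctor J A').obj E)).symm)

end UnitMorphism

section UnitData

open Pseudofunctor CoGrothendieck

variable {X : Type u} [Category.{u} X]

theorem unitLaw_isNatural {R : RawIndexed.{u, u, u, u} X}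
    (h : R.IsTangent (triv X)) : ∀ o A, (unitLaw h o A).IsNatural
  | false, A => ((unitTrans_isIndexedMorphism h .lax).fibre A).isNatural
  | true, A => ((unitTrans_isIndexedMorphism h .colax).fibre A).isNatural

theorem unitInvLaw_isNatural {R : RawIndexed.{u, u, u, u} X}
    (h : R.IsTangent (triv X)) : ∀ o A, (unitInvLaw h o A).IsNatural
  | false, A => ((unitInv_isIndexedMorphism h .lax).fibre A).isNatural
  | true, A => ((unitInv_isIndexedMorphism h .colax).fibre A).isNatural

variable {o : Bool}

/-- The structure of the unit. -/
abbrev unitStr (x : (IndDisp o X).Ob) : (IndDisp o X).Str (x := x) (y := vertOb (elOb x))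
      (unitTrans x.1.J) :=
  ⟨unitLaw x.2 o, unitLaw_isNatural x.2 o⟩

/-- The structure of the inverse of the unit. -/
abbrev unitInvStr (x : (IndDisp o X).Ob) : (IndDisp o X).Str (x := vertOb (elOb x)) (y := x)
      (unitInv x.1.J) :=
  ⟨unitInvLaw x.2 o, unitInvLaw_isNatural x.2 o⟩

theorem unitStr_inv (x : (IndDisp o X).Ob) :
    HEq ((IndDisp o X).compStr (x := x) (y := vertOb (elOb x)) (t := x)
      (unitStr x) (unitInvStr x)) ((IndDisp o X).idStr x) := by
  cases o
  · exact ind_str_heq_lax (R := x) (R' := x) (unitTrans_inv x.1.J) (fun A E => heq_of_eq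
      ((comp_id _).trans ((fibInvFunctor x.1.J A).map_id _)))
  · exact ind_str_heq_colax (R := x) (R' := x) (unitTrans_inv x.1.J) (fun A E => heq_of_eq
      ((id_comp _).trans ((fibInvFunctor x.1.J A).map_id _)))

theorem unitInvStr_trans (x : (IndDisp o X).Ob) :
    HEq ((IndDisp o X).compStr (x := vertOb (elOb x)) (y := x)
      (t := vertOb (elOb x)) (unitInvStr x) (unitStr x))
      ((IndDisp o X).idStr (vertOb (elOb x))) := by
  cases o
  · refine ind_str_heq_lax (R := vertOb (elOb x)) (R' := vertOb (elOb x)) (unitInv_trans x.1.J)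
      (fun A e => ?_)
    obtain ⟨E, rfl⟩ := exists_unitFunctor x.1.J e
    exact heq_of_eq ((comp_id _).trans ((unitFunctor x.1.J A).map_id _))
  · refine ind_str_heq_colax (R := vertOb (elOb x)) (R' := vertOb (elOb x)) (unitInv_trans x.1.J)
      (fun A e => ?_)
    obtain ⟨E, rfl⟩ := exists_unitFunctor x.1.J e
    exact heq_of_eq ((id_comp _).trans ((unitFunctor x.1.J A).map_id _))

theorem unitHom_natural {x y : (IndDisp o X).Ob}
    {κ : x.1.J ⟶ y.1.J} (a : (IndDisp o X).Str (x := x) (y := y) κ)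
    (ha : IsCoherentLaw (R := x.1) (R' := y.1) κ a.1) :
    κ ≫ unitTrans y.1.J = unitTrans x.1.J ≫ vertHom (x := elOb x) (y := elOb y) (elStr a ha) :=
  unitTrans_natural κ (elStr a ha).2.cartesian

theorem unitStr_natural {x y : (IndDisp o X).Ob}
    {κ : x.1.J ⟶ y.1.J} (a : (IndDisp o X).Str (x := x) (y := y) κ)
    (ha : IsCoherentLaw (R := x.1) (R' := y.1) κ a.1) :
    HEq ((IndDisp o X).compStr (x := x) (y := y) (t := vertOb (elOb y)) a (unitStr y)) ((IndDisp o
      X).compStr (x := x) (y := vertOb (elOb x)) (t := vertOb (elOb y)) (unitStr x)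
          (vertStr (x := elOb x) (y := elOb y) (elStr a ha))) := by
  cases o
  · exact ind_str_heq_lax (R := x) (R' := vertOb (elOb y)) (unitHom_natural a ha) (fun A E =>
      heq_of_eq ((comp_id _).trans (Eq.symm ((congrArg (fun t => t ≫ (unitFunctor y.1.J A).map (a.1
      A E)) ((fibreRestrict (El.map κ) A).map_id ((unitFunctor x.1.J A).obj ((x.1.D A).T.obj
      E)))).trans (id_comp _)))))
  · exact ind_str_heq_colax (R := x) (R' := vertOb (elOb y)) (unitHom_natural a ha) (fun A E =>
      heq_of_eq ((id_comp _).trans (Eq.symm ((congrArg (fun t => (unitFunctor y.1.J A).map (a.1 A E)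
      ≫ t) ((fibreRestrict (El.map κ) A).map_id ((unitFunctor x.1.J A).obj ((x.1.D A).T.obj
      E)))).trans (comp_id _)))))

variable (X) (fl : Flavour)

/-- Indexed tangent categories are naturally isomorphic to the fibres of their elements. -/
def unitData : UnitData (elFunctor X fl) (vertFunctor X fl) where
  i x := Total.Hom.mk (x := x) (y := ⟨vertOb (elOb x.obj)⟩) (unitTrans x.obj.1.J)
    (unitStr x.obj) (.of _ (unitTrans_isIndexedMorphism x.obj.2 fl))
  j x := Total.Hom.mk (x := ⟨vertOb (elOb x.obj)⟩) (y := x) (unitInv x.obj.1.J)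
    (unitInvStr x.obj) (.of _ (unitInv_isIndexedMorphism x.obj.2 fl))
  ij x := Total.hom_ext (unitTrans_inv x.obj.1.J) (unitStr_inv x.obj)
  ji x := Total.hom_ext (unitInv_trans x.obj.1.J) (unitInvStr_trans x.obj)
  nat κ := Total.hom_ext (unitHom_natural κ.str (isCoherentLaw_of_generated κ.gen))
    (unitStr_natural κ.str (isCoherentLaw_of_generated κ.gen))
  nat₂ {_ _ κ κ'} _ := Total.heq_cell (Total.hom_ext (unitHom_natural κ.str
    (isCoherentLaw_of_generated κ.gen)) (unitStr_natural κ.str (isCoherentLaw_of_generated κ.gen)))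
    (Total.hom_ext (unitHom_natural κ'.str (isCoherentLaw_of_generated κ'.gen)) (unitStr_natural
    κ'.str (isCoherentLaw_of_generated κ'.gen))) (modification_heq (unitHom_natural κ.str
    (isCoherentLaw_of_generated κ.gen)) (unitHom_natural κ'.str (isCoherentLaw_of_generated κ'.gen))
    (fun _ _ => HEq.rfl))

end UnitData

section CounitFunctor

open Pseudofunctor CoGrothendieck

variable {X : Type u} [Category.{u} X] {C : Type u} [Category.{u} C] {P : C ⥤ X} (cl : Cleavage P)

theorem Cleavage.unit_inv_lift {A : X} (E : P.Fiber A) :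
    (inc P A).map (cl.unit E).inv ≫ cl.lift (𝟙 A) E = 𝟙 _ := by
  rw [← cl.unit_hom, ← fmap_comp, Iso.inv_hom_id, fmap_id]

/-- The action on morphisms of the functor from the elements of the fibres to the total category. -/
def counitMap {e e' : El cl.fibres} (φ : e ⟶ e') :
    (inc P e.base).obj e.fiber ⟶ (inc P e'.base).obj e'.fiber :=
  (inc P e.base).map φ.fiber ≫ cl.lift φ.base e'.fiber

theorem counitMap_isHomLift {e e' : El cl.fibres} (φ : e ⟶ e') :
    P.IsHomLift φ.base (counitMap cl φ) :=
  cl.comp_isHomLift φ.base (E := e'.fiber) φ.fiber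

/-- The functor from the elements of the fibres to the total category. -/
def counitFunctor : El cl.fibres ⥤ C where
  obj e := (inc P e.base).obj e.fiber
  map φ := counitMap cl φ
  map_id e := cl.unit_inv_lift (A := e.base) e.fiber
  map_comp {e e' e''} φ ψ := by
    have key : ∀ {A A' A'' : X} (f : A ⟶ A') (g : A' ⟶ A'') (E : P.Fiber A) (E' : P.Fiber A')
        (E'' : P.Fiber A'') (y : E ⟶ cl.pull f E') (y' : E' ⟶ cl.pull g E''),
        (inc P A).map (y ≫ cl.pullMap f y' ≫ (cl.compositor f g E'').inv) ≫ cl.lift (f ≫ g) E'' =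
          ((inc P A).map y ≫ cl.lift f E') ≫ (inc P A').map y' ≫ cl.lift g E'' := by
      intro A A' A'' f g E E' E'' y y'
      rw [fmap_comp, fmap_comp, assoc, assoc, cl.compositor_inv, ← assoc ((inc P A).map (cl.pullMap
        f y')), cl.pullMap_lift, assoc, assoc]
    exact key φ.base ψ.base e.fiber e'.fiber e''.fiber φ.fiber ψ.fiber

theorem counitFunctor_vert {A : X} {E E' : P.Fiber A} (ξ : E ⟶ E') :
    (counitFunctor cl).map (El.vert cl.fibres ξ) = (inc P A).map ξ := by
  refine (congrArg (counitFunctor cl).map (El.vert_eq cl.fibres (A := A) ξ)).trans ?_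
  change (inc P A).map (ξ ≫ (cl.unit E').inv) ≫ cl.lift (𝟙 A) E' = _
  rw [fmap_comp, assoc, cl.unit_inv_lift, comp_id]

theorem counitFunctor_lift {A A' : X} (f : A ⟶ A') (E : P.Fiber A') :
    (counitFunctor cl).map (El.lift cl.fibres f E) = cl.lift f E :=
  (congrArg (· ≫ cl.lift f E) ((inc P A).map_id (cl.pull f E))).trans (id_comp _)

theorem hom_eq_of_counitMap {A A' : X} {E : P.Fiber A} {E' : P.Fiber A'} {f f' : A ⟶ A'}
    (hf : f = f') {y : E ⟶ cl.pull f E'} {y' : E ⟶ cl.pull f' E'}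
    (h : (inc P A).map y ≫ cl.lift f E' = (inc P A).map y' ≫ cl.lift f' E') :
    (⟨f, y⟩ : CoGrothendieck.Hom (El.mk cl.fibres A E) (El.mk cl.fibres A' E')) = ⟨f', y'⟩ := by
  subst hf
  exact congrArg (CoGrothendieck.Hom.mk _) (cl.hom_ext f h)

instance : (counitFunctor cl).Faithful where
  map_injective {e e' φ φ'} h := by
    have h1 := counitMap_isHomLift cl φ
    have h2 : P.IsHomLift φ'.base (counitMap cl φ) := by
      have := counitMap_isHomLift cl φ'
      rwa [show counitMap cl φ' = counitMap cl φ from h.symm] at this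
    have hf : φ.base = φ'.base := by
      rw [IsHomLift.fac P φ.base (counitMap cl φ), IsHomLift.fac P φ'.base (counitMap cl φ)]
    exact hom_eq_of_counitMap cl (E := e.fiber) (E' := e'.fiber) hf h

theorem exists_counitFunctor_map {A A' : X} {f : A ⟶ A'} {E : P.Fiber A} {E' : P.Fiber A'}
    (χ : (inc P A).obj E ⟶ (inc P A').obj E') (h : P.IsHomLift f χ) :
    ∃ y : E ⟶ cl.pull f E', (counitFunctor cl).map
      (⟨f, y⟩ : CoGrothendieck.Hom (El.mk cl.fibres A E) (El.mk cl.fibres A' E')) = χ :=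
  ⟨cl.vert f χ h, cl.vert_lift f χ h⟩

instance : (counitFunctor cl).Full where
  map_surjective {e e'} χ := by
    have h : P.IsHomLift (eqToHom e.fiber.2.symm ≫ P.map χ ≫ eqToHom e'.fiber.2) χ :=
      IsHomLift.of_fac P _ _ e.fiber.2 e'.fiber.2 rfl
    obtain ⟨y, hy⟩ := exists_counitFunctor_map cl (E := e.fiber) (E' := e'.fiber) χ h
    exact ⟨_, hy⟩

/-- An object of the total category as an object of its fibre. -/
abbrev selfFiber (P : C ⥤ X) (E : C) : P.Fiber (P.obj E) := ⟨E, rfl⟩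

/-- The action on morphisms of the functor from the total category to the elements of the
fibres. -/
def counitInvMap {E E' : C} (χ : E ⟶ E') :
    El.mk cl.fibres (P.obj E) (selfFiber P E) ⟶ El.mk cl.fibres (P.obj E') (selfFiber P E') :=
  (counitFunctor cl).preimage (X := El.mk cl.fibres (P.obj E) (selfFiber P E))
    (Y := El.mk cl.fibres (P.obj E') (selfFiber P E')) χ

theorem counitFunctor_counitInvMap {E E' : C} (χ : E ⟶ E') :
    (counitFunctor cl).map (counitInvMap cl χ) = χ :=
  (counitFunctor cl).map_preimage (X := El.mk cl.fibres (P.obj E) (selfFiber P E))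
    (Y := El.mk cl.fibres (P.obj E') (selfFiber P E')) χ

/-- The functor from the total category to the elements of the fibres. -/
def counitInvFunctor : C ⥤ El cl.fibres where
  obj E := El.mk cl.fibres (P.obj E) (selfFiber P E)
  map χ := counitInvMap cl χ
  map_id E := (counitFunctor cl).map_injective ((counitFunctor_counitInvMap cl (𝟙 E)).trans
    ((counitFunctor cl).map_id (El.mk cl.fibres (P.obj E) (selfFiber P E))).symm)
  map_comp χ χ' := (counitFunctor cl).map_injective ((counitFunctor_counitInvMap cl (χ ≫ χ')).trans
    (((counitFunctor cl).map_comp (counitInvMap cl χ) (counitInvMap cl χ')).trans (congrArg₂ (· ≫ ·)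
    (counitFunctor_counitInvMap cl χ) (counitFunctor_counitInvMap cl χ'))).symm)

theorem counitFunctor_inv_map {E E' : C} (χ : E ⟶ E') :
    (counitFunctor cl).map ((counitInvFunctor cl).map χ) = χ :=
  counitFunctor_counitInvMap cl χ

theorem counitInvFunctor_obj {A : X} : ∀ E : P.Fiber A,
    (counitInvFunctor cl).obj ((inc P A).obj E) = El.mk cl.fibres A E := by
  rintro ⟨E, rfl⟩
  rfl

theorem exists_counitInvFunctor : ∀ e : El cl.fibres, ∃ E, e = (counitInvFunctor cl).obj E
  | ⟨A, E⟩ => ⟨E.1, (counitInvFunctor_obj cl (A := A) E).symm⟩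

theorem counitInvFunctor_map_base {E E' : C} (χ : E ⟶ E') :
    ((counitInvFunctor cl).map χ).base = P.map χ := by
  have h := counitMap_isHomLift cl ((counitInvFunctor cl).map χ)
  have e : counitMap cl ((counitInvFunctor cl).map χ) = χ := counitFunctor_inv_map cl χ
  rw [e] at h
  exact @IsHomLift.eq_of_isHomLift _ _ _ _ P E E' _ χ h

theorem counitFunctor_comp_inv : counitFunctor cl ⋙ counitInvFunctor cl = 𝟭 _ := by
  refine CategoryTheory.Functor.hext (fun e => counitInvFunctor_obj cl (A := e.base) e.fiber)
    (fun e e' φ => ?_)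
  obtain ⟨E, rfl⟩ := exists_counitInvFunctor cl e
  obtain ⟨E', rfl⟩ := exists_counitInvFunctor cl e'
  exact heq_of_eq ((counitFunctor cl).map_injective (counitFunctor_inv_map cl _))

theorem counitInvFunctor_comp : counitInvFunctor cl ⋙ counitFunctor cl = 𝟭 C :=
  CategoryTheory.Functor.hext (fun _ => rfl) (fun _ _ χ => heq_of_eq (counitFunctor_inv_map cl χ))

theorem counitFunctor_comp_projection : counitFunctor cl ⋙ P = forget cl.fibres := by
  have key : ∀ {A A' : X} {E E' : C} {f : A ⟶ A'} {χ : E ⟶ E'}, P.IsHomLift f χ →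
      HEq (P.map χ) f := by
    intro A A' E E' f χ h
    cases h
    rfl
  exact CategoryTheory.Functor.hext (fun e => e.fiber.2)
    (fun e e' φ => key (counitMap_isHomLift cl φ))

theorem counitInvFunctor_comp_forget : counitInvFunctor cl ⋙ forget cl.fibres = P :=
  CategoryTheory.Functor.hext (fun _ => rfl)
    (fun _ _ χ => heq_of_eq (counitInvFunctor_map_base cl χ))

theorem counitFunctor_cartesian {A A' : X} {f : A ⟶ A'} {e e' : El cl.fibres} {φ : e ⟶ e'}
    (hφ : (forget cl.fibres).IsStronglyCartesian f φ) :
    P.IsStronglyCartesian f ((counitFunctor cl).map φ) := by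
  have h1 := hφ.toIsHomLift
  cases h1
  have key : ∀ {A A' : X} (f : A ⟶ A') (E : P.Fiber A) (E' : P.Fiber A') (y : E ⟶ cl.pull f E'),
      IsIso (El.vert cl.fibres y) →
        P.IsStronglyCartesian f ((inc P A).map y ≫ cl.lift f E') := by
    intro A A' f E E' y hy
    have h3 : IsIso ((inc P A).map y) := by
      rw [← counitFunctor_vert cl y]
      exact @CategoryTheory.Functor.map_isIso _ _ _ _ _ _ (counitFunctor cl) _ hy
    have h4 : P.IsHomLift (𝟙 A) ((inc P A).map y) := y.2
    exact isStronglyCartesian_of_eq (isStronglyCartesian_comp (Functor.IsStronglyCartesian.of_isIso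
      P (𝟙 A) ((inc P A).map y)) (cl.cartesian f E')) (id_comp _)
  exact key φ.base e.fiber e'.fiber φ.fiber (El.isIso_vert_fiber hφ)

theorem counitInvFunctor_cartesian {A A' : X} {f : A ⟶ A'} {E E' : C} {χ : E ⟶ E'}
    (hχ : P.IsStronglyCartesian f χ) :
    (forget cl.fibres).IsStronglyCartesian f ((counitInvFunctor cl).map χ) := by
  have h1 := hχ.toIsHomLift
  cases h1
  let y := vertIso (P := P) (E₀ := selfFiber P E) (P.map χ) χ hχ (cl.lift (P.map χ) (selfFiber P E'))
    (cl.cartesian _ _)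
  have e : (counitInvFunctor cl).map χ = El.vert cl.fibres y.hom ≫
      El.lift cl.fibres (P.map χ) (selfFiber P E') := by
    refine (counitFunctor cl).map_injective ((counitFunctor_inv_map cl χ).trans (Eq.symm ?_))
    refine ((counitFunctor cl).map_comp _ _).trans ?_
    refine (congrArg₂ (· ≫ ·) (counitFunctor_vert cl _) (counitFunctor_lift cl _ _)).trans ?_
    exact vert_fac _ _ _ _ _
  have hy : IsIso y.hom := y.isIso_hom
  rw [e]
  exact isStronglyCartesian_of_eq (isStronglyCartesian_comp (@El.vert_cartesian _ _ cl.fibres _ _ _ y.hom hy)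
    (El.lift_cartesian cl.fibres _ _)) (id_comp _)

end CounitFunctor

section CounitMorphism

open Pseudofunctor CoGrothendieck

variable {X : Type u} [Category.{u} X] {Q Q' : RawFibration.{u, u, u, u} X}
  (h : Q.IsTangent (triv X))

theorem counitFunctor_natural {A A' : X} (f : A ⟶ A') {E : Q.tot.p.Fiber A}
    {E' : Q.tot.p.Fiber A'} (y : E ⟶ Q.cl.pull f E') :
    (inc Q.tot.p A).map (h.tMap y ≫ (h.vertLawIso f E').hom) ≫ Q.cl.lift f (h.tObj E') =
      h.tArr ((inc Q.tot.p A).map y ≫ Q.cl.lift f E') := by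
  rw [h.comp_vertLaw_lift, h.inc_tMap, ← h.tArr_comp]

/-- The functor from the elements of the fibres to the total category, as a strong map. -/
def counitStrong :
    StrongMap (vertIndexed_isTangent h).elTangent Q.D (counitFunctor Q.cl) where
  b e := Iso.refl (Q.D.T.obj ((inc Q.tot.p e.base).obj e.fiber))
  b₂ e := (h.zzIso (A := e.base) e.fiber).symm
  natural {e e'} φ := (comp_id _).trans ((counitFunctor_natural h φ.base
    (E := e.fiber) (E' := e'.fiber) φ.fiber).symm.trans (id_comp _).symm)
  π₁ e := (congrArg (fun t => (h.zzIso (A := e.base) e.fiber).inv ≫ t)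
    (counitFunctor_vert Q.cl (A := e.base) ((h.vertTangent e.base).π₁ e.fiber))).trans
      ((h.incStrong e.base).π₁ e.fiber)
  π₂ e := (congrArg (fun t => (h.zzIso (A := e.base) e.fiber).inv ≫ t)
    (counitFunctor_vert Q.cl (A := e.base) ((h.vertTangent e.base).π₂ e.fiber))).trans
      ((h.incStrong e.base).π₂ e.fiber)
  p e := (id_comp _).trans
    (counitFunctor_vert Q.cl (A := e.base) ((h.vertTangent e.base).p e.fiber))
  z e := (comp_id _).trans
    (counitFunctor_vert Q.cl (A := e.base) ((h.vertTangent e.base).z e.fiber)).symm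
  s e := (congrArg (fun t => (h.zzIso (A := e.base) e.fiber).inv ≫ t)
    (counitFunctor_vert Q.cl (A := e.base) ((h.vertTangent e.base).s e.fiber))).trans
      ((h.incStrong e.base).s e.fiber)
  l e := ((h.incStrong e.base).l e.fiber).trans ((id_comp _).trans
    ((counitFunctor_vert Q.cl (A := e.base) ((h.vertTangent e.base).l e.fiber)).symm.trans
      (id_comp _).symm))
  c e := ((h.incStrong e.base).c e.fiber).trans (congrArg (fun t =>
    Q.D.T.map (𝟙 (Q.D.T.obj ((inc Q.tot.p e.base).obj e.fiber))) ≫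
      𝟙 (Q.D.T.obj (Q.D.T.obj ((inc Q.tot.p e.base).obj e.fiber))) ≫ t)
    (counitFunctor_vert Q.cl (A := e.base) ((h.vertTangent e.base).c e.fiber)).symm)

theorem counitFunctor_preserves :
    PreservesTangentLimits (vertIndexed_isTangent h).elTangent (counitFunctor Q.cl) :=
  (counitStrong h).preservesTangentLimits h.total (fun e _ _ pr H =>
    (vertIndexed_isTangent h).el_preserves e pr H (counitFunctor Q.cl) (fun pr' H' => by
      have h1 := h.inc_isFibrePower e.fiber pr' H'
      rw [← counitFunctor_vert Q.cl (A := e.base) ((h.vertTangent e.base).p e.fiber)] at h1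
      exact (funext fun i => counitFunctor_vert Q.cl (A := e.base) (pr' i)) ▸ h1))

/-- The distributive law of the functor to the total category: an identity. -/
abbrev counitLaw (o : Bool) : Law o (vertIndexed_isTangent h).elTangent Q.D (counitFunctor Q.cl) :=
  eqLaw (D := (vertIndexed_isTangent h).elTangent) (D' := Q.D) (F := counitFunctor Q.cl)
    (fun _ => rfl) o

theorem counitLaw_isTangentMorphism (fl : Flavour) :
    IsTangentMorphism (vertIndexed_isTangent h).elTangent Q.D (counitFunctor Q.cl) fl
      (counitLaw h fl.isColax) :=
  isTangentMorphism_eqLaw (vertIndexed_isTangent h).elTangent_isTangent h.total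
    ((counitStrong h).isColaxMorphism h.total (counitFunctor_preserves h)) fl

theorem counitInvFunctor_tObj (E : Q.tot.obj) :
    (vertIndexed_isTangent h).elTangent.T.obj ((counitInvFunctor Q.cl).obj E) =
      (counitInvFunctor Q.cl).obj (Q.D.T.obj E) :=
  (counitInvFunctor_obj Q.cl (h.tObj (selfFiber Q.tot.p E))).symm

/-- The distributive law of the functor from the total category: an identity. -/
abbrev counitInvLaw (o : Bool) :
    Law o Q.D (vertIndexed_isTangent h).elTangent (counitInvFunctor Q.cl) :=
  eqLaw (D' := (vertIndexed_isTangent h).elTangent) (D := Q.D) (F := counitInvFunctor Q.cl)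
    (counitInvFunctor_tObj h) o

theorem map_eqToHom_of_obj_eq {C : Type u} [Category.{v} C] {C' : Type u'} [Category.{v'} C']
    (F : C ⥤ C') {x y : C} (e : x = y) (e' : F.obj x = F.obj y) :
    F.map (eqToHom e) = eqToHom e' := by
  subst e
  exact F.map_id x

theorem counitInvLaw_isTangentMorphism (fl : Flavour) :
    IsTangentMorphism Q.D (vertIndexed_isTangent h).elTangent (counitInvFunctor Q.cl) fl
      (counitInvLaw h fl.isColax) :=
  isTangentMorphism_eqLaw h.total (vertIndexed_isTangent h).elTangent_isTangent
    (isColaxMorphism_of_inverse (F := counitFunctor Q.cl) (G := counitInvFunctor Q.cl) (counitStrong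
    h) h.total (fun E => Iso.refl E) (fun {E E'} χ => (comp_id χ).trans ((counitFunctor_inv_map Q.cl
    χ).symm.trans (id_comp _).symm))
      (fun E => by
        refine (map_eqToHom_of_obj_eq (counitFunctor Q.cl) (counitInvFunctor_tObj h E) rfl).trans
          (Eq.symm ?_)
        refine (congrArg (fun t => 𝟙 (Q.D.T.obj E) ≫ t ≫ 𝟙 (Q.D.T.obj E)) (Q.D.T.map_id E)).trans ?_
        exact (id_comp _).trans (id_comp _))) fl

/-- The functor from the elements of the fibres to the total category, over the base. -/
abbrev counitBased {tot : BasedCategory.{u, u} X} (cl : Cleavage tot.p) :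
    El.based cl.fibres ⟶ tot :=
  BasedFunctor.mk (𝒳 := El.based cl.fibres) (𝒴 := tot) (counitFunctor cl)
    (counitFunctor_comp_projection cl)

/-- The functor from the total category to the elements of the fibres, over the base. -/
abbrev counitInvBased {tot : BasedCategory.{u, u} X} (cl : Cleavage tot.p) :
    tot ⟶ El.based cl.fibres :=
  BasedFunctor.mk (𝒴 := El.based cl.fibres) (𝒳 := tot) (counitInvFunctor cl)
    (counitInvFunctor_comp_forget cl)

theorem isHomLift_eqToHom {C : Type u'} [Category.{v'} C] {P : C ⥤ X} {A : X} {e e' : C}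
    (he : e = e') (hA : P.obj e = A) : P.IsHomLift (𝟙 A) (eqToHom he) := by
  subst he hA
  exact IsHomLift.id rfl

theorem counitLaw_isFibrationLaw (o : Bool) :
    IsFibrationLaw (triv X) (Q := elFibration (vertIndexed_isTangent h)) (Q' := Q)
      (counitBased Q.cl) (counitLaw h o) where
  natural := by
    cases o
    · exact (counitLaw_isTangentMorphism h .lax).isNatural
    · exact (counitLaw_isTangentMorphism h .colax).isNatural
  vertical e := by
    cases o
    · exact isHomLift_eqToHom (P := Q.tot.p) rfl (h.tObj (A := e.base) e.fiber).2
    · exact isHomLift_eqToHom (P := Q.tot.p) rfl (h.tObj (A := e.base) e.fiber).2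
  cartesian H := counitFunctor_cartesian Q.cl H

theorem counitInvLaw_isFibrationLaw (o : Bool) :
    IsFibrationLaw (triv X) (Q' := elFibration (vertIndexed_isTangent h)) (Q := Q)
      (counitInvBased Q.cl) (counitInvLaw h o) where
  natural := by
    cases o
    · exact (counitInvLaw_isTangentMorphism h .lax).isNatural
    · exact (counitInvLaw_isTangentMorphism h .colax).isNatural
  vertical E := by
    cases o
    · exact isHomLift_eqToHom (P := forget Q.cl.fibres) (counitInvFunctor_tObj h E).symm
        (h.tObj (selfFiber Q.tot.p E)).2
    · exact isHomLift_eqToHom (P := forget Q.cl.fibres) (counitInvFunctor_tObj h E) rfl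
  cartesian H := counitInvFunctor_cartesian Q.cl H

theorem counitInv_comp {tot : BasedCategory.{u, u} X} (cl : Cleavage tot.p) :
    counitInvBased cl ≫ counitBased cl = 𝟙 tot :=
  based_ext (counitInvFunctor_comp cl)

theorem counit_comp_inv {tot : BasedCategory.{u, u} X} (cl : Cleavage tot.p) :
    counitBased cl ≫ counitInvBased cl = 𝟙 (El.based cl.fibres) :=
  based_ext (counitFunctor_comp_inv cl)

theorem counitBased_natural {tot tot' : BasedCategory.{u, u} X} (cl : Cleavage tot.p)
    (cl' : Cleavage tot'.p) (F : tot ⟶ tot')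
    (hF : ∀ {A A' : X} {f : A ⟶ A'} {E E' : tot.obj} {φ : E ⟶ E'},
      tot.p.IsStronglyCartesian f φ → tot'.p.IsStronglyCartesian f (F.map φ)) :
    (show El.based cl.fibres ⟶ El.based cl'.fibres from El.map (fibreTrans cl cl' F hF)) ≫
      counitBased cl' = counitBased cl ≫ F := by
  have key : ∀ {A A' : X} (f : A ⟶ A') (E : tot.p.Fiber A) (E' : tot.p.Fiber A') (y : E ⟶ cl.pull f
      E'), (inc tot'.p A).map ((fibreRestrict F A).map y ≫ (fibreDistributor cl cl' F hF f E').hom)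
      ≫ cl'.lift f ((fibreRestrict F A').obj E') =
          F.map ((inc tot.p A).map y ≫ cl.lift f E') := by
    intro A A' f E E' y
    rw [fmap_comp, assoc, fibreDistributor_hom]
    exact (F.toFunctor.map_comp _ _).symm
  exact based_ext (CategoryTheory.Functor.hext (fun _ => rfl) (fun e e' φ =>
    heq_of_eq (key φ.base e.fiber e'.fiber φ.fiber)))

end CounitMorphism

section CounitData

open Pseudofunctor CoGrothendieck

variable {X : Type u} [Category.{u} X] {o : Bool}

/-- The structure of the counit. -/
abbrev counitStr (x : (FibDisp o X).Ob) : (FibDisp o X).Str (x := elOb (vertOb x)) (y := x)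
      (counitBased x.1.cl) :=
  ⟨counitLaw x.2 o, counitLaw_isFibrationLaw x.2 o⟩

/-- The structure of the inverse of the counit. -/
abbrev counitInvStr (x : (FibDisp o X).Ob) : (FibDisp o X).Str (x := x) (y := elOb (vertOb x))
      (counitInvBased x.1.cl) :=
  ⟨counitInvLaw x.2 o, counitInvLaw_isFibrationLaw x.2 o⟩

theorem counitInvStr_counit (x : (FibDisp o X).Ob) :
    HEq ((FibDisp o X).compStr (x := x) (y := elOb (vertOb x)) (t := x)
      (counitInvStr x) (counitStr x)) ((FibDisp o X).idStr x) := by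
  cases o
  · refine fib_str_heq_lax (Q := x) (Q' := x) (counitInv_comp x.1.cl) (fun E => heq_of_eq ?_)
    exact (comp_id _).trans ((map_eqToHom_of_obj_eq (counitFunctor x.1.cl)
      (counitInvFunctor_tObj x.2 E).symm rfl))
  · refine fib_str_heq_colax (Q := x) (Q' := x) (counitInv_comp x.1.cl) (fun E => heq_of_eq ?_)
    exact (id_comp _).trans ((map_eqToHom_of_obj_eq (counitFunctor x.1.cl)
      (counitInvFunctor_tObj x.2 E) rfl))

theorem counitStr_inv (x : (FibDisp o X).Ob) :
    HEq ((FibDisp o X).compStr (x := elOb (vertOb x)) (y := x)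
      (t := elOb (vertOb x)) (counitStr x) (counitInvStr x))
      ((FibDisp o X).idStr (elOb (vertOb x))) := by
  cases o
  · refine fib_str_heq_lax (Q := elOb (vertOb x)) (Q' := elOb (vertOb x)) (counit_comp_inv x.1.cl)
      (fun e => ?_)
    obtain ⟨E, rfl⟩ := exists_counitInvFunctor x.1.cl e
    exact (heq_of_eq ((congrArg (fun t => t ≫ eqToHom (counitInvFunctor_tObj x.2 E).symm)
      ((counitInvFunctor x.1.cl).map_id (x.1.D.T.obj E))).trans (id_comp _))).trans
        (eqToHom_heq_id_cod _ _ (counitInvFunctor_tObj x.2 E).symm)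
  · refine fib_str_heq_colax (Q := elOb (vertOb x)) (Q' := elOb (vertOb x))
      (counit_comp_inv x.1.cl) (fun e => ?_)
    obtain ⟨E, rfl⟩ := exists_counitInvFunctor x.1.cl e
    exact (heq_of_eq ((congrArg (fun t => eqToHom (counitInvFunctor_tObj x.2 E) ≫ t)
      ((counitInvFunctor x.1.cl).map_id (x.1.D.T.obj E))).trans (comp_id _))).trans
        (eqToHom_heq_id_dom _ _ (counitInvFunctor_tObj x.2 E))

variable {x y : (FibDisp o X).Ob} {F : x.1.tot ⟶ y.1.tot}
  (a : (FibDisp o X).Str (x := x) (y := y) F)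

theorem counitHom_natural :
    (show El.based x.1.cl.fibres ⟶ El.based y.1.cl.fibres from El.map (vertHom a)) ≫
      counitBased y.1.cl = counitBased x.1.cl ≫ F :=
  counitBased_natural x.1.cl y.1.cl F a.2.cartesian

theorem counitStr_natural (ha : IsCoherentLaw (R := (vertOb x).1) (R' := (vertOb y).1) (vertHom a)
      (vertStr a).1) : HEq ((FibDisp o X).compStr (x := elOb (vertOb x))
      (y := elOb (vertOb y)) (t := y) (elStr (vertStr a) ha) (counitStr y))
      ((FibDisp o X).compStr (x := elOb (vertOb x)) (y := x) (t := y)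
        (counitStr x) a) := by
  cases o
  · refine fib_str_heq_lax (Q := elOb (vertOb x)) (Q' := y) (counitHom_natural a)
      (fun e => heq_of_eq ?_)
    exact (comp_id _).trans ((counitFunctor_vert y.1.cl (A := e.base) _).trans (Eq.symm
      ((congrArg (fun t => t ≫ a.1 ((inc x.1.tot.p e.base).obj e.fiber))
        (F.toFunctor.map_id _)).trans (id_comp _))))
  · refine fib_str_heq_colax (Q := elOb (vertOb x)) (Q' := y) (counitHom_natural a)
      (fun e => heq_of_eq ?_)
    exact (id_comp _).trans ((counitFunctor_vert y.1.cl (A := e.base) _).trans (Eq.symm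
      ((congrArg (fun t => a.1 ((inc x.1.tot.p e.base).obj e.fiber) ≫ t)
        (F.toFunctor.map_id _)).trans (comp_id _))))

variable (X) (fl : Flavour)

/-- Tangent fibrations are naturally isomorphic to the elements of their fibres. -/
def counitData : UnitData (vertFunctor X fl) (elFunctor X fl) :=
  UnitData.ofInverse (fibDisplayed_isStrict _ _ _) (fun x => Total.Hom.mk (x := x) (y := ⟨elOb
    (vertOb x.obj)⟩) (counitInvBased x.obj.1.cl) (counitInvStr x.obj) (.of _
    (counitInvLaw_isTangentMorphism x.obj.2 fl))) (fun x => Total.Hom.mk (x := ⟨elOb (vertOb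
    x.obj)⟩) (y := x) (counitBased x.obj.1.cl) (counitStr x.obj) (.of _ (counitLaw_isTangentMorphism
    x.obj.2 fl))) (fun x => Total.hom_ext (counitInv_comp x.obj.1.cl) (counitInvStr_counit x.obj))
    (fun x => Total.hom_ext (counit_comp_inv x.obj.1.cl) (counitStr_inv x.obj)) (fun F =>
    Total.hom_ext (counitHom_natural F.str) (counitStr_natural F.str (isCoherentLaw_of_generated
    (vertStr_generated fl F.gen)))) (fun {_ y F F'} _ => Total.heq_cell (Total.hom_ext
    (counitHom_natural F.str) (counitStr_natural F.str (isCoherentLaw_of_generated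
    (vertStr_generated fl F.gen)))) (Total.hom_ext (counitHom_natural F'.str) (counitStr_natural
    F'.str (isCoherentLaw_of_generated (vertStr_generated fl F'.gen)))) (based_heq
    (counitHom_natural F.str) (counitHom_natural F'.str) (fun e => heq_of_eq (counitFunctor_vert
    y.obj.1.cl (A := e.base) _))))

end CounitData

section Conjugation

variable {B : Type u} [Bicategory.{w, v} B] {B' : Type u'} [Bicategory.{w', v'} B']

theorem IsStrict.square_comp (s : IsStrict B) {x x' x'' y y' y'' : B} {f g : x ⟶ y}
    {f' g' : x' ⟶ y'} {f'' g'' : x'' ⟶ y''} {a : f ⟶ g} {a' : f' ⟶ g'} {a'' : f'' ⟶ g''}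
    {i : y ⟶ y'} {j : x ⟶ x'} {k : y' ⟶ y''} {m : x' ⟶ x''} (hf : f ≫ i = j ≫ f')
    (hg : g ≫ i = j ≫ g') (h : HEq (a ▷ i) (j ◁ a')) (hf' : f' ≫ k = m ≫ f'')
    (hg' : g' ≫ k = m ≫ g'') (h' : HEq (a' ▷ k) (m ◁ a'')) :
    HEq (a ▷ (i ≫ k)) ((j ≫ m) ◁ a'') :=
  (s.whiskerRight_comp a i k).trans ((whiskerRight_heq hf hg rfl h).trans ((s.whisker_assoc j a'
    k).trans ((whiskerLeft_heq rfl hf' hg' h').trans (s.comp_whiskerLeft j m a'').symm)))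

theorem IsStrict.square_inv (s : IsStrict B) {x x' y y' : B} {f g : x ⟶ y} {f' g' : x' ⟶ y'}
    {a : f ⟶ g} {a' : f' ⟶ g'} {i : y ⟶ y'} {i' : y' ⟶ y} {j : x ⟶ x'} {j' : x' ⟶ x}
    (hi : i ≫ i' = 𝟙 y) (hj : j' ≫ j = 𝟙 x') (hf : f ≫ i = j ≫ f') (hg : g ≫ i = j ≫ g')
    (h : HEq (a ▷ i) (j ◁ a')) : HEq (a' ▷ i') (j' ◁ a) := by
  have h1 : HEq ((j ◁ a') ▷ i') a :=
    (whiskerRight_heq hf.symm hg.symm rfl h.symm).trans ((s.whiskerRight_comp _ _ _).symm.trans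
      ((whiskerRight_heq rfl rfl hi HEq.rfl).trans (s.whiskerRight_id _)))
  have e : ∀ {f : x ⟶ y} {f' : x' ⟶ y'}, f ≫ i = j ≫ f' → (j ≫ f') ≫ i' = f := fun h => by
    rw [← h, s.assoc, hi, s.comp_id]
  have h2 : HEq (j' ◁ (j ◁ a') ▷ i') (j' ◁ a) := whiskerLeft_heq rfl (e hf) (e hg) h1
  refine HEq.trans ?_ h2
  have h3 : HEq (j' ◁ (j ◁ a') ▷ i') (j' ◁ j ◁ a' ▷ i') :=
    whiskerLeft_heq rfl (s.assoc _ _ _) (s.assoc _ _ _) (s.whisker_assoc _ _ _)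
  refine HEq.trans ?_ h3.symm
  refine HEq.trans ?_ (s.comp_whiskerLeft _ _ _)
  rw [hj]
  exact (s.id_whiskerLeft _).symm

/-- An invertible 2-natural transformation between assignments on objects, 1-cells and 2-cells. -/
structure TwoNatIso (F G : PrelaxFunctorStruct B B') where
  hom : ∀ x : B, F.obj x ⟶ G.obj x
  inv : ∀ x : B, G.obj x ⟶ F.obj x
  hom_inv : ∀ x, hom x ≫ inv x = 𝟙 (F.obj x)
  inv_hom : ∀ x, inv x ≫ hom x = 𝟙 (G.obj x)
  nat : ∀ {x y : B} (f : x ⟶ y), F.map f ≫ hom y = hom x ≫ G.map f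
  nat₂ : ∀ {x y : B} {f g : x ⟶ y} (a : f ⟶ g), HEq (F.map₂ a ▷ hom y) (hom x ◁ G.map₂ a)

namespace TwoNatIso

section

variable (s' : IsStrict B') {F G : PrelaxFunctorStruct B B'} (τ : TwoNatIso F G)

include s'

theorem map_eq {x y : B} (f : x ⟶ y) : F.map f = τ.hom x ≫ G.map f ≫ τ.inv y := by
  rw [← s'.assoc, ← τ.nat, s'.assoc, τ.hom_inv, s'.comp_id]

theorem inv_nat {x y : B} (f : x ⟶ y) : G.map f ≫ τ.inv y = τ.inv x ≫ F.map f := by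
  rw [τ.map_eq s' f, ← s'.assoc, τ.inv_hom, s'.id_comp]

/-- The inverse of an invertible 2-natural transformation. -/
def symm : TwoNatIso G F where
  hom := τ.inv
  inv := τ.hom
  hom_inv := τ.inv_hom
  inv_hom := τ.hom_inv
  nat := τ.inv_nat s'
  nat₂ {_ y _ _} a := s'.square_inv (τ.hom_inv y) (τ.inv_hom _) (τ.nat _) (τ.nat _) (τ.nat₂ a)

end

section

variable (s' : IsStrict B') {F : PrelaxFunctorStruct B B'} {G : StrictPseudofunctor B B'}
  (τ : TwoNatIso F G.toPrelaxFunctorStruct)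

include s' τ

theorem map_id (x : B) : F.map (𝟙 x) = 𝟙 (F.obj x) := by
  have h : G.toPrelaxFunctorStruct.map (𝟙 x) = 𝟙 (G.obj x) := G.map_id x
  rw [τ.map_eq s', h]
  exact (congrArg (τ.hom x ≫ ·) (s'.id_comp (τ.inv x))).trans (τ.hom_inv x)

theorem map_comp {x y r : B} (f : x ⟶ y) (g : y ⟶ r) : F.map (f ≫ g) = F.map f ≫ F.map g := by
  have h : G.toPrelaxFunctorStruct.map (f ≫ g) = G.toPrelaxFunctorStruct.map f ≫
    G.toPrelaxFunctorStruct.map g := G.map_comp f g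
  rw [τ.map_eq s' (f ≫ g), h, s'.assoc, τ.inv_nat s', ← s'.assoc, ← τ.nat, s'.assoc,
    ← s'.assoc (τ.hom y), τ.hom_inv, s'.id_comp]

end

/-- An invertible 2-natural transformation between strict 2-functors. -/
def toTwoNatTrans {F G : StrictPseudofunctor B B'}
    (τ : TwoNatIso F.toPrelaxFunctorStruct G.toPrelaxFunctorStruct) : TwoNatTrans F G :=
  .ofHEq τ.hom τ.nat τ.nat₂

end TwoNatIso

/-- Replacing the two functors of unit data by isomorphic ones. -/
def UnitData.transport (s : IsStrict B) {L L' : StrictPseudofunctor B B'}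
    {R R' : StrictPseudofunctor B' B} (η : UnitData L R)
    (l : TwoNatIso L.toPrelaxFunctorStruct L'.toPrelaxFunctorStruct)
    (r : TwoNatIso R.toPrelaxFunctorStruct R'.toPrelaxFunctorStruct) : UnitData L' R' where
  i x := η.i x ≫ R.map (l.hom x) ≫ r.hom (L'.obj x)
  j x := (r.inv (L'.obj x) ≫ R.map (l.inv x)) ≫ η.j x
  ij x := by
    have h1 : R.map (l.hom x) ≫ R.map (l.inv x) = 𝟙 (R.obj (L.obj x)) := by
      rw [← R.map_comp, l.hom_inv]
      exact R.map_id (L.obj x)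
    have h2 : r.hom (L'.obj x) ≫ r.inv (L'.obj x) = 𝟙 (R.obj (L'.obj x)) := r.hom_inv _
    calc _ = η.i x ≫ R.map (l.hom x) ≫ (r.hom (L'.obj x) ≫ r.inv (L'.obj x)) ≫
          R.map (l.inv x) ≫ η.j x := by simp only [s.assoc]
      _ = η.i x ≫ (R.map (l.hom x) ≫ R.map (l.inv x)) ≫ η.j x := by
          rw [h2, s.id_comp, s.assoc]
      _ = 𝟙 x := by rw [h1, s.id_comp, η.ij]
  ji x := by
    have h1 : R.map (l.inv x) ≫ R.map (l.hom x) = 𝟙 (R.obj (L'.obj x)) := by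
      rw [← R.map_comp, l.inv_hom]
      exact R.map_id (L'.obj x)
    have h2 : r.inv (L'.obj x) ≫ r.hom (L'.obj x) = 𝟙 (R'.obj (L'.obj x)) := r.inv_hom _
    calc _ = r.inv (L'.obj x) ≫ R.map (l.inv x) ≫ (η.j x ≫ η.i x) ≫ R.map (l.hom x) ≫
          r.hom (L'.obj x) := by simp only [s.assoc]
      _ = r.inv (L'.obj x) ≫ (R.map (l.inv x) ≫ R.map (l.hom x)) ≫ r.hom (L'.obj x) := by
          rw [η.ji, s.id_comp, s.assoc]
      _ = 𝟙 _ := by rw [h1, s.id_comp, h2]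
  nat {x y} f := by
    have h1 : R.map (L.map f) ≫ R.map (l.hom y) = R.map (l.hom x) ≫ R.map (L'.map f) := by
      rw [← R.map_comp, ← R.map_comp]
      exact congrArg R.map (l.nat f)
    have h2 : R.map (L'.map f) ≫ r.hom (L'.obj y) = r.hom (L'.obj x) ≫ R'.map (L'.map f) :=
      r.nat _
    rw [← s.assoc, η.nat, s.assoc, ← s.assoc (R.map (L.map f)), h1, s.assoc, h2]
    simp only [s.assoc]
  nat₂ {x y f g} a := by
    have h1 : ∀ f : x ⟶ y, R.map (L.map f) ≫ R.map (l.hom y) =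
        R.map (l.hom x) ≫ R.map (L'.map f) := fun f => by
      rw [← R.map_comp, ← R.map_comp]
      exact congrArg R.map (l.nat f)
    have h2 : ∀ f : x ⟶ y, R.map (L'.map f) ≫ r.hom (L'.obj y) =
        r.hom (L'.obj x) ≫ R'.map (L'.map f) := fun f => r.nat _
    have h3 : HEq (R.map₂ (L.map₂ a) ▷ R.map (l.hom y)) (R.map (l.hom x) ◁ R.map₂ (L'.map₂ a)) := by
      have key : ∀ {f g f' g' : L.obj x ⟶ L'.obj y} {b : f ⟶ g} {b' : f' ⟶ g'}, f = f' → g = g' →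
          HEq b b' → HEq (R.map₂ b) (R.map₂ b') := by
        intro f g f' g' b b' e e' hb
        subst e e' hb
        rfl
      exact (map₂_whiskerRight_heq R _ _).symm.trans
        ((key (l.nat f) (l.nat g) (l.nat₂ a)).trans (map₂_whiskerLeft_heq R _ _))
    have h4 : ∀ f : x ⟶ y, R.map (L.map f) ≫ R.map (l.hom y) ≫ r.hom (L'.obj y) =
        (R.map (l.hom x) ≫ r.hom (L'.obj x)) ≫ R'.map (L'.map f) := fun f => by
      rw [← s.assoc, h1, s.assoc, h2, s.assoc]
    exact s.square_comp (η.nat f) (η.nat g) (η.nat₂ a) (h4 f) (h4 g)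
      (s.square_comp (h1 f) (h1 g) h3 (h2 f) (h2 g) (r.nat₂ (L'.map₂ a)))

end Conjugation

section IdentityMap

variable {C : Type u} [Category.{v} C] {D D' : TangentData C}

theorem inv_comp_eq_comp_inv {A A' B B' : C} {i : A ≅ A'} {j : B ≅ B'} {f : A' ⟶ B'} {g : A ⟶ B}
    (h : i.hom ≫ f = g ≫ j.hom) : i.inv ≫ g = f ≫ j.inv := by
  rw [Iso.inv_comp_eq, ← assoc, h, assoc, Iso.hom_inv_id, comp_id]

theorem StrongMap.map_inv_comp_inv (φ : StrongMap D D' (𝟭 C)) (A : C) :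
    D.T.map (φ.b A).inv ≫ (φ.b (D'.T.obj A)).inv = (φ.bb A).inv :=
  (inv_comp_eq_comp_inv (φ.natural (φ.b A).inv).symm).symm

/-- The inverse of a strong map on the identity functor. -/
def StrongMap.symm (φ : StrongMap D D' (𝟭 C)) : StrongMap D' D (𝟭 C) where
  b A := (φ.b A).symm
  b₂ A := (φ.b₂ A).symm
  natural f := (inv_comp_eq_comp_inv (φ.natural f).symm).symm
  π₁ A := inv_comp_eq_comp_inv (φ.π₁ A)
  π₂ A := inv_comp_eq_comp_inv (φ.π₂ A)
  p A := (φ.map_p A).symm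
  z A := ((Iso.eq_comp_inv _).2 (φ.z A)).symm
  s A := inv_comp_eq_comp_inv (φ.s A)
  l A := (congrArg (D.l A ≫ ·) (φ.map_inv_comp_inv A)).trans
    (inv_comp_eq_comp_inv (j := φ.bb A) (φ.l A).symm).symm
  c A := (congrArg (D.c A ≫ ·) (φ.map_inv_comp_inv A)).trans
    ((inv_comp_eq_comp_inv (i := φ.bb A) (j := φ.bb A)
      ((assoc _ _ _).trans (φ.c A).symm)).symm.trans
        ((congrArg (· ≫ D'.c A) (φ.map_inv_comp_inv A)).symm.trans (assoc _ _ _)))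

theorem isTangent_of_strongMap_id (φ : StrongMap D D' (𝟭 C)) (hD' : D'.IsTangent) :
    D.IsTangent :=
  isTangent_of_jointlyReflects jointlyReflects_id (fun _ => φ) (fun _ => hD') (fun A n => by
    obtain ⟨P, pr, H⟩ := (hD'.additive A).powers n
    exact ⟨P, fun i => pr i ≫ (φ.b A).hom, fun _ => H.of_iso (φ.b A) (Iso.refl A) (Iso.refl P)
      ((comp_id _).trans (φ.p A).symm) (fun _ => (id_comp _).symm)⟩)

end IdentityMap

section TangentIso

variable {C : Type u} [Category.{v} C] {D D' : TangentData C}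

/-- The comparison of the tangent bundle functors of a strong map on the identity functor. -/
def StrongMap.tIso (φ : StrongMap D D' (𝟭 C)) (A : C) : D'.T.obj A ≅ D.T.obj A := φ.b A

theorem StrongMap.tIso_inv_nat (φ : StrongMap D D' (𝟭 C)) {A B : C} (f : A ⟶ B) :
    D.T.map f ≫ (φ.tIso B).inv = (φ.tIso A).inv ≫ D'.T.map f := φ.symm.natural f

end TangentIso

section IndexedTransport

variable {X : Type u} [Category.{v} X] {J : Indx.{v, v', u, u'} X}
  {D D' : ∀ A, TangentData (J.fib A)}
  {α : ∀ {A A' : X} (f : A ⟶ A') (E : J.fib A'),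
    (D A).T.obj ((J.sub f).obj E) ⟶ (J.sub f).obj ((D A').T.obj E)}
  {α' : ∀ {A A' : X} (f : A ⟶ A') (E : J.fib A'),
    (D' A).T.obj ((J.sub f).obj E) ⟶ (J.sub f).obj ((D' A').T.obj E)}
  (φ : ∀ A, StrongMap (D A) (D' A) (𝟭 (J.fib A)))
  (hα : ∀ {A A' : X} (f : A ⟶ A') (E : J.fib A'),
    α f E ≫ (J.sub f).map ((φ A').tIso E).inv = ((φ A).tIso ((J.sub f).obj E)).inv ≫ α' f E)

include hα in
theorem indexedLaw_eq {A A' : X} (f : A ⟶ A') (E : J.fib A') :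
    α f E = ((φ A).tIso ((J.sub f).obj E)).inv ≫ α' f E ≫ (J.sub f).map ((φ A').tIso E).hom := by
  rw [← assoc, ← hα, assoc, ← fmap_comp, Iso.inv_hom_id, fmap_id]
  exact (comp_id _).symm

include hα in
theorem indexedLaw_unit {A : X} {E : J.fib A}
    (h : α' (𝟙 A) E ≫ J.unit ((D' A).T.obj E) = (D' A).T.map (J.unit E)) :
    α (𝟙 A) E ≫ J.unit ((D A).T.obj E) = (D A).T.map (J.unit E) := by
  have hn : (J.sub (𝟙 A)).map ((φ A).tIso E).inv ≫ J.unit ((D' A).T.obj E) =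
    J.unit ((D A).T.obj E) ≫ ((φ A).tIso E).inv :=
    (J.mapId ⟨op A⟩).hom.toNatTrans.naturality ((φ A).tIso E).inv
  rw [← cancel_mono ((φ A).tIso E).inv, assoc, ← hn, ← assoc, hα, assoc, h, StrongMap.tIso_inv_nat]

include hα in
theorem indexedLaw_compositor {A A' A'' : X} {f : A ⟶ A'} {g : A' ⟶ A''} {E : J.fib A''}
    (h : α' (f ≫ g) E ≫ J.compositor f g ((D' A'').T.obj E) = (D' A).T.map (J.compositor f g E) ≫
      α' f ((J.sub g).obj E) ≫ (J.sub f).map (α' g E)) :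
    α (f ≫ g) E ≫ J.compositor f g ((D A'').T.obj E) = (D A).T.map (J.compositor f g E) ≫
      α f ((J.sub g).obj E) ≫ (J.sub f).map (α g E) := by
  have hn : (J.sub (f ≫ g)).map ((φ A'').tIso E).inv ≫ J.compositor f g ((D' A'').T.obj E) =
      J.compositor f g ((D A'').T.obj E) ≫ (J.sub f).map ((J.sub g).map ((φ A'').tIso E).inv) :=
    (J.mapComp g.op.toLoc f.op.toLoc).hom.toNatTrans.naturality ((φ A'').tIso E).inv
  rw [← cancel_mono ((J.sub f).map ((J.sub g).map ((φ A'').tIso E).inv)), assoc, assoc, assoc, ← hn,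
    ← assoc, hα, assoc, h, ← fmap_comp, hα, fmap_comp, ← assoc (α f _), hα, ← assoc, ←
    StrongMap.tIso_inv_nat]
  simp only [assoc]

include φ hα in
theorem isTangent_of_indexed_iso (h : (RawIndexed.mk J D' (fun f E => α' f E)).IsTangent (triv X)) :
    (RawIndexed.mk J D (fun f E => α f E)).IsTangent (triv X) where
  base := h.base
  fibre A := isTangent_of_strongMap_id (φ A) (h.fibre A)
  strong {A A'} f := by
    refine ⟨isColaxMorphism_of_jointlyReflects jointlyReflects_id (fun _ => h.fibre A') (fun _ => φ
      A') (fun _ => .id (isTangent_of_strongMap_id (φ A') (h.fibre A'))) (fun _ => φ A) (fun _ =>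
      h.fibre A) (F' := fun _ => J.sub f) (fun _ E => Iso.refl _) (fun _ {_ _} g => (comp_id
      _).trans (id_comp _).symm) (fun _ => (h.strong f).1) (fun _ E => ?_), fun E => ?_⟩
    · refine (indexedLaw_eq φ hα f E).trans (congrArg (((φ A).tIso ((J.sub f).obj E)).inv ≫ ·) ?_)
      change α' f E ≫ (J.sub f).map ((φ A').tIso E).hom = (D' A).T.map (𝟙 ((J.sub f).obj E)) ≫
        α' f E ≫ (J.sub f).map ((φ A').tIso E).hom ≫ 𝟙 _
      rw [fmap_id, id_comp, comp_id]
    · have h1 : IsIso (α' f E) := (h.strong f).2 E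
      change IsIso (α f E)
      rw [indexedLaw_eq φ hα f E]
      infer_instance
  mapId A E := by
    have h1 : α' (𝟙 A) E ≫ J.unit ((D' A).T.obj E) = (D' A).T.map (J.unit E) :=
      (h.mapId A E).trans (comp_id _)
    exact (indexedLaw_unit φ hα h1).trans (comp_id _).symm
  mapComp f g E := indexedLaw_compositor φ hα (h.mapComp f g E)

include hα in
theorem isCoherentLaw_id : ∀ o : Bool,
    IsCoherentLaw (R := RawIndexed.mk J D (fun f E => α f E)) (R' := RawIndexed.mk J D' (fun f E => α' f E)) (𝟙 J)
      (fun A => (φ A).law o)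
  | false => by
    intro f E
    rename_i A A'
    change α f E ≫ (Indx.distributor (𝟙 J) f ((D A').T.obj E)).hom ≫
      (J.sub f).map ((φ A').tIso E).inv = ((φ A).tIso ((J.sub f).obj E)).inv ≫
        (D' A).T.map (Indx.distributor (𝟙 J) f E).hom ≫ α' f E
    rw [Indx.distributor_id, Indx.distributor_id]
    refine (congrArg (α f E ≫ ·) (id_comp _)).trans ((hα f E).trans
      (congrArg (((φ A).tIso ((J.sub f).obj E)).inv ≫ ·) ?_))
    exact (id_comp _).symm.trans (congrArg (· ≫ α' f E) ((D' A).T.map_id _).symm)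
  | true => by
    intro f E
    rename_i A A'
    change ((φ A).tIso ((J.sub f).obj E)).hom ≫ α f E ≫ (Indx.distributor (𝟙 J) f ((D A').T.obj
      E)).hom = (D' A).T.map (Indx.distributor (𝟙 J) f E).hom ≫ α' f E ≫ (J.sub f).map ((φ A').tIso
      E).hom
    rw [Indx.distributor_id, Indx.distributor_id, indexedLaw_eq φ hα]
    refine (congrArg (((φ A).tIso ((J.sub f).obj E)).hom ≫ ·) (comp_id _)).trans ?_
    refine (Iso.hom_inv_id_assoc _ _).trans ?_
    exact (id_comp _).symm.trans (congrArg (· ≫ _) ((D' A).T.map_id _).symm)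

include hα in
theorem isIndexedMorphism_id (h : (RawIndexed.mk J D' (fun f E => α' f E)).IsTangent (triv X))
    (fl : Flavour) (hfl : fl ≠ .strict) :
    IsIndexedMorphism (R := RawIndexed.mk J D (fun f E => α f E)) (R' := RawIndexed.mk J D' (fun f E => α' f E)) fl (𝟙 J)
      (fun A => (φ A).law fl.isColax) where
  fibre A := (φ A).isTangentMorphism (h.fibre A)
    (.id (isTangent_of_strongMap_id (φ A) (h.fibre A))) fl (fun e => absurd e hfl)
  coherent := isCoherentLaw_id φ hα fl.isColax

include hα in
theorem symm_law_eq {A A' : X} (f : A ⟶ A') (E : J.fib A') :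
    α' f E ≫ (J.sub f).map ((φ A').symm.tIso E).inv =
      ((φ A).symm.tIso ((J.sub f).obj E)).inv ≫ α f E := by
  change α' f E ≫ (J.sub f).map ((φ A').tIso E).hom = ((φ A).tIso ((J.sub f).obj E)).hom ≫ α f E
  rw [indexedLaw_eq φ hα, Iso.hom_inv_id_assoc]

end IndexedTransport

section FibreComparison

variable {X : Type u} [Category.{u} X] {Q Q' : RawFibration.{u, u, u, u} X}

namespace RawFibration.IsTangent

variable (h : Q.IsTangent (triv X))

/-- The comparison `T' E ≅ z^* T' E`. -/
def zIso {A : X} (E : Q.tot.p.Fiber A) : h.tObj E ≅ h.fibreT E :=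
  vertIso (𝟙 A) (𝟙 ((inc Q.tot.p A).obj (h.tObj E))) (isStronglyCartesian_id (h.tObj E))
    (h.zLift E) (h.zLift_cartesian E)

/-- The cartesian morphism `z^* T' E ⟶ T' E`, as a vertical morphism. -/
def zArr {A : X} (E : Q.tot.p.Fiber A) :
    (inc Q.tot.p A).obj (h.fibreT E) ⟶ (inc Q.tot.p A).obj (h.tObj E) := h.zLift E

theorem inc_zIso_inv {A : X} (E : Q.tot.p.Fiber A) :
    (inc Q.tot.p A).map (h.zIso E).inv = h.zArr E :=
  (comp_id _).symm.trans (vert_fac (𝟙 A) (𝟙 ((inc Q.tot.p A).obj (h.tObj E)))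
    (isStronglyCartesian_id (h.tObj E)) (h.zLift E) (h.zLift_cartesian E).toIsHomLift)

theorem inc_zIso_hom_zArr {A : X} (E : Q.tot.p.Fiber A) :
    (inc Q.tot.p A).map (h.zIso E).hom ≫ h.zArr E = 𝟙 _ := by
  rw [← inc_zIso_inv, ← fmap_comp, Iso.hom_inv_id, fmap_id]

theorem eq_comp_zIso_hom {A : X} {E Y : Q.tot.p.Fiber A} {k : Y ⟶ h.fibreT E} {m : Y ⟶ h.tObj E}
    (hk : (inc Q.tot.p A).map k ≫ h.zArr E = (inc Q.tot.p A).map m) : k = m ≫ (h.zIso E).hom := by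
  rw [← Iso.comp_inv_eq]
  refine (inc Q.tot.p A).map_injective ?_
  rw [fmap_comp, inc_zIso_inv, hk]

theorem fibreMap_zArr {A : X} {E E' : Q.tot.p.Fiber A} (ξ : E ⟶ E') :
    (inc Q.tot.p A).map (h.fibreMap ξ) ≫ h.zArr E' = h.zArr E ≫ h.tArr ((inc Q.tot.p A).map ξ) :=
  h.fibreMap_zLift ξ

theorem zz_ext {A : X} {E Y : Q.tot.p.Fiber A} {k k' : Y ⟶ h.fibreT (h.fibreT E)}
    (hk : ((inc Q.tot.p A).map k ≫ h.zArr (h.fibreT E)) ≫ h.tArr (h.zArr E) =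
      ((inc Q.tot.p A).map k' ≫ h.zArr (h.fibreT E)) ≫ h.tArr (h.zArr E)) : k = k' := by
  have h1 : ∀ k : Y ⟶ h.fibreT (h.fibreT E),
      ((inc Q.tot.p A).map k ≫ h.zArr (h.fibreT E)) ≫ h.tArr (h.zArr E) =
        (inc Q.tot.p A).map (k ≫ (h.zIso (h.fibreT E)).inv ≫ h.tMap (h.zIso E).inv) := fun k => by
    rw [fmap_comp, fmap_comp, inc_zIso_inv, inc_tMap, inc_zIso_inv, assoc]
  rw [h1, h1] at hk
  have h2 : IsIso (h.tMap (h.zIso E).inv) :=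
    inferInstanceAs (IsIso ((h.vertTangent A).T.map (h.zIso E).inv))
  exact (cancel_mono _).1 ((inc Q.tot.p A).map_injective hk)

theorem comp_zIso_zArr {A : X} {E Y : Q.tot.p.Fiber A} (m : Y ⟶ h.tObj (h.tObj E)) :
    ((inc Q.tot.p A).map (m ≫ h.tMap (h.zIso E).hom ≫ (h.zIso (h.fibreT E)).hom) ≫
      h.zArr (h.fibreT E)) ≫ h.tArr (h.zArr E) = (inc Q.tot.p A).map m := by
  rw [← assoc m, fmap_comp, assoc ((inc Q.tot.p A).map _), inc_zIso_hom_zArr, comp_id, fmap_comp,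
    assoc, inc_tMap, ← tArr_comp, inc_zIso_hom_zArr, tArr_id, comp_id]

/-- The two tangent structures of a fibre are isomorphic. -/
def zStrong (A : X) :
    StrongMap (h.fibreTangent A) (h.vertTangent A) (𝟭 (Q.tot.p.Fiber A)) where
  b E := h.zIso E
  b₂ E := Iso.refl (h.fibreT₂ E)
  natural {E E'} f := (h.eq_comp_zIso_hom (k := (h.zIso E).hom ≫ h.fibreMap f) (m := h.tMap f) (by
    rw [fmap_comp, assoc, fibreMap_zArr, ← assoc, inc_zIso_hom_zArr, id_comp, inc_tMap])).symm
  π₁ E := (id_comp _).trans (h.eq_comp_zIso_hom (vert_fac _ _ _ _ _))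
  π₂ E := (id_comp _).trans (h.eq_comp_zIso_hom (vert_fac _ _ _ _ _))
  p E := (inc Q.tot.p A).map_injective (((inc Q.tot.p A).map_comp _ _).trans
    ((assoc _ _ _).symm.trans ((congrArg (fun t => t ≫ Q.D.p E.1)
      (h.inc_zIso_hom_zArr E)).trans (id_comp (Q.D.p E.1)))))
  z E := (h.eq_comp_zIso_hom (m := h.vz E) (vert_fac _ _ _ _ _)).symm
  s E := (id_comp _).trans (h.eq_comp_zIso_hom (vert_fac _ _ _ _ _))
  l E := h.zz_ext ((h.comp_zIso_zArr (h.vl E)).trans (Eq.symm (by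
    have h1 : (inc Q.tot.p A).map ((h.fibreTangent A).l E) ≫ h.zArr (h.fibreT E) ≫
      h.tArr (h.zArr E) = h.zArr E ≫ (inc Q.tot.p A).map (h.vl E) := vert_fac _ _ _ _ _
    refine (congrArg (fun t => (t ≫ h.zArr (h.fibreT E)) ≫ h.tArr (h.zArr E))
      ((inc Q.tot.p A).map_comp (h.zIso E).hom ((h.fibreTangent A).l E))).trans ?_
    refine (congrArg (fun t => t ≫ h.tArr (h.zArr E)) (assoc _ _ _)).trans ?_
    refine (assoc _ _ _).trans ?_
    refine (congrArg ((inc Q.tot.p A).map (h.zIso E).hom ≫ ·) ((assoc _ _ _).trans h1)).trans ?_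
    rw [← assoc, inc_zIso_hom_zArr, id_comp])))
  c E := h.zz_ext ((h.comp_zIso_zArr (h.vc E)).trans (Eq.symm (by
    have h1 : (inc Q.tot.p A).map ((h.fibreTangent A).c E) ≫ h.zArr (h.fibreT E) ≫
      h.tArr (h.zArr E) = (h.zArr (h.fibreT E) ≫ h.tArr (h.zArr E)) ≫
        (inc Q.tot.p A).map (h.vc E) := vert_fac _ _ _ _ _
    have h2 := h.comp_zIso_zArr (𝟙 (h.tObj (h.tObj E)))
    rw [id_comp, fmap_id] at h2
    refine (congrArg (fun t => (t ≫ h.zArr (h.fibreT E)) ≫ h.tArr (h.zArr E))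
      ((congrArg (inc Q.tot.p A).map (assoc _ _ _).symm).trans ((inc Q.tot.p A).map_comp
        (h.tMap (h.zIso E).hom ≫ (h.zIso (h.fibreT E)).hom) ((h.fibreTangent A).c E)))).trans ?_
    refine (congrArg (fun t => t ≫ h.tArr (h.zArr E)) (assoc _ _ _)).trans ?_
    refine (assoc _ _ _).trans ?_
    refine (congrArg ((inc Q.tot.p A).map (h.tMap (h.zIso E).hom ≫
      (h.zIso (h.fibreT E)).hom) ≫ ·) ((assoc _ _ _).trans h1)).trans ?_
    rw [← assoc, ← assoc, h2, id_comp])))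

theorem comp_pullMap_zIso_inv {A A' : X} (f : A ⟶ A') (E : Q.tot.p.Fiber A')
    (k : h.fibreT (Q.cl.pull f E) ⟶ Q.cl.pull f (h.fibreT E))
    (hk : (inc Q.tot.p A).map k ≫ Q.cl.lift f (h.fibreT E) ≫ h.zArr E =
      h.zArr (Q.cl.pull f E) ≫ h.tArr (Q.cl.lift f E)) : k ≫ Q.cl.pullMap f (h.zIso E).inv =
      (h.zIso (Q.cl.pull f E)).inv ≫ (h.vertLawIso f E).hom := by
  refine Q.cl.hom_ext f ?_
  rw [comp_vertLaw_lift, inc_zIso_inv, Q.cl.comp_pullMap_lift, inc_zIso_inv, ← hk, assoc]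

theorem fibreLaw_zIso {A A' : X} (f : A ⟶ A') (E : Q.tot.p.Fiber A') :
    h.fibreLaw f E ≫ Q.cl.pullMap f (h.zIso E).inv =
      (h.zIso (Q.cl.pull f E)).inv ≫ (h.vertLawIso f E).hom :=
  h.comp_pullMap_zIso_inv f E (h.fibreLaw f E) (vert_fac _ _ _ _ _)

theorem fibreIndexed_isTangent : (fibreIndexed h).IsTangent (triv X) :=
  isTangent_of_indexed_iso (J := Q.cl.fibres) (fun A => h.zStrong A) (fun f E => h.fibreLaw_zIso f E)
    (vertIndexed_isTangent h)

end RawFibration.IsTangent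

variable (h : Q.IsTangent (triv X)) (h' : Q'.IsTangent (triv X))

theorem fibreMorphismLaw_lax_zIso {F : BasedFunctor Q.tot Q'.tot}
    {β : Law false Q.D Q'.D F.toFunctor} (hF : IsFibrationLaw (triv X) F β) {A : X}
    (E : Q.tot.p.Fiber A) :
    fibreMorphismLaw h h' hF A E ≫ (h'.zIso ((fibreRestrict F A).obj E)).inv =
      (fibreRestrict F A).map (h.zIso E).inv ≫ vertMorphismLaw h h' hF A E := by
  have h1 : (inc Q'.tot.p A).map (fibreMorphismLaw h h' hF A E) ≫ h'.zArr ((fibreRestrict F A).obj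
    E) = F.map (h.zArr E) ≫ β ((inc Q.tot.p A).obj E) := vert_fac _ _ _ _ _
  refine (inc Q'.tot.p A).map_injective (((inc Q'.tot.p A).map_comp _ _).trans ((congrArg ((inc
    Q'.tot.p A).map (fibreMorphismLaw h h' hF A E) ≫ ·) (h'.inc_zIso_inv _)).trans (h1.trans ?_)))
  rw [← h.inc_zIso_inv]
  exact ((inc Q'.tot.p A).map_comp ((fibreRestrict F A).map (h.zIso E).inv)
    (vertMorphismLaw h h' hF A E)).symm

theorem fibreMorphismLaw_colax_zIso {F : BasedFunctor Q.tot Q'.tot}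
    {β : Law true Q.D Q'.D F.toFunctor} (hF : IsFibrationLaw (triv X) F β) {A : X}
    (E : Q.tot.p.Fiber A) :
    fibreMorphismLaw h h' hF A E ≫ (fibreRestrict F A).map (h.zIso E).inv =
      (h'.zIso ((fibreRestrict F A).obj E)).inv ≫ vertMorphismLaw h h' hF A E := by
  have h1 : (inc Q'.tot.p A).map (fibreMorphismLaw h h' hF A E) ≫ F.map (h.zArr E) =
    h'.zArr ((fibreRestrict F A).obj E) ≫ β ((inc Q.tot.p A).obj E) := vert_fac _ _ _ _ _
  rw [← h.inc_zIso_inv] at h1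
  refine (inc Q'.tot.p A).map_injective (((inc Q'.tot.p A).map_comp _ _).trans (h1.trans ?_))
  rw [← h'.inc_zIso_inv]
  exact ((inc Q'.tot.p A).map_comp (h'.zIso ((fibreRestrict F A).obj E)).inv
    (vertMorphismLaw h h' hF A E)).symm

end FibreComparison

section FibreFunctor

theorem hom_comp_eq_of_comp_inv_eq {C : Type u} [Category.{v} C] {a a' b b' : C} {i : a ≅ a'}
    {j : b ≅ b'} {k : a' ⟶ b'} {m : a ⟶ b} (h : k ≫ j.inv = i.inv ≫ m) :
    i.hom ≫ k = m ≫ j.hom := by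
  rw [← Iso.comp_inv_eq, assoc, h, Iso.hom_inv_id_assoc]

theorem paste_squares {C : Type u} [Category.{v} C] {a₀ a₁ a₂ b₀ b₁ b₂ c₁ d₁ : C} {m : a₀ ⟶ a₁}
    {k : a₁ ⟶ a₂} {z : a₁ ⟶ b₁} {z' : a₂ ⟶ b₂} {t : b₁ ⟶ b₂} {y : a₀ ⟶ b₀} {b : b₀ ⟶ b₁}
    {n : c₁ ⟶ a₂} {k' : a₀ ⟶ c₁} {y' : c₁ ⟶ d₁} {c : d₁ ⟶ b₂} {t' : b₀ ⟶ d₁}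
    (hm : m ≫ z = y ≫ b) (hk : k ≫ z' = z ≫ t) (hn : n ≫ z' = y' ≫ c) (hk' : k' ≫ y' = y ≫ t')
    (H : b ≫ t = t' ≫ c) : (m ≫ k) ≫ z' = (k' ≫ n) ≫ z' := by
  rw [assoc, hk, ← assoc, hm, assoc, H, assoc, hn, ← assoc, ← hk', assoc]

variable {X : Type u} [Category.{u} X]

section

variable {D : TangentData X} {Q Q' : RawFibration.{u, u, u, u} X} (h : Q.IsTangent D)
  (h' : Q'.IsTangent D)

theorem fibreMap_fibreNat {F G : Q.tot ⟶ Q'.tot} (θ : F ⟶ G) {A : X} (E : Q.tot.p.Fiber A) :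
    (inc Q'.tot.p A).map (h'.fibreMap ((fibreNat θ A).app E)) ≫
      h'.zLift ((fibreRestrict G A).obj E) = h'.zLift ((fibreRestrict F A).obj E) ≫
        Q'.D.T.map (θ.toNatTrans.app ((inc Q.tot.p A).obj E)) :=
  h'.fibreMap_zLift _

theorem fibreNat_mapZLift {F G : Q.tot ⟶ Q'.tot} (θ : F ⟶ G) {A : X} (E : Q.tot.p.Fiber A) :
    (inc Q'.tot.p A).map ((fibreNat θ A).app (h.fibreT E)) ≫ mapZLift h G E =
      mapZLift h F E ≫ θ.toNatTrans.app (Q.D.T.obj ((inc Q.tot.p A).obj E)) :=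
  (θ.toNatTrans.naturality (h.zLift E)).symm

theorem fibreMorphismLaw_compat_lax {F G : Q.tot ⟶ Q'.tot} (θ : F ⟶ G) {A : X} (E : Q.tot.p.Fiber A)
    {b : F.obj (Q.D.T.obj ((inc Q.tot.p A).obj E)) ⟶ Q'.D.T.obj (F.obj ((inc Q.tot.p A).obj E))}
    {c : G.obj (Q.D.T.obj ((inc Q.tot.p A).obj E)) ⟶ Q'.D.T.obj (G.obj ((inc Q.tot.p A).obj E))}
    (H : b ≫ Q'.D.T.map (θ.toNatTrans.app ((inc Q.tot.p A).obj E)) =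
      θ.toNatTrans.app (Q.D.T.obj ((inc Q.tot.p A).obj E)) ≫ c)
    {μ : (fibreRestrict F A).obj (h.fibreT E) ⟶ h'.fibreT ((fibreRestrict F A).obj E)}
    {ν : (fibreRestrict G A).obj (h.fibreT E) ⟶ h'.fibreT ((fibreRestrict G A).obj E)}
    (hμ : (inc Q'.tot.p A).map μ ≫ h'.zLift ((fibreRestrict F A).obj E) = mapZLift h F E ≫ b)
    (hν : (inc Q'.tot.p A).map ν ≫ h'.zLift ((fibreRestrict G A).obj E) = mapZLift h G E ≫ c) :
    μ ≫ h'.fibreMap ((fibreNat θ A).app E) = (fibreNat θ A).app (h.fibreT E) ≫ ν := by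
  refine vert_ext (D.z A) _ (h'.zLift_cartesian ((fibreRestrict G A).obj E)) ?_
  refine (congrArg (fun t => t ≫ h'.zLift _) ((inc Q'.tot.p A).map_comp μ _)).trans ?_
  refine Eq.trans ?_ (congrArg (fun t => t ≫ h'.zLift _)
    ((inc Q'.tot.p A).map_comp ((fibreNat θ A).app (h.fibreT E)) ν)).symm
  exact paste_squares hμ (fibreMap_fibreNat h' θ E) hν (fibreNat_mapZLift h θ E) H

theorem fibreMorphismLaw_compat_colax {F G : Q.tot ⟶ Q'.tot} (θ : F ⟶ G) {A : X}
    (E : Q.tot.p.Fiber A)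
    {b : Q'.D.T.obj (F.obj ((inc Q.tot.p A).obj E)) ⟶ F.obj (Q.D.T.obj ((inc Q.tot.p A).obj E))}
    {c : Q'.D.T.obj (G.obj ((inc Q.tot.p A).obj E)) ⟶ G.obj (Q.D.T.obj ((inc Q.tot.p A).obj E))}
    (H : b ≫ θ.toNatTrans.app (Q.D.T.obj ((inc Q.tot.p A).obj E)) =
      Q'.D.T.map (θ.toNatTrans.app ((inc Q.tot.p A).obj E)) ≫ c)
    {μ : h'.fibreT ((fibreRestrict F A).obj E) ⟶ (fibreRestrict F A).obj (h.fibreT E)}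
    {ν : h'.fibreT ((fibreRestrict G A).obj E) ⟶ (fibreRestrict G A).obj (h.fibreT E)}
    (hc : Q'.tot.p.IsStronglyCartesian (D.z A) (mapZLift h G E))
    (hμ : (inc Q'.tot.p A).map μ ≫ mapZLift h F E = h'.zLift ((fibreRestrict F A).obj E) ≫ b)
    (hν : (inc Q'.tot.p A).map ν ≫ mapZLift h G E = h'.zLift ((fibreRestrict G A).obj E) ≫ c) :
    μ ≫ (fibreNat θ A).app (h.fibreT E) = h'.fibreMap ((fibreNat θ A).app E) ≫ ν := by
  refine vert_ext (D.z A) _ hc ?_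
  refine (congrArg (fun t => t ≫ mapZLift h G E) ((inc Q'.tot.p A).map_comp μ _)).trans ?_
  refine Eq.trans ?_ (congrArg (fun t => t ≫ mapZLift h G E)
    ((inc Q'.tot.p A).map_comp (h'.fibreMap ((fibreNat θ A).app E)) ν)).symm
  exact paste_squares hμ (fibreNat_mapZLift h θ E) hν (fibreMap_fibreNat h' θ E) H

theorem fibreMorphismLaw_compat : ∀ {o : Bool} {F G : Q.tot ⟶ Q'.tot}
    {β : Law o Q.D Q'.D F.toFunctor} {γ : Law o Q.D Q'.D G.toFunctor}
    (hF : IsFibrationLaw D (Q := Q) (Q' := Q') F β)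
    (hG : IsFibrationLaw D (Q := Q) (Q' := Q') G γ) (θ : F ⟶ G),
    β.Compat γ θ.toNatTrans → ∀ A : X,
    (fibreMorphismLaw h h' hF A).Compat (fibreMorphismLaw h h' hG A) (fibreNat θ A)
  | false, _, _, _, _, _, _, θ, H, A => fun E => fibreMorphismLaw_compat_lax h h' θ E
      (H ((inc Q.tot.p A).obj E)) (vert_fac _ _ _ _ _) (vert_fac _ _ _ _ _)
  | true, _, _, _, _, _, hG, θ, H, A => fun E => fibreMorphismLaw_compat_colax h h' θ E
      (H ((inc Q.tot.p A).obj E)) (hG.cartesian (h.zLift_cartesian E)) (vert_fac _ _ _ _ _)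
      (vert_fac _ _ _ _ _)

end

variable {o : Bool}

/-- The fibres of a tangent fibration, with the tangent bundle functors `z^* T'`. -/
abbrev fibOb (x : (FibDisp o X).Ob) : (IndDisp o X).Ob :=
  ⟨fibreIndexed x.2, x.2.fibreIndexed_isTangent⟩

/-- The distributive laws on the fibres of a 1-cell. -/
abbrev fibStr
    {x y : (FibDisp o X).Ob} {F : x.1.tot ⟶ y.1.tot}
    (a : (FibDisp o X).Str (x := x) (y := y) F) :
    (IndDisp o X).Str (x := fibOb x) (y := fibOb y) (vertHom a) :=
  ⟨fibreMorphismLaw x.2 y.2 a.2, fibreMorphismLaw_isNatural x.2 y.2 a.2⟩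

theorem fibreMorphismLaw_colax_zIso_hom {Q Q' : RawFibration.{u, u, u, u} X}
    (h : Q.IsTangent (triv X)) (h' : Q'.IsTangent (triv X))
    {F : BasedFunctor Q.tot Q'.tot}
    {β : Law true Q.D Q'.D F.toFunctor} (hF : IsFibrationLaw (triv X) F β) {A : X}
    (E : Q.tot.p.Fiber A) :
    (h'.zIso ((fibreRestrict F A).obj E)).hom ≫ fibreMorphismLaw h h' hF A E =
      vertMorphismLaw h h' hF A E ≫ (fibreRestrict F A).map (h.zIso E).hom :=
  hom_comp_eq_of_comp_inv_eq (i := h'.zIso ((fibreRestrict F A).obj E))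
    (j := (fibreRestrict F A).mapIso (h.zIso E)) (fibreMorphismLaw_colax_zIso h h' hF E)

section

variable {Q : RawFibration.{u, u, u, u} X} (h : Q.IsTangent (triv X))

theorem toVert_isIndexedMorphism (fl : Flavour) (hfl : fl ≠ .strict) :
    IsIndexedMorphism (R := fibreIndexed h) (R' := vertIndexed h) fl (𝟙 Q.cl.fibres)
      (fun A => (h.zStrong A).law fl.isColax) :=
  isIndexedMorphism_id (J := Q.cl.fibres) (fun A => h.zStrong A)
    (fun f E => h.fibreLaw_zIso f E) (vertIndexed_isTangent h) fl hfl

theorem ofVert_isIndexedMorphism (fl : Flavour) (hfl : fl ≠ .strict) :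
    IsIndexedMorphism (R := vertIndexed h) (R' := fibreIndexed h) fl (𝟙 Q.cl.fibres)
      (fun A => (h.zStrong A).symm.law fl.isColax) :=
  isIndexedMorphism_id (J := Q.cl.fibres) (fun A => (h.zStrong A).symm)
    (symm_law_eq (J := Q.cl.fibres) (fun A => h.zStrong A) (fun f E => h.fibreLaw_zIso f E))
    h.fibreIndexed_isTangent fl hfl

end

/-- The comparison of the two tangent structures on the fibres. -/
abbrev toVertStr (x : (FibDisp o X).Ob) : (IndDisp o X).Str (x := fibOb x) (y := vertOb x)
      (𝟙 x.1.cl.fibres) :=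
  ⟨fun A => (x.2.zStrong A).law o, by
    cases o
    · exact fun A => ((toVert_isIndexedMorphism x.2 .lax nofun).fibre A).isNatural
    · exact fun A => ((toVert_isIndexedMorphism x.2 .colax nofun).fibre A).isNatural⟩

/-- The inverse of the comparison of the two tangent structures on the fibres. -/
abbrev ofVertStr (x : (FibDisp o X).Ob) : (IndDisp o X).Str (x := vertOb x) (y := fibOb x)
      (𝟙 x.1.cl.fibres) :=
  ⟨fun A => (x.2.zStrong A).symm.law o, by
    cases o
    · exact fun A => ((ofVert_isIndexedMorphism x.2 .lax nofun).fibre A).isNatural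
    · exact fun A => ((ofVert_isIndexedMorphism x.2 .colax nofun).fibre A).isNatural⟩

theorem toVertStr_ofVertStr (x : (FibDisp o X).Ob) :
    HEq ((IndDisp o X).compStr (x := fibOb x) (y := vertOb x)
      (t := fibOb x) (toVertStr x) (ofVertStr x))
      ((IndDisp o X).idStr (fibOb x)) := by
  cases o
  · exact ind_str_heq_lax (R := fibOb x) (R' := fibOb x) (indx_isStrict.comp_id (𝟙 _))
      (fun A E => heq_of_eq (x.2.zIso E).inv_hom_id)
  · exact ind_str_heq_colax (R := fibOb x) (R' := fibOb x) (indx_isStrict.comp_id (𝟙 _))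
      (fun A E => heq_of_eq (x.2.zIso E).inv_hom_id)

theorem ofVertStr_toVertStr (x : (FibDisp o X).Ob) :
    HEq ((IndDisp o X).compStr (x := vertOb x) (y := fibOb x)
      (t := vertOb x) (ofVertStr x) (toVertStr x))
      ((IndDisp o X).idStr (vertOb x)) := by
  cases o
  · exact ind_str_heq_lax (R := vertOb x) (R' := vertOb x) (indx_isStrict.comp_id (𝟙 _))
      (fun A E => heq_of_eq (x.2.zIso E).hom_inv_id)
  · exact ind_str_heq_colax (R := vertOb x) (R' := vertOb x) (indx_isStrict.comp_id (𝟙 _))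
      (fun A E => heq_of_eq (x.2.zIso E).hom_inv_id)

variable {x y : (FibDisp o X).Ob}

theorem vertHom_square {F : x.1.tot ⟶ y.1.tot} (a : (FibDisp o X).Str (x := x) (y := y) F) :
    vertHom a ≫ 𝟙 y.1.cl.fibres = 𝟙 x.1.cl.fibres ≫ vertHom a :=
  (indx_isStrict.comp_id _).trans (indx_isStrict.id_comp _).symm

theorem toVertStr_natural {F : x.1.tot ⟶ y.1.tot} (a : (FibDisp o X).Str (x := x) (y := y) F) :
    HEq ((IndDisp o X).compStr (x := fibOb x) (y := fibOb y)
      (t := vertOb y) (fibStr a) (toVertStr y))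
      ((IndDisp o X).compStr (x := fibOb x) (y := vertOb x)
        (t := vertOb y) (toVertStr x) (vertStr a)) := by
  cases o
  · exact ind_str_heq_lax (R := fibOb x) (R' := vertOb y) (vertHom_square a)
      (fun A E => heq_of_eq (fibreMorphismLaw_lax_zIso x.2 y.2 a.2 E))
  · exact ind_str_heq_colax (R := fibOb x) (R' := vertOb y) (vertHom_square a)
      (fun A E => heq_of_eq (fibreMorphismLaw_colax_zIso_hom x.2 y.2 a.2 E))

theorem fibStr_conj {F : x.1.tot ⟶ y.1.tot} (a : (FibDisp o X).Str (x := x) (y := y) F) :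
    HEq (fibStr a) ((IndDisp o X).compStr (x := fibOb x) (y := vertOb y)
      (t := fibOb y) ((IndDisp o X).compStr (x := fibOb x)
        (y := vertOb x) (t := vertOb y) (toVertStr x) (vertStr a)) (ofVertStr y)) := by
  cases o
  · refine ind_str_heq_lax (R := fibOb x) (R' := fibOb y) (κ := vertHom a) (κ' := (𝟙 x.1.cl.fibres ≫
      vertHom a) ≫ 𝟙 y.1.cl.fibres) ((indx_isStrict.id_comp _).symm.trans (indx_isStrict.comp_id
      _).symm) (fun A E => heq_of_eq (((Iso.comp_inv_eq _).1 (fibreMorphismLaw_lax_zIso x.2 y.2 a.2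
      E)).trans ?_))
    rfl
  · refine ind_str_heq_colax (R := fibOb x) (R' := fibOb y) (κ := vertHom a) (κ' := (𝟙 x.1.cl.fibres
      ≫ vertHom a) ≫ 𝟙 y.1.cl.fibres) ((indx_isStrict.id_comp _).symm.trans (indx_isStrict.comp_id
      _).symm) (fun A E => heq_of_eq (((Iso.eq_inv_comp _).2 (fibreMorphismLaw_colax_zIso_hom x.2
      y.2 a.2 E)).trans ?_))
    rfl

theorem fibStr_generated {fl : Flavour} (hfl : fl ≠ .strict)
    {x y : (FibDisp fl.isColax X).Ob}
    {F : x.1.tot ⟶ y.1.tot}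
    {a : (FibDisp fl.isColax X).Str (x := x) (y := y) F}
    (ha : FibGen fl a) :
    IndGen fl (x := fibOb x) (y := fibOb y) (fibStr a) :=
  .of_heq ((indx_isStrict.id_comp (vertHom a)).symm.trans (indx_isStrict.comp_id _).symm)
    (fibStr_conj a) (.comp (x := fibOb x) (y := vertOb y) (t := fibOb y) (.comp (x := fibOb x) (y :=
    vertOb x) (t := vertOb y) (.of _ (toVert_isIndexedMorphism x.2 fl hfl)) (vertStr_generated fl
    ha)) (.of _ (ofVert_isIndexedMorphism y.2 fl hfl)))

variable (X) {fl : Flavour} (hfl : fl ≠ .strict)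

/-- The assignments of the 2-functor of fibres are well defined. -/
def fibreAssignment : PrelaxFunctorStruct (TngFib.{u, u, u, u} fl (triv X))
      (IndxTng.{u, u, u, u} fl (triv X)) :=
  fibreStruct (triv X) fl (fun h => h.fibreIndexed_isTangent) (fun F => fibStr_generated hfl F.gen)
    (fun {Q Q' F G} θ A =>
      fibreMorphismLaw_compat Q.obj.2 Q'.obj.2 F.str.2 G.str.2 θ.cell θ.two A)

/-- The 2-functor of fibres is isomorphic to the one with restricted tangent bundle functors. -/
def fibreAssignmentIso :
    TwoNatIso (fibreAssignment X hfl) (vertFunctor X fl).toPrelaxFunctorStruct where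
  hom x := Total.Hom.mk (x := ⟨fibOb x.obj⟩) (y := ⟨vertOb x.obj⟩) (𝟙 x.obj.1.cl.fibres)
    (toVertStr x.obj) (.of _ (toVert_isIndexedMorphism x.obj.2 fl hfl))
  inv x := Total.Hom.mk (x := ⟨vertOb x.obj⟩) (y := ⟨fibOb x.obj⟩) (𝟙 x.obj.1.cl.fibres)
    (ofVertStr x.obj) (.of _ (ofVert_isIndexedMorphism x.obj.2 fl hfl))
  hom_inv x := Total.hom_ext (indx_isStrict.comp_id (𝟙 _)) (toVertStr_ofVertStr x.obj)
  inv_hom x := Total.hom_ext (indx_isStrict.comp_id (𝟙 _)) (ofVertStr_toVertStr x.obj)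
  nat F := Total.hom_ext (vertHom_square F.str) (toVertStr_natural F.str)
  nat₂ {_ _ F G} _ := Total.heq_cell
    (Total.hom_ext (vertHom_square F.str) (toVertStr_natural F.str))
    (Total.hom_ext (vertHom_square G.str) (toVertStr_natural G.str))
    (modification_heq (vertHom_square F.str) (vertHom_square G.str) (fun _ _ => HEq.rfl))

/-- The strict 2-functor of fibres. -/
def fibreFunctor : StrictPseudofunctor (TngFib.{u, u, u, u} fl (triv X))
      (IndxTng.{u, u, u, u} fl (triv X)) :=
  strictFunctor (fibDisplayed_isStrict _ _ _) (indDisplayed_isStrict _ _ _) (fibreAssignment X hfl)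
    (fun _ => Total.hom₂_ext (modification_ext fun _ _ => rfl)) (fun _ _ => Total.hom₂_ext
    (modification_ext fun _ _ => rfl)) ((fibreAssignmentIso X hfl).map_id (indDisplayed_isStrict _ _
    _)) ((fibreAssignmentIso X hfl).map_comp (indDisplayed_isStrict _ _ _)) (fun F G H _ =>
    Total.heq_cell ((fibreAssignmentIso X hfl).map_comp (indDisplayed_isStrict _ _ _) F G)
    ((fibreAssignmentIso X hfl).map_comp (indDisplayed_isStrict _ _ _) F H) (modification_heq
    (vertHom_comp F.str G.str) (vertHom_comp F.str H.str) (fun _ _ => HEq.rfl))) (fun {_ _ _ F G} _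
    H => Total.heq_cell ((fibreAssignmentIso X hfl).map_comp (indDisplayed_isStrict _ _ _) F H)
    ((fibreAssignmentIso X hfl).map_comp (indDisplayed_isStrict _ _ _) G H) (modification_heq
    (vertHom_comp F.str H.str) (vertHom_comp G.str H.str) (fun _ _ => HEq.rfl)))

theorem fibreFunctor_isFibreFunctor : IsFibreFunctor (triv X) fl (fibreFunctor X hfl) :=
  ⟨fun h => h.fibreIndexed_isTangent, _, _, rfl⟩

end FibreFunctor

theorem PreservesTangentLimits.of_strongMap_id {C : Type u} [Category.{v} C] {E : Type u}
    [Category.{v} E] {D D' : TangentData C} (φ : StrongMap D D' (𝟭 C)) (h' : D'.IsTangent)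
    {F : C ⥤ E} (h : PreservesTangentLimits D' F) : PreservesTangentLimits D F :=
  .of_jointlyReflects jointlyReflects_id (fun _ => h') (fun _ => φ)
    (fun _ => .id (isTangent_of_strongMap_id φ h')) (F' := fun _ => F) (fun _ _ => Iso.refl _)
    (fun _ {_ _} _ => (comp_id _).trans (id_comp _).symm) (fun _ => h)

section ElementsComparison

open Pseudofunctor CoGrothendieck

variable {X : Type u} [Category.{u} X] {R R' : RawIndexed.{u, u, u, u} X}

namespace RawIndexed.IsTangent

variable (h : R.IsTangent (triv X))

theorem pLift_vertical (e : El R.J) : (forget R.J).IsHomLift (𝟙 e.base) (h.pLift e) :=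
  h.pLift_isHomLift e

theorem isIso_pLift (e : El R.J) : IsIso (h.pLift e) :=
  @Functor.IsStronglyCartesian.isIso_of_base_isIso _ _ _ _ (forget R.J) _ _ _ _ (𝟙 e.base)
    (h.pLift e) (h.pLift_cartesian e) _

theorem isIso_pLift₂ (e : El R.J) : IsIso (h.pLift₂ e) :=
  @Functor.IsStronglyCartesian.isIso_of_base_isIso _ _ _ _ (forget R.J) _ _ _ _
    (𝟙 e.base ≫ 𝟙 e.base) (h.pLift₂ e)
    (isStronglyCartesian_comp (El.lift_cartesian R.J _ _) (El.lift_cartesian R.J _ _)) inferInstance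

/-- The comparison `(A, p^* T E) ≅ (A, T E)`. -/
def pIso (e : El R.J) : h.hatT e ≅ h.elFunctor.obj e :=
  @asIso _ _ _ _ (h.pLift e) (h.isIso_pLift e)

theorem hatMap_pLift_pLift (e : El R.J) :
    h.hatMap (h.pLift e) ≫ h.pLift (h.elFunctor.obj e) = h.ppLift e :=
  (h.hatMap_pLift (h.pLift e)).trans ((congrArg (h.pLift (h.hatT e) ≫ ·)
    (El.map_lift h.trans _ _)).trans (assoc _ _ _).symm)

theorem hat_z_aux (e : El R.J) : (forget R.J).IsHomLift (𝟙 e.base ≫ 𝟙 e.base)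
    (El.vert R.J ((R.D e.base).z e.fiber)) :=
  isHomLift_of_eq (El.vert_isHomLift R.J _) (comp_id _).symm

theorem hat_l_aux (e : El R.J) : (forget R.J).IsHomLift (𝟙 e.base ≫ 𝟙 e.base ≫ 𝟙 e.base)
    (h.pLift e ≫ El.vert R.J ((R.D e.base).l e.fiber)) :=
  isHomLift_comp_eq (h.pLift_isHomLift e) (El.vert_isHomLift R.J _)
    (congrArg (𝟙 e.base ≫ ·) (comp_id _).symm)

theorem hat_c_aux (e : El R.J) : (forget R.J).IsHomLift (𝟙 e.base ≫ 𝟙 e.base ≫ 𝟙 e.base)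
    (h.ppLift e ≫ El.vert R.J ((R.D e.base).c e.fiber)) :=
  isHomLift_comp_eq (h.ppLift_isHomLift e) (El.vert_isHomLift R.J _) (assoc _ _ _)

theorem hat₂_pLift (e : El R.J) (ξ : (R.D e.base).T₂ e.fiber ⟶ (R.D e.base).T.obj e.fiber) :
    h.hat₂ e (𝟙 e.base) rfl ξ ≫ h.pLift e = h.pLift₂ e ≫ El.vert R.J ξ :=
  induced_fac (forget R.J) (𝟙 e.base) (𝟙 e.base) (h.pLift_cartesian e)
    (h.pLift₂ e ≫ El.vert R.J ξ) _

theorem hat_z_pLift (e : El R.J) :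
    h.hatTangent.z e ≫ h.pLift e = El.vert R.J ((R.D e.base).z e.fiber) :=
  induced_fac (forget R.J) (𝟙 e.base) (𝟙 e.base) (h.pLift_cartesian e) _ (hat_z_aux e)

theorem hat_l_ppLift (e : El R.J) :
    h.hatTangent.l e ≫ h.ppLift e = h.pLift e ≫ El.vert R.J ((R.D e.base).l e.fiber) :=
  induced_fac (forget R.J) (𝟙 e.base) (𝟙 e.base ≫ 𝟙 e.base) (h.ppLift_cartesian e) _ (h.hat_l_aux e)

theorem hat_c_ppLift (e : El R.J) :
    h.hatTangent.c e ≫ h.ppLift e = h.ppLift e ≫ El.vert R.J ((R.D e.base).c e.fiber) :=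
  induced_fac (forget R.J) (𝟙 e.base) (𝟙 e.base ≫ 𝟙 e.base) (h.ppLift_cartesian e) _ (h.hat_c_aux e)

/-- The two tangent structures of the category of elements are isomorphic. -/
def hatStrong : StrongMap h.elTangent h.hatTangent (𝟭 (El R.J)) where
  b e := h.pIso e
  b₂ e := @asIso _ _ _ _ (h.pLift₂ e) (h.isIso_pLift₂ e)
  natural f := h.hatMap_pLift f
  π₁ e := (h.hat₂_pLift e _).symm
  π₂ e := (h.hat₂_pLift e _).symm
  p _ := rfl
  z e := h.hat_z_pLift e
  s e := (h.hat₂_pLift e _).symm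
  l e := (congrArg (h.hatTangent.l e ≫ ·) (h.hatMap_pLift_pLift e)).trans (h.hat_l_ppLift e)
  c e := ((congrArg (h.hatTangent.c e ≫ ·) (h.hatMap_pLift_pLift e)).trans
    (h.hat_c_ppLift e)).trans ((congrArg (fun t => t ≫ h.elTangent.c e)
      (h.hatMap_pLift_pLift e).symm).trans (assoc _ _ _))

theorem hatTangent_isTangent : h.hatTangent.IsTangent :=
  isTangent_of_strongMap_id h.hatStrong.symm h.elTangent_isTangent

theorem hat_z_isHomLift (e : El R.J) : (forget R.J).IsHomLift (𝟙 e.base) (h.hatTangent.z e) :=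
  induced_isHomLift (forget R.J) (𝟙 e.base) (𝟙 e.base) (h.pLift_cartesian e) _ (hat_z_aux e)

theorem hat₂_isHomLift (e : El R.J) (ξ : (R.D e.base).T₂ e.fiber ⟶ (R.D e.base).T.obj e.fiber) :
    (forget R.J).IsHomLift (𝟙 e.base) (h.hat₂ e (𝟙 e.base) rfl ξ) :=
  induced_isHomLift (forget R.J) (𝟙 e.base) (𝟙 e.base) (h.pLift_cartesian e)
    (h.pLift₂ e ≫ El.vert R.J ξ) _

theorem hat_l_isHomLift (e : El R.J) : (forget R.J).IsHomLift (𝟙 e.base) (h.hatTangent.l e) :=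
  induced_isHomLift (forget R.J) (𝟙 e.base) (𝟙 e.base ≫ 𝟙 e.base) (h.ppLift_cartesian e) _ 
    (h.hat_l_aux e)

theorem hat_c_isHomLift (e : El R.J) : (forget R.J).IsHomLift (𝟙 e.base) (h.hatTangent.c e) :=
  induced_isHomLift (forget R.J) (𝟙 e.base) (𝟙 e.base ≫ 𝟙 e.base) (h.ppLift_cartesian e) _ 
    (h.hat_c_aux e)

theorem hatMap_cartesian {A A' : X} {f : A ⟶ A'} {e e' : El R.J} {φ : e ⟶ e'}
    (H : (forget R.J).IsStronglyCartesian f φ) :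
    (forget R.J).IsStronglyCartesian f (h.hatMap φ) := by
  have h1 := H.toIsHomLift
  cases h1
  have h2 : (forget R.J).IsStronglyCartesian (𝟙 e.base ≫ φ.base) (h.pLift e ≫ h.fibrewise.map φ) :=
    isStronglyCartesian_comp (h.pLift_cartesian e) (El.map_cartesian h.trans H)
  have h3 : (forget R.J).IsStronglyCartesian (φ.base ≫ 𝟙 e'.base) (h.hatMap φ ≫ h.pLift e') := by
    rw [h.hatMap_pLift]
    exact isStronglyCartesian_of_eq h2 ((id_comp _).trans (comp_id _).symm)
  exact @Functor.IsStronglyCartesian.of_comp _ _ _ _ (forget R.J) _ _ _ _ _ _ φ.base (𝟙 e'.base)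
    (h.hatMap φ) (h.pLift e') (h.pLift_cartesian e') h3 (h.hatMap_isHomLift φ)

theorem elements_isTangent : (elements h).IsTangent (triv X) where
  base := h.base
  total := h.hatTangent_isTangent
  strict :=
    { T := fun {A A' f E E' φ} H => by
        cases H
        exact h.hatMap_isHomLift φ
      p := by
        rintro A ⟨E, rfl⟩
        exact isHomLift_comp_eq (h.pLift_isHomLift E) (El.vert_isHomLift R.J _) (comp_id _)
      z := by
        rintro A ⟨E, rfl⟩
        exact h.hat_z_isHomLift E
      s := by
        rintro A ⟨E, rfl⟩ k h1 h2
        have e1 : k ≫ 𝟙 E.base = (forget R.J).map (h.hatTangent.π₁ E) :=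
          @IsHomLift.eq_of_isHomLift _ _ _ _ (forget R.J) _ _ _ _ h1
        have e2 : 𝟙 E.base = (forget R.J).map (h.hatTangent.π₁ E) :=
          @IsHomLift.eq_of_isHomLift _ _ _ _ (forget R.J) _ _ _ _ (h.hat₂_isHomLift E _)
        exact isHomLift_of_eq (P := forget R.J) (h.hat₂_isHomLift E _) (e2.trans e1.symm)
      l := by
        rintro A ⟨E, rfl⟩
        exact h.hat_l_isHomLift E
      c := by
        rintro A ⟨E, rfl⟩
        exact h.hat_c_isHomLift E
      preserves := .of_strongMap_id h.hatStrong.symm h.elTangent_isTangent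
        (elFibration_isTangent h).strict.preserves }
  cartesian H := h.hatMap_cartesian H

end RawIndexed.IsTangent

variable (h : R.IsTangent (triv X)) (h' : R'.IsTangent (triv X))
  {κ κ' : R.J ⟶ R'.J}

theorem map_pLift (κ : R.J ⟶ R'.J) (e : El R.J) : (El.map κ).map (h.pLift e) =
    El.vert R'.J (Indx.distributor κ (𝟙 e.base) ((R.D e.base).T.obj e.fiber)).hom ≫
      El.lift R'.J (𝟙 e.base) ((Indx.functor κ e.base).obj ((R.D e.base).T.obj e.fiber)) :=
  El.map_lift κ _ _

theorem elementsLaw_lax_pLift {β : ∀ A, Law false (R.D A) (R'.D A) (Indx.functor κ A)}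
    (e : El R.J) : elementsLaw h h' β e ≫ h'.pLift ((El.map κ).obj e) =
      (El.map κ).map (h.pLift e) ≫ elLaw κ h h' β e := by
  let b : (Indx.functor κ e.base).obj ((R.D e.base).T.obj e.fiber) ⟶
    (R'.D e.base).T.obj ((Indx.functor κ e.base).obj e.fiber) := β e.base e.fiber
  refine Eq.trans ?_ (congrArg (fun t => t ≫ El.vert R'.J b) (map_pLift h κ e)).symm
  refine Eq.trans (congrArg (fun t => t ≫ El.lift R'.J (𝟙 e.base) _)
    (El.vert_vert R'.J _ ((R'.J.sub (𝟙 e.base)).map b)).symm) ?_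
  refine (assoc _ _ _).trans (Eq.trans ?_ (assoc _ _ _).symm)
  exact congrArg (_ ≫ ·) (El.lift_vert R'.J (𝟙 e.base) b).symm

theorem elementsLaw_colax_pLift {β : ∀ A, Law true (R.D A) (R'.D A) (Indx.functor κ A)}
    (e : El R.J) : elementsLaw h h' β e ≫ (El.map κ).map (h.pLift e) =
      h'.pLift ((El.map κ).obj e) ≫ elLaw κ h h' β e := by
  let b : (R'.D e.base).T.obj ((Indx.functor κ e.base).obj e.fiber) ⟶
    (Indx.functor κ e.base).obj ((R.D e.base).T.obj e.fiber) := β e.base e.fiber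
  refine (congrArg (fun t => elementsLaw h h' β e ≫ t) (map_pLift h κ e)).trans ?_
  refine (assoc _ _ _).symm.trans ?_
  refine (congrArg (fun t => t ≫ El.lift R'.J (𝟙 e.base) _) (El.vert_vert R'.J
    ((R'.J.sub (𝟙 e.base)).map b ≫ (Indx.distributor κ (𝟙 e.base) _).inv) _)).trans ?_
  refine (congrArg (fun t => El.vert R'.J t ≫ El.lift R'.J (𝟙 e.base) _) ((assoc _ _ _).trans
    ((congrArg (_ ≫ ·) (Iso.inv_hom_id _)).trans (comp_id _)))).trans ?_
  exact (El.lift_vert R'.J (𝟙 e.base) b).symm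

theorem elementsLaw_isNatural : ∀ {o : Bool}
    {β : ∀ A, Law o (R.D A) (R'.D A) (Indx.functor κ A)},
    (elLaw κ h h' β).IsNatural → (elementsLaw h h' β).IsNatural
  | false, β, hn => by
    intro φ
    rename_i e e'
    have h1 := h'.isIso_pLift ((El.map κ).obj e')
    refine (cancel_mono (h'.pLift ((El.map κ).obj e'))).1 ?_
    exact paste_squares (m := (El.map κ).map (h.hatMap φ)) (k := elementsLaw h h' β e')
      (k' := elementsLaw h h' β e) (n := h'.hatMap ((El.map κ).map φ))
      (((El.map κ).map_comp _ _).symm.trans ((congrArg (El.map κ).map (h.hatMap_pLift φ)).trans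
        ((El.map κ).map_comp _ _))) (elementsLaw_lax_pLift h h' e')
      (h'.hatMap_pLift ((El.map κ).map φ)) (elementsLaw_lax_pLift h h' e) (hn φ)
  | true, β, hn => by
    intro φ
    rename_i e e'
    have h0 := h.isIso_pLift e'
    have h1 : IsIso ((El.map κ).map (h.pLift e')) :=
      inferInstanceAs (IsIso ((CoGrothendieck.map κ).map (h.pLift e')))
    refine (cancel_mono ((El.map κ).map (h.pLift e'))).1 ?_
    exact paste_squares (m := h'.hatMap ((El.map κ).map φ)) (k := elementsLaw h h' β e')
      (k' := elementsLaw h h' β e) (n := (El.map κ).map (h.hatMap φ))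
      (h'.hatMap_pLift ((El.map κ).map φ)) (elementsLaw_colax_pLift h h' e')
      (((El.map κ).map_comp _ _).symm.trans ((congrArg (El.map κ).map (h.hatMap_pLift φ)).trans
        ((El.map κ).map_comp _ _))) (elementsLaw_colax_pLift h h' e) (hn φ)

theorem elementsLaw_compat (m : κ ⟶ κ') : ∀ {o : Bool}
    {β : ∀ A, Law o (R.D A) (R'.D A) (Indx.functor κ A)}
    {γ : ∀ A, Law o (R.D A) (R'.D A) (Indx.functor κ' A)},
    (elLaw κ h h' β).Compat (elLaw κ' h h' γ) (El.map₂ m).toNatTrans →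
    (elementsLaw h h' β).Compat (elementsLaw h h' γ) (El.map₂ m).toNatTrans
  | false, β, γ, H => by
    intro e
    have h1 := h'.isIso_pLift ((El.map κ').obj e)
    refine (cancel_mono (h'.pLift ((El.map κ').obj e))).1 ?_
    exact paste_squares (m := elementsLaw h h' β e) (k := h'.hatMap ((El.map₂ m).toNatTrans.app e))
      (n := elementsLaw h h' γ e) (k' := (El.map₂ m).toNatTrans.app (h.hatT e))
      (elementsLaw_lax_pLift h h' e) (h'.hatMap_pLift _) (elementsLaw_lax_pLift h h' e) ((El.map₂
      m).toNatTrans.naturality (h.pLift e)).symm (H e)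
  | true, β, γ, H => by
    intro e
    have h0 := h.isIso_pLift e
    have h1 : IsIso ((El.map κ').map (h.pLift e)) :=
      inferInstanceAs (IsIso ((CoGrothendieck.map κ').map (h.pLift e)))
    refine (cancel_mono ((El.map κ').map (h.pLift e))).1 ?_
    exact paste_squares (m := elementsLaw h h' β e) (k' := h'.hatMap ((El.map₂ m).toNatTrans.app e))
      (n := elementsLaw h h' γ e) (k := (El.map₂ m).toNatTrans.app (h.hatT e))
      (elementsLaw_colax_pLift h h' e) ((El.map₂ m).toNatTrans.naturality (h.pLift e)).symm
      (elementsLaw_colax_pLift h h' e) (h'.hatMap_pLift _) (H e)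

theorem elementsLaw_isFibrationLaw {o : Bool}
    {β : ∀ A, Law o (R.D A) (R'.D A) (Indx.functor κ A)} (hn : ∀ A, (β A).IsNatural)
    (hc : IsCoherentLaw κ β) : IsFibrationLaw (triv X) (Q := elements h)
      (Q' := elements h') (El.map κ) (elementsLaw h h' β) where
  natural := elementsLaw_isNatural h h' (elLaw_isNatural h h' hn hc)
  vertical e := by
    cases o
    · exact El.vert_isHomLift R'.J _
    · exact El.vert_isHomLift R'.J _
  cartesian H := El.map_cartesian κ H

end ElementsComparison

section ElementsTwoFunctor

open Pseudofunctor CoGrothendieck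

variable {X : Type u} [Category.{u} X]

theorem StrongMap.isTangentMorphism_id {C : Type u} [Category.{v} C] {D D' : TangentData C}
    (φ : StrongMap D D' (𝟭 C)) (hD : D.IsTangent) (hD' : D'.IsTangent) {fl : Flavour}
    (hfl : fl ≠ .strict) : IsTangentMorphism D D' (𝟭 C) fl (φ.law fl.isColax) :=
  φ.isTangentMorphism hD' (.id hD) fl (fun e => absurd e hfl)

section

variable {R : RawIndexed.{u, u, u, u} X} (h : R.IsTangent (triv X))

theorem pIso_inv_isHomLift (e : El R.J) : (forget R.J).IsHomLift (𝟙 e.base) (h.pIso e).inv :=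
  @IsHomLift.lift_id_inv _ _ _ _ (forget R.J) e.base _ _ (h.pIso e) (h.pLift_vertical e)

theorem ofEl_isFibrationLaw : ∀ o : Bool, IsFibrationLaw (triv X)
    (Q := elFibration h) (Q' := elements h)
    (𝟙 (El.based R.J) : BasedFunctor (El.based R.J) (El.based R.J)) (h.hatStrong.law o)
  | false =>
    { natural := (h.hatStrong.isTangentMorphism_id h.elTangent_isTangent h.hatTangent_isTangent
        (fl := .lax) nofun).isNatural
      vertical := fun e => pIso_inv_isHomLift h e
      cartesian := fun H => H }
  | true =>
    { natural := (h.hatStrong.isTangentMorphism_id h.elTangent_isTangent h.hatTangent_isTangent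
        (fl := .colax) nofun).isNatural
      vertical := fun e => h.pLift_vertical e
      cartesian := fun H => H }

theorem toEl_isFibrationLaw : ∀ o : Bool, IsFibrationLaw (triv X)
    (Q := elements h) (Q' := elFibration h)
    (𝟙 (El.based R.J) : BasedFunctor (El.based R.J) (El.based R.J)) (h.hatStrong.symm.law o)
  | false =>
    { natural := (h.hatStrong.symm.isTangentMorphism_id h.hatTangent_isTangent
        h.elTangent_isTangent (fl := .lax) nofun).isNatural
      vertical := fun e => h.pLift_vertical e
      cartesian := fun H => H }
  | true =>
    { natural := (h.hatStrong.symm.isTangentMorphism_id h.hatTangent_isTangent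
        h.elTangent_isTangent (fl := .colax) nofun).isNatural
      vertical := fun e => pIso_inv_isHomLift h e
      cartesian := fun H => H }

end

variable {o : Bool}

/-- The fibration of elements, with the tangent bundle functor `(A, E) ↦ (T A, p^* T E)`. -/
abbrev hatOb (x : (IndDisp o X).Ob) : (FibDisp o X).Ob :=
  ⟨elements x.2, x.2.elements_isTangent⟩

/-- The functor between categories of elements of a coherent morphism. -/
abbrev hatStr {x y : (IndDisp o X).Ob}
    {κ : x.1.J ⟶ y.1.J} (a : (IndDisp o X).Str (x := x) (y := y) κ)
    (ha : IsCoherentLaw (R := x.1) (R' := y.1) κ a.1) :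
    (FibDisp o X).Str (x := hatOb x) (y := hatOb y) (El.map κ) :=
  ⟨elementsLaw x.2 y.2 a.1, elementsLaw_isFibrationLaw x.2 y.2 a.2 ha⟩

/-- The comparison of the two tangent structures on the category of elements. -/
abbrev toElStr (x : (IndDisp o X).Ob) : (FibDisp o X).Str (x := hatOb x) (y := elOb x)
      (𝟙 (El.based x.1.J)) :=
  ⟨x.2.hatStrong.symm.law o, toEl_isFibrationLaw x.2 o⟩

/-- The inverse of the comparison of the two tangent structures on the category of elements. -/
abbrev ofElStr (x : (IndDisp o X).Ob) : (FibDisp o X).Str (x := elOb x) (y := hatOb x)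
      (𝟙 (El.based x.1.J)) :=
  ⟨x.2.hatStrong.law o, ofEl_isFibrationLaw x.2 o⟩

theorem toElStr_ofElStr (x : (IndDisp o X).Ob) :
    HEq ((FibDisp o X).compStr (x := hatOb x) (y := elOb x) (t := hatOb x) (toElStr x) (ofElStr x))
      ((FibDisp o X).idStr (hatOb x)) := by
  cases o
  · exact fib_str_heq_lax (Q := hatOb x) (Q' := hatOb x) rfl
      (fun e => heq_of_eq (x.2.pIso e).hom_inv_id)
  · exact fib_str_heq_colax (Q := hatOb x) (Q' := hatOb x) rfl
      (fun e => heq_of_eq (x.2.pIso e).hom_inv_id)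

theorem ofElStr_toElStr (x : (IndDisp o X).Ob) :
    HEq ((FibDisp o X).compStr (x := elOb x) (y := hatOb x) (t := elOb x) (ofElStr x) (toElStr x))
      ((FibDisp o X).idStr (elOb x)) := by
  cases o
  · exact fib_str_heq_lax (Q := elOb x) (Q' := elOb x) rfl
      (fun e => heq_of_eq (x.2.pIso e).inv_hom_id)
  · exact fib_str_heq_colax (Q := elOb x) (Q' := elOb x) rfl
      (fun e => heq_of_eq (x.2.pIso e).inv_hom_id)

section

variable {R R' : RawIndexed.{u, u, u, u} X} (h : R.IsTangent (triv X))
  (h' : R'.IsTangent (triv X)) {κ : R.J ⟶ R'.J}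
  {β : ∀ A, Law true (R.D A) (R'.D A) (Indx.functor κ A)}

theorem elementsLaw_colax_pIso (e : El R.J) :
    (h'.pIso ((El.map κ).obj e)).inv ≫ elementsLaw h h' β e =
      elLaw κ h h' β e ≫ (CoGrothendieck.map κ).map (h.pIso e).inv :=
  hom_comp_eq_of_comp_inv_eq (i := (h'.pIso ((El.map κ).obj e)).symm)
    (j := (CoGrothendieck.map κ).mapIso (h.pIso e).symm) (elementsLaw_colax_pLift h h' e)

end

variable {x y : (IndDisp o X).Ob} {κ : x.1.J ⟶ y.1.J} (a : (IndDisp o X).Str (x := x) (y := y) κ)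
  (ha : IsCoherentLaw (R := x.1) (R' := y.1) κ a.1)

theorem toElStr_natural : HEq ((FibDisp o X).compStr (x := hatOb x) (y := hatOb y)
      (t := elOb y) (hatStr a ha) (toElStr y)) ((FibDisp o X).compStr (x := hatOb x) (y := elOb x)
        (t := elOb y) (toElStr x) (elStr a ha)) := by
  cases o
  · exact fib_str_heq_lax (Q := hatOb x) (Q' := elOb y) rfl
      (fun e => heq_of_eq (elementsLaw_lax_pLift x.2 y.2 e))
  · exact fib_str_heq_colax (Q := hatOb x) (Q' := elOb y) rfl
      (fun e => heq_of_eq (elementsLaw_colax_pIso x.2 y.2 e))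

theorem hatStr_conj : HEq (hatStr a ha) ((FibDisp o X).compStr (x := hatOb x)
      (y := elOb y) (t := hatOb y) ((FibDisp o X).compStr
        (x := hatOb x) (y := elOb x) (t := elOb y) (toElStr x) (elStr a ha)) (ofElStr y)) := by
  cases o
  · exact fib_str_heq_lax (Q := hatOb x) (Q' := hatOb y) rfl (fun e => heq_of_eq ((Iso.eq_comp_inv
      (y.2.pIso ((El.map κ).obj e))).2 (elementsLaw_lax_pLift x.2 y.2 e)))
  · exact fib_str_heq_colax (Q := hatOb x) (Q' := hatOb y) rfl (fun e => heq_of_eq ((Iso.inv_comp_eq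
      (y.2.pIso ((El.map κ).obj e))).1 (elementsLaw_colax_pIso x.2 y.2 e)))

theorem hatStr_generated {fl : Flavour} (hfl : fl ≠ .strict)
    {x y : (IndDisp fl.isColax X).Ob} {κ : x.1.J ⟶ y.1.J}
    {a : (IndDisp fl.isColax X).Str (x := x) (y := y) κ}
    (ha : IndGen fl a) :
    FibGen fl (x := hatOb x) (y := hatOb y) (hatStr a (isCoherentLaw_of_generated ha)) :=
  .of_heq rfl (hatStr_conj a (isCoherentLaw_of_generated ha))
    (.comp (x := hatOb x) (y := elOb y) (t := hatOb y)
      (.comp (x := hatOb x) (y := elOb x) (t := elOb y)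
        (.of _ (x.2.hatStrong.symm.isTangentMorphism_id x.2.hatTangent_isTangent
          x.2.elTangent_isTangent hfl)) (elStr_generated fl ha _))
      (.of _ (y.2.hatStrong.isTangentMorphism_id y.2.elTangent_isTangent
        y.2.hatTangent_isTangent hfl)))

theorem elMap_square {J J' : SIndx X} (κ : J ⟶ J') :
    (show El.based J ⟶ El.based J' from El.map κ) ≫ 𝟙 (El.based J') =
      𝟙 (El.based J) ≫ (show El.based J ⟶ El.based J' from El.map κ) := rfl

variable (X) {fl : Flavour} (hfl : fl ≠ .strict)

/-- The assignments of the 2-functor of elements are well defined. -/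
def elementsAssignment : PrelaxFunctorStruct (IndxTng.{u, u, u, u} fl (triv X))
      (TngFib.{u, u, u, u} fl (triv X)) :=
  elementsStruct (triv X) fl (fun h => h.elements_isTangent) (fun {R R'} κ =>
    elementsLaw_isFibrationLaw R.obj.2 R'.obj.2 κ.str.2 (isCoherentLaw_of_generated κ.gen)) (fun κ
    => hatStr_generated hfl κ.gen) (fun {R R' _ _} m => elementsLaw_compat R.obj.2 R'.obj.2 m.cell
    (elLaw_compat R.obj.2 R'.obj.2 m.cell m.two))

/-- The 2-functor of elements is isomorphic to the one with fibrewise tangent structures. -/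
def elementsAssignmentIso :
    TwoNatIso (elementsAssignment X hfl) (elFunctor X fl).toPrelaxFunctorStruct where
  hom x := Total.Hom.mk (x := ⟨hatOb x.obj⟩) (y := ⟨elOb x.obj⟩)
    (𝟙 (El.based x.obj.1.J)) (toElStr x.obj) (.of _ (x.obj.2.hatStrong.symm.isTangentMorphism_id
      x.obj.2.hatTangent_isTangent x.obj.2.elTangent_isTangent hfl))
  inv x := Total.Hom.mk (x := ⟨elOb x.obj⟩) (y := ⟨hatOb x.obj⟩)
    (𝟙 (El.based x.obj.1.J)) (ofElStr x.obj) (.of _ (x.obj.2.hatStrong.isTangentMorphism_id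
      x.obj.2.elTangent_isTangent x.obj.2.hatTangent_isTangent hfl))
  hom_inv x := Total.hom_ext rfl (toElStr_ofElStr x.obj)
  inv_hom x := Total.hom_ext rfl (ofElStr_toElStr x.obj)
  nat κ := Total.hom_ext (elMap_square κ.hom)
    (toElStr_natural κ.str (isCoherentLaw_of_generated κ.gen))
  nat₂ {_ _ κ κ'} _ := Total.heq_cell (Total.hom_ext (elMap_square κ.hom) (toElStr_natural κ.str
    (isCoherentLaw_of_generated κ.gen))) (Total.hom_ext (elMap_square κ'.hom) (toElStr_natural
    κ'.str (isCoherentLaw_of_generated κ'.gen))) (based_heq (elMap_square κ.hom) (elMap_square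
    κ'.hom) (fun _ => HEq.rfl))

/-- The strict 2-functor of elements. -/
def elementsFunctor : StrictPseudofunctor (IndxTng.{u, u, u, u} fl (triv X))
      (TngFib.{u, u, u, u} fl (triv X)) :=
  strictFunctor (indDisplayed_isStrict _ _ _) (fibDisplayed_isStrict _ _ _) (elementsAssignment X
    hfl) (fun _ => Total.hom₂_ext (BasedNatTrans.homCategory.ext _ _ (NatTrans.ext (funext fun _ =>
    El.vert_id _ _)))) (fun _ _ => Total.hom₂_ext (BasedNatTrans.homCategory.ext _ _ (NatTrans.ext
    (funext fun _ => (El.vert_vert _ _ _).symm)))) ((elementsAssignmentIso X hfl).map_id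
    (fibDisplayed_isStrict _ _ _)) ((elementsAssignmentIso X hfl).map_comp (fibDisplayed_isStrict _
    _ _)) (fun κ κ₁ κ₂ _ => Total.heq_cell ((elementsAssignmentIso X hfl).map_comp
    (fibDisplayed_isStrict _ _ _) κ κ₁) ((elementsAssignmentIso X hfl).map_comp
    (fibDisplayed_isStrict _ _ _) κ κ₂) (based_heq (El.map_comp κ.hom κ₁.hom) (El.map_comp κ.hom
    κ₂.hom) (fun _ => HEq.rfl))) (fun {_ _ _ κ₁ κ₂} _ κ => Total.heq_cell ((elementsAssignmentIso X
    hfl).map_comp (fibDisplayed_isStrict _ _ _) κ₁ κ) ((elementsAssignmentIso X hfl).map_comp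
    (fibDisplayed_isStrict _ _ _) κ₂ κ) (based_heq (El.map_comp κ₁.hom κ.hom) (El.map_comp κ₂.hom
    κ.hom) (fun _ => heq_of_eq (El.map_vert κ.hom _).symm)))

theorem elementsFunctor_isElementsFunctor : IsElementsFunctor (triv X) fl (elementsFunctor X hfl) :=
  ⟨fun h => h.elements_isTangent, _, _, _, rfl⟩

end ElementsTwoFunctor

section Equivalence

variable (X : Type u) [Category.{u} X] {fl : Flavour} (hfl : fl ≠ .strict)

theorem areAdjointEquivalences_elFunctor_vertFunctor (fl : Flavour) :
    AreAdjointEquivalences (elFunctor X fl) (vertFunctor X fl) :=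
  (unitData X fl).areAdjointEquivalences (indDisplayed_isStrict _ _ _)
    (fibDisplayed_isStrict _ _ _) (counitData X fl)

/-- The isomorphism between the two 2-functors of fibres. -/
def vertFibreIso :
    TwoNatIso (vertFunctor X fl).toPrelaxFunctorStruct (fibreFunctor X hfl).toPrelaxFunctorStruct :=
  (fibreAssignmentIso X hfl).symm (indDisplayed_isStrict _ _ _)

/-- The isomorphism between the two 2-functors of elements. -/
def elElementsIso : TwoNatIso (elFunctor X fl).toPrelaxFunctorStruct
      (elementsFunctor X hfl).toPrelaxFunctorStruct :=
  (elementsAssignmentIso X hfl).symm (fibDisplayed_isStrict _ _ _)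

theorem areAdjointEquivalences_elementsFunctor_fibreFunctor :
    AreAdjointEquivalences (elementsFunctor X hfl) (fibreFunctor X hfl) :=
  ((unitData X fl).transport (indDisplayed_isStrict _ _ _) (elElementsIso X hfl)
    (vertFibreIso X hfl)).areAdjointEquivalences (indDisplayed_isStrict _ _ _)
    (fibDisplayed_isStrict _ _ _) ((counitData X fl).transport (fibDisplayed_isStrict _ _ _)
      (vertFibreIso X hfl) (elElementsIso X hfl))

/-- The strict 2-functor of fibres becomes isomorphic to the strong one. -/
def vertInclusionIso : TwoNatIso
    ((vertFunctor X .strict).comp (indInclusion (triv X))).toPrelaxFunctorStruct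
    ((fibInclusion (triv X)).comp
      (fibreFunctor X (fl := .strong) nofun)).toPrelaxFunctorStruct where
  hom x := (vertFibreIso X (fl := .strong) nofun).hom ⟨x.obj⟩
  inv x := (vertFibreIso X (fl := .strong) nofun).inv ⟨x.obj⟩
  hom_inv x := (vertFibreIso X (fl := .strong) nofun).hom_inv ⟨x.obj⟩
  inv_hom x := (vertFibreIso X (fl := .strong) nofun).inv_hom ⟨x.obj⟩
  nat f := (vertFibreIso X (fl := .strong) nofun).nat
    ((fibInclusion (triv X)).map f)
  nat₂ a := (vertFibreIso X (fl := .strong) nofun).nat₂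
    ((fibInclusion (triv X)).map₂ a)

/-- The strict 2-functor of elements becomes isomorphic to the strong one. -/
def elInclusionIso : TwoNatIso
    ((elFunctor X .strict).comp (fibInclusion (triv X))).toPrelaxFunctorStruct
    ((indInclusion (triv X)).comp
      (elementsFunctor X (fl := .strong) nofun)).toPrelaxFunctorStruct where
  hom x := (elElementsIso X (fl := .strong) nofun).hom ⟨x.obj⟩
  inv x := (elElementsIso X (fl := .strong) nofun).inv ⟨x.obj⟩
  hom_inv x := (elElementsIso X (fl := .strong) nofun).hom_inv ⟨x.obj⟩
  inv_hom x := (elElementsIso X (fl := .strong) nofun).inv_hom ⟨x.obj⟩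
  nat f := (elElementsIso X (fl := .strong) nofun).nat
    ((indInclusion (triv X)).map f)
  nat₂ a := (elElementsIso X (fl := .strong) nofun).nat₂
    ((indInclusion (triv X)).map₂ a)

theorem TwoNatIso.toTwoNatTrans_isInvertible {B : Type u} [Bicategory.{w, v} B] {B' : Type u'}
    [Bicategory.{w', v'} B'] {F G : StrictPseudofunctor B B'}
    (τ : TwoNatIso F.toPrelaxFunctorStruct G.toPrelaxFunctorStruct) :
    τ.toTwoNatTrans.IsInvertible :=
  fun x => ⟨τ.inv x, τ.hom_inv x, τ.inv_hom x⟩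

end Equivalence

section Representables

open Pseudofunctor CoGrothendieck

variable {X : Type u} [Category.{u} X]

theorem discrete_hom_ext {α : Type u} {a b : Discrete α} (ξ ξ' : a ⟶ b) : ξ = ξ' :=
  Subsingleton.elim _ _

/-- The indexed category represented by an object. -/
def Indx.hom (A : X) : SIndx X where
  obj B := Cat.of (Discrete (B.as.unop ⟶ A))
  map f := (Discrete.functor fun g => Discrete.mk (f.as.unop ≫ g)).toCatHom
  map₂ η := eqToHom (by rw [LocallyDiscrete.eq_of_hom η])
  map₂_id _ := Cat.Hom₂.ext (NatTrans.ext (funext fun _ => discrete_hom_ext _ _))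
  map₂_comp _ _ := Cat.Hom₂.ext (NatTrans.ext (funext fun _ => discrete_hom_ext _ _))
  mapId B := Cat.Hom.isoMk (NatIso.ofComponents
    (fun g => Discrete.eqToIso (id_comp g.as)) (fun _ => discrete_hom_ext _ _))
  mapComp f f' := Cat.Hom.isoMk (NatIso.ofComponents (fun g => Discrete.eqToIso (assoc f'.as.unop
    f.as.unop g.as)) (fun _ => discrete_hom_ext _ _))
  map₂_whisker_left _ _ _ _ := Cat.Hom₂.ext (NatTrans.ext (funext fun _ => discrete_hom_ext _ _))
  map₂_whisker_right _ _ := Cat.Hom₂.ext (NatTrans.ext (funext fun _ => discrete_hom_ext _ _))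
  map₂_associator _ _ _ := Cat.Hom₂.ext (NatTrans.ext (funext fun _ => discrete_hom_ext _ _))
  map₂_left_unitor _ := Cat.Hom₂.ext (NatTrans.ext (funext fun _ => discrete_hom_ext _ _))
  map₂_right_unitor _ := Cat.Hom₂.ext (NatTrans.ext (funext fun _ => discrete_hom_ext _ _))

variable {J J' J'' : SIndx X}

theorem El.vert_compositor_left (J : SIndx X) {B B' B'' A : X} (f : B ⟶ B')
    (f' : B' ⟶ B'') (g : B'' ⟶ A) (E : J.fib A) :
    El.vert J (J.compositor (f ≫ f') g E ≫ J.compositor f f' ((J.sub g).obj E)) ≫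
      El.lift J f _ ≫ El.lift J f' _ ≫ El.lift J g E = El.lift J ((f ≫ f') ≫ g) E := by
  refine Eq.trans ?_ (El.lift_lift J (f ≫ f') g E)
  refine ((congrArg (· ≫ _) (El.vert_vert J _ _).symm).trans (assoc _ _ _)).trans ?_
  refine congrArg (_ ≫ ·) ?_
  refine Eq.trans ?_ (congrArg (· ≫ El.lift J g E) (El.lift_lift J f f' ((J.sub g).obj E)))
  simp only [assoc]

theorem El.vert_compositor_right (J : SIndx X) {B B' B'' A : X} (f : B ⟶ B')
    (f' : B' ⟶ B'') (g : B'' ⟶ A) {E : J.fib A} {Y : J.fib B} (ξ : Y ⟶ (J.sub (f ≫ f' ≫ g)).obj E) :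
    El.vert J (ξ ≫ J.compositor f (f' ≫ g) E ≫ (J.sub f).map (J.compositor f' g E)) ≫
      El.lift J f _ ≫ El.lift J f' _ ≫ El.lift J g E =
        El.vert J ξ ≫ El.lift J (f ≫ f' ≫ g) E := by
  rw [← El.vert_vert, ← El.vert_vert, assoc, assoc, ← assoc (El.vert J ((J.sub f).map _)), ←
    El.lift_vert, assoc, El.lift_lift]
  exact congrArg (_ ≫ ·) (El.lift_lift J f (f' ≫ g) E)

theorem El.vert_ext {e : El J} {A : X} {E E' : J.fib A} {f : A ⟶ e.base}
    {ψ : El.mk J A E' ⟶ e} (hψ : (forget J).IsStronglyCartesian f ψ) {ξ ξ' : E ⟶ E'}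
    (h : El.vert J ξ ≫ ψ = El.vert J ξ' ≫ ψ) : ξ = ξ' := by
  have e1 := induced_ext (forget J) (𝟙 A) f hψ (El.vert_isHomLift J ξ) (El.vert_isHomLift J ξ') h
  have e3 : (⟨𝟙 A, ξ ≫ Hom.fiber (𝟙 (El.mk J A E'))⟩ : CoGrothendieck.Hom (El.mk J A E)
      (El.mk J A E')) = ⟨𝟙 A, ξ' ≫ Hom.fiber (𝟙 (El.mk J A E'))⟩ :=
    (El.vert_comp J ξ (𝟙 _)).symm.trans ((congrArg (· ≫ 𝟙 _) e1).trans (El.vert_comp J ξ' (𝟙 _)))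
  have e4 := El.hom_mk_inj e3
  exact (cancel_mono ((J.mapId ⟨op A⟩).inv.toNatTrans.app E')).1 e4

theorem El.vert_discrete (J : SIndx X) {A B : X} (E : J.fib A)
    {g g' : Discrete (B ⟶ A)} (ζ : g ⟶ g') :
    El.vert J ((Discrete.functor fun k : B ⟶ A => (J.sub k).obj E).map ζ) ≫
      El.lift J g'.as E = El.lift J g.as E := by
  obtain ⟨g⟩ := g
  obtain ⟨g'⟩ := g'
  obtain rfl : g = g' := Discrete.eq_of_hom ζ
  have : ζ = 𝟙 _ := discrete_hom_ext _ _
  subst this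
  rw [fmap_id]
  exact (congrArg (· ≫ _) (El.vert_id J _)).trans (id_comp _)

/-- An isomorphism of pseudonatural transformations from its components. -/
def Indx.mkIso {κ κ' : J ⟶ J'} (m : κ ⟶ κ')
    (h : ∀ A E, IsIso ((Indx.component m A).app E)) : κ ≅ κ' where
  hom := m
  inv := Indx.mkModification (fun A E => inv ((Indx.component m A).app E))
    (fun A {E E'} ξ => by
      rw [IsIso.comp_inv_eq, assoc, IsIso.eq_inv_comp]
      exact ((Indx.component m A).naturality ξ).symm)
    (fun {A A'} f E => by
      have := h A' E
      rw [IsIso.inv_comp_eq, ← assoc, Indx.component_naturality, assoc, ← fmap_comp,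
        IsIso.hom_inv_id, fmap_id, comp_id])
  hom_inv_id := modification_ext fun A E => IsIso.hom_inv_id ((Indx.component m A).app E)
  inv_hom_id := modification_ext fun A E => IsIso.inv_hom_id ((Indx.component m A).app E)

/-- The pseudonatural transformation `g ↦ g^* E`. -/
def Indx.point (J : SIndx X) {A : X} (E : J.fib A) : Indx.hom A ⟶ J :=
  Indx.mkTrans (fun B => Discrete.functor fun g : B ⟶ A => (J.sub g).obj E)
    (fun f g => (Cat.Hom.toNatIso (J.mapComp g.as.op.toLoc f.op.toLoc)).app E)
    (fun {B B'} f {g g'} ζ => by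
      obtain ⟨g⟩ := g
      obtain ⟨g'⟩ := g'
      obtain rfl : g = g' := Discrete.eq_of_hom ζ
      have : ζ = 𝟙 _ := discrete_hom_ext _ _
      subst this
      simp only
      exact (id_comp _).trans ((congrArg (_ ≫ ·) (fmap_id _ _)).trans (comp_id _)).symm)
    (fun {B} g => by
      refine El.vert_ext (El.lift_cartesian J g.as E) ?_
      refine Eq.trans ?_ (El.vert_discrete J E ((Indx.hom A).unit g)).symm
      refine (congrArg (· ≫ _) (El.vert_vert J _ _).symm).trans ((assoc _ _ _).trans ?_)
      exact (congrArg (fun t => _ ≫ t ≫ El.lift J g.as E)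
        (El.vert_unit J ((J.sub g.as).obj E))).trans (El.lift_lift J (𝟙 B) g.as E))
    (fun {B B' B''} f f' g => by
      refine El.vert_ext (isStronglyCartesian_comp (El.lift_cartesian J f _)
        (isStronglyCartesian_comp (El.lift_cartesian J f' _) (El.lift_cartesian J g.as E))) ?_
      exact (El.vert_compositor_left J f f' g.as E).trans ((El.vert_discrete J E ((Indx.hom
        A).compositor f f' g)).symm.trans (El.vert_compositor_right J f f' g.as _).symm))

/-- The functor `E ↦ (g ↦ g^* E)`. -/
def Indx.points (J : SIndx X) (A : X) : J.fib A ⥤ (Indx.hom A ⟶ J) where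
  obj E := J.point E
  map {E E'} ξ := Indx.mkModification (κ := J.point E) (κ' := J.point E')
    (fun B g => (J.sub g.as).map ξ)
    (fun B {g g'} ζ => by
      obtain ⟨g⟩ := g
      obtain ⟨g'⟩ := g'
      obtain rfl : g = g' := Discrete.eq_of_hom ζ
      have : ζ = 𝟙 _ := discrete_hom_ext _ _
      subst this
      simp only
      exact (id_comp _).trans (comp_id _).symm)
    (fun f g => (J.mapComp g.as.op.toLoc f.op.toLoc).hom.toNatTrans.naturality ξ)
  map_id E := modification_ext fun B g => (J.sub g.as).map_id E
  map_comp ξ ξ' := modification_ext fun B g => (J.sub g.as).map_comp ξ ξ'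

end Representables

section Points

open Pseudofunctor CoGrothendieck

variable {X : Type u} [Category.{u} X] {J J' J'' : SIndx X}

theorem Indx.compositor_id_unit (J : SIndx X) {A B : X} (g : B ⟶ A) (E : J.fib A)
    (ζ : (Discrete.mk (g ≫ 𝟙 A) : Discrete (B ⟶ A)) ⟶ Discrete.mk g) :
    J.compositor g (𝟙 A) E ≫ (J.sub g).map (J.unit E) =
      (Indx.functor (J.point E) B).map ζ := by
  refine El.vert_ext (El.lift_cartesian J g E) ?_
  refine Eq.trans ?_ (El.vert_discrete J E ζ).symm
  rw [← El.vert_vert, assoc, ← El.lift_vert, El.vert_unit]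
  exact El.lift_lift J g (𝟙 A) E

instance Indx.isIso_unit (J : SIndx X) {A : X} (E : J.fib A) : IsIso (J.unit E) :=
  ((Cat.Hom.toNatIso (J.mapId ⟨op A⟩)).app E).isIso_hom

instance Indx.isIso_compositor (J : SIndx X) {A A' A'' : X} (f : A ⟶ A')
    (g : A' ⟶ A'') (E : J.fib A'') : IsIso (J.compositor f g E) :=
  ((Cat.Hom.toNatIso (J.mapComp g.op.toLoc f.op.toLoc)).app E).isIso_hom

/-- The morphism of the fibre that corresponds to a modification between points. -/
def Indx.pointHom {A : X} {E E' : J.fib A} (m : J.point E ⟶ J.point E') : E ⟶ E' :=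
  inv (J.unit E) ≫ (Indx.component m A).app (Discrete.mk (𝟙 A)) ≫ J.unit E'

theorem comp_eq_comp_of_factors {C : Type u} [Category.{v} C] {Y Z Z₁ Y' Z' Z₁' : C} {c : Y ⟶ Z}
    {r : Z ⟶ Z₁} {z : Y ⟶ Z₁} {c' : Y' ⟶ Z'} {r' : Z' ⟶ Z₁'} {z' : Y' ⟶ Z₁'} {m : Z₁ ⟶ Z₁'}
    {k : Z ⟶ Z'} {n : Y ⟶ Y'} [IsIso c] (h : c ≫ r = z) (h' : c' ≫ r' = z')
    (hz : z ≫ m = n ≫ z') (hc : n ≫ c' = c ≫ k) : k ≫ r' = r ≫ m := by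
  rw [← cancel_epi c, ← assoc, ← hc, assoc, h', ← hz, ← h, assoc]

theorem Indx.sub_pointHom {A B : X} {E E' : J.fib A} (m : J.point E ⟶ J.point E')
    (g : B ⟶ A) : (J.sub g).map (Indx.pointHom m) = (Indx.component m B).app (Discrete.mk g) := by
  let ζ : (Discrete.mk (g ≫ 𝟙 A) : Discrete (B ⟶ A)) ⟶ Discrete.mk g :=
    Discrete.eqToHom (comp_id g)
  have h := comp_eq_comp_of_factors (J.compositor_id_unit g E ζ) (J.compositor_id_unit g E' ζ)
    ((Indx.component m B).naturality ζ) (Indx.component_naturality m g (Discrete.mk (𝟙 A)))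
  have h' : (J.sub g).map (J.unit E) ≫ (J.sub g).map (Indx.pointHom m) =
      (J.sub g).map (J.unit E) ≫ (Indx.component m B).app (Discrete.mk g) :=
    ((J.sub g).map_comp _ _).symm.trans ((congrArg _ (IsIso.hom_inv_id_assoc _ _)).trans
      (((J.sub g).map_comp _ _).trans h))
  exact (cancel_epi ((J.sub g).map (J.unit E))).1 h'

theorem Indx.pointHom_points {A : X} {E E' : J.fib A} (ξ : E ⟶ E') :
    Indx.pointHom ((J.points A).map ξ) = ξ := by
  exact (IsIso.inv_comp_eq (J.unit E)).2 ((J.mapId ⟨op A⟩).hom.toNatTrans.naturality ξ)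

instance {A : X} : (J.points A).Full where
  map_surjective m := ⟨Indx.pointHom m, modification_ext fun _ g => Indx.sub_pointHom m g.as⟩

instance {A : X} : (J.points A).Faithful where
  map_injective {E E' ξ ξ'} h := by
    rw [← Indx.pointHom_points ξ, h, Indx.pointHom_points]

/-- The distributors of a pseudonatural transformation, as comparisons of points. -/
def Indx.pointIso (κ : J ⟶ J') {A : X} (E : J.fib A) :
    J.point E ≫ κ ≅ J'.point ((Indx.functor κ A).obj E) :=
  Indx.mkIso (Indx.mkModification (κ := J.point E ≫ κ) (κ' := J'.point ((Indx.functor κ A).obj E))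
    (fun B g => (Indx.distributor κ g.as E).hom)
    (fun B {g g'} ζ => by
      obtain ⟨g⟩ := g
      obtain ⟨g'⟩ := g'
      obtain rfl : g = g' := Discrete.eq_of_hom ζ
      have : ζ = 𝟙 _ := discrete_hom_ext _ _
      subst this
      exact ((congrArg (· ≫ _) (fmap_id _ _)).trans (id_comp _)).trans ((congrArg ((Indx.distributor
        κ g E).hom ≫ ·) ((Indx.functor (J'.point ((Indx.functor κ A).obj E)) B).map_id (Discrete.mk
        g))).trans (comp_id _)).symm)
    (fun {B B'} f g => by
      refine (Indx.distributor_compositor κ f g.as E).trans ?_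
      rw [Indx.distributor_comp]
      exact (assoc _ _ _).symm))
    (fun B g => (Indx.distributor κ g.as E).isIso_hom)

theorem Indx.pointIso_naturality (κ : J ⟶ J') {A : X} {E E' : J.fib A} (ξ : E ⟶ E') :
    (J.points A).map ξ ▷ κ ≫ (Indx.pointIso κ E').hom =
      (Indx.pointIso κ E).hom ≫ (J'.points A).map ((Indx.functor κ A).map ξ) :=
  modification_ext fun _ g => Indx.distributor_naturality κ g.as ξ

theorem Indx.pointIso_modification {κ κ' : J ⟶ J'} (m : κ ⟶ κ') {A : X} (E : J.fib A) :
    J.point E ◁ m ≫ (Indx.pointIso κ' E).hom =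
      (Indx.pointIso κ E).hom ≫ (J'.points A).map ((Indx.component m A).app E) :=
  modification_ext fun _ g => Indx.component_naturality m g.as E

theorem Indx.pointIso_id {A : X} (E : J.fib A) :
    (Indx.pointIso (𝟙 J) E).hom = (ρ_ (J.point E)).hom :=
  modification_ext fun _ g => Indx.distributor_id g.as E

theorem Indx.pointIso_comp (κ : J ⟶ J') (κ' : J' ⟶ J'') {A : X} (E : J.fib A) :
    (Indx.pointIso (κ ≫ κ') E).hom = (α_ (J.point E) κ κ').inv ≫ (Indx.pointIso κ E).hom ▷ κ' ≫
      (Indx.pointIso κ' ((Indx.functor κ A).obj E)).hom :=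
  modification_ext fun _ g => (Indx.distributor_comp κ κ' g.as E).trans (id_comp _).symm

variable (M : RawTangentObject (SIndx X))

theorem RawTangentObject.pointIso_proj {P : M.x ⟶ M.x} (m : P ⟶ 𝟙 M.x) {A : X}
    (E : M.x.fib A) : (Indx.pointIso P E).hom ≫ (M.x.points A).map ((Indx.component m A).app E) =
      M.x.point E ◁ m ≫ (ρ_ (M.x.point E)).hom :=
  (Indx.pointIso_modification m E).symm.trans (congrArg (M.x.point E ◁ m ≫ ·) (Indx.pointIso_id E))

theorem RawTangentObject.pointIso_unit {P : M.x ⟶ M.x} (m : 𝟙 M.x ⟶ P) {A : X}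
    (E : M.x.fib A) : ((ρ_ (M.x.point E)).inv ≫ M.x.point E ◁ m) ≫ (Indx.pointIso P E).hom =
      (M.x.points A).map ((Indx.component m A).app E) :=
  (assoc _ _ _).trans ((Iso.inv_comp_eq _).2 ((Indx.pointIso_modification m E).trans
    (congrArg (· ≫ _) (Indx.pointIso_id E))))

theorem RawTangentObject.pointIso_lift {P : M.x ⟶ M.x} (m : P ⟶ P ≫ P) {A : X} (E : M.x.fib A) :
    (M.x.point E ◁ m ≫ (α_ (M.x.point E) P P).inv) ≫ (Indx.pointIso P E).hom ▷ P ≫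
      (Indx.pointIso P ((Indx.functor P A).obj E)).hom =
    (Indx.pointIso P E).hom ≫ (M.x.points A).map ((Indx.component m A).app E) :=
  (assoc _ _ _).trans ((congrArg (M.x.point E ◁ m ≫ ·)
    (Indx.pointIso_comp P P E).symm).trans (Indx.pointIso_modification m E))

theorem conj_comp_eq {C : Type u} [Category.{v} C] {Y Z Y₁ Y₂ : C} (a : Y ≅ Z) {m : Z ⟶ Z}
    {r : Y ⟶ Y₁} {r' : Y₁ ⟶ Y₂} {k : Y₂ ⟶ Y₂} (h : m ≫ a.inv ≫ r ≫ r' = (a.inv ≫ r ≫ r') ≫ k) :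
    (a.hom ≫ m ≫ a.inv) ≫ r ≫ r' = r ≫ r' ≫ k := by
  simp only [assoc] at h ⊢
  rw [h, Iso.hom_inv_id_assoc]

theorem RawTangentObject.pointIso_flip {P : M.x ⟶ M.x} (m : P ≫ P ⟶ P ≫ P) {A : X} (E : M.x.fib A) :
    ((α_ (M.x.point E) P P).hom ≫ M.x.point E ◁ m ≫ (α_ (M.x.point E) P P).inv) ≫
      (Indx.pointIso P E).hom ▷ P ≫ (Indx.pointIso P ((Indx.functor P A).obj E)).hom =
    (Indx.pointIso P E).hom ▷ P ≫ (Indx.pointIso P ((Indx.functor P A).obj E)).hom ≫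
      (M.x.points A).map ((Indx.component m A).app E) := by
  have h := Indx.pointIso_modification m E
  have e := Indx.pointIso_comp P P E
  have h' : M.x.point E ◁ m ≫ (α_ (M.x.point E) P P).inv ≫ (Indx.pointIso P E).hom ▷ P ≫
      (Indx.pointIso P ((Indx.functor P A).obj E)).hom = ((α_ (M.x.point E) P P).inv ≫
        (Indx.pointIso P E).hom ▷ P ≫ (Indx.pointIso P ((Indx.functor P A).obj E)).hom) ≫
      (M.x.points A).map ((Indx.component m A).app E) :=
    (congrArg (M.x.point E ◁ m ≫ ·) e.symm).trans (h.trans (congrArg (· ≫ _) e))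
  exact conj_comp_eq (α_ (M.x.point E) P P) h'

/-- The points of an indexed category as a strong map of tangent data. -/
def RawTangentObject.pointsMap (A : X) :
    StrongMap (M.components.D A) (M.rep (Indx.hom A)) (M.x.points A) where
  b E := Indx.pointIso M.T E
  b₂ E := Indx.pointIso M.T₂ E
  natural ξ := Indx.pointIso_naturality M.T ξ
  π₁ E := (Indx.pointIso_modification M.π₁ E).symm
  π₂ E := (Indx.pointIso_modification M.π₂ E).symm
  p E := M.pointIso_proj M.p E
  z E := M.pointIso_unit M.z E
  s E := (Indx.pointIso_modification M.s E).symm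
  l E := M.pointIso_lift M.l E
  c E := M.pointIso_flip M.c E

end Points

theorem isPullback_id {C : Type u} [Category.{v} C] (A : C) : IsPullback (𝟙 A) (𝟙 A) (𝟙 A) (𝟙 A) :=
  IsPullback.of_horiz_isIso ⟨rfl⟩

theorem iter_trivial (C : Type u) [Category.{v} C] : ∀ m : ℕ, (triv C).iter m = 𝟭 C
  | 0 => rfl
  | m + 1 => congrArg (· ⋙ 𝟭 C) (iter_trivial C m)

theorem isTangent_trivial (C : Type u) [Category.{v} C] : (triv C).IsTangent where
  p_nat f := (comp_id f).trans (id_comp f).symm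
  z_nat f := (comp_id f).trans (id_comp f).symm
  s_nat _ _ h1 _ := h1.symm
  l_nat f := (comp_id f).trans (id_comp f).symm
  c_nat f := (comp_id f).trans (id_comp f).symm
  additive A :=
    { powers := fun _ => ⟨A, fun _ => 𝟙 A, isFibrePower_of_isIso (inferInstanceAs (IsIso (𝟙 A)))
        (inferInstanceAs (IsIso (𝟙 A))) fun _ => rfl⟩
      isPullback := isPullback_id A
      zero_q := comp_id _
      sum_q := rfl
      zero_add := fun _ _ h2 => h2
      comm := fun _ h1 _ => h1
      assoc := fun _ _ _ _ h1 _ h3 h4 _ => h3.trans (h1.symm.trans h4.symm) }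
  preserves m A n P pr h := by
    rw [iter_trivial]
    exact h
  l_additive _ := ⟨rfl, rfl, fun _ h1 _ => h1.symm⟩
  c_additive _ := ⟨rfl, rfl, fun _ h1 _ => h1.symm⟩
  l_coassoc A := rfl
  c_c A := comp_id _
  c_braid A := rfl
  l_c A := comp_id (𝟙 A)
  l_c_c A := congrArg (𝟙 A ≫ ·) (comp_id _)
  universal A k h1 _ := by
    have e : k = 𝟙 A := (comp_id k).symm.trans (h1.trans (comp_id _))
    subst e
    have h : IsPullback (𝟙 A ≫ 𝟙 A) (𝟙 A ≫ 𝟙 A) (𝟙 A) (𝟙 A) := by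
      rw [comp_id]
      exact isPullback_id A
    exact h

section Components

variable {X : Type u} [Category.{u} X] {J J' J'' : SIndx X} (M : RawTangentObject (SIndx X))

/-- The substitution functors as strong maps between the components of tangent objects. -/
def RawTangentObject.subMap {A A' : X} (f : A ⟶ A') :
    StrongMap (M.components.D A') (M.components.D A) (M.x.sub f) where
  b E := Indx.distributor M.T f E
  b₂ E := Indx.distributor M.T₂ f E
  natural ξ := Indx.distributor_naturality M.T f ξ
  π₁ E := (Indx.component_naturality M.π₁ f E).symm
  π₂ E := (Indx.component_naturality M.π₂ f E).symm
  p E := (Indx.component_naturality M.p f E).symm.trans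
    ((congrArg (_ ≫ ·) (Indx.distributor_id f E)).trans (comp_id _))
  z E := (Indx.component_naturality M.z f E).trans
    ((congrArg (· ≫ _) (Indx.distributor_id f E)).trans (id_comp _))
  s E := (Indx.component_naturality M.s f E).symm
  l E := (congrArg ((Indx.component M.l A).app ((M.x.sub f).obj E) ≫ ·)
    (Indx.distributor_comp M.T M.T f E).symm).trans (Indx.component_naturality M.l f E)
  c E := (congrArg ((Indx.component M.c A).app ((M.x.sub f).obj E) ≫ ·)
    (Indx.distributor_comp M.T M.T f E).symm).trans ((Indx.component_naturality M.c f E).trans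
      ((congrArg (· ≫ _) (Indx.distributor_comp M.T M.T f E)).trans (assoc _ _ _)))

variable {M} {n : ℕ} {P : M.x ⟶ M.x} {pr : Fin (n + 1) → (P ⟶ M.T)}

theorem RawTangentObject.isFibrePower_points (H : ∀ (y : SIndx X) (g : y ⟶ M.x),
      IsFibrePower ((M.rep y).p g) (fun i => g ◁ pr i)) {A : X} (E : M.x.fib A) :
    IsFibrePower ((M.x.points A).map ((M.components.D A).p E))
      (fun i => (M.x.points A).map ((Indx.component (pr i) A).app E)) :=
  (H _ (M.x.point E)).of_iso (Indx.pointIso M.T E) (Iso.refl _) (Indx.pointIso P E) ((comp_id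
    _).trans ((M.pointsMap A).p E).symm) (fun i => Indx.pointIso_modification (pr i) E)

theorem RawTangentObject.isFibrePower_component (H : ∀ (y : SIndx X) (g : y ⟶ M.x),
      IsFibrePower ((M.rep y).p g) (fun i => g ◁ pr i)) {A : X} (E : M.x.fib A) :
    IsFibrePower ((M.components.D A).p E) (fun i => (Indx.component (pr i) A).app E) :=
  (jointlyReflects_of_fullyFaithful (M.x.points A)).power
    (fun _ => RawTangentObject.isFibrePower_points H E)

theorem RawTangentObject.IsTangent.fibre (h : M.IsTangent) (A : X) : (M.components.D A).IsTangent :=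
  isTangent_of_jointlyReflects (jointlyReflects_of_fullyFaithful (M.x.points A))
    (fun _ => M.pointsMap A) (fun _ => h.rep (Indx.hom A)) (fun E n => by
      obtain ⟨P, pr, H⟩ := h.pointwise n
      exact ⟨(Indx.functor P A).obj E, fun i => (Indx.component (pr i) A).app E,
        fun _ => RawTangentObject.isFibrePower_points H E⟩)

theorem RawTangentObject.isFibrePower_sub_component (H : ∀ (y : SIndx X) (g : y ⟶ M.x),
      IsFibrePower ((M.rep y).p g) (fun i => g ◁ pr i)) {A A' : X} (f : A ⟶ A')
    (E : M.x.fib A') : IsFibrePower ((M.x.sub f).map ((M.components.D A').p E))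
      (fun i => (M.x.sub f).map ((Indx.component (pr i) A').app E)) :=
  (RawTangentObject.isFibrePower_component H ((M.x.sub f).obj E)).of_iso (Indx.distributor M.T f E)
    (Iso.refl _) (Indx.distributor P f E) ((comp_id _).trans ((M.subMap f).p E).symm) (fun i =>
    Indx.component_naturality (pr i) f E)

theorem RawTangentObject.IsTangent.preservesTangentLimits_sub (h : M.IsTangent) {A A' : X}
    (f : A ⟶ A') : PreservesTangentLimits (M.components.D A') (M.x.sub f) :=
  (M.subMap f).preservesTangentLimits (h.fibre A) fun E n _ _ hpr => by
    obtain ⟨P, pr, H⟩ := h.pointwise n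
    exact hpr.map_of_map (RawTangentObject.isFibrePower_component H E) _
      (RawTangentObject.isFibrePower_sub_component H f E)

theorem RawTangentObject.IsTangent.preservesTangentLimits_points (h : M.IsTangent) (A : X) :
    PreservesTangentLimits (M.components.D A) (M.x.points A) :=
  (M.pointsMap A).preservesTangentLimits (h.rep _) fun E n _ _ hpr => by
    obtain ⟨P, pr, H⟩ := h.pointwise n
    exact hpr.map_of_map (RawTangentObject.isFibrePower_component H E) _
      (RawTangentObject.isFibrePower_points H E)

theorem RawTangentObject.IsTangent.components (h : M.IsTangent) :
    M.components.IsTangent (triv X) where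
  base := isTangent_trivial X
  fibre A := h.fibre A
  strong f := (M.subMap f).isTangentMorphism (h.fibre _) (h.preservesTangentLimits_sub f) .strong
    nofun
  mapId A E := (Indx.distributor_unit M.T E).trans (comp_id _).symm
  mapComp f g E := Indx.distributor_compositor M.T f g E

end Components

section Evaluation

variable {X : Type u} [Category.{u} X] {y J : SIndx X}

theorem Indx.exists_modification {κ P : y ⟶ J} {ι : Type} {E : ι → (y ⟶ J)} (pr : ∀ i, P ⟶ E i)
    (hpr : ∀ (A : X) (Y : y.fib A) {Z : J.fib A} {k k' : Z ⟶ (Indx.functor P A).obj Y},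
      (∀ i, k ≫ (Indx.component (pr i) A).app Y = k' ≫ (Indx.component (pr i) A).app Y) → k = k')
    (f : ∀ i, κ ⟶ E i)
    (m : ∀ (A : X) (Y : y.fib A), (Indx.functor κ A).obj Y ⟶ (Indx.functor P A).obj Y)
    (hm : ∀ A Y i, m A Y ≫ (Indx.component (pr i) A).app Y = (Indx.component (f i) A).app Y) :
    ∃ k : κ ⟶ P, (∀ A Y, (Indx.component k A).app Y = m A Y) ∧ ∀ i, k ≫ pr i = f i := by
  refine ⟨Indx.mkModification m (fun A {Y Y'} ξ => hpr A Y' fun i => ?_) (fun {A A'} f' Y => ?_),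
    fun _ _ => rfl, fun i => modification_ext fun A Y => hm A Y i⟩
  · rw [assoc, hm, assoc, (Indx.component (pr i) A).naturality, ← assoc,
      hm, (Indx.component (f i) A).naturality]
  · rw [← Iso.eq_comp_inv]
    refine hpr A _ fun i => ?_
    have h1 := Indx.component_naturality (pr i) f' Y
    have h2 := Indx.component_naturality (f i) f' Y
    have h3 : (Indx.distributor P f' Y).inv ≫ (Indx.component (pr i) A).app ((y.sub f').obj Y) =
        (J.sub f').map ((Indx.component (pr i) A').app Y) ≫ (Indx.distributor (E i) f' Y).inv := by
      rw [Iso.inv_comp_eq, ← assoc, Iso.eq_comp_inv, h1]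
    rw [hm, assoc, h3, assoc, ← CategoryTheory.Functor.map_comp_assoc, hm,
      ← assoc, Iso.eq_comp_inv, h2]

/-- Evaluation of pseudonatural transformations at an object of a fibre. -/
def Indx.eval (y J : SIndx X) (i : Σ A : X, y.fib A) : (y ⟶ J) ⥤ J.fib i.1 where
  obj κ := (Indx.functor κ i.1).obj i.2
  map m := (Indx.component m i.1).app i.2
  map_id _ := rfl
  map_comp _ _ := rfl

theorem Indx.jointlyReflects_eval (y J : SIndx X) :
    JointlyReflects (Indx.eval y J) where
  faithful h := modification_ext fun A Y => h ⟨A, Y⟩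
  power {E B P q n pr} h := by
    refine .mk_of_ext (fun i j => modification_ext fun A Y => (h ⟨A, Y⟩).comm i j)
      (fun {κ} f hf => ?_) (fun {κ k k'} hk => modification_ext fun A Y =>
        (h ⟨A, Y⟩).hom_ext fun i => congrArg (fun t => (Indx.component t A).app Y) (hk i))
    obtain ⟨k, -, hk⟩ := Indx.exists_modification pr (fun A Y _ _ _ => (h ⟨A, Y⟩).hom_ext) f (fun A
      Y => (h ⟨A, Y⟩).desc (fun i => (Indx.component (f i) A).app Y) fun i j => congrArg (fun t =>
      (Indx.component t A).app Y) (hf i j)) (fun A Y i => (h ⟨A, Y⟩).desc_pr _ _ i)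
    exact ⟨k, hk⟩
  square {P E E' B a b f g} h := by
    refine isPullback_of_existsUnique (modification_ext fun A Y => (h ⟨A, Y⟩).w)
      fun {κ} s t hs => ?_
    have hs' : ∀ A Y, (Indx.component s A).app Y ≫ (Indx.component f A).app Y =
        (Indx.component t A).app Y ≫ (Indx.component g A).app Y := fun A Y =>
      congrArg (fun t => (Indx.component t A).app Y) hs
    obtain ⟨k, hk, hk'⟩ := Indx.exists_modification (E := fun b => Bool.rec E E' b)
      (fun i => Bool.rec a b i) (fun A Y _ _ _ hh => (h ⟨A, Y⟩).hom_ext (hh false) (hh true))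
      (fun i => Bool.rec s t i) (fun A Y => (h ⟨A, Y⟩).lift _ _ (hs' A Y))
      (fun A Y i => by
        cases i
        · exact (h ⟨A, Y⟩).lift_fst _ _ (hs' A Y)
        · exact (h ⟨A, Y⟩).lift_snd _ _ (hs' A Y))
    refine ⟨k, ⟨hk' false, hk' true⟩, fun m hm => modification_ext fun A Y =>
      (h ⟨A, Y⟩).hom_ext ?_ ?_⟩
    · exact congrArg (fun t => (Indx.component t A).app Y) (hm.1.trans (hk' false).symm)
    · exact congrArg (fun t => (Indx.component t A).app Y) (hm.2.trans (hk' true).symm)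

variable (M : RawTangentObject (SIndx X))

theorem RawTangentObject.eval_p {y : SIndx X} (i : Σ A : X, y.fib A) (g : y ⟶ M.x) :
    (Indx.eval y M.x i).map ((M.rep y).p g) =
      (M.components.D i.1).p ((Indx.functor g i.1).obj i.2) :=
  comp_id _

/-- Evaluation as a strong map of tangent data. -/
def RawTangentObject.evalMap (y : SIndx X) (i : Σ A : X, y.fib A) :
    StrongMap (M.rep y) (M.components.D i.1) (Indx.eval y M.x i) where
  b _ := Iso.refl _
  b₂ _ := Iso.refl _
  natural _ := (comp_id _).trans (id_comp _).symm
  π₁ _ := (id_comp _).trans (comp_id _).symm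
  π₂ _ := (id_comp _).trans (comp_id _).symm
  p g := (id_comp _).trans (M.eval_p i g)
  z _ := (comp_id _).trans (id_comp _).symm
  s _ := (id_comp _).trans (comp_id _).symm
  l g := by
    refine Eq.trans ?_ (id_comp _).symm
    refine congrArg ((M.components.D i.1).l ((Indx.functor g i.1).obj i.2) ≫ ·) ?_
    exact (comp_id _).trans ((M.components.D i.1).T.map_id _)
  c g := by
    have e : (Indx.eval y M.x i).map ((M.rep y).c g) =
        (M.components.D i.1).c ((Indx.functor g i.1).obj i.2) :=
      (id_comp _).trans (comp_id _)
    have e' : (M.components.D i.1).T.map (𝟙 ((M.components.D i.1).T.obj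
        ((Indx.functor g i.1).obj i.2))) ≫ 𝟙 _ = 𝟙 _ :=
      (comp_id _).trans ((M.components.D i.1).T.map_id _)
    refine ((congrArg ((M.components.D i.1).c _ ≫ ·) e').trans ((comp_id _).trans e.symm)).trans ?_
    exact (id_comp _).symm.trans ((congrArg (· ≫ _) e'.symm).trans (assoc _ _ _))

variable {M}

theorem RawTangentObject.isFibrePower_eval {n : ℕ} {P : M.x ⟶ M.x} {pr : Fin (n + 1) → (P ⟶ M.T)}
    (H : ∀ (A : X) (E : M.x.fib A),
      IsFibrePower ((M.components.D A).p E) (fun i => (Indx.component (pr i) A).app E))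
    {y : SIndx X} (g : y ⟶ M.x) (i : Σ A : X, y.fib A) :
    IsFibrePower ((Indx.eval y M.x i).map ((M.rep y).p g))
      (fun j => (Indx.eval y M.x i).map (g ◁ pr j)) := by
  rw [M.eval_p i g]
  exact H i.1 ((Indx.functor g i.1).obj i.2)

theorem RawTangentObject.IsTangent.preservesTangentLimits_eval (h : M.IsTangent)
    (y : SIndx X) (i : Σ A : X, y.fib A) : PreservesTangentLimits (M.rep y) (Indx.eval y M.x i) :=
  (M.evalMap y i).preservesTangentLimits (h.fibre i.1) fun g n _ _ hpr => by
    obtain ⟨P, pr, H⟩ := h.pointwise n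
    exact hpr.map_of_map (H y g) _ (RawTangentObject.isFibrePower_eval
      (fun A E => RawTangentObject.isFibrePower_component H E) g i)

theorem RawTangentObject.isTangent_of_fibre (h : ∀ A, (M.components.D A).IsTangent)
    (hpow : ∀ n : ℕ, ∃ (P : M.x ⟶ M.x) (pr : Fin (n + 1) → (P ⟶ M.T)), ∀ (A : X) (E : M.x.fib A),
      IsFibrePower ((M.components.D A).p E) (fun i => (Indx.component (pr i) A).app E)) :
    M.IsTangent where
  rep y := isTangent_of_jointlyReflects (Indx.jointlyReflects_eval y M.x) (M.evalMap y)
    (fun i => h i.1) fun g n => by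
      obtain ⟨P, pr, H⟩ := hpow n
      exact ⟨g ≫ P, fun i => g ◁ pr i, RawTangentObject.isFibrePower_eval H g⟩
  pointwise n := by
    obtain ⟨P, pr, H⟩ := hpow n
    exact ⟨P, pr, fun y g => (Indx.jointlyReflects_eval y M.x).power
      (RawTangentObject.isFibrePower_eval H g)⟩

theorem RawIndexed.IsTangent.isTangent_tangentObject {D : TangentData X}
    {R : RawIndexed.{u, u, u, u} X} (h : R.IsTangent D) : h.tangentObject.IsTangent :=
  RawTangentObject.isTangent_of_fibre (M := h.tangentObject) h.fibre fun n => by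
    choose P pr hP using fun (A : X) (E : R.J.fib A) => ((h.fibre A).additive E).powers n
    exact ⟨h.powerTrans hP, h.powerProj hP, fun A E => h.isFibrePower_prj hP E⟩

end Evaluation

section Cells

variable {X : Type u} [Category.{u} X] {M M' : RawTangentObject (SIndx X)}
  {κ : M.x ⟶ M'.x}

theorem LawCell.components_isNatural : ∀ {o : Bool} (a : LawCell o M.T M'.T κ) (A : X),
    (a.components A).IsNatural
  | false, a, A => fun ξ => (Indx.component a A).naturality ξ
  | true, a, A => fun ξ => (Indx.component a A).naturality ξ

theorem LawCell.components_isCoherentLaw : ∀ {o : Bool} (a : LawCell o M.T M'.T κ),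
    IsCoherentLaw (R := M.components) (R' := M'.components) κ a.components
  | false, a => by
    intro f E
    exact ((assoc _ _ _).symm.trans ((congrArg (· ≫ _)
      (Indx.distributor_comp M.T κ f E).symm).trans (Indx.component_naturality a f E).symm)).trans
        (congrArg (_ ≫ ·) (Indx.distributor_comp κ M'.T f E))
  | true, a => by
    intro f E
    exact (congrArg (_ ≫ ·) (Indx.distributor_comp M.T κ f E).symm).trans
      ((Indx.component_naturality a f E).trans ((congrArg (· ≫ _)
        (Indx.distributor_comp κ M'.T f E)).trans (assoc _ _ _)))

theorem eq_conj_lax {C : Type u} [Category.{v} C] {Y₁ Y₂ Y₃ Y₄ Z₁ Z₂ Z₃ Z₄ : C} (i : Y₁ ≅ Y₂)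
    (j : Y₂ ≅ Z₁) (a : Y₁ ≅ Y₃) {n : Y₃ ⟶ Y₄} (a' : Z₂ ≅ Y₄) {r : Z₂ ⟶ Z₃} {r' : Z₃ ⟶ Z₄}
    {c : Z₁ ⟶ Z₄} {q : Y₃ ≅ Z₁} (h : n ≫ a'.inv ≫ r ≫ r' = q.hom ≫ c)
    (hq : q.hom = a.inv ≫ i.hom ≫ j.hom) :
    c = j.inv ≫ i.inv ≫ (a.hom ≫ n ≫ a'.inv) ≫ r ≫ r' := by
  simp only [assoc, h, hq, Iso.hom_inv_id_assoc, Iso.inv_hom_id_assoc]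

theorem LawCell.points_lax (a : M.T ≫ κ ⟶ κ ≫ M'.T) {A : X} (E : M.x.fib A) :
    (M'.x.points A).map ((Indx.component a A).app E) =
      (Indx.pointIso κ ((Indx.functor M.T A).obj E)).inv ≫ (Indx.pointIso M.T E).inv ▷ κ ≫
        ((α_ (M.x.point E) M.T κ).hom ≫ M.x.point E ◁ a ≫ (α_ (M.x.point E) κ M'.T).inv) ≫
          (Indx.pointIso κ E).hom ▷ M'.T ≫ (Indx.pointIso M'.T ((Indx.functor κ A).obj E)).hom :=
  eq_conj_lax (whiskerRightIso (Indx.pointIso M.T E) κ) (Indx.pointIso κ ((Indx.functor M.T A).obj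
    E)) (α_ (M.x.point E) M.T κ) (α_ (M.x.point E) κ M'.T) (q := Indx.pointIso (M.T ≫ κ) E)
    ((congrArg (M.x.point E ◁ a ≫ ·) (Indx.pointIso_comp κ M'.T E).symm).trans
    (Indx.pointIso_modification a E)) (Indx.pointIso_comp M.T κ E)

theorem LawCell.points_colax (a : κ ≫ M'.T ⟶ M.T ≫ κ) {A : X} (E : M.x.fib A) :
    (M'.x.points A).map ((Indx.component a A).app E) =
      (Indx.pointIso M'.T ((Indx.functor κ A).obj E)).inv ≫ (Indx.pointIso κ E).inv ▷ M'.T ≫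
        ((α_ (M.x.point E) κ M'.T).hom ≫ M.x.point E ◁ a ≫ (α_ (M.x.point E) M.T κ).inv) ≫
          (Indx.pointIso M.T E).hom ▷ κ ≫ (Indx.pointIso κ ((Indx.functor M.T A).obj E)).hom :=
  eq_conj_lax (whiskerRightIso (Indx.pointIso κ E) M'.T) (Indx.pointIso M'.T ((Indx.functor κ A).obj
    E)) (α_ (M.x.point E) κ M'.T) (α_ (M.x.point E) M.T κ) (q := Indx.pointIso (κ ≫ M'.T) E)
    ((congrArg (M.x.point E ◁ a ≫ ·) (Indx.pointIso_comp M.T κ E).symm).trans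
    (Indx.pointIso_modification a E)) (Indx.pointIso_comp κ M'.T E)

theorem LawCell.isLaxMorphism_components (hM' : M'.IsTangent) {a : LawCell false M.T M'.T κ}
    (h : ∀ y, IsLaxMorphism (M.rep y) (M'.rep y) (postcomp y κ) (a.rep y)) (A : X) :
    IsLaxMorphism (M.components.D A) (M'.components.D A) (Indx.functor κ A) (a.components A) :=
  isLaxMorphism_of_jointlyReflects (jointlyReflects_of_fullyFaithful (M'.x.points A)) (fun _ =>
    M.pointsMap A) (fun _ => M'.pointsMap A) (fun _ => hM'.rep (Indx.hom A)) (F' := fun _ =>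
    postcomp (Indx.hom A) κ) (fun _ E => Indx.pointIso κ E) (fun _ {_ _} ξ =>
    Indx.pointIso_naturality κ ξ) (fun _ => h (Indx.hom A)) (fun _ E => LawCell.points_lax a E)

theorem LawCell.isColaxMorphism_components (hM : M.IsTangent) (hM' : M'.IsTangent)
    {a : LawCell true M.T M'.T κ}
    (h : ∀ y, IsColaxMorphism (M.rep y) (M'.rep y) (postcomp y κ) (a.rep y)) (A : X) :
    IsColaxMorphism (M.components.D A) (M'.components.D A) (Indx.functor κ A) (a.components A) :=
  isColaxMorphism_of_jointlyReflects (jointlyReflects_of_fullyFaithful (M'.x.points A)) (fun _ =>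
    hM.rep (Indx.hom A)) (fun _ => M.pointsMap A) (fun _ => hM.preservesTangentLimits_points A) (fun
    _ => M'.pointsMap A) (fun _ => hM'.rep (Indx.hom A)) (F' := fun _ => postcomp (Indx.hom A) κ)
    (fun _ E => Indx.pointIso κ E) (fun _ {_ _} ξ => Indx.pointIso_naturality κ ξ) (fun _ => h
    (Indx.hom A)) (fun _ E => LawCell.points_colax a E)

theorem Indx.isIso_component {J J' : SIndx X} {κ κ' : J ⟶ J'} (m : κ ⟶ κ') [IsIso m]
    {A : X} (E : J.fib A) : IsIso ((Indx.component m A).app E) :=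
  inferInstanceAs (IsIso ((Indx.eval J J' ⟨A, E⟩).map m))

theorem IsTangentCell.components (hM : M.IsTangent) (hM' : M'.IsTangent) :
    ∀ {fl : Flavour} {a : LawCell fl.isColax M.T M'.T κ}, IsTangentCell κ fl a →
      IsIndexedMorphism (R := M.components) (R' := M'.components) fl κ a.components
  | .lax, a, h => ⟨LawCell.isLaxMorphism_components hM' h, a.components_isCoherentLaw⟩
  | .colax, a, h => ⟨LawCell.isColaxMorphism_components hM hM' h, a.components_isCoherentLaw⟩
  | .strong, a, ⟨h, hi⟩ => ⟨fun A => ⟨LawCell.isColaxMorphism_components hM hM' h A,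
      fun E => @Indx.isIso_component _ _ _ _ _ _ _ hi A E⟩, a.components_isCoherentLaw⟩
  | .strict, a, ⟨h, e, he⟩ => ⟨fun A => ⟨LawCell.isColaxMorphism_components hM hM' h A,
      fun E => congrArg (fun t => (Indx.functor t A).obj E) e, fun E => by
        subst he
        exact Indx.component_eqToHom e A E⟩, a.components_isCoherentLaw⟩

theorem id_comp_comp_id {C : Type u} [Category.{v} C] {C' : Type u'} [Category.{v'} C']
    {E : Type u''} [Category.{v''} E] (F : C ⥤ E) (G : C' ⥤ E) {Z : C} {Z' : C'}
    (n : F.obj Z ⟶ G.obj Z') :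
    𝟙 _ ≫ n ≫ 𝟙 _ = 𝟙 _ ≫ F.map (𝟙 Z) ≫ n ≫ G.map (𝟙 Z') ≫ 𝟙 _ := by
  simp

theorem LawCell.isLaxMorphism_rep (hM' : ∀ A, (M'.components.D A).IsTangent)
    {a : LawCell false M.T M'.T κ}
    (h : ∀ A, IsLaxMorphism (M.components.D A) (M'.components.D A) (Indx.functor κ A)
      (a.components A)) (y : SIndx X) :
    IsLaxMorphism (M.rep y) (M'.rep y) (postcomp y κ) (a.rep y) :=
  isLaxMorphism_of_jointlyReflects (Indx.jointlyReflects_eval y M'.x) (M.evalMap y) (M'.evalMap y)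
    (fun i => hM' i.1) (F := postcomp y κ) (F' := fun i => Indx.functor κ i.1) (fun i g => Iso.refl
    ((Indx.functor κ i.1).obj ((Indx.functor g i.1).obj i.2))) (fun _ {_ _} _ => (comp_id _).trans
    (id_comp _).symm) (fun i => h i.1) (fun i g => id_comp_comp_id (Indx.functor κ i.1)
    (M'.components.D i.1).T (Z := (M.components.D i.1).T.obj ((Indx.functor g i.1).obj i.2)) (Z' :=
    (Indx.functor κ i.1).obj ((Indx.functor g i.1).obj i.2)) (a.components i.1 _))

theorem LawCell.isColaxMorphism_rep (hM : M.IsTangent)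
    (hM' : ∀ A, (M'.components.D A).IsTangent) {a : LawCell true M.T M'.T κ}
    (h : ∀ A, IsColaxMorphism (M.components.D A) (M'.components.D A) (Indx.functor κ A)
      (a.components A)) (y : SIndx X) :
    IsColaxMorphism (M.rep y) (M'.rep y) (postcomp y κ) (a.rep y) :=
  isColaxMorphism_of_jointlyReflects (Indx.jointlyReflects_eval y M'.x) (fun i => hM.fibre i.1)
    (M.evalMap y) (hM.preservesTangentLimits_eval y) (M'.evalMap y) (fun i => hM' i.1) (F :=
    postcomp y κ) (F' := fun i => Indx.functor κ i.1) (fun i g => Iso.refl ((Indx.functor κ i.1).obj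
    ((Indx.functor g i.1).obj i.2))) (fun _ {_ _} _ => (comp_id _).trans (id_comp _).symm) (fun i =>
    h i.1) (fun i g => id_comp_comp_id (M'.components.D i.1).T (Indx.functor κ i.1) (Z :=
    (Indx.functor κ i.1).obj ((Indx.functor g i.1).obj i.2)) (Z' := (M.components.D i.1).T.obj
    ((Indx.functor g i.1).obj i.2)) (a.components i.1 _))

theorem heq_of_comp_eqToHom {C : Type u} [Category.{v} C] {Y Y' Z Z' : C} (e : Y = Y')
    (e' : Z = Z') {f : Y ⟶ Z} {f' : Y' ⟶ Z'} (h : eqToHom e ≫ f' = f ≫ eqToHom e') : HEq f f' := by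
  subst e e'
  rw [eqToHom_refl, eqToHom_refl, id_comp, comp_id] at h
  exact heq_of_eq h.symm

theorem Indx.exists_eqToHom {J J' : SIndx X} {κ κ' : J ⟶ J'} (m : κ ⟶ κ')
    (h : ∀ A, ∃ e : ∀ E, (Indx.functor κ A).obj E = (Indx.functor κ' A).obj E,
      ∀ E, (Indx.component m A).app E = eqToHom (e E)) : ∃ e : κ = κ', m = eqToHom e := by
  choose e he using h
  have hκ : κ = κ' := by
    refine indx_ext (fun A => CategoryTheory.Functor.ext (e A) fun E E' ξ => ?_)
      fun {A A'} f E => ?_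
    · have n := (Indx.component m A).naturality ξ
      rw [he, he] at n
      rw [← assoc, ← n, assoc, eqToHom_trans, eqToHom_refl, comp_id]
    · have n := Indx.component_naturality m f E
      rw [he, he, eqToHom_map] at n
      exact heq_of_comp_eqToHom _ _ n
  refine ⟨hκ, modification_ext fun A E => ?_⟩
  rw [he, Indx.component_eqToHom]

theorem IsTangentCell.of_components (hM : M.IsTangent) (hM' : M'.IsTangent) :
    ∀ {fl : Flavour} {a : LawCell fl.isColax M.T M'.T κ},
      (∀ A, IsTangentMorphism (M.components.D A) (M'.components.D A) (Indx.functor κ A) fl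
        (a.components A)) → IsTangentCell κ fl a
  | .lax, _, h => LawCell.isLaxMorphism_rep hM'.fibre h
  | .colax, _, h => LawCell.isColaxMorphism_rep hM hM'.fibre h
  | .strong, a, h => ⟨LawCell.isColaxMorphism_rep hM hM'.fibre fun A => (h A).1,
      (Indx.mkIso (show κ ≫ M'.T ⟶ M.T ≫ κ from a) fun A => (h A).2).isIso_hom⟩
  | .strict, a, h => ⟨LawCell.isColaxMorphism_rep hM hM'.fibre fun A => (h A).1,
      Indx.exists_eqToHom (show κ ≫ M'.T ⟶ M.T ≫ κ from a) fun A => (h A).2⟩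

end Cells

section ComponentsFunctor

variable {X : Type u} [Category.{u} X] {M M' M'' : RawTangentObject (SIndx X)}
  {κ κ' : M.x ⟶ M'.x}

theorem LawCell.components_injective : ∀ {o : Bool} {a b : LawCell o M.T M'.T κ},
    (∀ A, a.components A = b.components A) → a = b
  | false, _, _, h => modification_ext fun A E => congrFun (h A) E
  | true, _, _, h => modification_ext fun A E => congrFun (h A) E

theorem LawCell.heq_of_components {o : Bool} (h : κ = κ') {a : LawCell o M.T M'.T κ}
    {b : LawCell o M.T M'.T κ'} (hab : ∀ A, HEq (a.components A) (b.components A)) : HEq a b := by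
  subst h
  exact heq_of_eq (LawCell.components_injective fun A => eq_of_heq (hab A))

theorem LawCell.components_id (M : RawTangentObject (SIndx X)) :
    ∀ (o : Bool) (A : X), (LawCell.id o M.T).components A = Law.id o (M.components.D A)
  | false, _ => funext fun _ => comp_id _
  | true, _ => funext fun _ => comp_id _

theorem id_comp_id_comp_id {C : Type u} [Category.{v} C] {Y Y' Y'' : C} (f : Y ⟶ Y')
    (g : Y' ⟶ Y'') : 𝟙 _ ≫ f ≫ 𝟙 _ ≫ g ≫ 𝟙 _ = f ≫ g := by
  simp only [id_comp, comp_id]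

theorem LawCell.components_comp {κ' : M'.x ⟶ M''.x} :
    ∀ {o : Bool} (a : LawCell o M.T M'.T κ) (b : LawCell o M'.T M''.T κ') (A : X),
      (a.comp b).components A = (a.components A).comp (b.components A)
  | false, a, b, A => funext fun E => id_comp_id_comp_id
      ((Indx.functor κ' A).map ((Indx.component a A).app E)) ((Indx.component b A).app _)
  | true, a, b, A => funext fun E => id_comp_id_comp_id
      ((Indx.component b A).app ((Indx.functor κ A).obj E))
      ((Indx.functor κ' A).map ((Indx.component a A).app E))

theorem LawCell.components_assoc {N : RawTangentObject (SIndx X)} {κ' : M'.x ⟶ M''.x}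
    {κ'' : M''.x ⟶ N.x} {o : Bool} (a : LawCell o M.T M'.T κ) (b : LawCell o M'.T M''.T κ')
    (c : LawCell o M''.T N.T κ'') (A : X) :
    ((a.comp b).comp c).components A = (a.comp (b.comp c)).components A := by
  have h : ((a.comp b).comp c).components A =
      ((a.components A).comp (b.components A)).comp (c.components A) :=
    (LawCell.components_comp (M := M) (M' := M'') (M'' := N) (a.comp b) c A).trans
      (congrArg (fun t => Law.comp t (c.components A)) (LawCell.components_comp a b A))
  have h' : (a.comp (b.comp c)).components A =
      (a.components A).comp ((b.components A).comp (c.components A)) :=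
    (LawCell.components_comp (M := M) (M' := M') (M'' := N) a (b.comp c) A).trans
      (congrArg (fun t => Law.comp (a.components A) t) (LawCell.components_comp b c A))
  exact h.trans ((Law.comp_assoc (a.components A) (b.components A) (c.components A)).trans h'.symm)

theorem LawCell.components_compat : ∀ {o : Bool} {a : LawCell o M.T M'.T κ}
    {b : LawCell o M.T M'.T κ'} (m : κ ⟶ κ'),
    a.Compat b m ↔ ∀ A, (a.components A).Compat (b.components A) (Indx.component m A)
  | false, _, _, _ => ⟨fun h A E => congrArg (fun t => (Indx.component t A).app E) h,
      fun h => modification_ext fun A E => h A E⟩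
  | true, _, _, _ => ⟨fun h A E => congrArg (fun t => (Indx.component t A).app E) h,
      fun h => modification_ext fun A E => h A E⟩

theorem tngDisplayed_isStrict (o : Bool) (W) : IsStrict ((tngDisplayed o (SIndx X)).Total W) :=
  Total.isStrict indx_isStrict (fun {x y _} _ => LawCell.heq_of_components (M := x.1) (M' := y.1)
    (indx_isStrict.id_comp _) fun A => heq_of_eq ((LawCell.components_comp (M := x.1) (M' := x.1)
    (M'' := y.1) _ _ A).trans ((congrArg (fun t => Law.comp t _) (LawCell.components_id x.1 o
    A)).trans (Law.id_comp _)))) (fun {x y _} _ => LawCell.heq_of_components (M := x.1) (M' := y.1)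
    (indx_isStrict.comp_id _) fun A => heq_of_eq ((LawCell.components_comp (M := x.1) (M' := y.1)
    (M'' := y.1) _ _ A).trans ((congrArg (fun t => Law.comp _ t) (LawCell.components_id y.1 o
    A)).trans (Law.comp_id _)))) (fun {x y _ t _ _ _} a b c => LawCell.heq_of_components (M := x.1)
    (M' := t.1) (indx_isStrict.assoc _ _ _) fun A =>
        heq_of_eq (LawCell.components_assoc (M := x.1) (M' := y.1) a b c A))

variable (X) (fl : Flavour)

/-- The components of a tangent object in indexed categories, as an object. -/
abbrev componentsOb (M : (TngDisp fl X).Ob) : (IndDisp fl.isColax X).Ob :=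
  ⟨M.1.components, M.2.components⟩

variable {X fl}

/-- The components of a law, as a structure on a 1-cell. -/
abbrev componentsStr {M M' : (TngDisp fl X).Ob}
    {κ : M.1.x ⟶ M'.1.x} (a : LawCell fl.isColax M.1.T M'.1.T κ) :
    (IndDisp fl.isColax X).Str (x := componentsOb X fl M) (y := componentsOb X fl M') κ :=
  ⟨a.components, a.components_isNatural⟩

theorem componentsStr_id (M : (TngDisp fl X).Ob) :
    componentsStr (M := M) (M' := M) (LawCell.id fl.isColax M.1.T) =
      (IndDisp fl.isColax X).idStr (componentsOb X fl M) :=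
  Subtype.ext (funext fun A => LawCell.components_id M.1 fl.isColax A)

theorem componentsStr_comp {M M' M'' : (TngDisp fl X).Ob}
    {κ : M.1.x ⟶ M'.1.x} {κ' : M'.1.x ⟶ M''.1.x} (a : LawCell fl.isColax M.1.T M'.1.T κ)
    (b : LawCell fl.isColax M'.1.T M''.1.T κ') :
    componentsStr (M := M) (M' := M'') (a.comp b) = (IndDisp fl.isColax X).compStr (x :=
      componentsOb X fl M) (y := componentsOb X fl M') (t := componentsOb X fl M'') (componentsStr
      a) (componentsStr b) :=
  Subtype.ext (funext fun A => LawCell.components_comp a b A)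

theorem componentsStr_generated {M M' : (TngDisp fl X).Ob}
    {κ : M.1.x ⟶ M'.1.x} {a : LawCell fl.isColax M.1.T M'.1.T κ}
    (ha : TngGen fl (x := M) (y := M') a) :
    IndGen fl (componentsStr a) :=
  ha.map (componentsOb X fl) (fun {M M' f} a => ⟨f, componentsStr (M := M) (M' := M') a⟩) (fun {M M'
    _} _ h => .of _ (h.components M.2 M'.2)) (fun M => congrArg (Sigma.mk _) (componentsStr_id M))
    (fun {M M' M'' _ _} a b => congrArg (Sigma.mk _) (componentsStr_comp (M := M) (M' := M') (M'' :=
    M'') a b))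

variable {N N' N'' : Tng fl (SIndx X)}

/-- The components of a 1-cell. -/
abbrev componentsHom (κ : N ⟶ N') : (⟨componentsOb X fl N.obj⟩ : IndxTng.{u, u, u, u} fl (triv X)) ⟶
      ⟨componentsOb X fl N'.obj⟩ :=
  Total.Hom.mk κ.hom (componentsStr κ.str) (componentsStr_generated κ.gen)

theorem componentsHom_comp (κ : N ⟶ N') (κ' : N' ⟶ N'') :
    componentsHom (κ ≫ κ') = componentsHom κ ≫ componentsHom κ' :=
  Total.hom_ext rfl (heq_of_eq (componentsStr_comp κ.str κ'.str))

variable (X fl)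

/-- The strict 2-functor of components. -/
def componentsFunctor : StrictPseudofunctor (Tng fl (SIndx X)) (IndxTng.{u, u, u, u} fl (triv X)) :=
  strictFunctor (tngDisplayed_isStrict _ _) (indDisplayed_isStrict _ _ _) (componentsStruct X fl
    (fun h => h.components) (fun κ A => LawCell.components_isNatural κ.str A) (fun κ =>
    componentsStr_generated κ.gen) (fun m => (LawCell.components_compat m.cell).1 m.two)) (fun _ =>
    rfl) (fun _ _ => rfl) (fun M => Total.hom_ext rfl (heq_of_eq (componentsStr_id M.obj)))
    componentsHom_comp (fun κ κ₁ κ₂ _ => Total.heq_cell (componentsHom_comp κ κ₁)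
    (componentsHom_comp κ κ₂) HEq.rfl) (fun {_ _ _ κ₁ κ₂} _ κ => Total.heq_cell (componentsHom_comp
    κ₁ κ) (componentsHom_comp κ₂ κ) HEq.rfl)

theorem componentsFunctor_isComponentsFunctor : IsComponentsFunctor X fl (componentsFunctor X fl) :=
  ⟨fun h => h.components, fun κ A => LawCell.components_isNatural κ.str A, fun κ =>
    componentsStr_generated κ.gen, fun m => (LawCell.components_compat m.cell).1 m.two, rfl⟩

end ComponentsFunctor

section ComponentsEquivalence

variable {X : Type u} [Category.{u} X] {M M' : RawTangentObject (SIndx X)}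
  {κ : M.x ⟶ M'.x}

/-- The 2-cell of a coherent law between the components of tangent objects. -/
def LawCell.ofComponents : ∀ {o : Bool}
    (β : ∀ A, Law o (M.components.D A) (M'.components.D A) (Indx.functor κ A))
    (_ : ∀ A, (β A).IsNatural)
    (_ : IsCoherentLaw (R := M.components) (R' := M'.components) κ β), LawCell o M.T M'.T κ
  | false, β, hn, hc => Indx.mkModification (κ := M.T ≫ κ) (κ' := κ ≫ M'.T)
      (fun A E => β A E) (fun A {_ _} ξ => hn A ξ) (fun f E => by
        rw [Indx.distributor_comp, Indx.distributor_comp]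
        exact (hc f E).symm.trans (assoc _ _ _).symm)
  | true, β, hn, hc => Indx.mkModification (κ := κ ≫ M'.T) (κ' := M.T ≫ κ)
      (fun A E => β A E) (fun A {_ _} ξ => hn A ξ) (fun f E => by
        rw [Indx.distributor_comp, Indx.distributor_comp]
        exact (hc f E).trans (assoc _ _ _).symm)

theorem LawCell.components_ofComponents : ∀ {o : Bool}
    (β : ∀ A, Law o (M.components.D A) (M'.components.D A) (Indx.functor κ A))
    (hn : ∀ A, (β A).IsNatural)
    (hc : IsCoherentLaw (R := M.components) (R' := M'.components) κ β) (A : X),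
    (LawCell.ofComponents β hn hc).components A = β A
  | false, _, _, _, _ => rfl
  | true, _, _, _, _ => rfl

theorem isTangentMorphism_lawId {C : Type u} [Category.{v} C] {D : TangentData C}
    (hD : D.IsTangent) (fl : Flavour) :
    IsTangentMorphism D D (𝟭 C) fl (Law.id fl.isColax D) := by
  have := (StrongMap.id D).isTangentMorphism hD (.id hD) fl (fun _ => ⟨fun _ => rfl, fun _ => rfl⟩)
  cases fl <;> exact this

theorem LawCell.ofComponents_id (M : RawTangentObject (SIndx X)) (o : Bool) :
    LawCell.ofComponents (M := M) (M' := M) (fun A => Law.id o (M.components.D A))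
      (fun _ => Law.isNatural_id) (IsCoherentLaw.id M.components o) = LawCell.id o M.T :=
  LawCell.components_injective fun A => (LawCell.components_ofComponents _ _ _ A).trans
    (LawCell.components_id M o A).symm

theorem LawCell.ofComponents_comp {M'' : RawTangentObject (SIndx X)} {κ' : M'.x ⟶ M''.x}
    {o : Bool} {β : ∀ A, Law o (M.components.D A) (M'.components.D A) (Indx.functor κ A)}
    {γ : ∀ A, Law o (M'.components.D A) (M''.components.D A) (Indx.functor κ' A)}
    (nβ : ∀ A, (β A).IsNatural) (nγ : ∀ A, (γ A).IsNatural)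
    (hβ : IsCoherentLaw (R := M.components) (R' := M'.components) κ β)
    (hγ : IsCoherentLaw (R := M'.components) (R' := M''.components) κ' γ)
    (hn : ∀ A, ((β A).comp (γ A)).IsNatural)
    (hc : IsCoherentLaw (R := M.components) (R' := M''.components) (κ ≫ κ')
      fun A => (β A).comp (γ A)) :
    LawCell.ofComponents (fun A => (β A).comp (γ A)) hn hc =
      (LawCell.ofComponents β nβ hβ).comp (LawCell.ofComponents γ nγ hγ) :=
  LawCell.components_injective fun A => (LawCell.components_ofComponents _ _ _ A).trans
    (((LawCell.components_comp _ _ A).trans (congr (congrArg Law.comp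
      (LawCell.components_ofComponents β nβ hβ A)) (LawCell.components_ofComponents γ nγ hγ A))).symm)

theorem LawCell.ofComponents_conj {N N' : RawTangentObject (SIndx X)} {o : Bool}
    {β : ∀ A, Law o (M.components.D A) (M'.components.D A) (Indx.functor κ A)}
    {κ₁ : N.x ⟶ M.x} {κ₂ : M'.x ⟶ N'.x} {κ₃ : N.x ⟶ N'.x}
    {a : LawCell o N.T M.T κ₁} {b : LawCell o M'.T N'.T κ₂}
    {γ : ∀ A, Law o (N.components.D A) (N'.components.D A) (Indx.functor κ₃ A)}
    (nβ : ∀ A, (β A).IsNatural) (nγ : ∀ A, (γ A).IsNatural)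
    (hβ : IsCoherentLaw (R := M.components) (R' := M'.components) κ β)
    (hγ : IsCoherentLaw (R := N.components) (R' := N'.components) κ₃ γ)
    (e : κ₃ = κ₁ ≫ κ ≫ κ₂)
    (h : ∀ A, HEq (γ A) ((a.components A).comp ((β A).comp (b.components A)))) :
    HEq (LawCell.ofComponents γ nγ hγ) (a.comp ((LawCell.ofComponents β nβ hβ).comp b)) :=
  LawCell.heq_of_components e fun A => (heq_of_eq (LawCell.components_ofComponents γ nγ hγ A)).trans
    ((h A).trans (heq_of_eq ((LawCell.components_comp _ _ A).trans (congrArg (Law.comp _)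
      ((LawCell.components_comp _ _ A).trans (congrArg (Law.comp · _)
        (LawCell.components_ofComponents β nβ hβ A))))).symm))

theorem LawCell.isTangentCell_ofComponents {fl : Flavour} (hM : M.IsTangent) (hM' : M'.IsTangent)
    {β : ∀ A, Law fl.isColax (M.components.D A) (M'.components.D A) (Indx.functor κ A)}
    (hβ : ∀ A, IsTangentMorphism (M.components.D A) (M'.components.D A) (Indx.functor κ A) fl (β A))
    (hn : ∀ A, (β A).IsNatural)
    (hc : IsCoherentLaw (R := M.components) (R' := M'.components) κ β) :
    IsTangentCell κ fl (LawCell.ofComponents β hn hc) :=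
  IsTangentCell.of_components hM hM' fun A => by
    rw [LawCell.components_ofComponents]
    exact hβ A

variable {fl : Flavour}

/-- The tangent object of an indexed tangent category. -/
abbrev tangentOb (x : (IndDisp fl.isColax X).Ob) : (TngDisp fl X).Ob :=
  ⟨x.2.tangentObject, x.2.isTangent_tangentObject⟩

theorem generated_ofComponents_tangentOb
    {x y : (IndDisp fl.isColax X).Ob} {κ : x.1.J ⟶ y.1.J}
    {a : (IndDisp fl.isColax X).Str (x := x) (y := y) κ}
    (ha : IndGen fl a) :
    TngGen fl (x := tangentOb x) (y := tangentOb y) (f := κ) (LawCell.ofComponents (M :=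
      x.2.tangentObject) (M' := y.2.tangentObject) a.1 a.2
        (isCoherentLaw_of_generated ha)) := by
  induction ha with
  | of a ha =>
    rename_i x y κ
    exact .of (x := tangentOb x) (y := tangentOb y) (f := κ) _ (LawCell.isTangentCell_ofComponents
      x.2.isTangent_tangentObject y.2.isTangent_tangentObject ha.fibre a.2 ha.coherent)
  | id x =>
    exact .of_heq (x := tangentOb x) (y := tangentOb x) rfl
      (heq_of_eq (LawCell.ofComponents_id x.2.tangentObject fl.isColax)) (.id (tangentOb x))
  | comp h1 h2 ih1 ih2 =>
    rename_i x y t f g a b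
    exact .of_heq (x := tangentOb x) (y := tangentOb t) rfl
      (heq_of_eq (LawCell.ofComponents_comp (M := x.2.tangentObject) (M' := y.2.tangentObject)
        (M'' := t.2.tangentObject) a.2 b.2 (isCoherentLaw_of_generated h1)
        (isCoherentLaw_of_generated h2) _ _)) (.comp ih1 ih2)

/-- The identity, as a law between tangent objects with the same components. -/
abbrev lawToTangentOb (M : (TngDisp fl X).Ob) :
    LawCell fl.isColax M.1.T (componentsOb X fl M).2.tangentObject.T (𝟙 M.1.x) :=
  LawCell.ofComponents (M := M.1) (M' := (componentsOb X fl M).2.tangentObject)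
    (fun A => Law.id fl.isColax (M.1.components.D A)) (fun _ => Law.isNatural_id)
    (IsCoherentLaw.id M.1.components fl.isColax)

/-- The identity, as a law between tangent objects with the same components. -/
abbrev lawOfTangentOb (M : (TngDisp fl X).Ob) :
    LawCell fl.isColax (componentsOb X fl M).2.tangentObject.T M.1.T (𝟙 M.1.x) :=
  LawCell.ofComponents (M := (componentsOb X fl M).2.tangentObject) (M' := M.1)
    (fun A => Law.id fl.isColax (M.1.components.D A)) (fun _ => Law.isNatural_id)
    (IsCoherentLaw.id M.1.components fl.isColax)

theorem generated_lawToTangentOb (M : (TngDisp fl X).Ob) : TngGen fl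
      (x := M) (y := tangentOb (componentsOb X fl M)) (f := 𝟙 M.1.x) (lawToTangentOb M) :=
  .of (x := M) (y := tangentOb (componentsOb X fl M)) (f := 𝟙 M.1.x) _
    (LawCell.isTangentCell_ofComponents (M := M.1) (M' := (componentsOb X fl M).2.tangentObject)
      (κ := 𝟙 M.1.x) M.2 (componentsOb X fl M).2.isTangent_tangentObject
      (β := fun A => Law.id fl.isColax (M.1.components.D A))
      (fun A => isTangentMorphism_lawId (M.2.fibre A) fl) (fun _ => Law.isNatural_id)
      (IsCoherentLaw.id M.1.components fl.isColax))

theorem generated_lawOfTangentOb (M : (TngDisp fl X).Ob) : TngGen fl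
      (x := tangentOb (componentsOb X fl M)) (y := M) (f := 𝟙 M.1.x) (lawOfTangentOb M) :=
  .of (x := tangentOb (componentsOb X fl M)) (y := M) (f := 𝟙 M.1.x) _
    (LawCell.isTangentCell_ofComponents (M := (componentsOb X fl M).2.tangentObject) (M' := M.1)
      (κ := 𝟙 M.1.x) (componentsOb X fl M).2.isTangent_tangentObject M.2
      (β := fun A => Law.id fl.isColax (M.1.components.D A))
      (fun A => isTangentMorphism_lawId (M.2.fibre A) fl) (fun _ => Law.isNatural_id)
      (IsCoherentLaw.id M.1.components fl.isColax))

theorem lawComp_id_conj {C : Type u} [Category.{v} C] {C' : Type u'} [Category.{v'} C'] {o : Bool}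
    {D : TangentData C} {D' : TangentData C'} {F : C ⥤ C'} {i : Law o D D (𝟭 C)}
    {j : Law o D' D' (𝟭 C')} (hi : i = Law.id o D) (hj : j = Law.id o D') (β : Law o D D' F) :
    β = Law.comp i (Law.comp β j) := by
  subst hi hj
  exact ((Law.id_comp (F := F) (Law.comp β (Law.id o D'))).trans (Law.comp_id β)).symm

theorem Indx.eq_id_comp_comp_id {J J' : SIndx X} (κ : J ⟶ J') : κ = 𝟙 J ≫ κ ≫ 𝟙 J' :=
  (indx_isStrict.id_comp κ).symm.trans (congrArg (𝟙 J ≫ ·) (indx_isStrict.comp_id κ).symm)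

theorem LawCell.heq_conj_tangentOb {M M' : (TngDisp fl X).Ob}
    {κ : M.1.x ⟶ M'.1.x}
    {β : ∀ A, Law fl.isColax (M.1.components.D A) (M'.1.components.D A) (Indx.functor κ A)}
    (hn : ∀ A, (β A).IsNatural)
    (hc : IsCoherentLaw (R := M.1.components) (R' := M'.1.components) κ β) :
    HEq (LawCell.ofComponents β hn hc) ((lawToTangentOb M).comp ((LawCell.ofComponents (M :=
      (componentsOb X fl M).2.tangentObject) (M' := (componentsOb X fl M').2.tangentObject) (κ := κ)
      β hn hc).comp (lawOfTangentOb M'))) :=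
  LawCell.ofComponents_conj (M := (componentsOb X fl M).2.tangentObject) (M' := (componentsOb X fl
    M').2.tangentObject) (N := M.1) (N' := M'.1) (κ := κ) (κ₃ := κ) (a := lawToTangentOb M) (b :=
    lawOfTangentOb M') (β := β) (γ := β) hn hn hc hc (Indx.eq_id_comp_comp_id κ) fun A => heq_of_eq
    (lawComp_id_conj (F := Indx.functor κ A) (D := M.1.components.D A) (D' := M'.1.components.D A)
    (i := (lawToTangentOb M).components A) (j := (lawOfTangentOb M').components A)
    (LawCell.components_ofComponents (M := M.1) (M' := (componentsOb X fl M).2.tangentObject) (κ :=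
    𝟙 M.1.x) _ _ _ A) (LawCell.components_ofComponents (M := (componentsOb X fl M').2.tangentObject)
    (M' := M'.1) (κ := 𝟙 M'.1.x) _ _ _ A) (β A))

theorem generated_ofComponents {M M' : (TngDisp fl X).Ob}
    {κ : M.1.x ⟶ M'.1.x}
    {a : (IndDisp fl.isColax X).Str
      (x := componentsOb X fl M) (y := componentsOb X fl M') κ}
    (ha : IndGen fl a) :
    TngGen fl (x := M) (y := M') (f := κ) (LawCell.ofComponents (M := M.1) (M' := M'.1) a.1 a.2
      (isCoherentLaw_of_generated ha)) :=
  have h₁ := generated_ofComponents_tangentOb (x := componentsOb X fl M)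
    (y := componentsOb X fl M') ha
  have h₂ := Generated.comp (x := tangentOb (componentsOb X fl M))
    (y := tangentOb (componentsOb X fl M')) (t := M') (f := κ) (g := 𝟙 M'.1.x) h₁
    (generated_lawOfTangentOb M')
  have h₃ := Generated.comp (x := M) (y := tangentOb (componentsOb X fl M)) (t := M')
    (f := 𝟙 M.1.x) (g := κ ≫ 𝟙 M'.1.x) (generated_lawToTangentOb M) h₂
  .of_heq (x := M) (y := M') (Indx.eq_id_comp_comp_id κ)
    (LawCell.heq_conj_tangentOb (M := M) (M' := M') a.2 (isCoherentLaw_of_generated ha)) h₃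

theorem Displayed.Total.heq_str {B : Type u} [Bicategory.{w, v} B]
    {D : Displayed.{w, v, v', u, u'} B} {W : D.OneCells} {x y : D.Total W} {f g : x ⟶ y}
    (h : f = g) : HEq f.str g.str := by
  subst h
  rfl

variable (X fl)

theorem isTwoEquivalence_componentsFunctor : IsTwoEquivalence (componentsFunctor X fl) where
  bijective M M' := by
    refine ⟨?_, fun ⟨κ, a, ha⟩ => ⟨⟨κ, LawCell.ofComponents (M := M.obj.1) (M' := M'.obj.1) a.1 a.2
      (isCoherentLaw_of_generated ha), generated_ofComponents ha⟩, ?_⟩⟩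
    · rintro ⟨κ, a, ha⟩ ⟨κ', a', ha'⟩ h
      obtain rfl : κ = κ' := congrArg Total.Hom.hom h
      obtain rfl : a = a' := LawCell.components_injective (M := M.obj.1) (M' := M'.obj.1) fun A =>
        congrFun (congrArg Subtype.val (eq_of_heq (Total.heq_str h))) A
      rfl
    · exact Total.hom_ext rfl (heq_of_eq (Subtype.ext (funext fun A =>
        LawCell.components_ofComponents _ _ _ A)))
  bijective₂ f g := ⟨fun η θ h => Total.hom₂_ext
      (show ((componentsFunctor X fl).map₂ η).cell = ((componentsFunctor X fl).map₂ θ).cell from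
        congrArg Total.Hom₂.cell h),
    fun η => ⟨⟨η.cell, (LawCell.components_compat η.cell).2 η.two⟩, rfl⟩⟩
  surjective y := ⟨⟨tangentOb y.obj⟩, 𝟙 y, 𝟙 y, (indDisplayed_isStrict _ _ _).id_comp (𝟙 y),
    (indDisplayed_isStrict _ _ _).id_comp (𝟙 y)⟩

end ComponentsEquivalence

end

end TangentGrothendieck

/-- Over a base with the trivial tangent structure, the functors `𝓘` (fibres) and `𝓕` (elements)
between tangent fibrations and indexed tangent categories are adjoint equivalences for the lax,
colax, strong and strict morphisms, and indexed tangent categories are equivalent to tangent objects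
in indexed categories. -/
theorem mainTheorem6 (X : Type u) [Category.{u} X] :
    (∀ fl : Flavour, fl ≠ .strict →
      ∃ (I : StrictPseudofunctor (TngFib.{u, u, u, u} fl (TangentData.trivial X))
          (IndxTng.{u, u, u, u} fl (TangentData.trivial X)))
        (F : StrictPseudofunctor (IndxTng.{u, u, u, u} fl (TangentData.trivial X))
          (TngFib.{u, u, u, u} fl (TangentData.trivial X))),
        IsFibreFunctor (TangentData.trivial X) fl I ∧
        IsElementsFunctor (TangentData.trivial X) fl F ∧
        AreAdjointEquivalences F I) ∧
    (∃ (I : StrictPseudofunctor (TngFib.{u, u, u, u} .strong (TangentData.trivial X))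
          (IndxTng.{u, u, u, u} .strong (TangentData.trivial X)))
        (F : StrictPseudofunctor (IndxTng.{u, u, u, u} .strong (TangentData.trivial X))
          (TngFib.{u, u, u, u} .strong (TangentData.trivial X)))
        (I' : StrictPseudofunctor (TngFib.{u, u, u, u} .strict (TangentData.trivial X))
          (IndxTng.{u, u, u, u} .strict (TangentData.trivial X)))
        (F' : StrictPseudofunctor (IndxTng.{u, u, u, u} .strict (TangentData.trivial X))
          (TngFib.{u, u, u, u} .strict (TangentData.trivial X))),
      IsFibreFunctor (TangentData.trivial X) .strong I ∧
      IsElementsFunctor (TangentData.trivial X) .strong F ∧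
      (∃ τ : TwoNatTrans (I'.comp (indInclusion (TangentData.trivial X)))
        ((fibInclusion (TangentData.trivial X)).comp I), τ.IsInvertible) ∧
      (∃ τ : TwoNatTrans (F'.comp (fibInclusion (TangentData.trivial X)))
        ((indInclusion (TangentData.trivial X)).comp F), τ.IsInvertible) ∧
      AreAdjointEquivalences F' I') ∧
    (∀ fl : Flavour,
      ∃ E : StrictPseudofunctor (Tng fl (Indx.{u, u, u, u} X))
          (IndxTng.{u, u, u, u} fl (TangentData.trivial X)),
        IsComponentsFunctor X fl E ∧ IsTwoEquivalence E) :=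
  ⟨fun _ hfl => ⟨fibreFunctor X hfl, elementsFunctor X hfl, fibreFunctor_isFibreFunctor X hfl,
      elementsFunctor_isElementsFunctor X hfl,
      areAdjointEquivalences_elementsFunctor_fibreFunctor X hfl⟩,
    ⟨fibreFunctor X (fl := .strong) nofun,
      elementsFunctor X (fl := .strong) nofun,
      vertFunctor X .strict, elFunctor X .strict, fibreFunctor_isFibreFunctor X _,
      elementsFunctor_isElementsFunctor X _,
      ⟨(vertInclusionIso X).toTwoNatTrans, TwoNatIso.toTwoNatTrans_isInvertible _⟩,
      ⟨(elInclusionIso X).toTwoNatTrans, TwoNatIso.toTwoNatTrans_isInvertible _⟩,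
      areAdjointEquivalences_elFunctor_vertFunctor X .strict⟩,
    fun fl => ⟨componentsFunctor X fl, componentsFunctor_isComponentsFunctor X fl,
      isTwoEquivalence_componentsFunctor X fl⟩⟩
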